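/- **Setting.** Let $G$ be a compact Lie group, realised as a closed subgroup of $U(n)$, with Lie algebra $\mathfrak g\subset\mathfrak u(n)$ and an $\mathrm{Ad}$-invariant inner product $\langle\cdot,\cdot\rangle$ on $\mathfrak g$, extended complex-bilinearly to $\mathfrak g^{\mathbb C}=\mathfrak g\oplus i\mathfrak g$. Let $G^{\mathbb C}=G\exp(i\mathfrak g)\subset GL(n,\mathbb C)$ be its complexification. Put $\mathcal A=C^1([0,1],\mathfrak g)\otimes\mathbb R^4$ and let $\mu^{-1}(0)\subset\mathcal A$ be the set of solutions $(T_0,T_1,T_2,T_3)$ of the Nahm–Schmid equations $$\dot T_1+[T_0,T_1]=-[T_2,T_3],\quad \dot T_2+[T_0,T_2]=[T_3,T_1],\quad \dot T_3+[T_0,T_3]=[T_1,T_2].$$ With $\alpha=T_0-iT_1$, $\beta=T_2+iT_3$ these equations are equivalent to the complex equation $\dot\beta+[\alpha,\beta]=0$ together with the real equation $\dot\alpha+\dot\alpha^*+[\alpha,\alpha^*]-[\beta,\beta^*]=0$. The group $\mathcal G_{00}$ of $C^2$-maps $u:[0,1]\to G$ with $u(0)=u(1)=1$ acts on $\mathcal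 A$ by $u.(T_0,T_1,T_2,T_3)=(uT_0u^{-1}-\dot uu^{-1},uT_1u^{-1},uT_2u^{-1},uT_3u^{-1})$. The group $\mathcal G^{\mathbb C}_{00}$ of $C^2$-maps $u:[0,1]\to G^{\mathbb C}$ with $u(0)=u(1)=1$ acts on pairs $(\alpha,\beta)$ of $C^1$-maps $[0,1]\to\mathfrak g^{\mathbb C}$ by $u.(\alpha,\beta)=(u\alpha u^{-1}-\dot uu^{-1},u\beta u^{-1})$. Let $g(X,Y)=\int_0^1\big(\langle X_0,Y_0\rangle+\langle X_1,Y_1\rangle-\langle X_2,Y_2\rangle-\langle X_3,Y_3\rangle\big)\,dt$. The degeneracy locus $\mathcal D$ is the set of those $\mathcal T\in\mu^{-1}(0)$ at which $g$, restricted to the tangent space of the $\mathcal G_{00}$-orbit of $\mathcal T$, is degenerate. Let $\mathcal M=\mu^{-1}(0)/\mathcal G_{00}$ and $\mathcal M^0=(\mu^{-1}(0)\setminus\mathcal D)/\mathcal G_{00}$. The tangent space of $\mathcal M^0$ at the class of $\mathcal T$ is the space of those solutions $X$ of the Nahm–Schmid equations linearised at $\mathcal T$ that are $g$-orthogonal to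 the orbit, i.e. satisfy $\dot X_0+[T_0,X_0]+[T_1,X_1]-[T_2,X_2]-[T_3,X_3]=0$. On it one has the complex structure $I(X_0,X_1,X_2,X_3)=(X_1,-X_0,-X_3,X_2)$ and the complex symplectic form $\omega_I^{\mathbb C}=g(S\cdot,\cdot)+i\,g(T\cdot,\cdot)$, where $S(X_0,X_1,X_2,X_3)=(X_2,X_3,X_0,X_1)$ and $T(X_0,X_1,X_2,X_3)=(X_3,-X_2,-X_1,X_0)$. **Theorem.** Let $(\alpha,\beta)$ be the pair of a solution of the Nahm–Schmid equations that is not in $\mathcal D$. There is a $\delta_0>0$ such that for every $\delta\in(0,\delta_0]$ there is an $\epsilon>0$ with the following property. For every pair $(\tilde\alpha,\tilde\beta)$ of $C^1$-maps $[0,1]\to\mathfrak g^{\mathbb C}$ with $\dot{\tilde\beta}+[\tilde\alpha,\tilde\beta]=0$ and $\|\tilde\alpha-\alpha\|_{C^1}+\|\tilde\beta-\beta\|_{C^1}<\epsilon$ there is exactly one self-adjoint $u\in\mathcal G^{\mathbb C}_{00}$ with $\|u-1\|_{C^2}<\delta$ such that $u.(\tilde\alpha,\tilde\beta)$ solves the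 real equation. **Corollary.** If $G$ is connected, then an open neighbourhood of $\{T_2=T_3=0\}$ in $(\mathcal M^0,I,\omega_I^{\mathbb C})$ is isomorphic, as a complex symplectic manifold, to an open neighbourhood of the zero section in $T^*G^{\mathbb C}$ with its canonical complex symplectic form (minus the exterior derivative of the tautological one-form). -/

import Mathlib

open scoped Matrix.Norms.L2Operator ContDiff

noncomputable section

namespace NahmSchmid

/-- Complex `n × n` matrices, with the operator norm. -/
abbrev Mat (n : ℕ) : Type := Matrix (Fin n) (Fin n) ℂ

/-- The interval `U = [0,1]`. -/
abbrev U : Type := Set.Icc (0 : ℝ) 1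

/-- `f'` is the derivative of `f` on `[0,1]` (one-sided at the end points). -/
def IsDeriv {n : ℕ} (f f' : C(U, Mat n)) : Prop :=
  ∀ t : U, HasDerivWithinAt (Set.IccExtend zero_le_one f) (f' t) (Set.Icc (0 : ℝ) 1) (t : ℝ)

/-- `C¹([0,1], Mat n)`: a function together with its continuous derivative. The norm inherited from
`C(U, Mat n) × C(U, Mat n)` is equivalent to the `C¹`-norm `c1norm` below. -/
def C1Sub (n : ℕ) : Submodule ℂ (C(U, Mat n) × C(U, Mat n)) where
  carrier := {p | IsDeriv p.1 p.2}
  zero_mem' := fun t => hasDerivWithinAt_const (t : ℝ) (Set.Icc (0 : ℝ) 1) (0 : Mat n)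
  add_mem' := fun hp hq t => (hp t).add (hq t)
  smul_mem' := fun c _ hp t => (hp t).const_smul c

/-- `C²([0,1], Mat n)`: a function together with its first two derivatives. -/
def C2Sub (n : ℕ) : Submodule ℂ (C(U, Mat n) × C(U, Mat n) × C(U, Mat n)) where
  carrier := {p | IsDeriv p.1 p.2.1 ∧ IsDeriv p.2.1 p.2.2}
  zero_mem' := ⟨fun t => hasDerivWithinAt_const (t : ℝ) (Set.Icc (0 : ℝ) 1) (0 : Mat n),
    fun t => hasDerivWithinAt_const (t : ℝ) (Set.Icc (0 : ℝ) 1) (0 : Mat n)⟩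
  add_mem' := fun hp hq =>
    ⟨fun t => (hp.1 t).add (hq.1 t), fun t => (hp.2 t).add (hq.2 t)⟩
  smul_mem' := fun c _ hp =>
    ⟨fun t => (hp.1 t).const_smul c, fun t => (hp.2 t).const_smul c⟩

/-- `C¹`-functions `[0,1] → Mat n`. -/
abbrev C1 (n : ℕ) : Type := C1Sub n

/-- `C²`-functions `[0,1] → Mat n`. -/
abbrev C2 (n : ℕ) : Type := C2Sub n

variable {n : ℕ}

/-- The value of a `C¹`-function. -/
def C1.ev (p : C1 n) (t : U) : Mat n := (p : C(U, Mat n) × C(U, Mat n)).1 t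

/-- The derivative of a `C¹`-function. -/
def C1.dot (p : C1 n) (t : U) : Mat n := (p : C(U, Mat n) × C(U, Mat n)).2 t

/-- The value of a `C²`-function. -/
def C2.ev (p : C2 n) (t : U) : Mat n := (p : C(U, Mat n) × C(U, Mat n) × C(U, Mat n)).1 t

/-- The derivative of a `C²`-function. -/
def C2.dot (p : C2 n) (t : U) : Mat n := (p : C(U, Mat n) × C(U, Mat n) × C(U, Mat n)).2.1 t

/-- The `C¹`-norm `sup ‖p‖ + sup ‖p'‖`. -/
def c1norm (p : C1 n) : ℝ :=
  ‖(p : C(U, Mat n) × C(U, Mat n)).1‖ + ‖(p : C(U, Mat n) × C(U, Mat n)).2‖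

/-- The `C²`-distance of `u` from the constant function `1`. -/
def c2distOne (u : C2 n) : ℝ :=
  ‖(u : C(U, Mat n) × C(U, Mat n) × C(U, Mat n)).1 - 1‖ +
    ‖(u : C(U, Mat n) × C(U, Mat n) × C(U, Mat n)).2.1‖ +
    ‖(u : C(U, Mat n) × C(U, Mat n) × C(U, Mat n)).2.2‖

/-! ### The compact group, its Lie algebra, and their complexifications -/

/-- The Lie algebra `𝔤 ⊆ 𝔲(n)` of a closed subgroup `G ⊆ U(n)`. -/
def lie (G : Subgroup (Matrix.unitaryGroup (Fin n) ℂ)) : Set (Mat n) :=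
  {X | ∀ s : ℝ, ∃ k ∈ G, (k : Mat n) = NormedSpace.exp (s • X)}

/-- The complexified Lie algebra `𝔤 ⊕ i𝔤` in `𝔤𝔩(n, ℂ)`. -/
def lieC (G : Subgroup (Matrix.unitaryGroup (Fin n) ℂ)) : Set (Mat n) :=
  {Z | ∃ X ∈ lie G, ∃ Y ∈ lie G, Z = X + Complex.I • Y}

/-- The complexification `Gᶜ = G · exp(i𝔤)` in `GL(n, ℂ)` (polar decomposition). -/
def groupC (G : Subgroup (Matrix.unitaryGroup (Fin n) ℂ)) : Set (Mat n) :=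
  {A | ∃ k ∈ G, ∃ X ∈ lie G, A = (k : Mat n) * NormedSpace.exp (Complex.I • X)}

/-- The restriction of `B` to `𝔤` is an `Ad`-invariant inner product. (Every bilinear form on `𝔤`
is such a restriction; the values of `B` off `𝔤` are never used.) -/
structure IsInvariantInner (G : Subgroup (Matrix.unitaryGroup (Fin n) ℂ))
    (B : LinearMap.BilinForm ℝ (Mat n)) : Prop where
  symm : ∀ X ∈ lie G, ∀ Y ∈ lie G, B X Y = B Y X
  pos : ∀ X ∈ lie G, X ≠ 0 → 0 < B X X
  invariant : ∀ k ∈ G, ∀ X ∈ lie G, ∀ Y ∈ lie G,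
    B ((k : Mat n) * X * (k : Mat n)⁻¹) ((k : Mat n) * Y * (k : Mat n)⁻¹) = B X Y

/-- The `X ∈ 𝔤` with `Z = X + iY`, `Y ∈ 𝔤`, for `Z ∈ 𝔤ᶜ`: the skew-hermitian part. -/
def rePart (Z : Mat n) : Mat n := (1 / 2 : ℂ) • (Z - star Z)

/-- The `Y ∈ 𝔤` with `Z = X + iY`, `X ∈ 𝔤`, for `Z ∈ 𝔤ᶜ`. -/
def imPart (Z : Mat n) : Mat n := (-Complex.I / 2) • (Z + star Z)

/-- The complex bilinear extension of `B` to `𝔤ᶜ`. -/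
def formC (B : LinearMap.BilinForm ℝ (Mat n)) (Z Z' : Mat n) : ℂ :=
  ((B (rePart Z) (rePart Z') - B (imPart Z) (imPart Z') : ℝ) : ℂ) +
    Complex.I * ((B (rePart Z) (imPart Z') + B (imPart Z) (rePart Z') : ℝ) : ℂ)

/-! ### The Nahm–Schmid equations on `[0,1]` -/

/-- Quadruples of matrix-valued `C¹`-functions. The space `𝒜` of the `𝔤`-valued ones is a
closed real linear subspace. -/
abbrev Quad (n : ℕ) : Type := Fin 4 → C1 n

/-- The space `𝒜 = C¹([0,1], 𝔤) ⊗ ℝ⁴`. -/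
def configs (G : Subgroup (Matrix.unitaryGroup (Fin n) ℂ)) : Set (Quad n) :=
  {T | ∀ i t, (T i).ev t ∈ lie G}

/-- The set `μ⁻¹(0) ⊆ 𝒜` of solutions of the Nahm–Schmid equations. -/
def solutions (G : Subgroup (Matrix.unitaryGroup (Fin n) ℂ)) : Set (Quad n) :=
  {T | T ∈ configs G ∧ ∀ t,
    (T 1).dot t + ⁅(T 0).ev t, (T 1).ev t⁆ = -⁅(T 2).ev t, (T 3).ev t⁆ ∧
    (T 2).dot t + ⁅(T 0).ev t, (T 2).ev t⁆ = ⁅(T 3).ev t, (T 1).ev t⁆ ∧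
    (T 3).dot t + ⁅(T 0).ev t, (T 3).ev t⁆ = ⁅(T 1).ev t, (T 2).ev t⁆}

/-- The diagonal coefficients of the metric on `ℝ^{2,2}`. -/
def eta : Fin 4 → ℝ := ![1, 1, -1, -1]

/-- The indefinite metric `g(X,Y) = ∫₀¹ ∑ᵢ ηᵢᵢ ⟨Xᵢ(t), Yᵢ(t)⟩ dt`. -/
def metric (B : LinearMap.BilinForm ℝ (Mat n)) (X Y : Quad n) : ℝ :=
  ∫ t in (0 : ℝ)..1, ∑ i, eta i *
    B ((X i).ev (Set.projIcc 0 1 zero_le_one t)) ((Y i).ev (Set.projIcc 0 1 zero_le_one t))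

/-- The complex structure `I`. -/
def strI (X : Quad n) : Quad n := ![X 1, -X 0, -X 3, X 2]

/-- The product structure `S`. -/
def strS (X : Quad n) : Quad n := ![X 2, X 3, X 0, X 1]

/-- The product structure `T`. -/
def strT (X : Quad n) : Quad n := ![X 3, -X 2, -X 1, X 0]

/-- The complex symplectic form `ω_S + i ω_T`, where `ω_S = g(S·,·)` and `ω_T = g(T·,·)`. -/
def omegaC (B : LinearMap.BilinForm ℝ (Mat n)) (X Y : Quad n) : ℂ :=
  (metric B (strS X) Y : ℂ) + Complex.I * (metric B (strT X) Y : ℂ)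

/-- `Lie(𝒢₀₀)`: the `C²`-functions `[0,1] → 𝔤` vanishing at the end points. -/
def lieGauge (G : Subgroup (Matrix.unitaryGroup (Fin n) ℂ)) : Set (C2 n) :=
  {ξ | (∀ t, ξ.ev t ∈ lie G) ∧ ξ.ev 0 = 0 ∧ ξ.ev 1 = 0}

/-- The tangent space at `T` to the `𝒢₀₀`-orbit of `T`, i.e. the set of the vectors
`(-ξ' + [ξ,T₀], [ξ,T₁], [ξ,T₂], [ξ,T₃])` with `ξ ∈ Lie(𝒢₀₀)`. -/
def orbitTangent (G : Subgroup (Matrix.unitaryGroup (Fin n) ℂ)) (T : Quad n) : Set (Quad n) :=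
  {X | ∃ ξ ∈ lieGauge G, ∀ t,
    (X 0).ev t = -ξ.dot t + ⁅ξ.ev t, (T 0).ev t⁆ ∧
    ∀ i : Fin 4, i ≠ 0 → (X i).ev t = ⁅ξ.ev t, (T i).ev t⁆}

/-- The degeneracy locus `𝒟`: the solutions at which the metric restricted to the tangent space of
the `𝒢₀₀`-orbit is degenerate. -/
def degeneracyLocus (G : Subgroup (Matrix.unitaryGroup (Fin n) ℂ))
    (B : LinearMap.BilinForm ℝ (Mat n)) : Set (Quad n) :=
  {T | T ∈ solutions G ∧ ∃ X ∈ orbitTangent G T, X ≠ 0 ∧ ∀ Y ∈ orbitTangent G T, metric B X Y = 0}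

/-! ### Complex coordinates and complex gauge transformations -/

/-- `α = T₀ - i T₁`. -/
def alpha (T : Quad n) : C1 n := T 0 - Complex.I • T 1

/-- `β = T₂ + i T₃`. -/
def beta (T : Quad n) : C1 n := T 2 + Complex.I • T 3

/-- The complex equation `β' + [α,β] = 0`. -/
def ComplexEq (a b : C1 n) : Prop := ∀ t, b.dot t + ⁅a.ev t, b.ev t⁆ = 0

/-- The real equation `α' + α'^* + [α,α^*] - [β,β^*] = 0`. -/
def RealEq (a b : C1 n) : Prop :=
  ∀ t, a.dot t + star (a.dot t) + ⁅a.ev t, star (a.ev t)⁆ - ⁅b.ev t, star (b.ev t)⁆ = 0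

/-- `𝒢ᶜ₀₀`: the `C²`-functions `u : [0,1] → Gᶜ` with `u(0) = 1 = u(1)`. -/
def gaugeC (G : Subgroup (Matrix.unitaryGroup (Fin n) ℂ)) : Set (C2 n) :=
  {u | (∀ t, u.ev t ∈ groupC G) ∧ u.ev 0 = 1 ∧ u.ev 1 = 1}

/-- `(a',b') = u.(a,b)`, i.e. `a' = u a u⁻¹ - u' u⁻¹` and `b' = u b u⁻¹`. -/
def IsGaugeTransform (u : C2 n) (a b a' b' : C1 n) : Prop :=
  ∀ t, a'.ev t = u.ev t * a.ev t * (u.ev t)⁻¹ - u.dot t * (u.ev t)⁻¹ ∧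
    b'.ev t = u.ev t * b.ev t * (u.ev t)⁻¹

/-! ### The moduli space -/

/-- `𝒢₀₀`: the `C²`-functions `u : [0,1] → G` with `u(0) = 1 = u(1)`. -/
def gauge (G : Subgroup (Matrix.unitaryGroup (Fin n) ℂ)) : Set (C2 n) :=
  {u | (∀ t, ∃ k ∈ G, (k : Mat n) = u.ev t) ∧ u.ev 0 = 1 ∧ u.ev 1 = 1}

/-- `T' = u.T` for some `u ∈ 𝒢₀₀`. -/
def SameOrbit (G : Subgroup (Matrix.unitaryGroup (Fin n) ℂ)) (T T' : solutions G) : Prop :=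
  ∃ u ∈ gauge G, ∀ t,
    (T'.1 0).ev t = u.ev t * (T.1 0).ev t * (u.ev t)⁻¹ - u.dot t * (u.ev t)⁻¹ ∧
    ∀ i : Fin 4, i ≠ 0 → (T'.1 i).ev t = u.ev t * (T.1 i).ev t * (u.ev t)⁻¹

/-- The moduli space `ℳ = μ⁻¹(0) / 𝒢₀₀`, with the quotient of the `C¹`-topology. -/
abbrev Moduli (G : Subgroup (Matrix.unitaryGroup (Fin n) ℂ)) : Type := Quot (SameOrbit G)

/-- The subset `ℳ⁰ = (μ⁻¹(0) \ 𝒟) / 𝒢₀₀`. -/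
def moduliNondeg (G : Subgroup (Matrix.unitaryGroup (Fin n) ℂ))
    (B : LinearMap.BilinForm ℝ (Mat n)) : Set (Moduli G) :=
  {m | ∃ T : solutions G, T.1 ∉ degeneracyLocus G B ∧ Quot.mk (SameOrbit G) T = m}

/-- The subset `{T₂ = T₃ = 0}` of `ℳ`. -/
def moduliZero (G : Subgroup (Matrix.unitaryGroup (Fin n) ℂ)) : Set (Moduli G) :=
  {m | ∃ T : solutions G, T.1 2 = 0 ∧ T.1 3 = 0 ∧ Quot.mk (SameOrbit G) T = m}

/-- The tangent space of `ℳ⁰` at the class of `T`: the solutions of the linearised Nahm–Schmid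
equations that are `g`-orthogonal to the `𝒢₀₀`-orbit (the last equation). It is preserved by
`strI`, which is the complex structure of `ℳ⁰`, and `omegaC` is the complex symplectic form. -/
def tangentModuli (G : Subgroup (Matrix.unitaryGroup (Fin n) ℂ)) (T : Quad n) : Set (Quad n) :=
  {X | X ∈ configs G ∧ ∀ t,
    (X 1).dot t + ⁅(T 0).ev t, (X 1).ev t⁆ + ⁅(X 0).ev t, (T 1).ev t⁆
      + ⁅(T 2).ev t, (X 3).ev t⁆ + ⁅(X 2).ev t, (T 3).ev t⁆ = 0 ∧
    (X 2).dot t + ⁅(T 0).ev t, (X 2).ev t⁆ + ⁅(X 0).ev t, (T 2).ev t⁆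
      - ⁅(T 3).ev t, (X 1).ev t⁆ - ⁅(X 3).ev t, (T 1).ev t⁆ = 0 ∧
    (X 3).dot t + ⁅(T 0).ev t, (X 3).ev t⁆ + ⁅(X 0).ev t, (T 3).ev t⁆
      - ⁅(T 1).ev t, (X 2).ev t⁆ - ⁅(X 1).ev t, (T 2).ev t⁆ = 0 ∧
    (X 0).dot t + ⁅(T 0).ev t, (X 0).ev t⁆ + ⁅(T 1).ev t, (X 1).ev t⁆
      - ⁅(T 2).ev t, (X 2).ev t⁆ - ⁅(T 3).ev t, (X 3).ev t⁆ = 0}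

/-! ### The cotangent bundle `T^*Gᶜ` -/

/-- `T^*Gᶜ`, as the submanifold `Gᶜ × 𝔤ᶜ` of `Mat n × Mat n`: the pair `(g, β)` stands for the
complex linear form `v ↦ ⟨β, g⁻¹v⟩` on the tangent space `g𝔤ᶜ` of `Gᶜ` at `g`. The zero section
is `Gᶜ × {0}`. -/
def cotangentGroupC (G : Subgroup (Matrix.unitaryGroup (Fin n) ℂ)) : Set (Mat n × Mat n) :=
  groupC G ×ˢ lieC G

/-- The tautological one-form `θ` of `T^*Gᶜ`, at `x = (g, β)`, on a tangent vector `w = (v, b)`. -/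
def liouville (B : LinearMap.BilinForm ℝ (Mat n)) (x w : Mat n × Mat n) : ℂ :=
  formC B x.2 (x.1⁻¹ * w.1)

/-- The canonical complex symplectic form `-dθ` of `T^*Gᶜ` at `x`, on tangent vectors `w`, `w'`.
The formula is that of the exterior derivative in the linear coordinates of `Mat n × Mat n`, in
which `liouville` extends `θ` to a neighbourhood of `T^*Gᶜ`. -/
def canonicalForm (B : LinearMap.BilinForm ℝ (Mat n)) (x w w' : Mat n × Mat n) : ℂ :=
  fderiv ℝ (fun y => liouville B y w) x w' - fderiv ℝ (fun y => liouville B y w') x w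

/-! ### Complex symplectic isomorphisms between open subsets of `ℳ⁰` and of `T^*Gᶜ` -/

/-- A map defined on `ℳ`, regarded as a map defined on `μ⁻¹(0)` (and zero on the rest of the Banach
space `Quad n`). -/
def lift {G : Subgroup (Matrix.unitaryGroup (Fin n) ℂ)} (F : Moduli G → Mat n × Mat n) :
    Quad n → Mat n × Mat n :=
  Function.extend (Subtype.val : solutions G → Quad n) (fun T => F (Quot.mk (SameOrbit G) T)) 0

/-- `F` is a biholomorphic map of `W` onto `V` that pulls the canonical form of `T^*Gᶜ` back to
`ω_S + i ω_T`. Here `ℳ` has the smooth structure that makes the projection `μ⁻¹(0) → ℳ` a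
submersion: a map out of `ℳ` is smooth when its composition with the projection is, and a map into
`ℳ` is smooth when it lifts locally to a smooth map into `μ⁻¹(0)`. -/
structure IsComplexSymplecticIso (G : Subgroup (Matrix.unitaryGroup (Fin n) ℂ))
    (B : LinearMap.BilinForm ℝ (Mat n)) (W : Set (Moduli G)) (V : Set (Mat n × Mat n))
    (F : Moduli G → Mat n × Mat n) : Prop where
  bijOn : Set.BijOn F W V
  smooth : ContDiffOn ℝ ∞ (lift F) {T | ∃ h : T ∈ solutions G, Quot.mk (SameOrbit G) ⟨T, h⟩ ∈ W}
  smooth_inverse : ∀ x ∈ V, ∃ N ∈ nhds x, ∃ σ : Mat n × Mat n → Quad n,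
    ContDiffOn ℝ ∞ σ (N ∩ V) ∧ ∀ y ∈ N ∩ V, ∃ h : σ y ∈ solutions G,
      Quot.mk (SameOrbit G) ⟨σ y, h⟩ ∈ W ∧ F (Quot.mk (SameOrbit G) ⟨σ y, h⟩) = y
  holomorphic_symplectic : ∀ T : solutions G, Quot.mk (SameOrbit G) T ∈ W →
    ∃ D : Quad n →L[ℝ] Mat n × Mat n, HasFDerivWithinAt (lift F) D (solutions G) T.1 ∧
      (∀ X ∈ tangentModuli G T.1, D (strI X) = Complex.I • D X) ∧
      ∀ X ∈ tangentModuli G T.1, ∀ Y ∈ tangentModuli G T.1,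
        canonicalForm B (F (Quot.mk (SameOrbit G) T)) (D X) (D Y) = omegaC B X Y

end NahmSchmid

end

open scoped Matrix.Norms.L2Operator ContDiff

noncomputable section

namespace NahmSchmid

open Set Filter Topology Metric

variable {n : ℕ}

/-! Local slice. For u = exp(iX) with X : [0,1] → 𝔤 vanishing at the end points, the real equation
for u.(α̃,β̃) is a second order boundary value problem for X. Its linearisation at a solution T is
`jacobi T`, that is ∇² + (ad T₁)² - (ad T₂)² - (ad T₃)² (`linearised_identity`,
`hasFDerivAt_momentI`). Integration by parts (`metric_orbitVec`) shows that -∫⟨jacobi ξ, η⟩ is the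
value of g on the orbit directions of ξ and η, so a Dirichlet solution of jacobi ξ = 0 is a
degenerate orbit direction and must vanish when T is not in 𝒟. On an interval, uniqueness for the
Dirichlet problem implies solvability (`exists_bvp`: Volterra inversion and shooting). The analytic
implicit function theorem then yields X as an analytic function of the pair (`exists_slice`). Since
a self-adjoint complex gauge transformation close to 1 is exp(iX) for a small X
(`eventually_eq_expI`), the theorem follows.

Corollary. Let g' = gα, g(0) = 1, and send T to (g(1), -β(1)). A complex gauge transformation u with
u(0) = u(1) = 1 replaces g by gu⁻¹ and fixes these data, so the map descends to ℳ. It is holomorphic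
because (α,β) are complex linear coordinates for I, and symplectic because the integrand of ω_I^ℂ is
the derivative of an expression in the logarithmic variations g⁻¹δg, whose boundary value at 1 is
the canonical form in the left trivialisation (`IsInvariantC.intU_eq`, `canonicalForm_endDeriv`).

Injectivity holds where ‖β‖ < c. If T and T' have equal data, the complex equation makes them
complex gauge equivalent. The unitary factor of the polar decomposition of the gauge transformation
preserves the real equation, so only exp(iX) matters. Along s ↦ exp(isX) the function s ↦ ∫⟨μ_s, X⟩,
with μ_s a multiple of the left hand side of the real equation, vanishes at s = 0 and s = 1, and its
derivative is minus the metric on the orbit direction of X. That metric is positive definite for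
small T₂, T₃ by a Poincaré inequality (`exists_metric_pos`), and β stays small between the two
solutions by the three lines theorem (`norm_exp_conj_le`). Rolle's theorem forces X = 0.

Surjectivity near the zero section comes from explicit solutions with T₂ = T₃ = 0
(`exists_solution_zero`) and smooth local sections through them: move the end point data by explicit
complex gauge paths, then restore the real equation with the slice (`exists_section`).

The Lie theory rests on Nagumo's invariance theorem `mem_of_tangent`: it gives the linear structure
of 𝔤, the fact that parallel transport of a 𝔤ᶜ-valued α stays in Gᶜ = G exp(i𝔤), and, through this,
that Gᶜ is a group. -/

section

/-! ### Invariance of closed sets under flows. -/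

open Set Filter Topology Metric in
/-- Nagumo's theorem: a closed set to which a Lipschitz vector field is tangent is invariant under
its flow. -/
theorem mem_of_tangent {E : Type*} [NormedAddCommGroup E] [NormedSpace ℝ E] [ProperSpace E]
    {S : Set E} (hS : IsClosed S) {V : ℝ → E → E} {L a b : ℝ}
    (hL : ∀ t ∈ Ico a b, ∀ x y, ‖V t x - V t y‖ ≤ L * ‖x - y‖) {u : ℝ → E}
    (hu : ContinuousOn u (Icc a b))
    (hu' : ∀ t ∈ Ico a b, HasDerivWithinAt u (V t (u t)) (Ici t) t) (h0 : u a ∈ S)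
    (tang : ∀ t ∈ Ico a b, ∀ h ∈ S, ∀ ε : ℝ, 0 < ε →
      ∃ᶠ s in 𝓝[>] (0 : ℝ), infDist (h + s • V t h) S ≤ ε * s) :
    ∀ t ∈ Icc a b, u t ∈ S := by
  have hne : S.Nonempty := ⟨_, h0⟩
  -- Grönwall's inequality for the distance from u(t) to S, which vanishes at a: its lower right
  -- derivative is at most L times the distance.
  have key := le_gronwallBound_of_liminf_deriv_right_le (f := fun t => infDist (u t) S)
    (f' := fun t => L * infDist (u t) S) (δ := 0) (K := L) (ε := 0) (a := a) (b := b)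
    ((continuous_infDist_pt S).comp_continuousOn hu) ?_ (by simp [infDist_zero_of_mem h0])
    (fun t _ => by simp)
  · intro t ht
    have h1 := key t ht
    rw [gronwallBound_ε0_δ0] at h1
    exact (hS.mem_iff_infDist_zero hne).2 (le_antisymm h1 infDist_nonneg)
  · intro t ht r hr
    obtain ⟨h, hhS, hh⟩ := hS.exists_infDist_eq_dist hne (u t)
    -- At a nearest point h of S, the tangency of V and the differentiability of u each cost εs;
    -- together 2εs, strictly below the available slack 3εs.
    set ε := (r - L * infDist (u t) S) / 3 with hε
    have hεp : 0 < ε := by simp only [hε]; linarith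
    have h1 := (hu' t ht).Ioi_of_Ici
    rw [hasDerivWithinAt_iff_isLittleO] at h1
    have h2 := h1.def hεp
    have h3 : Tendsto (fun s : ℝ => t + s) (𝓝[>] 0) (𝓝[>] t) := by
      refine tendsto_nhdsWithin_iff.2 ⟨?_, ?_⟩
      · have : Tendsto (fun s : ℝ => t + s) (𝓝 0) (𝓝 (t + 0)) :=
          (continuous_const.add continuous_id).tendsto 0
        rw [add_zero] at this
        exact this.mono_left nhdsWithin_le_nhds
      · filter_upwards [self_mem_nhdsWithin] with s hs
        simpa using hs
    have h4 := (tang t ht h hhS ε hεp).and_eventually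
      ((h3.eventually h2).and self_mem_nhdsWithin)
    refine h3.frequently (h4.mono ?_)
    rintro s ⟨hs1, hs2, hs3⟩
    have hs3 : 0 < s := hs3
    rw [add_sub_cancel_left] at hs2 ⊢
    rw [Real.norm_eq_abs, abs_of_pos hs3] at hs2
    have e1 : infDist (u (t + s)) S ≤ infDist (h + s • V t h) S + dist (u (t + s)) (h + s • V t h) :=
      infDist_le_infDist_add_dist
    have e2 : dist (u (t + s)) (h + s • V t h) ≤ ε * s + (1 + s * L) * ‖u t - h‖ := by
      rw [dist_eq_norm]
      have : u (t + s) - (h + s • V t h) = (u (t + s) - u t - s • V t (u t)) + (u t - h)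
          + s • (V t (u t) - V t h) := by rw [smul_sub]; abel
      rw [this]
      refine (norm_add₃_le).trans ?_
      rw [norm_smul, Real.norm_eq_abs, abs_of_pos hs3]
      have := mul_le_mul_of_nonneg_left (hL t ht (u t) h) hs3.le
      linarith
    rw [← dist_eq_norm, ← hh] at e2
    rw [inv_mul_lt_iff₀ hs3]
    have : s * r = s * (3 * ε + L * infDist (u t) S) := by simp only [hε]; ring
    rw [this]
    nlinarith [mul_pos hs3 hεp]

-- Supplies the tangency hypothesis of `mem_of_tangent`: a curve inside S stays within o(s) of its
-- tangent line.
open Set Filter Topology Metric in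
theorem frequently_infDist_le_of_curve {E : Type*} [NormedAddCommGroup E] [NormedSpace ℝ E]
    {S : Set E} {c : ℝ → E} {v : E} (hc : HasDerivAt c v 0) (hS : ∀ s, c s ∈ S) (ε : ℝ)
    (hε : 0 < ε) : ∃ᶠ s in 𝓝[>] (0 : ℝ), infDist (c 0 + s • v) S ≤ ε * s := by
  rw [hasDerivAt_iff_isLittleO] at hc
  have h1 := (hc.def hε).filter_mono (nhdsWithin_le_nhds (s := Ioi 0))
  refine Eventually.frequently ?_
  filter_upwards [h1, self_mem_nhdsWithin] with s hs hs0
  have hs0 : 0 < s := hs0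
  rw [sub_zero, Real.norm_eq_abs, abs_of_pos hs0] at hs
  refine (infDist_le_dist_of_mem (hS s)).trans ?_
  rw [dist_comm, dist_eq_norm, ← sub_sub]
  exact hs

/-! ### The derivative of the exponential map -/

section Exp
variable {A : Type*} [NormedRing A] [NormedAlgebra ℝ A] [CompleteSpace A]

theorem hasDerivAt_exp_smul (Y : A) (τ : ℝ) :
    HasDerivAt (fun τ : ℝ => NormedSpace.exp (τ • Y)) (NormedSpace.exp (τ • Y) * Y) τ :=
  hasDerivAt_exp_smul_const Y τ

theorem hasDerivAt_exp_smul' (Y : A) (τ : ℝ) :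
    HasDerivAt (fun τ : ℝ => NormedSpace.exp (τ • Y)) (Y * NormedSpace.exp (τ • Y)) τ :=
  hasDerivAt_exp_smul_const' Y τ

theorem continuous_exp : Continuous (NormedSpace.exp : A → A) :=
  letI := NormedAlgebra.restrictScalars ℚ ℝ A
  NormedSpace.exp_continuous

theorem contDiff_exp {m : WithTop ℕ∞} : ContDiff ℝ m (NormedSpace.exp : A → A) := by
  rw [contDiff_iff_contDiffAt]
  exact fun x => (NormedSpace.exp_analytic x).contDiffAt

/-- Duhamel's formula: exp(τ(Y+H)) exp((1-τ)Y) interpolates between the two exponentials, and in its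
derivative the terms containing Y cancel. -/
theorem exp_sub_exp (Y H : A) : NormedSpace.exp (Y + H) - NormedSpace.exp Y =
    ∫ τ in (0 : ℝ)..1, NormedSpace.exp (τ • (Y + H)) * H * NormedSpace.exp ((1 - τ) • Y) := by
  have h (τ : ℝ) : HasDerivAt
      (fun τ : ℝ => NormedSpace.exp (τ • (Y + H)) * NormedSpace.exp ((1 - τ) • Y))
      (NormedSpace.exp (τ • (Y + H)) * H * NormedSpace.exp ((1 - τ) • Y)) τ := by
    have h1 := hasDerivAt_exp_smul (Y + H) τ
    have h2 := (hasDerivAt_exp_smul' Y (1 - τ)).scomp τ ((hasDerivAt_id τ).const_sub 1)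
    refine (h1.mul h2).congr_deriv ?_
    rw [neg_one_smul, mul_neg, mul_add, add_mul, mul_assoc _ Y]
    exact add_neg_cancel_comm _ _
  rw [intervalIntegral.integral_eq_sub_of_hasDerivAt (fun τ _ => h τ)]
  · simp
  · apply Continuous.intervalIntegrable
    have := continuous_exp (A := A)
    fun_prop

/-- The derivative of the exponential map. -/
theorem fderiv_exp_apply (Y H : A) : fderiv ℝ (NormedSpace.exp : A → A) Y H =
    ∫ τ in (0 : ℝ)..1, NormedSpace.exp (τ • Y) * H * NormedSpace.exp ((1 - τ) • Y) := by
  have h1 : HasDerivAt (fun s : ℝ => NormedSpace.exp (Y + s • H))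
      (fderiv ℝ (NormedSpace.exp : A → A) Y H) 0 := by
    have hd : HasFDerivAt (NormedSpace.exp : A → A) (fderiv ℝ NormedSpace.exp Y)
        (Y + (0 : ℝ) • H) := by
      rw [zero_smul, add_zero]
      exact ((contDiff_exp (A := A) (m := 1)).differentiable (by simp) Y).hasFDerivAt
    have hl : HasDerivAt (fun s : ℝ => Y + s • H) H 0 := by
      simpa using ((hasDerivAt_id (0 : ℝ)).smul_const H).const_add Y
    exact hd.comp_hasDerivAt 0 hl
  -- By Duhamel's formula for sH, the difference quotient at s ≠ 0 is exactly this integral;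
  -- continuity in s identifies the limit at 0.
  have hcont : Continuous fun s : ℝ => ∫ τ in (0 : ℝ)..1,
      NormedSpace.exp (τ • (Y + s • H)) * H * NormedSpace.exp ((1 - τ) • Y) := by
    apply intervalIntegral.continuous_parametric_intervalIntegral_of_continuous'
    have := continuous_exp (A := A)
    simp only [Function.uncurry_def]
    fun_prop
  have h2 := hasDerivAt_iff_tendsto_slope.1 h1
  have h3 := (hcont.tendsto 0).mono_left (nhdsWithin_le_nhds (s := {(0 : ℝ)}ᶜ))
  simp only [zero_smul, add_zero] at h3
  refine tendsto_nhds_unique (h2.congr' ?_) h3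
  filter_upwards [self_mem_nhdsWithin] with s hs
  have hs : s ≠ 0 := hs
  have h4 := exp_sub_exp Y (s • H)
  rw [slope_def_module, zero_smul, add_zero, sub_zero, h4, ← intervalIntegral.integral_smul]
  refine intervalIntegral.integral_congr fun τ _ => ?_
  simp only [mul_smul_comm, smul_mul_assoc, smul_smul, inv_mul_cancel₀ hs, one_smul]

end Exp

open scoped ComplexOrder in

open scoped ComplexOrder in
theorem re_trace_star_mul_self_pos {M : Mat n} (hM : M ≠ 0) :
    0 < (Matrix.trace (star M * M)).re := by
  have h1 := (Matrix.posSemidef_conjTranspose_mul_self M).trace_nonneg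
  have h2 : Matrix.trace (star M * M) ≠ 0 := by
    rw [Matrix.star_eq_conjTranspose]
    exact fun h => hM (Matrix.trace_conjTranspose_mul_self_eq_zero_iff.1 h)
  exact (Complex.lt_def.1 (lt_of_le_of_ne h1 (Ne.symm h2))).1

theorem exp_smul_half_mul_self (s : ℝ) (Y : Mat n) :
    NormedSpace.exp ((s / 2) • Y) * NormedSpace.exp ((s / 2) • Y) = NormedSpace.exp (s • Y) := by
  rw [← Matrix.exp_add_of_commute _ _ (Commute.refl _), ← add_smul, add_halves]

theorem isSelfAdjoint_exp_smul {Y : Mat n} (hY : IsSelfAdjoint Y) (s : ℝ) :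
    IsSelfAdjoint (NormedSpace.exp (s • Y)) :=
  ((IsSelfAdjoint.all s).smul hY).exp

/-- Pair the integral formula for the derivative with H under Re tr(H^* ·). For hermitian Y,
splitting each exponential into two halves turns the integrand into the squared Hilbert–Schmidt norm
of exp(τY/2) H exp((1-τ)Y/2), which is positive unless H = 0. -/
theorem eq_zero_of_fderiv_exp_eq_zero {Y H : Mat n} (hY : IsSelfAdjoint Y)
    (h : fderiv ℝ (NormedSpace.exp : Mat n → Mat n) Y H = 0) : H = 0 := by
  by_contra hH
  rw [fderiv_exp_apply] at h
  let ℓ : Mat n →L[ℝ] ℝ := LinearMap.toContinuousLinearMap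
    { toFun := fun M => (Matrix.trace (star H * M)).re
      map_add' := fun x y => by simp [mul_add]
      map_smul' := fun c x => by simp }
  have hc : Continuous fun τ : ℝ =>
      NormedSpace.exp (τ • Y) * H * NormedSpace.exp ((1 - τ) • Y) := by
    have := continuous_exp (A := Mat n)
    fun_prop
  have h1 := congrArg ℓ h
  rw [← ContinuousLinearMap.intervalIntegral_comp_comm _ (hc.intervalIntegrable _ _), map_zero]
    at h1
  refine (ne_of_gt ?_) h1
  refine intervalIntegral.intervalIntegral_pos_of_pos ((ℓ.continuous.comp hc).intervalIntegrable _ _)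
    (fun τ => ?_) one_pos
  have h2 : ℓ (NormedSpace.exp (τ • Y) * H * NormedSpace.exp ((1 - τ) • Y)) =
      (Matrix.trace (star (NormedSpace.exp ((τ / 2) • Y) * H * NormedSpace.exp (((1 - τ) / 2) • Y))
        * (NormedSpace.exp ((τ / 2) • Y) * H * NormedSpace.exp (((1 - τ) / 2) • Y)))).re := by
    change (Matrix.trace (_ : Mat n)).re = _
    rw [star_mul, star_mul, (isSelfAdjoint_exp_smul hY _).star_eq,
      (isSelfAdjoint_exp_smul hY _).star_eq, ← exp_smul_half_mul_self τ,
      ← exp_smul_half_mul_self (1 - τ)]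
    congr 1
    simp only [mul_assoc]
    rw [Matrix.trace_mul_comm (NormedSpace.exp (((1 - τ) / 2) • Y))]
    simp only [mul_assoc]
  change 0 < ℓ _
  rw [h2]
  apply re_trace_star_mul_self_pos
  intro h3
  apply hH
  rwa [IsUnit.mul_left_eq_zero (Matrix.isUnit_exp _),
    IsUnit.mul_right_eq_zero (Matrix.isUnit_exp _)] at h3

/-- The exponential map of `Mat n` is a local diffeomorphism at a hermitian matrix. -/
theorem exists_fderiv_exp_equiv {Y : Mat n} (hY : IsSelfAdjoint Y) :
    ∃ e : Mat n ≃L[ℝ] Mat n,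
      HasFDerivAt (NormedSpace.exp : Mat n → Mat n) (e : Mat n →L[ℝ] Mat n) Y := by
  have hinj : Function.Injective (fderiv ℝ (NormedSpace.exp : Mat n → Mat n) Y : Mat n →ₗ[ℝ] Mat n) :=
    (injective_iff_map_eq_zero _).2 fun H h => eq_zero_of_fderiv_exp_eq_zero hY h
  refine ⟨(LinearEquiv.ofInjectiveEndo _ hinj).toContinuousLinearEquiv, ?_⟩
  exact ((contDiff_exp (A := Mat n) (m := 1)).differentiable (by simp) Y).hasFDerivAt

end

section

/-! ### The Lie algebra of a closed subgroup of `U(n)` -/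


/-- `G` as a set of matrices. -/
def gset (G : Subgroup (Matrix.unitaryGroup (Fin n) ℂ)) : Set (Mat n) := {A | ∃ k ∈ G, (k : Mat n) = A}

section
variable {G : Subgroup (Matrix.unitaryGroup (Fin n) ℂ)}

theorem one_mem_gset : (1 : Mat n) ∈ gset G := ⟨1, G.one_mem, rfl⟩

theorem mul_mem_gset {A B : Mat n} (hA : A ∈ gset G) (hB : B ∈ gset G) : A * B ∈ gset G := by
  obtain ⟨k, hk, rfl⟩ := hA
  obtain ⟨l, hl, rfl⟩ := hB
  exact ⟨k * l, G.mul_mem hk hl, rfl⟩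

theorem star_mem_gset {A : Mat n} (hA : A ∈ gset G) : star A ∈ gset G := by
  obtain ⟨k, hk, rfl⟩ := hA
  exact ⟨k⁻¹, G.inv_mem hk, rfl⟩

theorem gset_unitary {A : Mat n} (hA : A ∈ gset G) : A ∈ unitary (Mat n) := by
  obtain ⟨k, hk, rfl⟩ := hA
  exact k.2

theorem star_mul_of_mem {A : Mat n} (hA : A ∈ gset G) : star A * A = 1 :=
  Unitary.star_mul_self_of_mem (gset_unitary hA)

theorem mul_star_of_mem {A : Mat n} (hA : A ∈ gset G) : A * star A = 1 :=
  Unitary.mul_star_self_of_mem (gset_unitary hA)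

theorem inv_of_mem {A : Mat n} (hA : A ∈ gset G) : A⁻¹ = star A :=
  Matrix.inv_eq_left_inv (star_mul_of_mem hA)

theorem isClosed_gset (hG : IsClosed (G : Set (Matrix.unitaryGroup (Fin n) ℂ))) :
    IsClosed (gset G) := by
  have h : gset G = Subtype.val '' (G : Set (Matrix.unitaryGroup (Fin n) ℂ)) := by
    ext A; simp [gset]
  rw [h]
  exact (isClosed_unitary (R := Mat n)).isClosedEmbedding_subtypeVal.isClosedMap _ hG

theorem mem_lie_iff {X : Mat n} : X ∈ lie G ↔ ∀ s : ℝ, NormedSpace.exp (s • X) ∈ gset G := Iff.rfl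

theorem exp_mem_gset {X : Mat n} (hX : X ∈ lie G) : NormedSpace.exp X ∈ gset G := by
  simpa using mem_lie_iff.1 hX 1


/-- A matrix tangent to `G` at `1` belongs to the Lie algebra. -/
theorem mem_lie_of_tangent (hG : IsClosed (G : Set (Matrix.unitaryGroup (Fin n) ℂ))) {Z : Mat n}
    (hZ : ∀ ε : ℝ, 0 < ε → ∃ᶠ s in 𝓝[>] (0 : ℝ), infDist (1 + s • Z) (gset G) ≤ ε * s) :
    Z ∈ lie G := by
  have key : ∀ s : ℝ, 0 ≤ s → NormedSpace.exp (s • Z) ∈ gset G := by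
    intro s hs
    -- The curve exp(tZ) is an integral curve of x ↦ xZ. Tangency of this field at h ∈ G is tangency
    -- at 1, translated by the isometry x ↦ hx.
    refine mem_of_tangent (isClosed_gset hG) (V := fun _ x => x * Z) (L := ‖Z‖) (a := 0) (b := s)
      (u := fun t => NormedSpace.exp (t • Z)) (fun t _ x y => ?_) ?_ ?_ ?_ ?_ s ⟨hs, le_rfl⟩
    · rw [← sub_mul, mul_comm ‖Z‖]
      exact norm_mul_le _ _
    · have := continuous_exp (A := Mat n)
      fun_prop
    · exact fun t _ => (hasDerivAt_exp_smul Z t).hasDerivWithinAt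
    · simpa using one_mem_gset
    · intro t _ h hh ε hε
      refine (hZ ε hε).mono fun s hs => le_trans ?_ hs
      refine (le_infDist ⟨1, one_mem_gset⟩).2 fun y hy => ?_
      refine (infDist_le_dist_of_mem (mul_mem_gset hh hy)).trans_eq ?_
      rw [dist_eq_norm, dist_eq_norm]
      have : h + s • (h * Z) - h * y = h * (1 + s • Z - y) := by
        rw [mul_sub, mul_add, mul_one, mul_smul_comm]
      rw [this]
      exact CStarRing.norm_mem_unitary_mul _ (gset_unitary hh)
  intro s
  rcases le_total 0 s with hs | hs
  · exact key s hs
  · have h1 := key (-s) (by linarith)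
    have h2 := star_mem_gset h1
    rwa [← inv_of_mem h1, ← Matrix.exp_neg, neg_smul, neg_neg] at h2

theorem mem_lie_of_hasDerivAt (hG : IsClosed (G : Set (Matrix.unitaryGroup (Fin n) ℂ)))
    {c : ℝ → Mat n} {Z : Mat n} (hc : HasDerivAt c Z 0) (h0 : c 0 = 1) (hS : ∀ s, c s ∈ gset G) :
    Z ∈ lie G := by
  refine mem_lie_of_tangent hG fun ε hε => ?_
  have := frequently_infDist_le_of_curve hc hS ε hε
  rwa [h0] at this

theorem zero_mem_lie : (0 : Mat n) ∈ lie G := fun s => ⟨1, G.one_mem, by simp⟩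

theorem smul_mem_lie (c : ℝ) {X : Mat n} (hX : X ∈ lie G) : c • X ∈ lie G := fun s => by
  rw [smul_smul]; exact hX _

theorem neg_mem_lie {X : Mat n} (hX : X ∈ lie G) : -X ∈ lie G := by
  simpa using smul_mem_lie (-1) hX

theorem hasDerivAt_exp_smul_zero (X : Mat n) :
    HasDerivAt (fun s : ℝ => NormedSpace.exp (s • X)) X 0 := by
  simpa using hasDerivAt_exp_smul X 0

theorem add_mem_lie (hG : IsClosed (G : Set (Matrix.unitaryGroup (Fin n) ℂ))) {X Y : Mat n}
    (hX : X ∈ lie G) (hY : Y ∈ lie G) : X + Y ∈ lie G := by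
  refine mem_lie_of_hasDerivAt hG
    (c := fun s : ℝ => NormedSpace.exp (s • X) * NormedSpace.exp (s • Y)) ?_ (by simp)
    fun s => mul_mem_gset (hX s) (hY s)
  exact ((hasDerivAt_exp_smul_zero X).mul (hasDerivAt_exp_smul_zero Y)).congr_deriv (by simp)

theorem star_of_mem_lie {X : Mat n} (hX : X ∈ lie G) : star X = -X := by
  have h1 := (hasDerivAt_exp_smul_zero X).star.mul (hasDerivAt_exp_smul_zero X)
  have h2 : (fun s : ℝ => star (NormedSpace.exp (s • X)) * NormedSpace.exp (s • X)) = fun _ => 1 :=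
    funext fun s => star_mul_of_mem (hX s)
  have h3 := h1.unique ((hasDerivAt_const (0 : ℝ) (1 : Mat n)).congr_of_eventuallyEq
    (Eventually.of_forall fun s => congrFun h2 s))
  simp only [zero_smul, NormedSpace.exp_zero, mul_one, star_one, one_mul] at h3
  exact eq_neg_of_add_eq_zero_left h3

/-- The Lie algebra as a real subspace. -/
def lieSub (hG : IsClosed (G : Set (Matrix.unitaryGroup (Fin n) ℂ))) : Submodule ℝ (Mat n) where
  carrier := lie G
  zero_mem' := zero_mem_lie
  add_mem' := add_mem_lie hG
  smul_mem' := fun c _ => smul_mem_lie c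

theorem sub_mem_lie (hG : IsClosed (G : Set (Matrix.unitaryGroup (Fin n) ℂ))) {X Y : Mat n}
    (hX : X ∈ lie G) (hY : Y ∈ lie G) : X - Y ∈ lie G :=
  (lieSub hG).sub_mem hX hY

theorem isClosed_lie (hG : IsClosed (G : Set (Matrix.unitaryGroup (Fin n) ℂ))) :
    IsClosed (lie G) :=
  (lieSub hG).closed_of_finiteDimensional

/-- Conjugation by a unit commutes with the exponential map. -/
theorem exp_conj_of_mul_eq_one {a b : Mat n} (hab : a * b = 1) (hba : b * a = 1) (X : Mat n) :
    NormedSpace.exp (a * X * b) = a * NormedSpace.exp X * b :=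
  Matrix.exp_units_conj ⟨a, b, hab, hba⟩ X

theorem conj_mem_lie {k X : Mat n} (hk : k ∈ gset G) (hX : X ∈ lie G) :
    k * X * star k ∈ lie G := fun s => by
  have : s • (k * X * star k) = k * (s • X) * star k := by
    rw [mul_smul_comm, smul_mul_assoc]
  rw [this, exp_conj_of_mul_eq_one (mul_star_of_mem hk) (star_mul_of_mem hk)]
  exact mul_mem_gset (mul_mem_gset hk (hX s)) (star_mem_gset hk)

theorem deriv_mem_submodule {E : Type*} [NormedAddCommGroup E] [NormedSpace ℝ E]
    (S : Submodule ℝ E) (hS : IsClosed (S : Set E)) {c : ℝ → E} {v : E} {s : Set ℝ} {t : ℝ}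
    (hs : (𝓝[s \ {t}] t).NeBot)
    (hc : HasDerivWithinAt c v s t) (h : ∀ r ∈ s, c r ∈ S) (ht : c t ∈ S) : v ∈ S := by
  rw [hasDerivWithinAt_iff_tendsto_slope] at hc
  refine hS.mem_of_tendsto hc ?_
  filter_upwards [self_mem_nhdsWithin] with r hr
  rw [slope_def_module]
  exact S.smul_mem _ (S.sub_mem (h r hr.1) ht)

theorem deriv_mem_submodule' {E : Type*} [NormedAddCommGroup E] [NormedSpace ℝ E]
    (S : Submodule ℝ E) (hS : IsClosed (S : Set E)) {c : ℝ → E} {v : E} {t : ℝ}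
    (hc : HasDerivAt c v t) (h : ∀ r, c r ∈ S) : v ∈ S :=
  deriv_mem_submodule S hS (s := univ) (by rw [← compl_eq_univ_sdiff]; infer_instance)
    hc.hasDerivWithinAt (fun r _ => h r) (h t)

theorem hasDerivAt_exp_conj (X Z : Mat n) (s : ℝ) :
    HasDerivAt (fun s : ℝ => NormedSpace.exp (s • X) * Z * NormedSpace.exp (-(s • X)))
      ⁅X, NormedSpace.exp (s • X) * Z * NormedSpace.exp (-(s • X))⁆ s := by
  have h1 := (hasDerivAt_exp_smul' X s).mul_const Z
  have h2 := hasDerivAt_exp_smul (-X) s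
  simp only [smul_neg] at h2
  refine (h1.mul h2).congr_deriv ?_
  rw [Ring.lie_def, mul_neg, mul_neg, ← sub_eq_add_neg]
  simp only [mul_assoc]

theorem lie_mem_lie (hG : IsClosed (G : Set (Matrix.unitaryGroup (Fin n) ℂ))) {X Y : Mat n}
    (hX : X ∈ lie G) (hY : Y ∈ lie G) : ⁅X, Y⁆ ∈ lie G := by
  have h := hasDerivAt_exp_conj X Y 0
  simp only [zero_smul, neg_zero, NormedSpace.exp_zero, one_mul, mul_one] at h
  refine deriv_mem_submodule' (lieSub hG) (isClosed_lie hG) h fun s => ?_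
  have h1 := conj_mem_lie (hX s) hY
  rwa [← inv_of_mem (hX s), ← Matrix.exp_neg] at h1

end

end

section

/-! ### Matrix logarithm near the identity -/

/-- The inverse of the exponential map near `1`. -/
def logOne : Mat n → Mat n :=
  (contDiff_exp (A := Mat n) (m := ω)).contDiffAt.localInverse
    (f' := ContinuousLinearEquiv.refl ℝ (Mat n)) (a := 0) (hasFDerivAt_exp_zero (𝕂 := ℝ)) (by simp)

theorem logOne_one : logOne (1 : Mat n) = 0 := by
  have := (contDiff_exp (A := Mat n) (m := ω)).contDiffAt.localInverse_apply_image
    (f' := ContinuousLinearEquiv.refl ℝ (Mat n)) (a := 0) (hasFDerivAt_exp_zero (𝕂 := ℝ)) (by simp)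
  rwa [NormedSpace.exp_zero] at this

theorem contDiffAt_logOne : ContDiffAt ℝ ω (logOne : Mat n → Mat n) 1 := by
  have := (contDiff_exp (A := Mat n) (m := ω)).contDiffAt.to_localInverse
    (f' := ContinuousLinearEquiv.refl ℝ (Mat n)) (a := 0) (hasFDerivAt_exp_zero (𝕂 := ℝ)) (by simp)
  rwa [NormedSpace.exp_zero] at this

theorem eventually_exp_logOne : ∀ᶠ A : Mat n in 𝓝 1, NormedSpace.exp (logOne A) = A := by
  have := ((contDiff_exp (A := Mat n) (m := ω)).contDiffAt.hasStrictFDerivAt'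
    (f' := ContinuousLinearEquiv.refl ℝ (Mat n)) (x := 0)
    (hasFDerivAt_exp_zero (𝕂 := ℝ)) (by simp)).eventually_right_inverse
  rwa [NormedSpace.exp_zero] at this

theorem eventually_logOne_exp : ∀ᶠ Y : Mat n in 𝓝 0, logOne (NormedSpace.exp Y) = Y :=
  ((contDiff_exp (A := Mat n) (m := ω)).contDiffAt.hasStrictFDerivAt'
    (f' := ContinuousLinearEquiv.refl ℝ (Mat n)) (x := 0)
    (hasFDerivAt_exp_zero (𝕂 := ℝ)) (by simp)).eventually_left_inverse

theorem exists_proj (S : Submodule ℝ (Mat n)) :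
    ∃ π : Mat n →L[ℝ] Mat n, (∀ x, π x ∈ S) ∧ ∀ x ∈ S, π x = x := by
  obtain ⟨p, hp⟩ := Submodule.ClosedComplemented.of_finiteDimensional (𝕜 := ℝ) S
  exact ⟨S.subtypeL.comp p, fun x => (p x).2, fun x hx => congrArg Subtype.val (hp ⟨x, hx⟩)⟩

variable {G : Subgroup (Matrix.unitaryGroup (Fin n) ℂ)}

/-- The compactness argument of the closed subgroup theorem. Otherwise there are nonzero M_j → 0 in
ker π with exp M_j in G; a limit N of the unit vectors M_j/‖M_j‖ is tangent to G along s = ‖M_j‖, so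
N lies in 𝔤 and πN = N. But πN = 0 and ‖N‖ = 1. -/
theorem eventually_eq_zero_of_exp_mem (hG : IsClosed (G : Set (Matrix.unitaryGroup (Fin n) ℂ)))
    {π : Mat n →L[ℝ] Mat n} (hπ : ∀ X ∈ lie G, π X = X) :
    ∀ᶠ M : Mat n in 𝓝 0, π M = 0 → NormedSpace.exp M ∈ gset G → M = 0 := by
  by_contra hcon
  rw [not_eventually] at hcon
  obtain ⟨M, hM0, hM⟩ := exists_seq_forall_of_frequently hcon
  have hM' : ∀ j, π (M j) = 0 ∧ NormedSpace.exp (M j) ∈ gset G ∧ M j ≠ 0 := fun j => by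
    have := hM j; push Not at this; exact this
  have hsph : ∀ j, ‖M j‖⁻¹ • M j ∈ sphere (0 : Mat n) 1 := fun j => by
    rw [mem_sphere_zero_iff_norm, norm_smul, norm_inv, norm_norm,
      inv_mul_cancel₀ (norm_ne_zero_iff.2 (hM' j).2.2)]
  obtain ⟨N, hN, φ, hφ, hlim⟩ := (isCompact_sphere (0 : Mat n) 1).tendsto_subseq hsph
  have hπN : π N = 0 := by
    refine tendsto_nhds_unique ((π.continuous.tendsto N).comp hlim) ?_
    have : (π ∘ (fun j => ‖M j‖⁻¹ • M j) ∘ φ) = fun _ => 0 := by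
      ext1 j
      simp [map_smul, (hM' (φ j)).1]
    rw [this]
    exact tendsto_const_nhds
  have hMφ : Tendsto (fun j => M (φ j)) atTop (𝓝 0) := hM0.comp hφ.tendsto_atTop
  have hNlie : N ∈ lie G := by
    refine mem_lie_of_tangent hG fun ε hε => ?_
    have h1 : Tendsto (fun j => ‖M (φ j)‖) atTop (𝓝[>] 0) := by
      refine tendsto_nhdsWithin_iff.2 ⟨?_, Eventually.of_forall fun j => ?_⟩
      · simpa using hMφ.norm
      · exact norm_pos_iff.2 (hM' (φ j)).2.2
    refine h1.frequently (Eventually.frequently ?_)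
    have h2 : ∀ᶠ j in atTop, ‖N - ‖M (φ j)‖⁻¹ • M (φ j)‖ < ε / 2 := by
      have := (tendsto_const_nhds (x := N)).sub hlim
      rw [sub_self] at this
      simpa using (tendsto_zero_iff_norm_tendsto_zero.1 this).eventually_lt_const (half_pos hε)
    have h3 : ∀ᶠ j in atTop, ‖NormedSpace.exp (M (φ j)) - 1 - M (φ j)‖ ≤ ε / 2 * ‖M (φ j)‖ := by
      have h := (hasFDerivAt_exp_zero (𝕂 := ℝ) (𝔸 := Mat n)).isLittleO.def (half_pos hε)
      filter_upwards [hMφ.eventually h] with j hj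
      simpa using hj
    filter_upwards [h2, h3] with j hj2 hj3
    refine (infDist_le_dist_of_mem (hM' (φ j)).2.1).trans ?_
    rw [dist_eq_norm]
    have hne : ‖M (φ j)‖ ≠ 0 := norm_ne_zero_iff.2 (hM' (φ j)).2.2
    have e : 1 + ‖M (φ j)‖ • N - NormedSpace.exp (M (φ j)) =
        ‖M (φ j)‖ • (N - ‖M (φ j)‖⁻¹ • M (φ j)) - (NormedSpace.exp (M (φ j)) - 1 - M (φ j)) := by
      rw [smul_sub, smul_smul, mul_inv_cancel₀ hne, one_smul]
      abel
    rw [e]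
    refine (norm_sub_le _ _).trans ?_
    rw [norm_smul, norm_norm]
    nlinarith [norm_nonneg (M (φ j))]
  rw [hπ N hNlie] at hπN
  rw [hπN] at hN
  simp at hN

/-- A closed subgroup of `U(n)` is the image of its Lie algebra near the identity. -/
theorem eventually_logOne_mem_lie (hG : IsClosed (G : Set (Matrix.unitaryGroup (Fin n) ℂ))) :
    ∀ᶠ k : Mat n in 𝓝 1, k ∈ gset G → logOne k ∈ lie G := by
  obtain ⟨π, hπ1, hπ2⟩ := exists_proj (lieSub hG)
  -- A chart at 1 adapted to the splitting 𝔤 ⊕ ker π, with derivative the identity at 0. For k =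
  -- Φ(Z) in G the second factor lies in G too, so it is trivial by `eventually_eq_zero_of_exp_mem`,
  -- and k = exp(πZ).
  let Φ : Mat n → Mat n := fun Z => NormedSpace.exp (π Z) * NormedSpace.exp (Z - π Z)
  have hΦ0 : Φ 0 = 1 := by simp [Φ]
  have hΦc : ContDiff ℝ ω Φ := by
    have := contDiff_exp (A := Mat n) (m := ω)
    have h1 : ContDiff ℝ ω fun Z => NormedSpace.exp (π Z) := this.comp π.contDiff
    have h2 : ContDiff ℝ ω fun Z => NormedSpace.exp (Z - π Z) :=
      this.comp (contDiff_id.sub π.contDiff)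
    exact h1.mul h2
  have hΦd : HasFDerivAt Φ ((ContinuousLinearEquiv.refl ℝ (Mat n) : Mat n →L[ℝ] Mat n)) 0 := by
    have he : HasFDerivAt (NormedSpace.exp : Mat n → Mat n) (1 : Mat n →L[ℝ] Mat n) (π 0) := by
      rw [map_zero]; exact hasFDerivAt_exp_zero
    have he' : HasFDerivAt (NormedSpace.exp : Mat n → Mat n) (1 : Mat n →L[ℝ] Mat n) (0 - π 0) := by
      rw [map_zero, sub_zero]; exact hasFDerivAt_exp_zero
    have h1 := he.comp (0 : Mat n) π.hasFDerivAt
    have h2 := he'.comp (0 : Mat n) ((hasFDerivAt_id (0 : Mat n)).sub π.hasFDerivAt)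
    refine (h1.mul' h2).congr_fderiv ?_
    ext1 x
    simp
  have hs := hΦc.contDiffAt.hasStrictFDerivAt' hΦd (by simp)
  set Ψ := hs.localInverse Φ _ 0 with hΨ
  have hΨ1 : ∀ᶠ k in 𝓝 (1 : Mat n), Φ (Ψ k) = k := by
    have := hs.eventually_right_inverse
    rwa [hΦ0] at this
  have hΨ0 : Ψ 1 = 0 := by
    have := hs.localInverse_apply_image
    rwa [hΦ0] at this
  have hΨt : Tendsto Ψ (𝓝 1) (𝓝 0) := by
    have := hs.localInverse_continuousAt
    rw [hΦ0] at this
    rw [ContinuousAt, ← hΨ, hΨ0] at this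
    exact this
  have hY : Tendsto (fun k => π (Ψ k)) (𝓝 1) (𝓝 0) := by
    have := (π.continuous.tendsto 0).comp hΨt
    rwa [map_zero] at this
  have hM : Tendsto (fun k => Ψ k - π (Ψ k)) (𝓝 1) (𝓝 0) := by
    simpa using hΨt.sub hY
  filter_upwards [hΨ1, hM.eventually (eventually_eq_zero_of_exp_mem hG hπ2),
    hY.eventually eventually_logOne_exp] with k h1 h2 h3 hk
  have h4 : NormedSpace.exp (Ψ k - π (Ψ k)) ∈ gset G := by
    have : NormedSpace.exp (Ψ k - π (Ψ k)) = star (NormedSpace.exp (π (Ψ k))) * k := by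
      rw [← congrArg (star (NormedSpace.exp (π (Ψ k))) * ·) h1]
      simp only [Φ]
      rw [← mul_assoc, star_mul_of_mem (exp_mem_gset (hπ1 _)), one_mul]
    rw [this]
    exact mul_mem_gset (star_mem_gset (exp_mem_gset (hπ1 _))) hk
  have h5 := h2 (by rw [map_sub, hπ2 _ (hπ1 _), sub_self]) h4
  have h6 : NormedSpace.exp (π (Ψ k)) = k := by
    refine Eq.trans ?_ h1
    simp only [Φ]
    rw [h5, NormedSpace.exp_zero, mul_one]
  rw [← h6, h3]
  exact hπ1 _

/-! ### The complexified Lie algebra -/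

theorem rePart_add_imPart (Z : Mat n) : rePart Z + Complex.I • imPart Z = Z := by
  simp only [rePart, imPart, smul_smul]
  rw [show Complex.I * (-Complex.I / 2) = 1 / 2 by
    rw [mul_div_assoc', mul_neg, Complex.I_mul_I, neg_neg], ← smul_add]
  rw [sub_add_add_cancel, ← two_smul ℂ, smul_smul]
  norm_num

theorem star_I_smul (Y : Mat n) : star (Complex.I • Y) = -(Complex.I • star Y) := by
  rw [star_smul, Complex.star_def, Complex.conj_I, neg_smul]

theorem rePart_add_I_smul {X Y : Mat n} (hX : star X = -X) (hY : star Y = -Y) :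
    rePart (X + Complex.I • Y) = X := by
  rw [rePart, star_add, star_I_smul, hX, hY, smul_neg, neg_neg]
  rw [show X + Complex.I • Y - (-X + Complex.I • Y) = (2 : ℂ) • X by rw [two_smul]; abel,
    smul_smul]
  norm_num

theorem imPart_add_I_smul {X Y : Mat n} (hX : star X = -X) (hY : star Y = -Y) :
    imPart (X + Complex.I • Y) = Y := by
  rw [imPart, star_add, star_I_smul, hX, hY, smul_neg, neg_neg]
  rw [show X + Complex.I • Y + (-X + Complex.I • Y) = (2 * Complex.I : ℂ) • Y by
      rw [two_mul, add_smul]; abel, smul_smul]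
  rw [show -Complex.I / 2 * (2 * Complex.I) = 1 by
    rw [neg_div, neg_mul, ← mul_assoc, div_mul_cancel₀ _ two_ne_zero, Complex.I_mul_I, neg_neg],
    one_smul]

theorem mem_lieC_iff {Z : Mat n} : Z ∈ lieC G ↔ rePart Z ∈ lie G ∧ imPart Z ∈ lie G := by
  constructor
  · rintro ⟨X, hX, Y, hY, rfl⟩
    rw [rePart_add_I_smul (star_of_mem_lie hX) (star_of_mem_lie hY),
      imPart_add_I_smul (star_of_mem_lie hX) (star_of_mem_lie hY)]
    exact ⟨hX, hY⟩
  · exact fun h => ⟨_, h.1, _, h.2, (rePart_add_imPart Z).symm⟩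

/-- The complexified Lie algebra as a complex subspace. -/
def lieCSub (hG : IsClosed (G : Set (Matrix.unitaryGroup (Fin n) ℂ))) : Submodule ℂ (Mat n) where
  carrier := lieC G
  zero_mem' := ⟨0, zero_mem_lie, 0, zero_mem_lie, by simp⟩
  add_mem' := by
    rintro _ _ ⟨X, hX, Y, hY, rfl⟩ ⟨X', hX', Y', hY', rfl⟩
    exact ⟨X + X', add_mem_lie hG hX hX', Y + Y', add_mem_lie hG hY hY', by rw [smul_add]; abel⟩
  smul_mem' := by
    rintro c _ ⟨X, hX, Y, hY, rfl⟩
    refine ⟨c.re • X - c.im • Y, sub_mem_lie hG (smul_mem_lie _ hX) (smul_mem_lie _ hY),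
      c.im • X + c.re • Y, add_mem_lie hG (smul_mem_lie _ hX) (smul_mem_lie _ hY), ?_⟩
    ext i j
    simp only [Matrix.smul_apply, Matrix.add_apply, Matrix.sub_apply, smul_eq_mul,
      Complex.real_smul]
    conv_lhs => rw [← Complex.re_add_im c]
    linear_combination (c.im * Y i j : ℂ) * Complex.I_mul_I

theorem mem_lieCSub {hG : IsClosed (G : Set (Matrix.unitaryGroup (Fin n) ℂ))} {X : Mat n} :
    X ∈ lieCSub hG ↔ X ∈ lieC G := Iff.rfl

theorem lie_subset_lieC {X : Mat n} (hX : X ∈ lie G) : X ∈ lieC G :=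
  ⟨X, hX, 0, zero_mem_lie, by simp⟩

theorem I_smul_mem_lieC {X : Mat n} (hX : X ∈ lie G) : Complex.I • X ∈ lieC G :=
  ⟨0, zero_mem_lie, X, hX, by simp⟩

theorem isClosed_lieC (hG : IsClosed (G : Set (Matrix.unitaryGroup (Fin n) ℂ))) :
    IsClosed (lieC G) :=
  (lieCSub hG).closed_of_finiteDimensional

theorem star_mem_lieC {Z : Mat n}
    (hZ : Z ∈ lieC G) : star Z ∈ lieC G := by
  obtain ⟨X, hX, Y, hY, rfl⟩ := hZ
  refine ⟨-X, neg_mem_lie hX, Y, hY, ?_⟩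
  rw [star_add, star_I_smul, star_of_mem_lie hX, star_of_mem_lie hY, smul_neg, neg_neg]

theorem lie_add_I_smul (X Y X' Y' : Mat n) :
    ⁅X + Complex.I • Y, X' + Complex.I • Y'⁆ =
      (⁅X, X'⁆ - ⁅Y, Y'⁆) + Complex.I • (⁅X, Y'⁆ + ⁅Y, X'⁆) := by
  simp only [Ring.lie_def, mul_add, add_mul, smul_mul_assoc, mul_smul_comm, smul_sub, smul_add,
    smul_smul, Complex.I_mul_I, neg_one_smul]
  abel

theorem lie_mem_lieC (hG : IsClosed (G : Set (Matrix.unitaryGroup (Fin n) ℂ))) {Z W : Mat n}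
    (hZ : Z ∈ lieC G) (hW : W ∈ lieC G) : ⁅Z, W⁆ ∈ lieC G := by
  obtain ⟨X, hX, Y, hY, rfl⟩ := hZ
  obtain ⟨X', hX', Y', hY', rfl⟩ := hW
  rw [lie_add_I_smul]
  exact ⟨_, sub_mem_lie hG (lie_mem_lie hG hX hX') (lie_mem_lie hG hY hY'), _,
    add_mem_lie hG (lie_mem_lie hG hX hY') (lie_mem_lie hG hY hX'), rfl⟩

theorem conj_mem_lieC {k Z : Mat n} (hk : k ∈ gset G) (hZ : Z ∈ lieC G) :
    k * Z * star k ∈ lieC G := by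
  obtain ⟨X, hX, Y, hY, rfl⟩ := hZ
  refine ⟨_, conj_mem_lie hk hX, _, conj_mem_lie hk hY, ?_⟩
  rw [mul_add, add_mul, mul_smul_comm, smul_mul_assoc]

/-- A closed subspace preserved by a bounded time-dependent linear vector field is invariant under
the flow. -/
theorem mem_submodule_of_ode {E : Type*} [NormedAddCommGroup E] [NormedSpace ℝ E]
    [FiniteDimensional ℝ E] (S : Submodule ℝ E) {V : ℝ → E → E} {L a b : ℝ}
    (hL : ∀ t ∈ Ico a b, ∀ x y, ‖V t x - V t y‖ ≤ L * ‖x - y‖) {u : ℝ → E}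
    (hu : ContinuousOn u (Icc a b))
    (hu' : ∀ t ∈ Ico a b, HasDerivWithinAt u (V t (u t)) (Ici t) t) (h0 : u a ∈ S)
    (hV : ∀ t ∈ Ico a b, ∀ h ∈ S, V t h ∈ S) : ∀ t ∈ Icc a b, u t ∈ S := by
  have := FiniteDimensional.proper ℝ E
  refine mem_of_tangent S.closed_of_finiteDimensional hL hu hu' h0 fun t ht h hh ε hε => ?_
  refine Eventually.frequently ?_
  filter_upwards [self_mem_nhdsWithin] with s hs
  rw [infDist_zero_of_mem (S.add_mem hh (S.smul_mem s (hV t ht h hh)))]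
  exact mul_nonneg hε.le (le_of_lt hs)

theorem lie_norm_le (X Y : Mat n) : ‖⁅X, Y⁆‖ ≤ 2 * ‖X‖ * ‖Y‖ := by
  rw [Ring.lie_def]
  refine (norm_sub_le _ _).trans ?_
  have h1 := norm_mul_le X Y
  have h2 := norm_mul_le Y X
  linarith

theorem mat_lie_sub (X Y Z : Mat n) : ⁅X, Y - Z⁆ = ⁅X, Y⁆ - ⁅X, Z⁆ := by
  simp only [Ring.lie_def, mul_sub, sub_mul]
  abel

theorem mat_lie_add (X Y Z : Mat n) : ⁅X, Y + Z⁆ = ⁅X, Y⁆ + ⁅X, Z⁆ := by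
  simp only [Ring.lie_def, mul_add, add_mul]
  abel

theorem mat_lie_skew (X Y : Mat n) : -⁅X, Y⁆ = ⁅Y, X⁆ := by
  simp only [Ring.lie_def, neg_sub]

/-- `exp(Z)` normalises the complexified Lie algebra. -/
theorem exp_conj_mem_lieC (hG : IsClosed (G : Set (Matrix.unitaryGroup (Fin n) ℂ))) {Z W : Mat n}
    (hZ : Z ∈ lieC G) (hW : W ∈ lieC G) (τ : ℝ) :
    NormedSpace.exp (τ • Z) * W * NormedSpace.exp (-(τ • Z)) ∈ lieC G := by
  have key : ∀ Z ∈ lieC G, NormedSpace.exp Z * W * NormedSpace.exp (-Z) ∈ lieC G := by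
    intro Z hZ
    -- The conjugate exp(sZ) W exp(-sZ) solves x' = [Z,x], a field that preserves 𝔤ᶜ.
    have h := mem_submodule_of_ode ((lieCSub hG).restrictScalars ℝ) (V := fun _ x => ⁅Z, x⁆)
      (L := 2 * ‖Z‖) (a := 0) (b := 1)
      (u := fun s : ℝ => NormedSpace.exp (s • Z) * W * NormedSpace.exp (-(s • Z)))
      (fun t _ x y => (congrArg norm (mat_lie_sub Z x y).symm).trans_le (lie_norm_le _ _))
      (fun t _ => (hasDerivAt_exp_conj Z W t).continuousAt.continuousWithinAt)
      (fun t _ => (hasDerivAt_exp_conj Z W t).hasDerivWithinAt) (by simpa [mem_lieCSub] using hW)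
      (fun t _ x hx => lie_mem_lieC hG hZ hx) 1 ⟨zero_le_one, le_rfl⟩
    simpa [mem_lieCSub] using h
  exact key _ (((lieCSub hG).restrictScalars ℝ).smul_mem τ hZ)

end

section

/-! ### Polar decomposition -/

theorem exp_mul_exp_neg (Z : Mat n) : NormedSpace.exp Z * NormedSpace.exp (-Z) = 1 := by
  rw [← Matrix.exp_add_of_commute _ _ ((Commute.refl Z).neg_right), add_neg_cancel,
    NormedSpace.exp_zero]

theorem exp_neg_mul_exp (Z : Mat n) : NormedSpace.exp (-Z) * NormedSpace.exp Z = 1 := by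
  simpa using exp_mul_exp_neg (-Z)

theorem eq_of_exp_eq {H K : Mat n} (hH : IsSelfAdjoint H) (hK : IsSelfAdjoint K)
    (h : NormedSpace.exp H = NormedSpace.exp K) : H = K := by
  rw [← CFC.log_exp H hH, h, CFC.log_exp K hK]

theorem exp_two_smul (H : Mat n) :
    NormedSpace.exp ((2 : ℝ) • H) = NormedSpace.exp H * NormedSpace.exp H := by
  rw [← Matrix.exp_add_of_commute _ _ (Commute.refl H), two_smul]

theorem isSelfAdjoint_I_smul {X : Mat n} (hX : star X = -X) : IsSelfAdjoint (Complex.I • X) := by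
  rw [isSelfAdjoint_iff, star_I_smul, hX, smul_neg, neg_neg]

/-- The skew-hermitian `X` with `A^* A = exp(2iX)`. -/
def polarX (A : Mat n) : Mat n := (-Complex.I / 2) • CFC.log (star A * A)

theorem polarX_mul_exp {k X : Mat n} (hk : star k * k = 1) (hX : star X = -X) :
    polarX (k * NormedSpace.exp (Complex.I • X)) = X := by
  have hs := isSelfAdjoint_I_smul hX
  have h1 : star (k * NormedSpace.exp (Complex.I • X)) * (k * NormedSpace.exp (Complex.I • X)) =
      NormedSpace.exp ((2 : ℝ) • Complex.I • X) := by
    rw [star_mul, hs.exp.star_eq, mul_assoc, ← mul_assoc (star k), hk, one_mul, exp_two_smul]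
  rw [polarX, h1, CFC.log_exp _ ((IsSelfAdjoint.all (2 : ℝ)).smul hs), ← Complex.coe_smul,
    smul_smul, smul_smul]
  convert one_smul ℂ _
  rw [Complex.ofReal_ofNat, div_mul_cancel₀ _ two_ne_zero, neg_mul, Complex.I_mul_I, neg_neg]

theorem continuousOn_polarX : ContinuousOn (polarX : Mat n → Mat n) {A | IsUnit A} := by
  suffices h : ContinuousOn (fun A : Mat n => CFC.log (star A * A)) {A | IsUnit A} from
    h.const_smul (-Complex.I / 2)
  refine CFC.continuousOn_log.comp (f := fun A : Mat n => star A * A) (by fun_prop) fun A hA => ?_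
  exact ⟨IsSelfAdjoint.star_mul_self A, hA.star.mul hA⟩

variable {G : Subgroup (Matrix.unitaryGroup (Fin n) ℂ)}

theorem mem_groupC_iff {A : Mat n} :
    A ∈ groupC G ↔ ∃ k ∈ gset G, ∃ X ∈ lie G, A = k * NormedSpace.exp (Complex.I • X) := by
  simp [groupC, gset]

theorem isUnit_of_mem_groupC {A : Mat n} (hA : A ∈ groupC G) : IsUnit A := by
  obtain ⟨k, hk, X, hX, rfl⟩ := mem_groupC_iff.1 hA
  exact (IsUnit.of_mul_eq_one _ (mul_star_of_mem hk)).mul (Matrix.isUnit_exp _)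

/-- Uniqueness of the polar decomposition replaces the existential quantifiers in the definition of
Gᶜ by two closed conditions on functions of A. -/
theorem mem_groupC_iff_polarX {A : Mat n} : A ∈ groupC G ↔
    polarX A ∈ lie G ∧ A * NormedSpace.exp (-(Complex.I • polarX A)) ∈ gset G := by
  rw [mem_groupC_iff]
  constructor
  · rintro ⟨k, hk, X, hX, rfl⟩
    rw [polarX_mul_exp (star_mul_of_mem hk) (star_of_mem_lie hX), mul_assoc, exp_mul_exp_neg,
      mul_one]
    exact ⟨hX, hk⟩
  · rintro ⟨h1, h2⟩
    exact ⟨_, h2, _, h1, by rw [mul_assoc, exp_neg_mul_exp, mul_one]⟩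

/-- `Gᶜ` as a closed set of pairs of mutually inverse matrices. -/
def groupCPairs (G : Subgroup (Matrix.unitaryGroup (Fin n) ℂ)) : Set (Mat n × Mat n) :=
  {p | p.1 * p.2 = 1 ∧ p.1 ∈ groupC G}

/-- Gᶜ itself need not be closed among all matrices, since a limit can be singular. Recording the
inverse as a second component keeps limits invertible, and there `polarX` is continuous. -/
theorem isClosed_groupCPairs (hG : IsClosed (G : Set (Matrix.unitaryGroup (Fin n) ℂ))) :
    IsClosed (groupCPairs G) := by
  have h1 : IsClosed {p : Mat n × Mat n | p.1 * p.2 = 1} :=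
    isClosed_eq (by fun_prop) continuous_const
  have hmaps : MapsTo Prod.fst {p : Mat n × Mat n | p.1 * p.2 = 1} {A : Mat n | IsUnit A} :=
    fun p hp => IsUnit.of_mul_eq_one _ hp
  have h2 : ContinuousOn (fun p : Mat n × Mat n => polarX p.1) {p | p.1 * p.2 = 1} :=
    continuousOn_polarX.comp continuousOn_fst hmaps
  have h3 : ContinuousOn (fun p : Mat n × Mat n =>
      p.1 * NormedSpace.exp (-(Complex.I • polarX p.1))) {p | p.1 * p.2 = 1} :=
    continuousOn_fst.mul (continuous_exp.comp_continuousOn (h2.const_smul Complex.I).neg)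
  have e : groupCPairs G = ({p | p.1 * p.2 = 1} ∩ (fun p => polarX p.1) ⁻¹' lie G) ∩
      ({p | p.1 * p.2 = 1} ∩ (fun p => p.1 * NormedSpace.exp (-(Complex.I • polarX p.1))) ⁻¹'
        gset G) := by
    ext p
    simp only [groupCPairs, mem_groupC_iff_polarX, mem_ofPred_eq, mem_inter_iff, mem_preimage]
    tauto
  rw [e]
  exact (h2.preimage_isClosed_of_isClosed h1 (isClosed_lie hG)).inter
    (h3.preimage_isClosed_of_isClosed h1 (isClosed_gset hG))

theorem integral_mem_submodule {S : Submodule ℝ (Mat n)} {f : ℝ → Mat n} (hf : Continuous f)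
    (h : ∀ t, f t ∈ S) (a b : ℝ) : ∫ t in a..b, f t ∈ S := by
  obtain ⟨π, h1, h2⟩ := exists_proj S
  have : π (∫ t in a..b, f t) = ∫ t in a..b, f t := by
    rw [← ContinuousLinearMap.intervalIntegral_comp_comm _ (hf.intervalIntegrable _ _)]
    simp only [h2 _ (h _)]
  rw [← this]
  exact h1 _

/-- By the integral formula this is the average of exp(τZ) W exp(-τZ) over 0 ≤ τ ≤ 1, and every
conjugate lies in 𝔤ᶜ. -/
theorem fderiv_exp_mul_mem_lieC (hG : IsClosed (G : Set (Matrix.unitaryGroup (Fin n) ℂ)))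
    {Z W : Mat n} (hZ : Z ∈ lieC G) (hW : W ∈ lieC G) :
    fderiv ℝ (NormedSpace.exp : Mat n → Mat n) Z W * NormedSpace.exp (-Z) ∈ lieC G := by
  have hc : Continuous fun τ : ℝ =>
      NormedSpace.exp (τ • Z) * W * NormedSpace.exp ((1 - τ) • Z) := by
    have := continuous_exp (A := Mat n)
    fun_prop
  have hm : Continuous fun M : Mat n => M * NormedSpace.exp (-Z) := by fun_prop
  let ℓ : Mat n →L[ℝ] Mat n := ⟨(LinearMap.mulRight ℝ (NormedSpace.exp (-Z))), hm⟩
  have e1 : fderiv ℝ (NormedSpace.exp : Mat n → Mat n) Z W * NormedSpace.exp (-Z) =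
      ∫ τ in (0 : ℝ)..1, NormedSpace.exp (τ • Z) * W * NormedSpace.exp (-(τ • Z)) := by
    rw [fderiv_exp_apply]
    refine (ContinuousLinearMap.intervalIntegral_comp_comm ℓ (hc.intervalIntegrable _ _)).symm.trans
      (intervalIntegral.integral_congr fun τ _ => ?_)
    change NormedSpace.exp (τ • Z) * W * NormedSpace.exp ((1 - τ) • Z) * NormedSpace.exp (-Z) =
      NormedSpace.exp (τ • Z) * W * NormedSpace.exp (-(τ • Z))
    rw [mul_assoc _ (NormedSpace.exp ((1 - τ) • Z)), ← Matrix.exp_add_of_commute]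
    · congr 2
      rw [sub_smul, one_smul]; abel
    · exact ((Commute.refl Z).smul_left _).neg_right
  rw [e1]
  have := continuous_exp (A := Mat n)
  exact integral_mem_submodule (S := (lieCSub hG).restrictScalars ℝ) (by fun_prop)
    (fun t => exp_conj_mem_lieC hG hZ hW t) 0 1

theorem hasDerivAt_exp_I_add (X ξ : Mat n) :
    HasDerivAt (fun s : ℝ => NormedSpace.exp (Complex.I • (X + s • ξ)))
      (fderiv ℝ (NormedSpace.exp : Mat n → Mat n) (Complex.I • X) (Complex.I • ξ)) 0 := by
  have hd : HasFDerivAt (NormedSpace.exp : Mat n → Mat n) (fderiv ℝ NormedSpace.exp (Complex.I • X))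
      (Complex.I • (X + (0 : ℝ) • ξ)) := by
    rw [zero_smul, add_zero]
    exact ((contDiff_exp (A := Mat n) (m := 1)).differentiable (by simp) _).hasFDerivAt
  have hl : HasDerivAt (fun s : ℝ => Complex.I • (X + s • ξ)) (Complex.I • ξ) 0 := by
    refine HasDerivAt.const_smul Complex.I ?_
    simpa using ((hasDerivAt_id (0 : ℝ)).smul_const ξ).const_add X
  exact hd.comp_hasDerivAt 0 hl

/-- The tangent directions `κ ∈ 𝔤` and `iξ ∈ i𝔤` of the polar decomposition span `𝔤ᶜ`. -/
theorem exists_polar_direction (hG : IsClosed (G : Set (Matrix.unitaryGroup (Fin n) ℂ)))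
    {X Z : Mat n} (hX : X ∈ lie G) (hZ : Z ∈ lieC G) :
    ∃ κ ∈ lie G, ∃ ξ ∈ lie G, κ + fderiv ℝ (NormedSpace.exp : Mat n → Mat n) (Complex.I • X)
      (Complex.I • ξ) * NormedSpace.exp (-(Complex.I • X)) = Z := by
  let S := lieSub hG
  let SC := (lieCSub hG).restrictScalars ℝ
  let J : S × S →ₗ[ℝ] SC :=
    { toFun := fun p => ⟨p.1 + Complex.I • (p.2 : Mat n), p.1, p.1.2, p.2, p.2.2, rfl⟩
      map_add' := fun p q => by
        ext1; simp only [Prod.fst_add, Prod.snd_add, Submodule.coe_add, smul_add]; abel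
      map_smul' := fun c p => by
        ext1
        simp only [Prod.smul_fst, Prod.smul_snd, Submodule.coe_smul, RingHom.id_apply, smul_add,
          smul_comm c Complex.I] }
  let Λ : S × S →ₗ[ℝ] SC :=
    { toFun := fun p => ⟨p.1 + fderiv ℝ (NormedSpace.exp : Mat n → Mat n) (Complex.I • X)
          (Complex.I • (p.2 : Mat n)) * NormedSpace.exp (-(Complex.I • X)),
        (lieCSub hG).add_mem (lie_subset_lieC p.1.2)
          (fderiv_exp_mul_mem_lieC hG (I_smul_mem_lieC hX) (I_smul_mem_lieC p.2.2))⟩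
      map_add' := fun p q => by
        ext1
        simp only [Prod.fst_add, Prod.snd_add, Submodule.coe_add, smul_add, map_add, add_mul]; abel
      map_smul' := fun c p => by
        ext1
        simp only [Prod.smul_fst, Prod.smul_snd, Submodule.coe_smul, RingHom.id_apply, smul_add,
          smul_comm Complex.I c, map_smul, smul_mul_assoc] }
  -- J enters only through a dimension count: it shows that 𝔤 × 𝔤 and 𝔤ᶜ have the same real
  -- dimension, so injectivity of Λ gives surjectivity.
  have hJ : Function.Bijective J := by
    constructor
    · rintro ⟨⟨a, ha⟩, ⟨b, hb⟩⟩ ⟨⟨a', ha'⟩, ⟨b', hb'⟩⟩ h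
      have h' : a + Complex.I • b = a' + Complex.I • b' := congrArg Subtype.val h
      have h1 := congrArg rePart h'
      have h2 := congrArg imPart h'
      rw [rePart_add_I_smul (star_of_mem_lie ha) (star_of_mem_lie hb),
        rePart_add_I_smul (star_of_mem_lie ha') (star_of_mem_lie hb')] at h1
      rw [imPart_add_I_smul (star_of_mem_lie ha) (star_of_mem_lie hb),
        imPart_add_I_smul (star_of_mem_lie ha') (star_of_mem_lie hb')] at h2
      subst h1 h2
      rfl
    · rintro ⟨_, a, ha, b, hb, rfl⟩
      exact ⟨(⟨a, ha⟩, ⟨b, hb⟩), rfl⟩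
  have hΛ : Function.Injective Λ := by
    refine (injective_iff_map_eq_zero Λ).2 ?_
    rintro ⟨⟨κ, hκ⟩, ⟨ξ, hξ⟩⟩ h
    have h1 : κ + fderiv ℝ (NormedSpace.exp : Mat n → Mat n) (Complex.I • X)
      (Complex.I • ξ) * NormedSpace.exp (-(Complex.I • X)) = 0 := congrArg Subtype.val h
    have h2 : κ * NormedSpace.exp (Complex.I • X) +
        fderiv ℝ (NormedSpace.exp : Mat n → Mat n) (Complex.I • X) (Complex.I • ξ) = 0 := by
      have := congrArg (· * NormedSpace.exp (Complex.I • X)) h1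
      simpa only [add_mul, mul_assoc, exp_neg_mul_exp, mul_one, zero_mul] using this
    -- A kernel element makes A(s) = exp(sκ) exp(i(X+sξ)) stationary at s = 0. The product A^*A =
    -- exp(2i(X+sξ)) no longer involves κ, so injectivity of the derivative of exp at 2iX gives ξ =
    -- 0, and then κ = 0.
    have h3 : HasDerivAt (fun s : ℝ => NormedSpace.exp (s • κ) *
        NormedSpace.exp (Complex.I • (X + s • ξ))) 0 0 := by
      refine ((hasDerivAt_exp_smul_zero κ).mul (hasDerivAt_exp_I_add X ξ)).congr_deriv ?_
      simpa using h2
    have h4 := h3.star.mul h3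
    have h5 : HasDerivAt (fun s : ℝ => NormedSpace.exp (Complex.I • ((2 : ℝ) • X + s • (2 : ℝ) • ξ)))
        0 0 := by
      refine (h4.congr_deriv (by simp)).congr_of_eventuallyEq (Eventually.of_forall fun s => ?_)
      have hs : star (X + s • ξ) = -(X + s • ξ) :=
        star_of_mem_lie (add_mem_lie hG hX (smul_mem_lie s hξ))
      change _ = star (NormedSpace.exp (s • κ) * NormedSpace.exp (Complex.I • (X + s • ξ))) *
        (NormedSpace.exp (s • κ) * NormedSpace.exp (Complex.I • (X + s • ξ)))
      rw [star_mul, (isSelfAdjoint_I_smul hs).exp.star_eq, mul_assoc,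
        ← mul_assoc (star (NormedSpace.exp (s • κ))), star_mul_of_mem (hκ s), one_mul,
        ← exp_two_smul, smul_comm (2 : ℝ) Complex.I, smul_add, smul_comm (2 : ℝ) s]
    have h6 := (hasDerivAt_exp_I_add ((2 : ℝ) • X) ((2 : ℝ) • ξ)).unique h5
    have h7 := eq_zero_of_fderiv_exp_eq_zero
      (isSelfAdjoint_I_smul (star_of_mem_lie (smul_mem_lie 2 hX))) h6
    have h8 : ξ = 0 := by simpa using h7
    subst h8
    have h9 : κ = 0 := by simpa using h1
    subst h9
    rfl
  have hfr : Module.finrank ℝ (S × S) = Module.finrank ℝ SC :=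
    (LinearEquiv.ofBijective J hJ).finrank_eq
  obtain ⟨p, hp⟩ := (LinearMap.injective_iff_surjective_of_finrank_eq_finrank hfr).1 hΛ ⟨Z, hZ⟩
  exact ⟨p.1, p.1.2, p.2, p.2.2, congrArg Subtype.val hp⟩

/-- `Gᶜ` is invariant under the flow of `g' = g α` with `α ∈ 𝔤ᶜ`. -/
theorem mem_groupC_of_ode (hG : IsClosed (G : Set (Matrix.unitaryGroup (Fin n) ℂ)))
    {α u w : ℝ → Mat n} {L a b : ℝ} (hL : ∀ t ∈ Ico a b, ‖α t‖ ≤ L)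
    (hα : ∀ t ∈ Ico a b, α t ∈ lieC G) (hu : ContinuousOn u (Icc a b))
    (hw : ContinuousOn w (Icc a b))
    (hu' : ∀ t ∈ Ico a b, HasDerivWithinAt u (u t * α t) (Ici t) t)
    (hw' : ∀ t ∈ Ico a b, HasDerivWithinAt w (-(α t * w t)) (Ici t) t)
    (h0 : u a ∈ groupC G) (h1 : u a * w a = 1) :
    ∀ t ∈ Icc a b, u t * w t = 1 ∧ u t ∈ groupC G := by
  -- Nagumo's theorem for the pair of u and its inverse w, which satisfies w' = -αw.
  refine mem_of_tangent (isClosed_groupCPairs hG) (V := fun t p => (p.1 * α t, -(α t * p.2)))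
    (L := L) (u := fun t => (u t, w t)) ?_ (hu.prodMk hw)
    (fun t ht => (hu' t ht).prodMk (hw' t ht)) ⟨h1, h0⟩ ?_
  · intro t ht x y
    simp only [Prod.mk_sub_mk, Prod.norm_mk]
    have hL0 : 0 ≤ L := (norm_nonneg _).trans (hL t ht)
    refine max_le ?_ ?_
    · rw [← sub_mul, mul_comm L]
      refine (norm_mul_le _ _).trans (mul_le_mul (norm_fst_le (x - y)) (hL t ht) (norm_nonneg _)
        (norm_nonneg _))
    · rw [neg_sub_neg, ← mul_sub, ← norm_neg, ← mul_neg, neg_sub]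
      refine (norm_mul_le _ _).trans (mul_le_mul (hL t ht) (norm_snd_le (x - y)) (norm_nonneg _)
        hL0)
  · rintro t ht ⟨A, A'⟩ ⟨hAA', hA⟩
    obtain ⟨k, hk, X, hX, rfl⟩ := mem_groupC_iff.1 hA
    simp only at hAA'
    have hZ : NormedSpace.exp (Complex.I • X) * α t * NormedSpace.exp (-(Complex.I • X)) ∈
        lieC G := by
      simpa using exp_conj_mem_lieC hG (I_smul_mem_lieC hX) (hα t ht) 1
    -- With A = k exp(iX), these directions make c1(s) = k exp(sκ) exp(i(X+sξ)) a curve in Gᶜ with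
    -- velocity Aα at s = 0. The velocity of the inverse curve c2 is obtained by differentiating c1
    -- c2 = 1.
    obtain ⟨κ, hκ, ξ, hξ, he⟩ := exists_polar_direction hG hX hZ
    have he' : κ * NormedSpace.exp (Complex.I • X) +
        fderiv ℝ (NormedSpace.exp : Mat n → Mat n) (Complex.I • X) (Complex.I • ξ) =
        NormedSpace.exp (Complex.I • X) * α t := by
      have := congrArg (· * NormedSpace.exp (Complex.I • X)) he
      simpa only [add_mul, mul_assoc, exp_neg_mul_exp, mul_one, zero_mul] using this
    let c1 : ℝ → Mat n := fun s =>
      k * (NormedSpace.exp (s • κ) * NormedSpace.exp (Complex.I • (X + s • ξ)))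
    let c2 : ℝ → Mat n := fun s =>
      NormedSpace.exp (Complex.I • (-X + s • (-ξ))) * NormedSpace.exp (s • (-κ)) * star k
    have hc1 : HasDerivAt c1 (k * NormedSpace.exp (Complex.I • X) * α t) 0 := by
      refine (((hasDerivAt_exp_smul_zero κ).mul (hasDerivAt_exp_I_add X ξ)).const_mul k).congr_deriv ?_
      rw [mul_assoc, ← he']
      simp
    have hc12 : ∀ s, c1 s * c2 s = 1 := fun s => by
      have e1 : Complex.I • (-X + s • (-ξ)) = -(Complex.I • (X + s • ξ)) := by
        rw [smul_neg, ← neg_add, smul_neg]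
      simp only [c1, c2]
      rw [e1, smul_neg s κ]
      calc _ = k * (NormedSpace.exp (s • κ) * (NormedSpace.exp (Complex.I • (X + s • ξ)) *
            NormedSpace.exp (-(Complex.I • (X + s • ξ)))) * NormedSpace.exp (-(s • κ))) * star k := by
              simp only [mul_assoc]
        _ = 1 := by
              rw [exp_mul_exp_neg, mul_one, exp_mul_exp_neg, mul_one, mul_star_of_mem hk]
    have hc10 : c1 0 = k * NormedSpace.exp (Complex.I • X) := by simp [c1]
    have hc20 : c2 0 = A' := by
      have h1 := hc12 0
      rw [hc10] at h1
      have h2 := Matrix.inv_eq_right_inv h1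
      rw [← h2, Matrix.inv_eq_right_inv hAA']
    obtain ⟨d, hd⟩ : ∃ d, HasDerivAt c2 d 0 :=
      ⟨_, ((hasDerivAt_exp_I_add (-X) (-ξ)).mul (hasDerivAt_exp_smul_zero (-κ))).mul_const (star k)⟩
    have hprod := (hc1.mul hd).unique ((hasDerivAt_const (0 : ℝ) (1 : Mat n)).congr_of_eventuallyEq
      (Eventually.of_forall hc12))
    have hd' : d = -(α t * A') := by
      rw [hc10, hc20] at hprod
      have h1 : A' * (k * NormedSpace.exp (Complex.I • X)) = 1 := mul_eq_one_comm.1 hAA'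
      have h2 := congrArg (A' * ·) hprod
      simp only [mul_add, ← mul_assoc] at h2
      rw [mul_assoc A' k, h1, one_mul, one_mul, mul_zero] at h2
      exact eq_neg_of_add_eq_zero_right h2
    intro ε hε
    have hcurve := frequently_infDist_le_of_curve (S := groupCPairs G) (c := fun s => (c1 s, c2 s))
      (hc1.prodMk hd) (fun s => ⟨hc12 s, mem_groupC_iff.2 ⟨k * NormedSpace.exp (s • κ),
        mul_mem_gset hk (hκ s), X + s • ξ, add_mem_lie hG hX (smul_mem_lie s hξ),
        (mul_assoc _ _ _).symm⟩⟩) ε hε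
    rw [hd'] at hcurve
    simp only [hc10, hc20] at hcurve
    exact hcurve

/-! ### `Gᶜ` is a group -/

theorem gset_subset_groupC {k : Mat n} (hk : k ∈ gset G) : k ∈ groupC G :=
  mem_groupC_iff.2 ⟨k, hk, 0, zero_mem_lie, by simp⟩

theorem one_mem_groupC : (1 : Mat n) ∈ groupC G := gset_subset_groupC one_mem_gset

theorem exp_I_mem_groupC {X : Mat n} (hX : X ∈ lie G) :
    NormedSpace.exp (Complex.I • X) ∈ groupC G :=
  mem_groupC_iff.2 ⟨1, one_mem_gset, X, hX, by simp⟩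

theorem exp_conj_of_mem {k : Mat n} (hk : k ∈ gset G) (X : Mat n) :
    NormedSpace.exp (Complex.I • (k * X * star k)) = k * NormedSpace.exp (Complex.I • X) * star k := by
  rw [← exp_conj_of_mul_eq_one (mul_star_of_mem hk) (star_mul_of_mem hk), mul_smul_comm,
    smul_mul_assoc]

theorem mul_mem_groupC_right {k A : Mat n} (hA : A ∈ groupC G) (hk : k ∈ gset G) :
    A * k ∈ groupC G := by
  obtain ⟨l, hl, X, hX, rfl⟩ := mem_groupC_iff.1 hA
  refine mem_groupC_iff.2 ⟨l * k, mul_mem_gset hl hk, star k * X * star (star k),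
    conj_mem_lie (star_mem_gset hk) hX, ?_⟩
  rw [exp_conj_of_mem (star_mem_gset hk), star_star]
  simp only [mul_assoc]
  rw [← mul_assoc k (star k), mul_star_of_mem hk, one_mul]

/-- The path A exp(tZ) is a flow line of g' = gZ, which cannot leave Gᶜ. Closure of Gᶜ under
products follows, because the second factor is an element of G times such an exponential. -/
theorem mul_exp_mem_groupC (hG : IsClosed (G : Set (Matrix.unitaryGroup (Fin n) ℂ)))
    {A Z : Mat n} (hA : A ∈ groupC G) (hZ : Z ∈ lieC G) : A * NormedSpace.exp Z ∈ groupC G := by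
  obtain ⟨v, rfl⟩ := isUnit_of_mem_groupC hA
  have h := mem_groupC_of_ode hG (α := fun _ => Z) (L := ‖Z‖) (a := 0) (b := 1)
    (u := fun t => v * NormedSpace.exp (t • Z))
    (w := fun t => NormedSpace.exp (t • (-Z)) * (v⁻¹ : (Mat n)ˣ))
    (fun _ _ => le_rfl) (fun _ _ => hZ)
    (fun t _ => ((hasDerivAt_exp_smul Z t).const_mul _).continuousAt.continuousWithinAt)
    (fun t _ => ((hasDerivAt_exp_smul (-Z) t).mul_const _).continuousAt.continuousWithinAt)
    (fun t _ => (((hasDerivAt_exp_smul Z t).const_mul _).congr_deriv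
      (mul_assoc _ _ _).symm).hasDerivWithinAt)
    (fun t _ => (((hasDerivAt_exp_smul' (-Z) t).mul_const _).congr_deriv
      (by rw [neg_mul, neg_mul, mul_assoc])).hasDerivWithinAt)
    (by simpa using hA) (by simp) 1 ⟨zero_le_one, le_rfl⟩
  simpa using h.2

theorem mul_mem_groupC (hG : IsClosed (G : Set (Matrix.unitaryGroup (Fin n) ℂ))) {A A' : Mat n}
    (hA : A ∈ groupC G) (hA' : A' ∈ groupC G) : A * A' ∈ groupC G := by
  obtain ⟨k, hk, X, hX, rfl⟩ := mem_groupC_iff.1 hA'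
  rw [← mul_assoc]
  exact mul_exp_mem_groupC hG (mul_mem_groupC_right hA hk) (I_smul_mem_lieC hX)

theorem inv_mem_groupC {A : Mat n} (hA : A ∈ groupC G) : A⁻¹ ∈ groupC G := by
  obtain ⟨k, hk, X, hX, rfl⟩ := mem_groupC_iff.1 hA
  have h1 := mul_mem_groupC_right (exp_I_mem_groupC (neg_mem_lie hX)) (star_mem_gset hk)
  convert h1 using 1
  refine Matrix.inv_eq_right_inv ?_
  rw [smul_neg, mul_assoc, ← mul_assoc (NormedSpace.exp (Complex.I • X)), exp_mul_exp_neg, one_mul,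
    mul_star_of_mem hk]

end

/-! ### Self-adjoint elements of Gᶜ and smoothness of the polar decomposition. -/

section

/-- For self-adjoint u the adjoint of log u is also a logarithm of u, and it is close to 0, where
exp is injective. -/
theorem eventually_isSelfAdjoint_logOne :
    ∀ᶠ u : Mat n in 𝓝 1, IsSelfAdjoint u → IsSelfAdjoint (logOne u) := by
  have h1 : Tendsto (logOne : Mat n → Mat n) (𝓝 1) (𝓝 0) := by
    have := contDiffAt_logOne (n := n).continuousAt
    rwa [ContinuousAt, logOne_one] at this
  have h2 : Tendsto (fun u : Mat n => star (logOne u)) (𝓝 1) (𝓝 0) := by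
    simpa using h1.star
  filter_upwards [eventually_exp_logOne, h2.eventually eventually_logOne_exp] with u hu1 hu2 hu
  rw [← NormedSpace.star_exp, hu1, hu.star_eq] at hu2
  exact hu2.symm

variable {G : Subgroup (Matrix.unitaryGroup (Fin n) ℂ)}

/-- A self-adjoint element of `Gᶜ` near `1` is the exponential of an element of `i𝔤`. -/
theorem eventually_logOne_of_mem_groupC :
    ∀ᶠ u : Mat n in 𝓝 1, IsSelfAdjoint u → u ∈ groupC G →
      ∃ X ∈ lie G, logOne u = Complex.I • X ∧ NormedSpace.exp (Complex.I • X) = u := by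
  filter_upwards [eventually_exp_logOne, eventually_isSelfAdjoint_logOne] with u hu1 hu2 hu hG
  obtain ⟨k, hk, X, hX, he⟩ := mem_groupC_iff.1 hG
  have hs := isSelfAdjoint_I_smul (star_of_mem_lie hX)
  -- Both 2iX, from the polar form, and 2 log u are hermitian logarithms of u^*u, and exp is
  -- injective on hermitian matrices.
  have h1 : star u * u = NormedSpace.exp ((2 : ℝ) • Complex.I • X) := by
    rw [he, star_mul, hs.exp.star_eq, mul_assoc, ← mul_assoc (star k), star_mul_of_mem hk, one_mul,
      exp_two_smul]
  have h2 : star u * u = NormedSpace.exp ((2 : ℝ) • logOne u) := by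
    rw [hu.star_eq, exp_two_smul, hu1]
  have h3 := eq_of_exp_eq ((IsSelfAdjoint.all (2 : ℝ)).smul (hu2 hu))
    ((IsSelfAdjoint.all (2 : ℝ)).smul hs) (h2.symm.trans h1)
  have h4 : logOne u = Complex.I • X := smul_right_injective _ (two_ne_zero (α := ℝ)) h3
  exact ⟨X, hX, h4, by rw [← h4, hu1]⟩

theorem exp_log_star_mul_self {A : Mat n} (hA : IsUnit A) :
    NormedSpace.exp (CFC.log (star A * A)) = star A * A := by
  open scoped MatrixOrder in
  refine CFC.exp_log _ ?_
  have := hA.isStrictlyPositive_star_left_conjugate_iff (a := (1 : Mat n))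
  rw [mul_one] at this
  exact this.2 isStrictlyPositive_one

/-- Since exp is a local diffeomorphism at the hermitian matrix log(A^*A), it has an analytic local
inverse there. Continuity of the hermitian logarithm makes it agree near A with that inverse applied
to A^*A. -/
theorem contDiffAt_polarX {A : Mat n} (hA : IsUnit A) : ContDiffAt ℝ ω (polarX : Mat n → Mat n) A := by
  set L : Mat n → Mat n := fun A => CFC.log (star A * A) with hL
  suffices h : ContDiffAt ℝ ω L A from
    contDiffAt_const.smul (f := fun _ => (-Complex.I / 2)) h
  have hLc : ContinuousAt L A := by
    have h1 : ContinuousOn L {A | IsUnit A} := by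
      refine CFC.continuousOn_log.comp (f := fun A : Mat n => star A * A) (by fun_prop)
        fun A hA => ?_
      exact ⟨IsSelfAdjoint.star_mul_self A, hA.star.mul hA⟩
    exact h1.continuousAt (Units.isOpen.mem_nhds hA)
  obtain ⟨e, he⟩ := exists_fderiv_exp_equiv (Y := L A) .log
  have hs := (contDiff_exp (A := Mat n) (m := ω)).contDiffAt.hasStrictFDerivAt' he (by simp)
  have hψ := (contDiff_exp (A := Mat n) (m := ω)).contDiffAt.to_localInverse he (by simp)
  rw [exp_log_star_mul_self hA] at hψ
  have hm : ContDiffAt ℝ ω (fun A : Mat n => star A * A) A := by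
    have h1 : ContDiff ℝ ω (fun A : Mat n => star A) := (starL' ℝ : Mat n ≃L[ℝ] Mat n).contDiff
    exact (h1.mul contDiff_id).contDiffAt
  refine (ContDiffAt.comp (f := fun A : Mat n => star A * A) A hψ hm).congr_of_eventuallyEq ?_
  filter_upwards [hLc.eventually hs.eventually_left_inverse, Units.isOpen.mem_nhds hA] with A' h1 h2
  rw [exp_log_star_mul_self h2] at h1
  exact h1.symm

/-! ### Paths in `G` -/

theorem star_mul_deriv_mem_lie (hG : IsClosed (G : Set (Matrix.unitaryGroup (Fin n) ℂ)))
    {κ : ℝ → Mat n} {κ' : Mat n} {t : ℝ} (h : HasDerivAt κ κ' t) (hκ : ∀ s, κ s ∈ gset G) :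
    star (κ t) * κ' ∈ lie G := by
  have h1 : HasDerivAt (fun s => κ (t + s)) κ' 0 := by
    have h0 : HasDerivAt κ κ' (t + 0) := by rwa [add_zero]
    exact h0.comp_const_add t 0
  refine mem_lie_of_hasDerivAt hG (h1.const_mul (star (κ t))) ?_ fun s =>
    mul_mem_gset (star_mem_gset (hκ t)) (hκ _)
  rw [add_zero, star_mul_of_mem (hκ t)]

/-- A connected closed subgroup of `U(n)` is path connected by analytic paths. -/
theorem exists_path (hG : IsClosed (G : Set (Matrix.unitaryGroup (Fin n) ℂ)))
    (hc : IsConnected (G : Set (Matrix.unitaryGroup (Fin n) ℂ))) {k : Mat n} (hk : k ∈ gset G) :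
    ∃ κ : ℝ → Mat n, ContDiff ℝ ω κ ∧ (∀ t, κ t ∈ gset G) ∧ κ 0 = 1 ∧ κ 1 = k := by
  obtain ⟨k, hk, rfl⟩ := hk
  -- P x y says that x⁻¹y is joined to 1 by an analytic path in G. It holds in both directions for
  -- nearby elements, by the logarithm, and is transitive by pointwise products of paths;
  -- connectedness does the rest.
  let P : Matrix.unitaryGroup (Fin n) ℂ → Matrix.unitaryGroup (Fin n) ℂ → Prop := fun x y =>
    ∃ κ : ℝ → Mat n, ContDiff ℝ ω κ ∧ (∀ t, κ t ∈ gset G) ∧ κ 0 = 1 ∧ κ 1 = star (x : Mat n) * y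
  suffices h : P 1 k by simpa [P] using h
  have hstar : ContDiff ℝ ω (fun A : Mat n => star A) := (starL' ℝ : Mat n ≃L[ℝ] Mat n).contDiff
  refine hc.isPreconnected.induction₂' P ?_ ?_ G.one_mem hk
  · intro x hx
    have hcont : Tendsto (fun y : Matrix.unitaryGroup (Fin n) ℂ => star (x : Mat n) * (y : Mat n))
        (𝓝[(G : Set (Matrix.unitaryGroup (Fin n) ℂ))] x) (𝓝 1) := by
      have h1 : Continuous (fun y : Matrix.unitaryGroup (Fin n) ℂ => star (x : Mat n) * (y : Mat n)) :=
        continuous_const.mul continuous_subtype_val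
      have h2 := h1.tendsto x
      rw [star_mul_of_mem (G := G) ⟨x, hx, rfl⟩] at h2
      exact h2.mono_left nhdsWithin_le_nhds
    filter_upwards [hcont.eventually (eventually_logOne_mem_lie hG),
      hcont.eventually eventually_exp_logOne, self_mem_nhdsWithin] with y h1 h2 hy
    have h3 := h1 (mul_mem_gset (star_mem_gset ⟨x, hx, rfl⟩) ⟨y, hy, rfl⟩)
    have h4 : P x y := by
      refine ⟨fun t => NormedSpace.exp (t • logOne (star (x : Mat n) * (y : Mat n))), ?_, fun t => h3 t,
        by simp, by simpa using h2⟩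
      exact contDiff_exp.comp (contDiff_id.smul contDiff_const)
    refine ⟨h4, ?_⟩
    obtain ⟨κ, h5, h6, h7, h8⟩ := h4
    exact ⟨fun t => star (κ t), hstar.comp h5, fun t => star_mem_gset (h6 t), by simp [h7],
      by simp [h8]⟩
  · rintro x y z _ hy _ ⟨κ, h1, h2, h3, h4⟩ ⟨κ', h1', h2', h3', h4'⟩
    refine ⟨fun t => κ t * κ' t, h1.mul h1', fun t => mul_mem_gset (h2 t) (h2' t),
      by simp [h3, h3'], ?_⟩
    change κ 1 * κ' 1 = _
    have : (y : Mat n) * star (y : Mat n) = 1 := mul_star_of_mem (G := G) ⟨y, hy, rfl⟩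
    rw [h4, h4', mul_assoc, ← mul_assoc (y : Mat n), this, one_mul]

/-! ### Invariant inner products -/

variable {B : LinearMap.BilinForm ℝ (Mat n)}

theorem HasDerivWithinAt.bilinForm (B : LinearMap.BilinForm ℝ (Mat n)) {f g : ℝ → Mat n}
    {f' g' : Mat n} {s : Set ℝ} {t : ℝ} (hf : HasDerivWithinAt f f' s t)
    (hg : HasDerivWithinAt g g' s t) :
    HasDerivWithinAt (fun t => B (f t) (g t)) (B (f t) g' + B f' (g t)) s t :=
  (LinearMap.toContinuousBilinearMap B).hasDerivWithinAt_of_bilinear hf hg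

theorem continuous_bilinForm (B : LinearMap.BilinForm ℝ (Mat n)) {α : Type*} [TopologicalSpace α]
    {f g : α → Mat n} (hf : Continuous f) (hg : Continuous g) :
    Continuous fun t => B (f t) (g t) :=
  ((LinearMap.toContinuousBilinearMap B).continuous.comp hf).clm_apply hg

/-- Infinitesimal invariance: `⟨[X,Y],Z⟩ = -⟨Y,[X,Z]⟩`. -/
theorem IsInvariantInner.lie_left (hB : IsInvariantInner G B) {X Y Z : Mat n} (hX : X ∈ lie G)
    (hY : Y ∈ lie G) (hZ : Z ∈ lie G) : B ⁅X, Y⁆ Z = -B Y ⁅X, Z⁆ := by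
  have h1 := (hasDerivAt_exp_conj X Y 0).hasDerivWithinAt (s := univ)
  have h2 := (hasDerivAt_exp_conj X Z 0).hasDerivWithinAt (s := univ)
  have h3 := (HasDerivWithinAt.bilinForm B h1 h2).hasDerivAt univ_mem
  simp only [zero_smul, neg_zero, NormedSpace.exp_zero, one_mul, mul_one] at h3
  have h4 := h3.unique ((hasDerivAt_const (0 : ℝ) (B Y Z)).congr_of_eventuallyEq
    (Eventually.of_forall fun s => ?_))
  · linarith
  · obtain ⟨k, hk, hk'⟩ := hX s
    have := hB.invariant k hk Y hY Z hZ
    rw [hk', ← Matrix.exp_neg] at this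
    exact this

theorem IsInvariantInner.nonneg (hB : IsInvariantInner G B) {X : Mat n} (hX : X ∈ lie G) :
    0 ≤ B X X := by
  rcases eq_or_ne X 0 with rfl | h
  · simp
  · exact (hB.pos X hX h).le

theorem IsInvariantInner.lie_self (hB : IsInvariantInner G B)
    (hG : IsClosed (G : Set (Matrix.unitaryGroup (Fin n) ℂ))) {X Y : Mat n} (hX : X ∈ lie G)
    (hY : Y ∈ lie G) : B ⁅X, Y⁆ Y = 0 := by
  have h1 := hB.lie_left hX hY hY
  have h2 := hB.symm _ (lie_mem_lie hG hX hY) _ hY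
  linarith

end

section

/-! ### Integration of continuous functions on `[0,1]` -/

section Volterra
variable {E : Type*} [NormedAddCommGroup E]

/-- The continuous extension of a function on `[0,1]` to `ℝ`. -/
def ext (f : C(U, E)) : ℝ → E := IccExtend zero_le_one f

theorem continuous_ext (f : C(U, E)) : Continuous (ext f) := f.continuous.Icc_extend'

theorem ext_coe (f : C(U, E)) (t : U) : ext f t = f t := IccExtend_val _ _ t

theorem ext_of_mem (f : C(U, E)) {t : ℝ} (ht : t ∈ Icc (0 : ℝ) 1) : ext f t = f ⟨t, ht⟩ :=
  IccExtend_of_mem _ _ ht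

theorem norm_ext_le (f : C(U, E)) (t : ℝ) : ‖ext f t‖ ≤ ‖f‖ := f.norm_coe_le_norm _

variable [NormedSpace ℝ E]

theorem deriv_unique {f f' f'' : C(U, E)}
    (h : ∀ t : U, HasDerivWithinAt (ext f) (f' t) (Icc (0 : ℝ) 1) (t : ℝ))
    (h' : ∀ t : U, HasDerivWithinAt (ext f) (f'' t) (Icc (0 : ℝ) 1) (t : ℝ)) : f' = f'' := by
  ext1 t
  exact (uniqueDiffOn_Icc_zero_one t t.2).eq_deriv _ (h t) (h' t)

variable [CompleteSpace E]

theorem hasDerivAt_integral_ext (f : C(U, E)) (t : ℝ) :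
    HasDerivAt (fun t => ∫ s in (0 : ℝ)..t, ext f s) (ext f t) t :=
  intervalIntegral.integral_hasDerivAt_right ((continuous_ext f).intervalIntegrable _ _)
    ((continuous_ext f).stronglyMeasurableAtFilter _ _) (continuous_ext f).continuousAt

/-- The integration operator `(Jf)(t) = ∫₀ᵗ f`. -/
def integ : C(U, E) →L[ℝ] C(U, E) :=
  LinearMap.mkContinuous
    { toFun := fun f => ⟨fun t : U => ∫ s in (0 : ℝ)..t, ext f s,
        (continuous_iff_continuousAt.2 fun t => (hasDerivAt_integral_ext f t).continuousAt).comp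
          continuous_subtype_val⟩
      map_add' := fun f g => by
        ext1 t
        exact intervalIntegral.integral_add ((continuous_ext f).intervalIntegrable _ _)
          ((continuous_ext g).intervalIntegrable _ _)
      map_smul' := fun c f => by
        ext1 t
        exact intervalIntegral.integral_smul c (ext f) } 1 fun f => by
    rw [one_mul]
    refine (ContinuousMap.norm_le _ (norm_nonneg _)).2 fun t => ?_
    refine (intervalIntegral.norm_integral_le_of_norm_le_const (C := ‖f‖)
      fun s _ => norm_ext_le f s).trans ?_
    rw [sub_zero, abs_of_nonneg t.2.1]
    exact mul_le_of_le_one_right (norm_nonneg _) t.2.2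

theorem integ_apply (f : C(U, E)) (t : U) : integ f t = ∫ s in (0 : ℝ)..t, ext f s := rfl

theorem hasDerivWithinAt_integ (f : C(U, E)) (t : U) :
    HasDerivWithinAt (ext (integ f)) (f t) (Icc (0 : ℝ) 1) (t : ℝ) := by
  have h := (hasDerivAt_integral_ext f t).hasDerivWithinAt (s := Icc (0 : ℝ) 1)
  rw [ext_coe] at h
  exact h.congr (fun s hs => ext_of_mem _ hs) (ext_coe _ _)

theorem integ_zero (f : C(U, E)) : integ f 0 = 0 := by
  rw [integ_apply]; exact intervalIntegral.integral_same

theorem eq_const_add_integ {f f' : C(U, E)}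
    (h : ∀ t : U, HasDerivWithinAt (ext f) (f' t) (Icc (0 : ℝ) 1) (t : ℝ)) :
    f = ContinuousMap.const U (f 0) + integ f' := by
  ext1 t
  have h1 := intervalIntegral.integral_eq_sub_of_hasDeriv_right_of_le (f := ext f) (f' := ext f')
    (a := 0) (b := t) t.2.1 (continuous_ext f).continuousOn (fun s hs => ?_)
    ((continuous_ext f').intervalIntegrable _ _)
  · rw [ContinuousMap.add_apply, integ_apply, h1, ext_coe]
    have : ext f 0 = f 0 := ext_coe f 0
    rw [this, ContinuousMap.const_apply]
    abel
  · have hs1 : s ∈ Icc (0 : ℝ) 1 := ⟨hs.1.le, hs.2.le.trans t.2.2⟩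
    have := h ⟨s, hs1⟩
    rw [ext_of_mem f' hs1]
    exact (this.hasDerivAt (Icc_mem_nhds hs.1 (hs.2.trans_le t.2.2))).hasDerivWithinAt

end Volterra

/-- The integrated form is closed under uniform convergence, whence the completeness of the C¹ and
C² spaces, and it turns linear differential equations into Volterra equations. -/
theorem isDeriv_iff {f f' : C(U, Mat n)} :
    IsDeriv f f' ↔ f = ContinuousMap.const U (f 0) + integ f' := by
  constructor
  · exact fun h => eq_const_add_integ h
  · intro h t
    rw [h]
    exact (hasDerivWithinAt_integ f' t).const_add (f 0)

/-! ### The spaces `C¹` and `C²` -/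

/-- Continuous matrix-valued functions on `[0,1]`. -/
def D0 (n : ℕ) : Type := C(U, Mat n)

/-- The Banach space of `C¹`-functions; the same type as `C1 n`, regarded as a real Banach space. -/
def D1 (n : ℕ) : Type := C1 n

/-- The Banach space of `C²`-functions; the same type as `C2 n`, regarded as a real Banach space. -/
def D2 (n : ℕ) : Type := C2 n

instance : NormedRing (D0 n) := inferInstanceAs (NormedRing C(U, Mat n))
instance : NormedAlgebra ℝ (D0 n) := inferInstanceAs (NormedAlgebra ℝ C(U, Mat n))
instance : CompleteSpace (D0 n) := inferInstanceAs (CompleteSpace C(U, Mat n))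
instance : NormedAddCommGroup (D1 n) := inferInstanceAs (NormedAddCommGroup (C1 n))
instance : NormedSpace ℝ (D1 n) := inferInstanceAs (NormedSpace ℝ (C1 n))
instance : NormedAddCommGroup (D2 n) := inferInstanceAs (NormedAddCommGroup (C2 n))
instance : NormedSpace ℝ (D2 n) := inferInstanceAs (NormedSpace ℝ (C2 n))

theorem isClosed_isDeriv : IsClosed {p : C(U, Mat n) × C(U, Mat n) | IsDeriv p.1 p.2} := by
  simp only [isDeriv_iff]
  have h : Continuous fun p : C(U, Mat n) × C(U, Mat n) => ContinuousMap.const U (p.1 0) :=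
    ContinuousMap.continuous_const'.comp ((continuous_eval_const 0).comp continuous_fst)
  exact isClosed_eq continuous_fst (h.add (integ.continuous.comp continuous_snd))

instance : CompleteSpace (D1 n) :=
  (isClosed_isDeriv (n := n)).completeSpace_coe

instance : CompleteSpace (D2 n) := by
  have h : IsClosed (C2Sub n : Set (C(U, Mat n) × C(U, Mat n) × C(U, Mat n))) :=
    (isClosed_isDeriv.preimage (f := fun p : C(U, Mat n) × C(U, Mat n) × C(U, Mat n) =>
      (p.1, p.2.1)) (by fun_prop)).inter (isClosed_isDeriv.preimage (by fun_prop : Continuous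
        fun p : C(U, Mat n) × C(U, Mat n) × C(U, Mat n) => (p.2.1, p.2.2)))
  exact h.completeSpace_coe

/-- The value and the derivative of a `C¹`-function. -/
def D1.toProd (p : D1 n) : C(U, Mat n) × C(U, Mat n) := Subtype.val (show C1 n from p)

/-- The value and the first two derivatives of a `C²`-function. -/
def D2.toProd (p : D2 n) : C(U, Mat n) × C(U, Mat n) × C(U, Mat n) := Subtype.val (show C2 n from p)

theorem D2.isDeriv (p : D2 n) : IsDeriv p.toProd.1 p.toProd.2.1 ∧ IsDeriv p.toProd.2.1 p.toProd.2.2 :=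
  Subtype.property (show C2 n from p)

/-- The value of a continuous function. -/
def D0.ev (f : D0 n) (t : U) : Mat n := ContinuousMap.toFun f t

/-- The value of a `C¹`-function. -/
def D1.ev (p : D1 n) (t : U) : Mat n := C1.ev p t

/-- The derivative of a `C¹`-function. -/
def D1.dot (p : D1 n) (t : U) : Mat n := C1.dot p t

/-- The value of a `C²`-function. -/
def D2.ev (p : D2 n) (t : U) : Mat n := C2.ev p t

/-- The derivative of a `C²`-function. -/
def D2.dot (p : D2 n) (t : U) : Mat n := C2.dot p t

/-- The second derivative of a `C²`-function. -/
def D2.ddot (p : D2 n) (t : U) : Mat n := p.toProd.2.2 t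

@[ext] theorem D0.ext {f g : D0 n} (h : ∀ t, f.ev t = g.ev t) : f = g := ContinuousMap.ext h

section simp
variable (f g : D0 n) (p q : D1 n) (P Q : D2 n) (r : ℝ) (t : U)
@[simp] theorem D0.ev_add : (f + g).ev t = f.ev t + g.ev t := rfl
@[simp] theorem D0.ev_sub : (f - g).ev t = f.ev t - g.ev t := rfl
@[simp] theorem D0.ev_neg : (-f).ev t = -f.ev t := rfl
@[simp] theorem D0.ev_smul : (r • f).ev t = r • f.ev t := rfl
@[simp] theorem D0.ev_mul : (f * g).ev t = f.ev t * g.ev t := rfl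
@[simp] theorem D0.ev_zero : (0 : D0 n).ev t = 0 := rfl
@[simp] theorem D0.ev_one : (1 : D0 n).ev t = 1 := rfl
@[simp] theorem D1.ev_add : (p + q).ev t = p.ev t + q.ev t := rfl
@[simp] theorem D1.ev_sub : (p - q).ev t = p.ev t - q.ev t := rfl
@[simp] theorem D1.ev_neg : (-p).ev t = -p.ev t := rfl
@[simp] theorem D1.ev_smul : (r • p).ev t = r • p.ev t := rfl
@[simp] theorem D1.ev_zero : (0 : D1 n).ev t = 0 := rfl
@[simp] theorem D1.dot_add : (p + q).dot t = p.dot t + q.dot t := rfl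
@[simp] theorem D1.dot_sub : (p - q).dot t = p.dot t - q.dot t := rfl
@[simp] theorem D1.dot_neg : (-p).dot t = -p.dot t := rfl
@[simp] theorem D1.dot_smul : (r • p).dot t = r • p.dot t := rfl
@[simp] theorem D1.dot_zero : (0 : D1 n).dot t = 0 := rfl
@[simp] theorem D2.ev_add : (P + Q).ev t = P.ev t + Q.ev t := rfl
@[simp] theorem D2.ev_sub : (P - Q).ev t = P.ev t - Q.ev t := rfl
@[simp] theorem D2.ev_neg : (-P).ev t = -P.ev t := rfl
@[simp] theorem D2.ev_smul : (r • P).ev t = r • P.ev t := rfl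
@[simp] theorem D2.ev_zero : (0 : D2 n).ev t = 0 := rfl
@[simp] theorem D2.dot_add : (P + Q).dot t = P.dot t + Q.dot t := rfl
@[simp] theorem D2.dot_sub : (P - Q).dot t = P.dot t - Q.dot t := rfl
@[simp] theorem D2.dot_neg : (-P).dot t = -P.dot t := rfl
@[simp] theorem D2.dot_smul : (r • P).dot t = r • P.dot t := rfl
@[simp] theorem D2.dot_zero : (0 : D2 n).dot t = 0 := rfl
@[simp] theorem D2.ddot_add : (P + Q).ddot t = P.ddot t + Q.ddot t := rfl
@[simp] theorem D2.ddot_smul : (r • P).ddot t = r • P.ddot t := rfl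
@[simp] theorem D2.ddot_zero : (0 : D2 n).ddot t = 0 := rfl
end simp

/-- Linear maps into `D0 n` are bounded by a bound on the values. -/
theorem D0.norm_le {f : D0 n} {c : ℝ} (hc : 0 ≤ c) (h : ∀ t, ‖f.ev t‖ ≤ c) : ‖f‖ ≤ c :=
  (ContinuousMap.norm_le (f : C(U, Mat n)) hc).2 h

theorem D0.norm_ev_le (f : D0 n) (t : U) : ‖f.ev t‖ ≤ ‖f‖ :=
  ContinuousMap.norm_coe_le_norm (f : C(U, Mat n)) t

theorem D1.norm_ev_le (p : D1 n) (t : U) : ‖p.ev t‖ ≤ ‖p‖ :=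
  (ContinuousMap.norm_coe_le_norm p.toProd.1 t).trans (le_max_left _ _)

theorem D1.norm_dot_le (p : D1 n) (t : U) : ‖p.dot t‖ ≤ ‖p‖ :=
  (ContinuousMap.norm_coe_le_norm p.toProd.2 t).trans (le_max_right _ _)

theorem D1.norm_le {p : D1 n} {c : ℝ} (hc : 0 ≤ c) (h : ∀ t, ‖p.ev t‖ ≤ c)
    (h' : ∀ t, ‖p.dot t‖ ≤ c) : ‖p‖ ≤ c :=
  max_le ((ContinuousMap.norm_le _ hc).2 h) ((ContinuousMap.norm_le _ hc).2 h')

theorem D2.norm_ev_le (p : D2 n) (t : U) : ‖p.ev t‖ ≤ ‖p‖ :=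
  (ContinuousMap.norm_coe_le_norm p.toProd.1 t).trans
    (le_max_left _ _)

theorem D2.norm_dot_le (p : D2 n) (t : U) : ‖p.dot t‖ ≤ ‖p‖ :=
  (ContinuousMap.norm_coe_le_norm p.toProd.2.1 t).trans
    ((le_max_left _ _).trans (le_max_right _ _))

theorem D2.norm_ddot_le (p : D2 n) (t : U) : ‖p.ddot t‖ ≤ ‖p‖ :=
  (ContinuousMap.norm_coe_le_norm p.toProd.2.2 t).trans
    ((le_max_right _ _).trans (le_max_right _ _))

theorem D2.norm_le {p : D2 n} {c : ℝ} (hc : 0 ≤ c) (h : ∀ t, ‖p.ev t‖ ≤ c)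
    (h' : ∀ t, ‖p.dot t‖ ≤ c) (h'' : ∀ t, ‖p.ddot t‖ ≤ c) : ‖p‖ ≤ c :=
  max_le ((ContinuousMap.norm_le _ hc).2 h) (max_le ((ContinuousMap.norm_le _ hc).2 h')
    ((ContinuousMap.norm_le _ hc).2 h''))

/-- The value of a `C¹`-function, as a continuous function. -/
def D1.val : D1 n →L[ℝ] D0 n :=
  LinearMap.mkContinuous
    { toFun := fun p => p.toProd.1
      map_add' := fun _ _ => rfl
      map_smul' := fun _ _ => rfl } 1 fun p => by
    rw [one_mul]; exact D0.norm_le (norm_nonneg p) p.norm_ev_le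

/-- The derivative of a `C¹`-function, as a continuous function. -/
def D1.der : D1 n →L[ℝ] D0 n :=
  LinearMap.mkContinuous
    { toFun := fun p => p.toProd.2
      map_add' := fun _ _ => rfl
      map_smul' := fun _ _ => rfl } 1 fun p => by
    rw [one_mul]; exact D0.norm_le (norm_nonneg p) p.norm_dot_le

@[simp] theorem D1.val_ev (p : D1 n) (t : U) : (D1.val p).ev t = p.ev t := rfl
@[simp] theorem D1.der_ev (p : D1 n) (t : U) : (D1.der p).ev t = p.dot t := rfl

theorem D1.isDeriv (p : D1 n) : IsDeriv (D1.val p : D0 n) (D1.der p : D0 n) :=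
  Subtype.property (show C1 n from p)

/-- The `C¹`-function with given value and derivative. -/
def D1.mk (f f' : D0 n) (h : IsDeriv f f') : D1 n := (⟨(f, f'), h⟩ : C1 n)

@[ext] theorem D1.ext {p q : D1 n} (h : ∀ t, p.ev t = q.ev t) : p = q := by
  have h1 : D1.val p = D1.val q := D0.ext h
  have h2 : D1.der p = D1.der q := by
    refine deriv_unique p.isDeriv ?_
    have := q.isDeriv
    rw [← h1] at this
    exact this
  exact Subtype.ext (Prod.ext h1 h2)

/-- The inclusion `C² → C¹`. -/
def D2.incl : D2 n →L[ℝ] D1 n :=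
  LinearMap.mkContinuous
    { toFun := fun p => (⟨(p.toProd.1,
        p.toProd.2.1), p.isDeriv.1⟩ : C1 n)
      map_add' := fun _ _ => rfl
      map_smul' := fun _ _ => rfl } 1 fun p => by
    rw [one_mul]; exact D1.norm_le (norm_nonneg p) p.norm_ev_le p.norm_dot_le

/-- Differentiation `C² → C¹`. -/
def D2.diff : D2 n →L[ℝ] D1 n :=
  LinearMap.mkContinuous
    { toFun := fun p => (⟨(p.toProd.2.1,
        p.toProd.2.2), p.isDeriv.2⟩ : C1 n)
      map_add' := fun _ _ => rfl
      map_smul' := fun _ _ => rfl } 1 fun p => by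
    rw [one_mul]; exact D1.norm_le (norm_nonneg p) p.norm_dot_le p.norm_ddot_le

@[simp] theorem D2.incl_ev (p : D2 n) (t : U) : (D2.incl p).ev t = p.ev t := rfl
@[simp] theorem D2.incl_dot (p : D2 n) (t : U) : (D2.incl p).dot t = p.dot t := rfl
@[simp] theorem D2.diff_ev (p : D2 n) (t : U) : (D2.diff p).ev t = p.dot t := rfl
@[simp] theorem D2.diff_dot (p : D2 n) (t : U) : (D2.diff p).dot t = p.ddot t := rfl

/-- The `C²`-function with given value and derivative, where the derivative is `C¹`. -/
def D2.mk (f : D0 n) (p : D1 n) (h : IsDeriv f (D1.val p : D0 n)) : D2 n :=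
  (⟨(f, D1.val p, D1.der p), h, p.isDeriv⟩ : C2 n)

@[ext] theorem D2.ext {p q : D2 n} (h : ∀ t, p.ev t = q.ev t) : p = q := by
  have h1 : D2.incl p = D2.incl q := D1.ext h
  have h2 : D2.diff p = D2.diff q := D1.ext fun t => by
    rw [D2.diff_ev, D2.diff_ev, ← D2.incl_dot, ← D2.incl_dot, h1]
  exact Subtype.ext (Prod.ext (congrArg D1.val h1) (Prod.ext (congrArg D1.val h2)
    (congrArg D1.der h2)))

theorem IsDeriv.mul {f f' g g' : D0 n} (hf : IsDeriv f f') (hg : IsDeriv g g') :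
    IsDeriv (f * g : D0 n) (f' * g + f * g' : D0 n) := fun t => by
  have := (hf t).mul (hg t)
  refine this.congr_deriv ?_
  simp only [IccExtend_val]
  rfl

theorem norm_mul_le_of_le' {x y : Mat n} {a b : ℝ} (hx : ‖x‖ ≤ a) (hy : ‖y‖ ≤ b) :
    ‖x * y‖ ≤ a * b :=
  (norm_mul_le x y).trans (mul_le_mul hx hy (norm_nonneg _) ((norm_nonneg _).trans hx))

theorem D1.mul_mem (p q : D1 n) : IsDeriv (D1.val p * D1.val q : D0 n)
    (D1.der p * D1.val q + D1.val p * D1.der q : D0 n) := p.isDeriv.mul q.isDeriv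

/-- The product of `C¹`-functions. -/
def D1.mul : D1 n →L[ℝ] D1 n →L[ℝ] D1 n :=
  LinearMap.mkContinuous₂
    (LinearMap.mk₂ ℝ (fun p q => D1.mk _ _ (p.mul_mem q))
      (fun p p' q => D1.ext fun t => add_mul (p.ev t) (p'.ev t) (q.ev t))
      (fun c p q => D1.ext fun t => smul_mul_assoc c (p.ev t) (q.ev t))
      (fun p q q' => D1.ext fun t => mul_add (p.ev t) (q.ev t) (q'.ev t))
      (fun c p q => D1.ext fun t => mul_smul_comm c (p.ev t) (q.ev t))) 2 fun p q => by
    have h0 : 0 ≤ ‖p‖ * ‖q‖ := mul_nonneg (norm_nonneg p) (norm_nonneg q)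
    refine D1.norm_le (by linarith) (fun t => ?_) fun t => ?_
    · change ‖p.ev t * q.ev t‖ ≤ _
      have := norm_mul_le_of_le' (p.norm_ev_le t) (q.norm_ev_le t)
      linarith
    · change ‖p.dot t * q.ev t + p.ev t * q.dot t‖ ≤ _
      have h1 := norm_mul_le_of_le' (p.norm_dot_le t) (q.norm_ev_le t)
      have h2 := norm_mul_le_of_le' (p.norm_ev_le t) (q.norm_dot_le t)
      have h3 := norm_add_le (p.dot t * q.ev t) (p.ev t * q.dot t)
      linarith

@[simp] theorem D1.mul_ev (p q : D1 n) (t : U) : (D1.mul p q).ev t = p.ev t * q.ev t := rfl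
@[simp] theorem D1.mul_dot (p q : D1 n) (t : U) :
    (D1.mul p q).dot t = p.dot t * q.ev t + p.ev t * q.dot t := rfl

theorem D2.mul_mem (p q : D2 n) :
    IsDeriv (D1.val (D2.incl p) * D1.val (D2.incl q) : D0 n)
      (D1.val (D1.mul (D2.diff p) (D2.incl q) + D1.mul (D2.incl p) (D2.diff q)) : D0 n) :=
  (D2.incl p).isDeriv.mul (D2.incl q).isDeriv

/-- The product of `C²`-functions. -/
def D2.mul : D2 n →L[ℝ] D2 n →L[ℝ] D2 n :=
  LinearMap.mkContinuous₂
    (LinearMap.mk₂ ℝ (fun p q => D2.mk _ _ (p.mul_mem q))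
      (fun p p' q => D2.ext fun t => add_mul (p.ev t) (p'.ev t) (q.ev t))
      (fun c p q => D2.ext fun t => smul_mul_assoc c (p.ev t) (q.ev t))
      (fun p q q' => D2.ext fun t => mul_add (p.ev t) (q.ev t) (q'.ev t))
      -- The norm is the maximum of the three sup norms; the bound 4 counts the terms of (pq)'' =
      -- p''q + 2p'q' + pq''.
      (fun c p q => D2.ext fun t => mul_smul_comm c (p.ev t) (q.ev t))) 4 fun p q => by
    have h0 : 0 ≤ ‖p‖ * ‖q‖ := mul_nonneg (norm_nonneg p) (norm_nonneg q)
    refine D2.norm_le (by linarith) (fun t => ?_) (fun t => ?_) fun t => ?_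
    · change ‖p.ev t * q.ev t‖ ≤ _
      have := norm_mul_le_of_le' (p.norm_ev_le t) (q.norm_ev_le t)
      linarith
    · change ‖p.dot t * q.ev t + p.ev t * q.dot t‖ ≤ _
      have h1 := norm_mul_le_of_le' (p.norm_dot_le t) (q.norm_ev_le t)
      have h2 := norm_mul_le_of_le' (p.norm_ev_le t) (q.norm_dot_le t)
      have h3 := norm_add_le (p.dot t * q.ev t) (p.ev t * q.dot t)
      linarith
    · change ‖(p.ddot t * q.ev t + p.dot t * q.dot t) + (p.dot t * q.dot t + p.ev t * q.ddot t)‖ ≤ _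
      have h1 := norm_mul_le_of_le' (p.norm_ddot_le t) (q.norm_ev_le t)
      have h2 := norm_mul_le_of_le' (p.norm_dot_le t) (q.norm_dot_le t)
      have h3 := norm_mul_le_of_le' (p.norm_ev_le t) (q.norm_ddot_le t)
      have h4 := norm_add_le (p.ddot t * q.ev t + p.dot t * q.dot t)
        (p.dot t * q.dot t + p.ev t * q.ddot t)
      have h5 := norm_add_le (p.ddot t * q.ev t) (p.dot t * q.dot t)
      have h6 := norm_add_le (p.dot t * q.dot t) (p.ev t * q.ddot t)
      linarith

@[simp] theorem D2.mul_ev (p q : D2 n) (t : U) : (D2.mul p q).ev t = p.ev t * q.ev t := rfl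
@[simp] theorem D2.mul_dot (p q : D2 n) (t : U) :
    (D2.mul p q).dot t = p.dot t * q.ev t + p.ev t * q.dot t := rfl

/-- Composition of a `C¹`-function with a real linear map. -/
def D1.map (φ : Mat n →L[ℝ] Mat n) : D1 n →L[ℝ] D1 n :=
  LinearMap.mkContinuous
    { toFun := fun p => (⟨((φ : C(Mat n, Mat n)).comp p.toProd.1,
        (φ : C(Mat n, Mat n)).comp p.toProd.2),
          fun t => φ.hasFDerivAt.comp_hasDerivWithinAt _ (p.isDeriv t)⟩ : C1 n)
      map_add' := fun p q => D1.ext fun t => map_add φ (p.ev t) (q.ev t)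
      map_smul' := fun c p => D1.ext fun t => map_smul φ c (p.ev t) } ‖φ‖ fun p => by
    have h0 := mul_nonneg (norm_nonneg φ) (norm_nonneg p)
    exact D1.norm_le h0 (fun t => φ.le_opNorm_of_le (p.norm_ev_le t))
      fun t => φ.le_opNorm_of_le (p.norm_dot_le t)

@[simp] theorem D1.map_ev (φ : Mat n →L[ℝ] Mat n) (p : D1 n) (t : U) :
    (D1.map φ p).ev t = φ (p.ev t) := rfl
@[simp] theorem D1.map_dot (φ : Mat n →L[ℝ] Mat n) (p : D1 n) (t : U) :
    (D1.map φ p).dot t = φ (p.dot t) := rfl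

/-- Composition of a continuous function with a real linear map. -/
def D0.map (φ : Mat n →L[ℝ] Mat n) : D0 n →L[ℝ] D0 n :=
  LinearMap.mkContinuous
    { toFun := fun p => (φ : C(Mat n, Mat n)).comp (p : C(U, Mat n))
      map_add' := fun p q => D0.ext fun t => map_add φ (p.ev t) (q.ev t)
      map_smul' := fun c p => D0.ext fun t => map_smul φ c (p.ev t) } ‖φ‖ fun p =>
    D0.norm_le (mul_nonneg (norm_nonneg φ) (norm_nonneg p))
      fun t => φ.le_opNorm_of_le (p.norm_ev_le t)

@[simp] theorem D0.map_ev (φ : Mat n →L[ℝ] Mat n) (p : D0 n) (t : U) :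
    (D0.map φ p).ev t = φ (p.ev t) := rfl

/-- Composition of a `C²`-function with a real linear map. -/
def D2.map (φ : Mat n →L[ℝ] Mat n) : D2 n →L[ℝ] D2 n :=
  LinearMap.mkContinuous
    { toFun := fun p => D2.mk (D1.val (D1.map φ (D2.incl p))) (D1.map φ (D2.diff p))
        (D1.map φ (D2.incl p)).isDeriv
      map_add' := fun p q => D2.ext fun t => map_add φ (p.ev t) (q.ev t)
      map_smul' := fun c p => D2.ext fun t => map_smul φ c (p.ev t) } ‖φ‖ fun p => by
    have h0 := mul_nonneg (norm_nonneg φ) (norm_nonneg p)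
    exact D2.norm_le h0 (fun t => φ.le_opNorm_of_le (p.norm_ev_le t))
      (fun t => φ.le_opNorm_of_le (p.norm_dot_le t)) fun t => φ.le_opNorm_of_le (p.norm_ddot_le t)

@[simp] theorem D2.map_ev (φ : Mat n →L[ℝ] Mat n) (p : D2 n) (t : U) :
    (D2.map φ p).ev t = φ (p.ev t) := rfl
@[simp] theorem D2.map_dot (φ : Mat n →L[ℝ] Mat n) (p : D2 n) (t : U) :
    (D2.map φ p).dot t = φ (p.dot t) := rfl
@[simp] theorem D2.map_ddot (φ : Mat n →L[ℝ] Mat n) (p : D2 n) (t : U) :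
    (D2.map φ p).ddot t = φ (p.ddot t) := rfl

/-- The constant function `1`. -/
def D2.one : D2 n :=
  (⟨(1, 0, 0), fun t => hasDerivWithinAt_const (t : ℝ) (Icc (0 : ℝ) 1) (1 : Mat n),
    fun t => hasDerivWithinAt_const (t : ℝ) (Icc (0 : ℝ) 1) (0 : Mat n)⟩ : C2 n)

@[simp] theorem D2.one_ev (t : U) : (D2.one : D2 n).ev t = 1 := rfl
@[simp] theorem D2.one_dot (t : U) : (D2.one : D2 n).dot t = 0 := rfl

/-- Evaluation of continuous functions. -/
def D0.evL (t : U) : D0 n →L[ℝ] Mat n :=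
  LinearMap.mkContinuous
    { toFun := fun f => f.ev t
      map_add' := fun _ _ => rfl
      map_smul' := fun _ _ => rfl } 1 fun f => by rw [one_mul]; exact f.norm_ev_le t

/-- Evaluation of `C²`-functions. -/
def D2.evL (t : U) : D2 n →L[ℝ] Mat n := (D0.evL t).comp (D1.val.comp D2.incl)

/-- The pointwise exponential of a `C²`-function. -/
def D2.exp (f : D2 n) : D2 n := NormedSpace.exp (D2.mul f) D2.one

-- `D2.exp f` is the exponential of the operator of multiplication by f, applied to 1. Its
-- smoothness in f thus comes from the Banach algebra of operators, and evaluation at t carries the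
-- exponential series of the operator to that of f(t) term by term.
@[simp] theorem D2.exp_ev (f : D2 n) (t : U) : (D2.exp f).ev t = NormedSpace.exp (f.ev t) := by
  let φ : (D2 n →L[ℝ] D2 n) →L[ℝ] Mat n :=
    (D2.evL t).comp (ContinuousLinearMap.apply ℝ (D2 n) D2.one)
  have hpow (k : ℕ) : φ (D2.mul f ^ k) = f.ev t ^ k := by
    change ((D2.mul f ^ k) D2.one).ev t = _
    induction k with
    | zero => simp
    | succ k ih =>
      rw [pow_succ', pow_succ', ← ih]
      rfl
  have h1 := (NormedSpace.exp_series_hasSum_exp' (𝕂 := ℝ) (D2.mul f)).mapL φ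
  have h2 := NormedSpace.exp_series_hasSum_exp' (𝕂 := ℝ) (f.ev t)
  have h3 : (fun k : ℕ => φ ((k.factorial : ℝ)⁻¹ • D2.mul f ^ k)) =
      fun k : ℕ => (k.factorial : ℝ)⁻¹ • f.ev t ^ k :=
    funext fun k => (φ.map_smul _ _).trans (congrArg _ (hpow k))
  rw [h3] at h1
  exact HasSum.unique h1 h2

theorem D2.contDiff_exp {m : WithTop ℕ∞} : ContDiff ℝ m (D2.exp : D2 n → D2 n) :=
  (ContinuousLinearMap.apply ℝ (D2 n) D2.one).contDiff.comp
    (NahmSchmid.contDiff_exp.comp (D2.mul (n := n)).contDiff)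

theorem D2.exp_zero : D2.exp (0 : D2 n) = D2.one := D2.ext fun t => by simp

theorem D2.hasFDerivAt_exp_zero :
    HasFDerivAt (D2.exp : D2 n → D2 n) (ContinuousLinearMap.id ℝ (D2 n)) 0 := by
  have h1 : HasFDerivAt (NormedSpace.exp : (D2 n →L[ℝ] D2 n) → (D2 n →L[ℝ] D2 n))
      (1 : (D2 n →L[ℝ] D2 n) →L[ℝ] (D2 n →L[ℝ] D2 n)) (D2.mul 0) := by
    rw [map_zero]; exact _root_.hasFDerivAt_exp_zero
  have h2 := (ContinuousLinearMap.apply ℝ (D2 n) D2.one).hasFDerivAt.comp (0 : D2 n)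
    (h1.comp (0 : D2 n) (D2.mul (n := n)).hasFDerivAt)
  refine h2.congr_fderiv ?_
  ext1 p
  exact D2.ext fun t => by
    change (D2.mul p D2.one).ev t = _
    simp

end

section

/-! ### Linear differential equations on `[0,1]` -/

theorem intervalIntegrable_norm_ext {E : Type*} [NormedAddCommGroup E] (f : C(U, E)) (a b : ℝ) :
    IntervalIntegrable (fun s => ‖ext f s‖) MeasureTheory.volume a b :=
  (continuous_ext f).norm.intervalIntegrable _ _

section Volterra
variable {E : Type*} [NormedAddCommGroup E] [NormedSpace ℝ E]

/-- Each application of K integrates the previous bound, so the iterates acquire the factor tᵐ/m!.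
Hence some power of K is a contraction whatever the size of C. -/
theorem norm_pow_volterra_le {K : C(U, E) →L[ℝ] C(U, E)} {C : ℝ} (hC : 0 ≤ C)
    (hK : ∀ f (t : U), ‖K f t‖ ≤ C * ∫ s in (0 : ℝ)..t, ‖ext f s‖) (f : C(U, E)) (m : ℕ) (t : U) :
    ‖(K ^ m) f t‖ ≤ C ^ m * (t : ℝ) ^ m / m.factorial * ‖f‖ := by
  induction m generalizing t with
  | zero => simpa using f.norm_coe_le_norm t
  | succ m ih =>
    rw [pow_succ']
    refine (hK ((K ^ m) f) t).trans ?_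
    have h1 : ∫ s in (0 : ℝ)..t, ‖ext ((K ^ m) f) s‖ ≤
        ∫ s in (0 : ℝ)..t, (C ^ m / m.factorial * ‖f‖) * s ^ m := by
      refine intervalIntegral.integral_mono_on t.2.1 (intervalIntegrable_norm_ext _ _ _)
        ((continuous_const.mul (continuous_pow m)).intervalIntegrable _ _) fun s hs => ?_
      have hs1 : s ∈ Icc (0 : ℝ) 1 := ⟨hs.1, hs.2.trans t.2.2⟩
      rw [ext_of_mem _ hs1]
      refine (ih ⟨s, hs1⟩).trans_eq ?_
      ring
    refine (mul_le_mul_of_nonneg_left h1 hC).trans_eq ?_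
    rw [intervalIntegral.integral_const_mul, integral_pow, Nat.factorial_succ]
    push_cast
    field_simp
    simp only [zero_pow (Nat.succ_ne_zero m), sub_zero]
    ring

/-- `1 - K` is invertible for a Volterra operator `K`. -/
theorem isUnit_one_sub_volterra {K : C(U, E) →L[ℝ] C(U, E)} [CompleteSpace E] {C : ℝ} (hC : 0 ≤ C)
    (hK : ∀ f (t : U), ‖K f t‖ ≤ C * ∫ s in (0 : ℝ)..t, ‖ext f s‖) : IsUnit (1 - K) := by
  obtain ⟨m, hm⟩ := ((FloorSemiring.tendsto_pow_div_factorial_atTop C).eventually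
    (gt_mem_nhds one_pos)).exists
  have hn : ‖K ^ m‖ < 1 := by
    refine lt_of_le_of_lt (ContinuousLinearMap.opNorm_le_bound _ (by positivity) fun f => ?_) hm
    refine (ContinuousMap.norm_le _ (by positivity)).2 fun t => ?_
    refine (norm_pow_volterra_le hC hK f m t).trans ?_
    gcongr
    exact mul_le_of_le_one_right (by positivity) (pow_le_one₀ t.2.1 t.2.2)
  -- 1 - Kᵐ is a product of 1 - K and a geometric sum that commutes with it, so both factors are
  -- invertible.
  have h1 : IsUnit (1 - K ^ m) := isUnit_one_sub_of_norm_lt_one (R := C(U, E) →L[ℝ] C(U, E)) hn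
  rw [← mul_neg_geom_sum K m] at h1
  refine ((Commute.isUnit_mul_iff ?_).1 h1).1
  rw [commute_iff_eq, mul_neg_geom_sum, geom_sum_mul_neg]

variable [CompleteSpace E]

theorem norm_integ_le (f : C(U, E)) (t : U) : ‖integ f t‖ ≤ ∫ s in (0 : ℝ)..t, ‖ext f s‖ :=
  intervalIntegral.norm_integral_le_integral_norm t.2.1

theorem norm_integ_comp_le {C : ℝ} {f g : C(U, E)} (h : ∀ t, ‖f t‖ ≤ C * ‖g t‖) (t : U) :
    ‖integ f t‖ ≤ C * ∫ s in (0 : ℝ)..t, ‖ext g s‖ := by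
  refine (norm_integ_le f t).trans ?_
  rw [← intervalIntegral.integral_const_mul]
  exact intervalIntegral.integral_mono_on t.2.1 (intervalIntegrable_norm_ext _ _ _)
    ((intervalIntegrable_norm_ext _ _ _).const_mul _) fun s _ => h _

theorem norm_integ_integ_le (f : C(U, E)) (t : U) :
    ‖integ (integ f) t‖ ≤ ∫ s in (0 : ℝ)..t, ‖ext f s‖ := by
  refine (intervalIntegral.norm_integral_le_of_norm_le_const
    (C := ∫ s in (0 : ℝ)..t, ‖ext f s‖) fun s hs => ?_).trans ?_
  · rw [uIoc_of_le t.2.1] at hs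
    have hs1 : s ∈ Icc (0 : ℝ) 1 := ⟨hs.1.le, hs.2.trans t.2.2⟩
    rw [ext_of_mem _ hs1]
    refine (norm_integ_le f ⟨s, hs1⟩).trans ?_
    exact intervalIntegral.integral_mono_interval le_rfl hs.1.le hs.2
      (Eventually.of_forall fun _ => norm_nonneg _) (intervalIntegrable_norm_ext _ _ _)
  · rw [sub_zero, abs_of_nonneg t.2.1]
    exact mul_le_of_le_one_right
      (intervalIntegral.integral_nonneg t.2.1 fun _ _ => norm_nonneg _) t.2.2

end Volterra

/-- Integration. -/
def D0.integ : D0 n →L[ℝ] D0 n := NahmSchmid.integ (E := Mat n)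

/-- Constant functions. -/
def D0.const : Mat n →L[ℝ] D0 n :=
  LinearMap.mkContinuous
    { toFun := fun c => ContinuousMap.const U c
      map_add' := fun _ _ => rfl
      map_smul' := fun _ _ => rfl } 1 fun c =>
    D0.norm_le (by positivity) fun t => (one_mul ‖c‖).ge

@[simp] theorem D0.const_ev (c : Mat n) (t : U) : (D0.const c).ev t = c := rfl

@[simp] theorem D0.integ_ev_zero (f : D0 n) : (D0.integ f).ev 0 = 0 := integ_zero (E := Mat n) f

theorem D0.isDeriv_iff {f f' : D0 n} : IsDeriv f f' ↔ f = D0.const (f.ev 0) + D0.integ f' :=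
  NahmSchmid.isDeriv_iff

theorem D0.isDeriv_integ (c : Mat n) (f : D0 n) : IsDeriv (D0.const c + D0.integ f) f :=
  D0.isDeriv_iff.2 (by simp)

/-- The operator `g ↦ ∫₀ᵗ g a`. -/
def volterraMul : D0 n →L[ℝ] (D0 n →L[ℝ] D0 n) :=
  (ContinuousLinearMap.compL ℝ (D0 n) (D0 n) (D0 n) D0.integ).comp
    (ContinuousLinearMap.mul ℝ (D0 n)).flip

theorem volterraMul_apply (a g : D0 n) : volterraMul a g = D0.integ (g * a) := rfl

theorem D0.isUnit_one_sub {K : D0 n →L[ℝ] D0 n} {C : ℝ} (hC : 0 ≤ C)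
    (hK : ∀ (f : D0 n) (t : U), ‖(K f).ev t‖ ≤ C * ∫ s in (0 : ℝ)..t, ‖NahmSchmid.ext (E := Mat n) f s‖) :
    IsUnit (1 - K) :=
  isUnit_one_sub_volterra (E := Mat n) hC hK

theorem D0.norm_integ_comp_le {C : ℝ} {f g : D0 n} (h : ∀ t, ‖f.ev t‖ ≤ C * ‖g.ev t‖) (t : U) :
    ‖(D0.integ f).ev t‖ ≤ C * ∫ s in (0 : ℝ)..t, ‖NahmSchmid.ext (E := Mat n) g s‖ :=
  NahmSchmid.norm_integ_comp_le (E := Mat n) h t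

theorem isUnit_one_sub_volterraMul (a : D0 n) : IsUnit (1 - volterraMul a) := by
  refine D0.isUnit_one_sub (norm_nonneg a) fun f t => ?_
  rw [volterraMul_apply]
  refine D0.norm_integ_comp_le (fun t => ?_) t
  rw [mul_comm, D0.ev_mul]
  exact norm_mul_le_of_le' le_rfl (a.norm_ev_le t)

/-- Integration from 0 reduces existence, uniqueness and parameter dependence for g' = ga + f to the
inverse of the operator 1 - `volterraMul a`. -/
theorem isDeriv_mul_iff {a g : D0 n} {f : D0 n} : IsDeriv g (g * a + f : D0 n) ↔
    (1 - volterraMul a) g = D0.const (g.ev 0) + D0.integ f := by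
  rw [D0.isDeriv_iff, map_add, sub_apply, volterraMul_apply,
    one_apply_eq_self, sub_eq_iff_eq_add]
  rw [add_assoc, add_comm (D0.integ f)]

/-- The solution of `g' = g a`, `g(0) = 1`. -/
def parallel (a : D0 n) : D0 n := Ring.inverse (1 - volterraMul a) 1

theorem one_sub_volterraMul_inverse (a f : D0 n) :
    (1 - volterraMul a) (Ring.inverse (1 - volterraMul a) f) = f :=
  congrArg (fun L : D0 n →L[ℝ] D0 n => L f) (Ring.mul_inverse_cancel _ (isUnit_one_sub_volterraMul a))

theorem inverse_one_sub_volterraMul (a f : D0 n) :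
    Ring.inverse (1 - volterraMul a) ((1 - volterraMul a) f) = f :=
  congrArg (fun L : D0 n →L[ℝ] D0 n => L f) (Ring.inverse_mul_cancel _ (isUnit_one_sub_volterraMul a))

theorem one_sub_volterraMul_ev_zero (a f : D0 n) : ((1 - volterraMul a) f).ev 0 = f.ev 0 := by
  rw [sub_apply, volterraMul_apply, D0.ev_sub, D0.integ_ev_zero, sub_zero]
  rfl

theorem parallel_zero (a : D0 n) : (parallel a).ev 0 = 1 := by
  rw [← one_sub_volterraMul_ev_zero a, parallel, one_sub_volterraMul_inverse, D0.ev_one]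

theorem isDeriv_parallel (a : D0 n) : IsDeriv (parallel a) (parallel a * a : D0 n) := by
  have h : (1 - volterraMul a) (parallel a) = D0.const ((parallel a).ev 0) + D0.integ 0 := by
    rw [parallel_zero, parallel, one_sub_volterraMul_inverse, map_zero, add_zero]
    rfl
  have h1 := isDeriv_mul_iff.2 h
  rwa [add_zero] at h1

theorem eq_parallel {a g : D0 n} (h : IsDeriv g (g * a : D0 n)) (h0 : g.ev 0 = 1) :
    g = parallel a := by
  rw [← add_zero (g * a)] at h
  have h1 := isDeriv_mul_iff.1 h
  rw [h0, map_zero, add_zero] at h1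
  rw [parallel, ← inverse_one_sub_volterraMul a g, h1]
  rfl

/-- Operator inversion is analytic at invertible operators, and `volterraMul a` is linear in a. -/
theorem contDiff_parallel : ContDiff ℝ ω (parallel : D0 n → D0 n) := by
  refine contDiff_iff_contDiffAt.2 fun a => ?_
  obtain ⟨u, hu⟩ := isUnit_one_sub_volterraMul a
  have h1 : ContDiffAt ℝ ω Ring.inverse (1 - volterraMul a) := hu ▸ contDiffAt_ringInverse ℝ u
  have h2 : ContDiffAt ℝ ω (fun a : D0 n => 1 - volterraMul a) a :=
    contDiffAt_const.sub (volterraMul (n := n)).contDiff.contDiffAt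
  have h3 : ContDiffAt ℝ ω (fun a : D0 n => Ring.inverse (1 - volterraMul a)) a :=
    ContDiffAt.comp (g := Ring.inverse) (f := fun a : D0 n => 1 - volterraMul a) a h1 h2
  exact h3.clm_apply contDiffAt_const

/-- The derivative of `a ↦ parallel a` in the direction `x` solves the linearised equation. -/
theorem fderiv_parallel (a x : D0 n) : ∃ y : D0 n, fderiv ℝ parallel a x = y ∧ y.ev 0 = 0 ∧
    IsDeriv y (y * a + parallel a * x : D0 n) := by
  refine ⟨_, rfl, ?_⟩
  have hd : DifferentiableAt ℝ (parallel : D0 n → D0 n) a :=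
    contDiff_parallel.contDiffAt.differentiableAt (by simp)
  have h0 : (fderiv ℝ parallel a x).ev 0 = 0 := by
    have h1 := (D0.evL (n := n) 0).hasFDerivAt.comp a hd.hasFDerivAt
    have h2 : (⇑(D0.evL (n := n) 0) ∘ parallel) = fun _ => (1 : Mat n) :=
      funext fun a => parallel_zero a
    rw [h2] at h1
    exact congrArg (fun L : D0 n →L[ℝ] Mat n => L x) (h1.unique (hasFDerivAt_const (1 : Mat n) a))
  refine ⟨h0, isDeriv_mul_iff.2 ?_⟩
  rw [h0, map_zero, zero_add]
  -- Differentiate the integral equation g - ∫ga = 1 that defines the parallel transport.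
  have h1 : HasFDerivAt (fun a : D0 n => parallel a - volterraMul a (parallel a)) _ a :=
    hd.hasFDerivAt.sub (ContinuousLinearMap.hasFDerivAt_of_bilinear volterraMul
      (hasFDerivAt_id a) hd.hasFDerivAt)
  have h2 : (fun a : D0 n => parallel a - volterraMul a (parallel a)) = fun _ => (1 : D0 n) :=
    funext fun a => one_sub_volterraMul_inverse a 1
  rw [h2] at h1
  have h3 := congrArg (fun L : D0 n →L[ℝ] D0 n => L x) (h1.unique (hasFDerivAt_const (1 : D0 n) a))
  change fderiv ℝ parallel a x - (volterraMul a (fderiv ℝ parallel a x) +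
    volterraMul x (parallel a)) = 0 at h3
  rw [sub_apply, ← volterraMul_apply x, ← sub_eq_zero, ← h3]
  simp only [one_apply_eq_self]
  abel

/-- A `C²`-function with prescribed second derivative and initial values. -/
def D2.ofDdot (c d : Mat n) (z : D0 n) : D2 n :=
  D2.mk (D0.const d + D0.integ (D0.const c + D0.integ z))
    (D1.mk (D0.const c + D0.integ z) z (D0.isDeriv_integ c z)) (D0.isDeriv_integ d _)

/-- The second derivative. -/
def D2.der2 : D2 n →L[ℝ] D0 n := D1.der.comp D2.diff

/-- The derivative, as a continuous function. -/
def D2.der1 : D2 n →L[ℝ] D0 n := D1.val.comp D2.diff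

/-- The value, as a continuous function. -/
def D2.val : D2 n →L[ℝ] D0 n := D1.val.comp D2.incl

@[simp] theorem D2.val_ev (p : D2 n) (t : U) : (D2.val p).ev t = p.ev t := rfl
@[simp] theorem D2.der1_ev (p : D2 n) (t : U) : (D2.der1 p).ev t = p.dot t := rfl
@[simp] theorem D2.der2_ev (p : D2 n) (t : U) : (D2.der2 p).ev t = p.ddot t := rfl

/-- The boundary value problem `X'' + A₁X' + A₀X = f`, `X(0) = X(1) = 0` is solvable if the
homogeneous problem has only the trivial solution. -/
theorem exists_bvp {A₀ A₁ : D0 n →L[ℝ] D0 n} {C : ℝ} (hC : 0 ≤ C)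
    (h₀ : ∀ z t, ‖(A₀ z).ev t‖ ≤ C * ‖z.ev t‖) (h₁ : ∀ z t, ‖(A₁ z).ev t‖ ≤ C * ‖z.ev t‖)
    (hinj : ∀ X : D2 n, X.ev 0 = 0 → X.ev 1 = 0 →
      D2.der2 X + A₁ (D2.der1 X) + A₀ (D2.val X) = 0 → X = 0) (f : D0 n) :
    ∃ X : D2 n, X.ev 0 = 0 ∧ X.ev 1 = 0 ∧ D2.der2 X + A₁ (D2.der1 X) + A₀ (D2.val X) = f := by
  -- With z = X'' and c = X'(0), X(0) = 0, one has X' = c + ∫z and X = ct + ∫∫z. The equation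
  -- becomes (1 - K)z = f - Mc, with K a Volterra operator.
  let K : D0 n →L[ℝ] D0 n := -(A₁.comp D0.integ + A₀.comp (D0.integ.comp D0.integ))
  have hK : IsUnit (1 - K) := by
    refine D0.isUnit_one_sub (C := C + C) (by positivity) fun f t => ?_
    have e : (K f).ev t = -((A₁ (D0.integ f)).ev t + (A₀ (D0.integ (D0.integ f))).ev t) := rfl
    rw [e, norm_neg, add_mul]
    refine (norm_add_le _ _).trans (add_le_add ?_ ?_)
    · exact (h₁ _ t).trans (mul_le_mul_of_nonneg_left (norm_integ_le (E := Mat n) f t) hC)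
    · exact (h₀ _ t).trans (mul_le_mul_of_nonneg_left (norm_integ_integ_le (E := Mat n) f t) hC)
  let M : Mat n →L[ℝ] D0 n := A₁.comp D0.const + A₀.comp (D0.integ.comp D0.const)
  let P : D0 n →L[ℝ] D0 n := Ring.inverse (1 - K)
  have hP (f : D0 n) : P f - K (P f) = f :=
    congrArg (fun L : D0 n →L[ℝ] D0 n => L f) (Ring.mul_inverse_cancel _ hK)
  -- The shooting map: Nc is the end value X(1) of the homogeneous solution with X(0) = 0 and X'(0)
  -- = c. The hypothesis makes it injective, hence surjective in finite dimension, so c can be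
  -- chosen to cancel the end value produced by f.
  let N : Mat n →ₗ[ℝ] Mat n :=
    ((D0.evL 1).comp (D0.integ.comp (D0.const - (D0.integ.comp (P.comp M))))).toLinearMap
  have key (c : Mat n) (f : D0 n) :
      D2.der2 (D2.ofDdot c 0 (P (f - M c))) + A₁ (D2.der1 (D2.ofDdot c 0 (P (f - M c)))) +
        A₀ (D2.val (D2.ofDdot c 0 (P (f - M c)))) = f := by
    have e1 : D2.der2 (D2.ofDdot c 0 (P (f - M c))) = P (f - M c) := rfl
    have e2 : D2.der1 (D2.ofDdot c 0 (P (f - M c))) = D0.const c + D0.integ (P (f - M c)) := rfl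
    have e3 : D2.val (D2.ofDdot c 0 (P (f - M c))) =
      D0.const 0 + D0.integ (D0.const c + D0.integ (P (f - M c))) := rfl
    have e4 : M c = A₁ (D0.const c) + A₀ (D0.integ (D0.const c)) := rfl
    have e5 : K (P (f - M c)) = -(A₁ (D0.integ (P (f - M c))) +
      A₀ (D0.integ (D0.integ (P (f - M c))))) := rfl
    have e6 := hP (f - M c)
    rw [e5] at e6
    rw [e1, e2, e3, map_zero, zero_add, map_add, map_add, map_add]
    generalize P (f - M c) = z at e6 ⊢
    rw [e4, sub_neg_eq_add, eq_sub_iff_add_eq] at e6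
    rw [← e6]
    abel
  have hb0 (c : Mat n) (f : D0 n) : (D2.ofDdot c 0 (P (f - M c))).ev 0 = 0 := by
    change (D0.const 0 + D0.integ _ : D0 n).ev 0 = 0
    rw [D0.ev_add, D0.integ_ev_zero, D0.const_ev, add_zero]
  have hb1 (c : Mat n) (f : D0 n) : (D2.ofDdot c 0 (P (f - M c))).ev 1 =
      N c + (D0.integ (D0.integ (P f))).ev 1 := by
    change (D0.const 0 + D0.integ (D0.const c + D0.integ (P (f - M c))) : D0 n).ev 1 =
      (D0.integ (D0.const c - D0.integ (P (M c)))).ev 1 + (D0.integ (D0.integ (P f))).ev 1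
    simp only [map_add, map_sub, map_zero, D0.ev_add, D0.ev_sub, D0.ev_zero]
    abel
  have hN : Function.Injective N := by
    refine (injective_iff_map_eq_zero N).2 fun c hc => ?_
    have h := hinj (D2.ofDdot c 0 (P (0 - M c))) (hb0 c 0) (by rw [hb1, hc]; simp) (key c 0)
    have h2 : (D2.ofDdot c 0 (P (0 - M c))).dot 0 = c := by
      change (D0.const c + D0.integ _ : D0 n).ev 0 = c
      rw [D0.ev_add, D0.integ_ev_zero, D0.const_ev, add_zero]
    rw [← h2, h, D2.dot_zero]
  obtain ⟨c, hc⟩ := (LinearMap.injective_iff_surjective.1 hN) (-(D0.integ (D0.integ (P f))).ev 1)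
  exact ⟨_, hb0 c f, by rw [hb1, hc, neg_add_cancel], key c f⟩

end

section

/-! ### The moment map and complex gauge transformations -/

/-- The adjoint, as a real linear map. -/
def starM : Mat n →L[ℝ] Mat n :=
  LinearMap.toContinuousLinearMap
    { toFun := fun X : Mat n => star X
      map_add' := star_add
      map_smul' := fun c X => by simp }

/-- Multiplication by a complex number, as a real linear map. -/
def smulM (z : ℂ) : Mat n →L[ℝ] Mat n :=
  LinearMap.toContinuousLinearMap
    { toFun := fun X : Mat n => z • X
      map_add' := smul_add z
      map_smul' := fun c X => smul_comm z c X }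

@[simp] theorem starM_apply (X : Mat n) : starM X = star X := rfl
@[simp] theorem smulM_apply (z : ℂ) (X : Mat n) : smulM z X = z • X := rfl

/-- The commutator of continuous functions. -/
def D0.ad : D0 n →L[ℝ] (D0 n →L[ℝ] D0 n) :=
  ContinuousLinearMap.mul ℝ (D0 n) - (ContinuousLinearMap.mul ℝ (D0 n)).flip

@[simp] theorem D0.ad_ev (f g : D0 n) (t : U) : (D0.ad f g).ev t = ⁅f.ev t, g.ev t⁆ := by
  rw [Ring.lie_def]; rfl

/-- The left hand side of the real equation. -/
def moment (p : D1 n × D1 n) : D0 n :=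
  D1.der p.1 + D0.map starM (D1.der p.1) + D0.ad (D1.val p.1) (D0.map starM (D1.val p.1)) -
    D0.ad (D1.val p.2) (D0.map starM (D1.val p.2))

theorem moment_ev (p : D1 n × D1 n) (t : U) : (moment p).ev t =
    p.1.dot t + star (p.1.dot t) + ⁅p.1.ev t, star (p.1.ev t)⁆ - ⁅p.2.ev t, star (p.2.ev t)⁆ := by
  simp [moment]

theorem moment_eq_zero_iff {a b : C1 n} : moment ((a, b) : D1 n × D1 n) = 0 ↔ RealEq a b := by
  constructor
  · intro h t
    have := moment_ev ((a, b) : D1 n × D1 n) t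
    rw [h] at this
    exact this.symm
  · intro h
    exact D0.ext fun t => (moment_ev _ t).trans (h t)

theorem contDiff_moment : ContDiff ℝ ω (moment : D1 n × D1 n → D0 n) := by
  have h1 : ContDiff ℝ ω fun p : D1 n × D1 n => D1.der p.1 := D1.der.contDiff.comp contDiff_fst
  have h2 : ContDiff ℝ ω fun p : D1 n × D1 n => D1.val p.1 := D1.val.contDiff.comp contDiff_fst
  have h3 : ContDiff ℝ ω fun p : D1 n × D1 n => D1.val p.2 := D1.val.contDiff.comp contDiff_snd
  have hs : ContDiff ℝ ω (D0.map (starM (n := n))) := (D0.map starM).contDiff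
  have hb {f : D1 n × D1 n → D0 n} (hf : ContDiff ℝ ω f) :
      ContDiff ℝ ω fun p => D0.ad (f p) (D0.map starM (f p)) :=
    (D0.ad.contDiff.comp hf).clm_apply (hs.comp hf)
  exact ((h1.add (hs.comp h1)).add (hb h2)).sub (hb h3)

theorem hasFDerivAt_moment (p : D1 n × D1 n) : ∃ L : D1 n × D1 n →L[ℝ] D0 n,
    HasFDerivAt moment L p ∧ ∀ x t, (L x).ev t = x.1.dot t + star (x.1.dot t) +
      (⁅x.1.ev t, star (p.1.ev t)⁆ + ⁅p.1.ev t, star (x.1.ev t)⁆) -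
      (⁅x.2.ev t, star (p.2.ev t)⁆ + ⁅p.2.ev t, star (x.2.ev t)⁆) := by
  have f1 : HasFDerivAt (fun p : D1 n × D1 n => p.1) (ContinuousLinearMap.fst ℝ _ _) p :=
    hasFDerivAt_fst
  have f2 : HasFDerivAt (fun p : D1 n × D1 n => p.2) (ContinuousLinearMap.snd ℝ _ _) p :=
    hasFDerivAt_snd
  have h1 := (D1.der (n := n)).hasFDerivAt.comp p f1
  have h2 := (D1.val (n := n)).hasFDerivAt.comp p f1
  have h3 := (D1.val (n := n)).hasFDerivAt.comp p f2
  have hs {f : D1 n × D1 n → D0 n} {f'} (hf : HasFDerivAt f f' p) :=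
    (D0.map (starM (n := n))).hasFDerivAt.comp p hf
  have h4 := D0.ad.hasFDerivAt_of_bilinear h2 (hs h2)
  have h5 := D0.ad.hasFDerivAt_of_bilinear h3 (hs h3)
  refine ⟨_, ((h1.add (hs h1)).add h4).sub h5, fun x t => ?_⟩
  simp
  abel

/-- The complex gauge transformation `exp(iX)`. -/
def expI (X : D2 n) : D2 n := D2.exp (D2.map (smulM Complex.I) X)

@[simp] theorem expI_ev (X : D2 n) (t : U) :
    (expI X).ev t = NormedSpace.exp (Complex.I • X.ev t) := by simp [expI]

theorem contDiff_expI : ContDiff ℝ ω (expI : D2 n → D2 n) :=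
  D2.contDiff_exp.comp (D2.map _).contDiff

theorem hasFDerivAt_expI : HasFDerivAt (expI : D2 n → D2 n) (D2.map (smulM Complex.I)) 0 := by
  have h := D2.hasFDerivAt_exp_zero (n := n)
  rw [← map_zero (D2.map (smulM (n := n) Complex.I))] at h
  exact h.comp (0 : D2 n) (D2.map (smulM (n := n) Complex.I)).hasFDerivAt

theorem hasFDerivAt_expI_neg :
    HasFDerivAt (fun X : D2 n => expI (-X)) (-D2.map (smulM Complex.I)) 0 := by
  have h := hasFDerivAt_expI (n := n)
  rw [← neg_zero] at h
  refine (h.comp (0 : D2 n) (hasFDerivAt_id (𝕜 := ℝ) (0 : D2 n)).neg).congr_fderiv ?_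
  ext1 X
  exact D2.ext fun t => by simp

theorem expI_zero : expI (0 : D2 n) = D2.one := by
  rw [expI, map_zero, D2.exp_zero]

@[simp] theorem D2.one_ddot (t : U) : (D2.one : D2 n).ddot t = 0 := rfl

/-- The action of a pair `(E, E⁻¹)` of complex gauge transformations. -/
def gaugeAct (E F : D2 n) (p : D1 n × D1 n) : D1 n × D1 n :=
  (D1.mul (D1.mul (D2.incl E) p.1) (D2.incl F) - D1.mul (D2.diff E) (D2.incl F),
    D1.mul (D1.mul (D2.incl E) p.2) (D2.incl F))

/-- The action of `exp(iX)`. -/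
def actI (X : D2 n) (p : D1 n × D1 n) : D1 n × D1 n := gaugeAct (expI X) (expI (-X)) p

theorem contDiff_mul1 {V : Type*} [NormedAddCommGroup V] [NormedSpace ℝ V] {f g : V → D1 n}
    {m : WithTop ℕ∞} (hf : ContDiff ℝ m f) (hg : ContDiff ℝ m g) :
    ContDiff ℝ m fun x => D1.mul (f x) (g x) :=
  (D1.mul.contDiff.comp hf).clm_apply hg

theorem contDiff_gaugeAct {V : Type*} [NormedAddCommGroup V] [NormedSpace ℝ V] {E F : V → D2 n}
    {p : V → D1 n × D1 n} {m : WithTop ℕ∞} (hE : ContDiff ℝ m E) (hF : ContDiff ℝ m F)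
    (hp : ContDiff ℝ m p) : ContDiff ℝ m fun x => gaugeAct (E x) (F x) (p x) := by
  have h1 := (D2.incl (n := n)).contDiff.comp hE
  have h2 := (D2.incl (n := n)).contDiff.comp hF
  have h3 := (D2.diff (n := n)).contDiff.comp hE
  exact ((contDiff_mul1 (contDiff_mul1 h1 (contDiff_fst.comp hp)) h2).sub
    (contDiff_mul1 h3 h2)).prodMk (contDiff_mul1 (contDiff_mul1 h1 (contDiff_snd.comp hp)) h2)

theorem contDiff_actI {V : Type*} [NormedAddCommGroup V] [NormedSpace ℝ V] {X : V → D2 n}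
    {p : V → D1 n × D1 n} (hX : ContDiff ℝ ω X) (hp : ContDiff ℝ ω p) :
    ContDiff ℝ ω fun x => actI (X x) (p x) :=
  contDiff_gaugeAct (contDiff_expI.comp hX) (contDiff_expI.comp hX.neg) hp

theorem actI_zero (p : D1 n × D1 n) : actI 0 p = p := by
  rw [actI, neg_zero, expI_zero, gaugeAct]
  refine Prod.ext (D1.ext fun t => ?_) (D1.ext fun t => ?_) <;> simp

theorem hasFDerivAt_actI (p : D1 n × D1 n) : ∃ L : D2 n →L[ℝ] D1 n × D1 n,
    HasFDerivAt (fun X => actI X p) L 0 ∧ ∀ X t,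
      (L X).1.ev t = Complex.I • (⁅X.ev t, p.1.ev t⁆ - X.dot t) ∧
      (L X).1.dot t = Complex.I • (⁅X.dot t, p.1.ev t⁆ + ⁅X.ev t, p.1.dot t⁆ - X.ddot t) ∧
      (L X).2.ev t = Complex.I • ⁅X.ev t, p.2.ev t⁆ := by
  have h1 := (D2.incl (n := n)).hasFDerivAt.comp (0 : D2 n) hasFDerivAt_expI
  have h2 := (D2.incl (n := n)).hasFDerivAt.comp (0 : D2 n) hasFDerivAt_expI_neg
  have h3 := (D2.diff (n := n)).hasFDerivAt.comp (0 : D2 n) hasFDerivAt_expI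
  have hb {f g : D2 n → D1 n} {f' g'} (hf : HasFDerivAt f f' 0) (hg : HasFDerivAt g g' 0) :=
    D1.mul.hasFDerivAt_of_bilinear hf hg
  have e1 := (hb (hb h1 (hasFDerivAt_const p.1 _)) h2).sub (hb h3 h2)
  have e2 := hb (hb h1 (hasFDerivAt_const p.2 _)) h2
  refine ⟨_, e1.prodMk e2, fun X t => ⟨?_, ?_, ?_⟩⟩
  · simp [expI_zero, Ring.lie_def, smul_sub]
    abel
  · simp [expI_zero, Ring.lie_def, smul_sub, smul_add]
    abel
  · simp [expI_zero, Ring.lie_def, smul_sub]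
    abel

/-- `(i/2)` times the left hand side of the real equation for `exp(iX).p`. -/
def momentI (X : D2 n) (p : D1 n × D1 n) : D0 n :=
  D0.map (smulM (Complex.I / 2)) (moment (actI X p))

theorem contDiff_momentI {V : Type*} [NormedAddCommGroup V] [NormedSpace ℝ V] {X : V → D2 n}
    {p : V → D1 n × D1 n} (hX : ContDiff ℝ ω X) (hp : ContDiff ℝ ω p) :
    ContDiff ℝ ω fun x => momentI (X x) (p x) :=
  (D0.map _).contDiff.comp (contDiff_moment.comp (contDiff_actI hX hp))

end

section

/-! ### The linearised real equation -/

/-- The pair `(α, β)` of a quadruple. -/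
def pairOf (T : Quad n) : D1 n × D1 n := (alpha T, beta T)

theorem pairOf_fst_ev (T : Quad n) (t : U) :
    (pairOf T).1.ev t = (T 0).ev t - Complex.I • (T 1).ev t := rfl
theorem pairOf_fst_dot (T : Quad n) (t : U) :
    (pairOf T).1.dot t = (T 0).dot t - Complex.I • (T 1).dot t := rfl
theorem pairOf_snd_ev (T : Quad n) (t : U) :
    (pairOf T).2.ev t = (T 2).ev t + Complex.I • (T 3).ev t := rfl
theorem pairOf_snd_dot (T : Quad n) (t : U) :
    (pairOf T).2.dot t = (T 2).dot t + Complex.I • (T 3).dot t := rfl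

/-- The zeroth order part of `jacobi`. -/
def jacobi₀ (T : Quad n) : D0 n →L[ℝ] D0 n :=
  D0.ad (D1.der (T 0)) + D0.ad (D1.val (T 0)) ∘L D0.ad (D1.val (T 0)) +
    D0.ad (D1.val (T 1)) ∘L D0.ad (D1.val (T 1)) - D0.ad (D1.val (T 2)) ∘L D0.ad (D1.val (T 2)) -
    D0.ad (D1.val (T 3)) ∘L D0.ad (D1.val (T 3))

/-- The first order part of `jacobi`. -/
def jacobi₁ (T : Quad n) : D0 n →L[ℝ] D0 n := (2 : ℝ) • D0.ad (D1.val (T 0))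

/-- The operator `∇² + (ad T₁)² - (ad T₂)² - (ad T₃)²` with `∇ = d/dt + ad T₀`. -/
def jacobi (T : Quad n) : D2 n →L[ℝ] D0 n :=
  D2.der2 + jacobi₁ T ∘L D2.der1 + jacobi₀ T ∘L D2.val

theorem jacobi₀_ev (T : Quad n) (z : D0 n) (t : U) : (jacobi₀ T z).ev t =
    ⁅(T 0).dot t, z.ev t⁆ + ⁅(T 0).ev t, ⁅(T 0).ev t, z.ev t⁆⁆ +
      ⁅(T 1).ev t, ⁅(T 1).ev t, z.ev t⁆⁆ - ⁅(T 2).ev t, ⁅(T 2).ev t, z.ev t⁆⁆ -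
      ⁅(T 3).ev t, ⁅(T 3).ev t, z.ev t⁆⁆ := by
  simp only [jacobi₀, sub_apply, add_apply, D0.ev_sub, D0.ev_add, D0.ad_ev,
    ContinuousLinearMap.comp_apply]
  rfl

theorem jacobi₁_ev (T : Quad n) (z : D0 n) (t : U) :
    (jacobi₁ T z).ev t = (2 : ℝ) • ⁅(T 0).ev t, z.ev t⁆ := by
  rw [jacobi₁, smul_apply, D0.ev_smul, D0.ad_ev]
  rfl

theorem jacobi_ev (T : Quad n) (X : D2 n) (t : U) : (jacobi T X).ev t =
    X.ddot t + (2 : ℝ) • ⁅(T 0).ev t, X.dot t⁆ + (⁅(T 0).dot t, X.ev t⁆ +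
      ⁅(T 0).ev t, ⁅(T 0).ev t, X.ev t⁆⁆ +
      ⁅(T 1).ev t, ⁅(T 1).ev t, X.ev t⁆⁆ - ⁅(T 2).ev t, ⁅(T 2).ev t, X.ev t⁆⁆ -
      ⁅(T 3).ev t, ⁅(T 3).ev t, X.ev t⁆⁆) := by
  simp only [jacobi, add_apply, D0.ev_add, ContinuousLinearMap.comp_apply, jacobi₀_ev, jacobi₁_ev,
    D2.val_ev, D2.der1_ev, D2.der2_ev]

/-- The factor i/2 normalises the coefficient of X'' to 1: the second derivative enters A' as -iX'',
and A' + A'^* doubles it. The terms with T₁' and the brackets mixing different Tᵢ cancel between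
each expression and its adjoint. -/
theorem linearised_identity {T₀ T₁ T₂ T₃ T₀' T₁' X X' X'' : Mat n} (h₀ : star T₀ = -T₀)
    (h₁ : star T₁ = -T₁) (h₂ : star T₂ = -T₂) (h₃ : star T₃ = -T₃) (h₀' : star T₀' = -T₀')
    (h₁' : star T₁' = -T₁') (h : star X = -X) (h' : star X' = -X') (h'' : star X'' = -X'')
    {a a' b A A' B : Mat n} (ha : a = T₀ - Complex.I • T₁) (ha' : a' = T₀' - Complex.I • T₁')
    (hb : b = T₂ + Complex.I • T₃) (hA : A = Complex.I • (⁅X, a⁆ - X'))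
    (hA' : A' = Complex.I • (⁅X', a⁆ + ⁅X, a'⁆ - X'')) (hB' : B = Complex.I • ⁅X, b⁆) :
    (Complex.I / 2) • (A' + star A' + (⁅A, star a⁆ + ⁅a, star A⁆) - (⁅B, star b⁆ + ⁅b, star B⁆)) =
      X'' + (2 : ℝ) • ⁅T₀, X'⁆ + (⁅T₀', X⁆ + ⁅T₀, ⁅T₀, X⁆⁆ + ⁅T₁, ⁅T₁, X⁆⁆ - ⁅T₂, ⁅T₂, X⁆⁆ -
        ⁅T₃, ⁅T₃, X⁆⁆) := by
  have e2 : (2 : ℝ) • ⁅T₀, X'⁆ = (2 : ℂ) • ⁅T₀, X'⁆ := by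
    rw [two_smul, two_smul]
  rw [e2]
  subst ha ha' hb hA hA' hB'
  simp only [Ring.lie_def, star_sub, star_add, star_mul, star_smul, h₀, h₁, h₂, h₃, h₀', h₁', h, h',
    h'', Complex.star_def, Complex.conj_I, mul_sub, sub_mul, mul_add, add_mul, smul_mul_assoc,
    mul_smul_comm, neg_mul, mul_neg, neg_smul, smul_neg, neg_neg, smul_sub, smul_add, smul_smul,
    mul_assoc]
  match_scalars <;> ring_nf <;> simp [Complex.I_sq]

end

/-! ### Derivatives of 𝔤-valued functions and the linearised real equation. -/

section

theorem D1.dot_mem (p : D1 n) {S : Submodule ℝ (Mat n)} (hS : IsClosed (S : Set (Mat n)))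
    (h : ∀ t, p.ev t ∈ S) (t : U) : p.dot t ∈ S := by
  refine deriv_mem_submodule S hS ?_ (p.isDeriv t) (fun r hr => ?_) ?_
  · have h0 : AccPt (t : ℝ) (𝓟 (Icc (0 : ℝ) 1)) :=
      uniqueDiffWithinAt_iff_accPt.1 (uniqueDiffOn_Icc_zero_one t t.2)
    rwa [accPt_principal_iff_nhdsWithin] at h0
  · rw [IccExtend_of_mem _ _ hr]
    exact h _
  · rw [IccExtend_val]
    exact h _

variable {G : Subgroup (Matrix.unitaryGroup (Fin n) ℂ)} {B : LinearMap.BilinForm ℝ (Mat n)}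

theorem D1.dot_mem_lie (hG : IsClosed (G : Set (Matrix.unitaryGroup (Fin n) ℂ))) (p : D1 n)
    (h : ∀ t, p.ev t ∈ lie G) (t : U) : p.dot t ∈ lie G :=
  p.dot_mem (S := lieSub hG) (isClosed_lie hG) h t

theorem D1.dot_mem_lieC (hG : IsClosed (G : Set (Matrix.unitaryGroup (Fin n) ℂ))) (p : D1 n)
    (h : ∀ t, p.ev t ∈ lieC G) (t : U) : p.dot t ∈ lieC G :=
  p.dot_mem (S := (lieCSub hG).restrictScalars ℝ) (isClosed_lieC hG) h t

theorem D2.dot_mem_lie (hG : IsClosed (G : Set (Matrix.unitaryGroup (Fin n) ℂ))) (X : D2 n)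
    (h : ∀ t, X.ev t ∈ lie G) (t : U) : X.dot t ∈ lie G :=
  (D2.incl X).dot_mem_lie hG h t

theorem D2.ddot_mem_lie (hG : IsClosed (G : Set (Matrix.unitaryGroup (Fin n) ℂ))) (X : D2 n)
    (h : ∀ t, X.ev t ∈ lie G) (t : U) : X.ddot t ∈ lie G :=
  (D2.diff X).dot_mem_lie hG (X.dot_mem_lie hG h) t

theorem jacobi_mem_lie (hG : IsClosed (G : Set (Matrix.unitaryGroup (Fin n) ℂ))) {T : Quad n}
    (hT : T ∈ configs G) {X : D2 n} (h : ∀ t, X.ev t ∈ lie G) (t : U) :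
    (jacobi T X).ev t ∈ lie G := by
  rw [jacobi_ev]
  have hl {Y Z : Mat n} (hY : Y ∈ lie G) (hZ : Z ∈ lie G) := lie_mem_lie hG hY hZ
  have h0 := X.dot_mem_lie hG h t
  have hd := D1.dot_mem_lie hG (T 0) (hT 0) t
  have hq (i) : ⁅(T i).ev t, ⁅(T i).ev t, X.ev t⁆⁆ ∈ lie G := hl (hT i t) (hl (hT i t) (h t))
  exact add_mem_lie hG (add_mem_lie hG (X.ddot_mem_lie hG h t)
    (smul_mem_lie _ (hl (hT 0 t) h0))) (sub_mem_lie hG (sub_mem_lie hG (add_mem_lie hG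
      (add_mem_lie hG (hl hd (h t)) (hq 0)) (hq 1)) (hq 2)) (hq 3))

/-- The linearisation of the real equation along `exp(iX)` is `jacobi`. -/
theorem hasFDerivAt_momentI (hG : IsClosed (G : Set (Matrix.unitaryGroup (Fin n) ℂ))) {T : Quad n}
    (hT : T ∈ configs G) : ∃ L : D2 n →L[ℝ] D0 n,
      HasFDerivAt (fun X => momentI X (pairOf T)) L 0 ∧
      ∀ X : D2 n, (∀ t, X.ev t ∈ lie G) → L X = jacobi T X := by
  obtain ⟨L₁, hL₁, h₁⟩ := hasFDerivAt_actI (pairOf T)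
  obtain ⟨L₂, hL₂, h₂⟩ := hasFDerivAt_moment (pairOf T)
  rw [← actI_zero (pairOf T)] at hL₂
  have h3 := (D0.map (smulM (n := n) (Complex.I / 2))).hasFDerivAt.comp (0 : D2 n)
    (hL₂.comp (0 : D2 n) hL₁)
  refine ⟨_, h3, fun X hX => D0.ext fun t => ?_⟩
  rw [jacobi_ev]
  have hs (i) : star ((T i).ev t) = -(T i).ev t := star_of_mem_lie (hT i t)
  have hd (i) : star ((T i).dot t) = -(T i).dot t :=
    star_of_mem_lie (D1.dot_mem_lie hG (T i) (hT i) t)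
  refine Eq.trans ?_ (linearised_identity (hs 0) (hs 1) (hs 2) (hs 3) (hd 0) (hd 1)
    (star_of_mem_lie (hX t)) (star_of_mem_lie (X.dot_mem_lie hG hX t))
    (star_of_mem_lie (X.ddot_mem_lie hG hX t)) (pairOf_fst_ev T t) (pairOf_fst_dot T t)
    (pairOf_snd_ev T t) (h₁ X t).1 (h₁ X t).2.1 (h₁ X t).2.2)
  exact congrArg (fun Z : Mat n => (Complex.I / 2) • Z) (h₂ (L₁ X) t)

/-! ### The metric on tangent vectors to orbits -/

/-- The tangent vector to the orbit of `T` in the direction `ξ`. -/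
def orbitVec (T : Quad n) (ξ : D2 n) : Fin 4 → D1 n :=
  ![-(D2.diff ξ) + (D1.mul (D2.incl ξ) (T 0) - D1.mul (T 0) (D2.incl ξ)),
    D1.mul (D2.incl ξ) (T 1) - D1.mul (T 1) (D2.incl ξ),
    D1.mul (D2.incl ξ) (T 2) - D1.mul (T 2) (D2.incl ξ),
    D1.mul (D2.incl ξ) (T 3) - D1.mul (T 3) (D2.incl ξ)]

theorem orbitVec_zero_ev (T : Quad n) (ξ : D2 n) (t : U) :
    (orbitVec T ξ 0).ev t = -ξ.dot t + ⁅ξ.ev t, (T 0).ev t⁆ := by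
  rw [Ring.lie_def]; rfl

theorem orbitVec_ev (T : Quad n) (ξ : D2 n) (t : U) {i : Fin 4} (hi : i ≠ 0) :
    (orbitVec T ξ i).ev t = ⁅ξ.ev t, (T i).ev t⁆ := by
  rw [Ring.lie_def]
  fin_cases i
  · exact absurd rfl hi
  all_goals rfl

theorem orbitVec_mem {T : Quad n} {ξ : D2 n} (hξ : ξ ∈ lieGauge G) :
    orbitVec T ξ ∈ orbitTangent G T :=
  ⟨ξ, hξ, fun t => ⟨orbitVec_zero_ev T ξ t, fun _ hi => orbitVec_ev T ξ t hi⟩⟩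

theorem mem_orbitTangent {T X : Quad n} (h : X ∈ orbitTangent G T) :
    ∃ ξ ∈ lieGauge G, X = orbitVec T ξ := by
  obtain ⟨ξ, hξ, h⟩ := h
  refine ⟨ξ, hξ, funext fun i => D1.ext fun t => ?_⟩
  by_cases hi : i = 0
  · subst hi
    exact ((h t).1).trans (orbitVec_zero_ev T ξ t).symm
  · exact ((h t).2 i hi).trans (orbitVec_ev T ξ t hi).symm

theorem orbitVec_zero_dot (T : Quad n) (ξ : D2 n) (t : U) : (orbitVec T ξ 0).dot t =
    -(ξ.ddot t + ⁅(T 0).dot t, ξ.ev t⁆ + ⁅(T 0).ev t, ξ.dot t⁆) := by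
  have : (orbitVec T ξ 0).dot t = -ξ.ddot t + ((ξ.dot t * (T 0).ev t + ξ.ev t * (T 0).dot t) -
    ((T 0).dot t * ξ.ev t + (T 0).ev t * ξ.dot t)) := rfl
  rw [this, Ring.lie_def, Ring.lie_def]
  abel

/-- The integral over `[0,1]` of a function on `[0,1]`. -/
def intU (f : U → ℝ) : ℝ := ∫ t in (0 : ℝ)..1, f (projIcc 0 1 zero_le_one t)

theorem intU_sub {f g : U → ℝ} (hf : Continuous f) (hg : Continuous g) :
    intU (fun t => f t - g t) = intU f - intU g :=
  intervalIntegral.integral_sub ((hf.comp continuous_projIcc).intervalIntegrable _ _)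
    ((hg.comp continuous_projIcc).intervalIntegrable _ _)

theorem intU_add {f g : U → ℝ} (hf : Continuous f) (hg : Continuous g) :
    intU (fun t => f t + g t) = intU f + intU g :=
  intervalIntegral.integral_add ((hf.comp continuous_projIcc).intervalIntegrable _ _)
    ((hg.comp continuous_projIcc).intervalIntegrable _ _)

theorem intU_mono {f g : U → ℝ} (hf : Continuous f) (hg : Continuous g) (h : ∀ t, f t ≤ g t) :
    intU f ≤ intU g :=
  intervalIntegral.integral_mono_on zero_le_one ((hf.comp continuous_projIcc).intervalIntegrable _ _)
    ((hg.comp continuous_projIcc).intervalIntegrable _ _) fun _ _ => h _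

theorem D0.continuous_ev (f : D0 n) : Continuous f.ev := ContinuousMap.continuous (f : C(U, Mat n))
theorem D1.continuous_ev (f : D1 n) : Continuous f.ev := (D1.val f).continuous_ev
theorem D1.continuous_dot (f : D1 n) : Continuous f.dot := (D1.der f).continuous_ev
theorem D2.continuous_ev (f : D2 n) : Continuous f.ev := (D2.val f).continuous_ev

theorem intU_deriv_bilin (B : LinearMap.BilinForm ℝ (Mat n)) (p q : D1 n) :
    intU (fun t => B (p.ev t) (q.dot t) + B (p.dot t) (q.ev t)) =
      B (p.ev 1) (q.ev 1) - B (p.ev 0) (q.ev 0) := by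
  let f : ℝ → ℝ := fun t =>
    B (p.ev (projIcc 0 1 zero_le_one t)) (q.ev (projIcc 0 1 zero_le_one t))
  have hc : Continuous fun t => B (p.ev t) (q.dot t) + B (p.dot t) (q.ev t) :=
    (continuous_bilinForm B p.continuous_ev q.continuous_dot).add
      (continuous_bilinForm B p.continuous_dot q.continuous_ev)
  have h := intervalIntegral.integral_eq_sub_of_hasDeriv_right_of_le (f := f)
    (f' := fun t => (fun t => B (p.ev t) (q.dot t) + B (p.dot t) (q.ev t))
      (projIcc 0 1 zero_le_one t)) zero_le_one
    ((continuous_bilinForm B p.continuous_ev q.continuous_ev).comp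
      continuous_projIcc).continuousOn (fun t ht => ?_)
    ((hc.comp (continuous_projIcc (h := zero_le_one))).intervalIntegrable 0 1)
  · refine h.trans ?_
    have h1 : projIcc (0 : ℝ) 1 zero_le_one 1 = 1 := projIcc_right _
    have h0 : projIcc (0 : ℝ) 1 zero_le_one 0 = 0 := projIcc_left _
    simp only [f, h0, h1]
  · have ht1 : t ∈ Icc (0 : ℝ) 1 := ⟨ht.1.le, ht.2.le⟩
    have hd := HasDerivWithinAt.bilinForm B (p.isDeriv ⟨t, ht1⟩) (q.isDeriv ⟨t, ht1⟩)
    have hd1 := (hd.hasDerivAt (Icc_mem_nhds ht.1 ht.2)).hasDerivWithinAt (s := Ioi t)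
    refine hd1.congr_deriv ?_
    simp only [projIcc_of_mem _ ht1, IccExtend_of_mem _ _ ht1]
    rfl

theorem metric_eq (X Y : Fin 4 → D1 n) : metric B X Y = intU (fun t =>
    B ((X 0).ev t) ((Y 0).ev t) + B ((X 1).ev t) ((Y 1).ev t) - B ((X 2).ev t) ((Y 2).ev t) -
      B ((X 3).ev t) ((Y 3).ev t)) := by
  unfold metric intU
  congr 1
  ext t
  simp only [Fin.sum_univ_four, eta]
  simp only [Matrix.cons_val]
  simp only [one_mul, neg_mul, ← sub_eq_add_neg]
  rfl

/-- The link between the degeneracy locus and the linearised real equation. Invariance moves each ad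
Tᵢ from η onto ξ, and the derivative of η is removed by an integration by parts whose boundary terms
vanish with η. Neither the Nahm–Schmid equations nor boundary values of ξ enter. -/
theorem metric_orbitVec (hG : IsClosed (G : Set (Matrix.unitaryGroup (Fin n) ℂ)))
    (hB : IsInvariantInner G B) {T : Quad n} (hT : T ∈ configs G) {ξ η : D2 n}
    (hξ : ∀ t, ξ.ev t ∈ lie G) (hη : η ∈ lieGauge G) :
    metric B (orbitVec T ξ) (orbitVec T η) =
      -intU (fun t => B ((jacobi T ξ).ev t) (η.ev t)) := by
  obtain ⟨hη, hη0, hη1⟩ := hη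
  replace hη : ∀ t, η.ev t ∈ lie G := hη
  have hl {Y Z : Mat n} (hY : Y ∈ lie G) (hZ : Z ∈ lie G) := lie_mem_lie hG hY hZ
  let v := orbitVec T ξ 0
  -- Pointwise, the integrand of the metric differs from -⟨jacobi ξ, η⟩ by minus the derivative of
  -- ⟨v, η⟩, where v = -(ξ' + [T₀,ξ]).
  have key (t : U) : B ((orbitVec T ξ 0).ev t) ((orbitVec T η 0).ev t) +
      B ((orbitVec T ξ 1).ev t) ((orbitVec T η 1).ev t) -
      B ((orbitVec T ξ 2).ev t) ((orbitVec T η 2).ev t) -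
      B ((orbitVec T ξ 3).ev t) ((orbitVec T η 3).ev t) =
      -B ((jacobi T ξ).ev t) (η.ev t) -
      (B (v.ev t) ((D2.incl η).dot t) + B (v.dot t) ((D2.incl η).ev t)) := by
    have h0 := hl (hT 0 t) (hη t)
    have hq {i : Fin 4} (hi : i ≠ 0) : B ((orbitVec T ξ i).ev t) ((orbitVec T η i).ev t) =
        -B ⁅(T i).ev t, ⁅(T i).ev t, ξ.ev t⁆⁆ (η.ev t) := by
      rw [orbitVec_ev _ _ _ hi, orbitVec_ev _ _ _ hi, ← mat_lie_skew, ← mat_lie_skew (T i |>.ev t),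
        hB.lie_left (hT i t) (hl (hT i t) (hξ t)) (hη t)]
      simp
    rw [hq one_ne_zero, hq (by decide : (2 : Fin 4) ≠ 0), hq (by decide : (3 : Fin 4) ≠ 0)]
    have hv : v.ev t = -(ξ.dot t + ⁅(T 0).ev t, ξ.ev t⁆) := by
      rw [orbitVec_zero_ev, ← mat_lie_skew]; abel
    have hvl : ξ.dot t + ⁅(T 0).ev t, ξ.ev t⁆ ∈ lie G :=
      add_mem_lie hG (ξ.dot_mem_lie hG hξ t) (hl (hT 0 t) (hξ t))
    have h1 := hB.lie_left (hT 0 t) hvl (hη t)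
    have hv0 : (orbitVec T ξ 0).ev t = v.ev t := rfl
    rw [hv0, orbitVec_zero_dot, hv, orbitVec_zero_ev, jacobi_ev,
      ← mat_lie_skew (T 0 |>.ev t) (η.ev t)]
    rw [mat_lie_add] at h1
    simp only [map_add, map_sub, map_neg, map_smul, LinearMap.add_apply, LinearMap.sub_apply,
      LinearMap.neg_apply, LinearMap.smul_apply, D2.incl_ev, D2.incl_dot, smul_eq_mul] at h1 ⊢
    linarith
  have hb := intU_deriv_bilin B v (D2.incl η)
  have e1 : (D2.incl η).ev 1 = 0 := hη1
  have e0 : (D2.incl η).ev 0 = 0 := hη0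
  rw [e1, e0, map_zero, map_zero, sub_zero] at hb
  rw [metric_eq]
  simp only [key]
  have hc : Continuous fun t => -B ((jacobi T ξ).ev t) (η.ev t) :=
    (continuous_bilinForm B (D0.continuous_ev _) η.continuous_ev).neg
  rw [intU_sub hc, hb, sub_zero]
  · exact intervalIntegral.integral_neg
  · exact (continuous_bilinForm B v.continuous_ev (D2.incl η).continuous_dot).add
      (continuous_bilinForm B v.continuous_dot (D2.incl η).continuous_ev)

/-- A solution of a linear homogeneous differential equation that vanishes at `0` vanishes. -/
theorem D0.eq_zero_of_isDeriv {A : D0 n →L[ℝ] D0 n} {C : ℝ} (hC : 0 ≤ C)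
    (hA : ∀ z t, ‖(A z).ev t‖ ≤ C * ‖z.ev t‖) {f : D0 n} (hf : IsDeriv f (A f : D0 n))
    (h0 : f.ev 0 = 0) : f = 0 := by
  rw [D0.isDeriv_iff, h0, map_zero, zero_add] at hf
  have hu : IsUnit (1 - D0.integ ∘L A) :=
    D0.isUnit_one_sub hC fun f t => D0.norm_integ_comp_le (hA f) t
  have h1 : (1 - D0.integ ∘L A) f = 0 := by
    rw [sub_apply, one_apply_eq_self, ContinuousLinearMap.comp_apply, ← hf, sub_self]
  have h2 := congrArg (fun L : D0 n →L[ℝ] D0 n => L f) (Ring.inverse_mul_cancel _ hu)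
  change Ring.inverse (1 - D0.integ ∘L A) ((1 - D0.integ ∘L A) f) = f at h2
  rw [← h2, h1, map_zero]

theorem D0.norm_ad_ev_le (f z : D0 n) (t : U) : ‖(D0.ad f z).ev t‖ ≤ 2 * ‖f‖ * ‖z.ev t‖ := by
  rw [D0.ad_ev]
  refine (lie_norm_le _ _).trans ?_
  gcongr
  exact f.norm_ev_le t

/-- The zeroth component alone says ξ' = -[T₀,ξ], a linear equation whose solution is determined by
its value at 0. -/
theorem eq_zero_of_orbitVec_eq_zero {T : Quad n} {ξ : D2 n} (h0 : ξ.ev 0 = 0)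
    (h : orbitVec T ξ 0 = 0) : ξ = 0 := by
  have h1 : D2.val ξ = 0 := by
    refine D0.eq_zero_of_isDeriv (A := -D0.ad (D1.val (T 0)))
      (mul_nonneg zero_le_two (norm_nonneg (D1.val (T 0)))) (fun z t => ?_) ?_ h0
    · rw [neg_apply, D0.ev_neg, norm_neg]
      exact D0.norm_ad_ev_le _ _ _
    · have h2 : D2.der1 ξ = (-D0.ad (D1.val (T 0))) (D2.val ξ) := by
        refine D0.ext fun t => ?_
        have h3 := orbitVec_zero_ev T ξ t
        rw [h, D1.ev_zero, ← mat_lie_skew, eq_comm, ← neg_add, neg_eq_zero] at h3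
        rw [neg_apply, D0.ev_neg, D0.ad_ev]
        exact eq_neg_of_add_eq_zero_left h3
      rw [← h2]
      exact (D2.incl ξ).isDeriv
  exact D2.ext fun t => congrArg (fun f : D0 n => f.ev t) h1

/-- Off the degeneracy locus, the operator `jacobi` is injective on the Lie algebra of the gauge
group. -/
theorem eq_zero_of_jacobi_eq_zero (hG : IsClosed (G : Set (Matrix.unitaryGroup (Fin n) ℂ)))
    (hB : IsInvariantInner G B) {T : Quad n} (hT : T ∈ solutions G)
    (hD : T ∉ degeneracyLocus G B) {ξ : D2 n} (hξ : ξ ∈ lieGauge G) (h : jacobi T ξ = 0) :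
    ξ = 0 := by
  by_contra hne
  refine hD ⟨hT, orbitVec T ξ, orbitVec_mem hξ, fun h0 => hne ?_, fun Y hY => ?_⟩
  · exact eq_zero_of_orbitVec_eq_zero hξ.2.1 (congrFun h0 0)
  · obtain ⟨η, hη, rfl⟩ := mem_orbitTangent hY
    rw [metric_orbitVec hG hB hT.1 hξ.1 hη, h]
    simp [intU]

end

section

/-! ### Operators bounded pointwise -/

/-- `‖(A z)(t)‖ ≤ C ‖z(t)‖` for some constant `C`. -/
def IsPointwiseBounded (A : D0 n →L[ℝ] D0 n) : Prop :=
  ∃ C : ℝ, 0 ≤ C ∧ ∀ z t, ‖(A z).ev t‖ ≤ C * ‖z.ev t‖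

namespace IsPointwiseBounded

theorem ad (f : D0 n) : IsPointwiseBounded (D0.ad f) :=
  ⟨2 * ‖f‖, by positivity, fun z t => D0.norm_ad_ev_le f z t⟩

theorem map (φ : Mat n →L[ℝ] Mat n) : IsPointwiseBounded (D0.map φ) :=
  ⟨‖φ‖, by positivity, fun z t => φ.le_opNorm (z.ev t)⟩

theorem add {A A' : D0 n →L[ℝ] D0 n} (h : IsPointwiseBounded A) (h' : IsPointwiseBounded A') :
    IsPointwiseBounded (A + A') := by
  obtain ⟨C, hC, h⟩ := h
  obtain ⟨C', hC', h'⟩ := h'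
  refine ⟨C + C', by positivity, fun z t => ?_⟩
  rw [add_mul]
  exact (norm_add_le _ _).trans (add_le_add (h z t) (h' z t))

theorem sub {A A' : D0 n →L[ℝ] D0 n} (h : IsPointwiseBounded A) (h' : IsPointwiseBounded A') :
    IsPointwiseBounded (A - A') := by
  obtain ⟨C, hC, h⟩ := h
  obtain ⟨C', hC', h'⟩ := h'
  refine ⟨C + C', by positivity, fun z t => ?_⟩
  rw [add_mul]
  exact (norm_sub_le _ _).trans (add_le_add (h z t) (h' z t))

theorem comp {A A' : D0 n →L[ℝ] D0 n} (h : IsPointwiseBounded A) (h' : IsPointwiseBounded A') :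
    IsPointwiseBounded (A ∘L A') := by
  obtain ⟨C, hC, h⟩ := h
  obtain ⟨C', hC', h'⟩ := h'
  refine ⟨C * C', by positivity, fun z t => (h _ t).trans ?_⟩
  rw [mul_assoc]
  exact mul_le_mul_of_nonneg_left (h' z t) hC

theorem smul (c : ℝ) {A : D0 n →L[ℝ] D0 n} (h : IsPointwiseBounded A) :
    IsPointwiseBounded (c • A) := by
  obtain ⟨C, hC, h⟩ := h
  refine ⟨|c| * C, by positivity, fun z t => ?_⟩
  have e : ((c • A) z).ev t = c • (A z).ev t := rfl
  rw [e, norm_smul, Real.norm_eq_abs, mul_assoc]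
  exact mul_le_mul_of_nonneg_left (h z t) (abs_nonneg c)

end IsPointwiseBounded

theorem isPointwiseBounded_jacobi₀ (T : Quad n) : IsPointwiseBounded (jacobi₀ T) :=
  (((IsPointwiseBounded.ad _).add ((IsPointwiseBounded.ad _).comp (.ad _))).add
    ((IsPointwiseBounded.ad _).comp (.ad _))).sub ((IsPointwiseBounded.ad _).comp (.ad _)) |>.sub
    ((IsPointwiseBounded.ad _).comp (.ad _))

theorem isPointwiseBounded_jacobi₁ (T : Quad n) : IsPointwiseBounded (jacobi₁ T) :=
  (IsPointwiseBounded.ad _).smul _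

/-! ### Functions vanishing at the end points -/

/-- The `C²`-functions that vanish at the end points. -/
def D2z (n : ℕ) : Submodule ℝ (D2 n) :=
  LinearMap.ker (D2.evL (n := n) 0).toLinearMap ⊓ LinearMap.ker (D2.evL (n := n) 1).toLinearMap

theorem mem_D2z {X : D2 n} : X ∈ D2z n ↔ X.ev 0 = 0 ∧ X.ev 1 = 0 := Iff.rfl

instance : CompleteSpace (D2z n) := by
  have h : IsClosed (D2z n : Set (D2 n)) :=
    (isClosed_singleton.preimage (D2.evL (n := n) 0).continuous).inter
      (isClosed_singleton.preimage (D2.evL (n := n) 1).continuous)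
  exact h.completeSpace_coe

theorem D2.eq_zero_of_der2_eq_zero {X : D2 n} (hX : X ∈ D2z n) (h : D2.der2 X = 0) : X = 0 := by
  have h1 := D0.isDeriv_iff.1 (D2.diff X).isDeriv
  have h2 := D0.isDeriv_iff.1 (D2.incl X).isDeriv
  change D2.der1 X = D0.const ((D2.der1 X).ev 0) + D0.integ (D2.der2 X) at h1
  change D2.val X = D0.const (X.ev 0) + D0.integ (D2.der1 X) at h2
  rw [h, map_zero, add_zero] at h1
  rw [(mem_D2z.1 hX).1, map_zero, zero_add, h1] at h2
  have h3 (t : U) : X.ev t = (t : ℝ) • (D2.der1 X).ev 0 := by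
    have h4 := congrArg (fun f : D0 n => f.ev t) h2
    refine h4.trans ?_
    change ∫ s in (0 : ℝ)..t, (D2.der1 X).ev 0 = _
    rw [intervalIntegral.integral_const, sub_zero]
  have h5 := h3 1
  rw [mem_D2z.1 hX |>.2] at h5
  have h6 : (D2.der1 X).ev 0 = 0 := by simpa using h5.symm
  exact D2.ext fun t => by rw [h3, h6, smul_zero, D2.ev_zero]

variable {G : Subgroup (Matrix.unitaryGroup (Fin n) ℂ)} {B : LinearMap.BilinForm ℝ (Mat n)}

/-! ### Gauge transformations with values in the complexified group -/

/-- Pairs of functions with values in the complexified Lie algebra. -/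
def IsLieC (G : Subgroup (Matrix.unitaryGroup (Fin n) ℂ)) (p : D1 n × D1 n) : Prop :=
  (∀ t, p.1.ev t ∈ lieC G) ∧ ∀ t, p.2.ev t ∈ lieC G

theorem D2.exp_dot (f : D2 n) (t : U) : (D2.exp f).dot t =
    fderiv ℝ (NormedSpace.exp : Mat n → Mat n) (f.ev t) (f.dot t) := by
  have h1 := (D2.incl (D2.exp f)).isDeriv t
  have hd : DifferentiableAt ℝ (NormedSpace.exp : Mat n → Mat n) (f.ev t) :=
    (NahmSchmid.contDiff_exp (m := 1)).contDiffAt.differentiableAt one_ne_zero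
  have h2 := (D2.incl f).isDeriv t
  have e : NahmSchmid.ext (E := Mat n) (D1.val (D2.incl f)) (t : ℝ) = f.ev t :=
    ext_coe (E := Mat n) (D1.val (D2.incl f)) t
  have h3 : HasFDerivAt (NormedSpace.exp : Mat n → Mat n)
      (fderiv ℝ (NormedSpace.exp : Mat n → Mat n) (f.ev t))
      (NahmSchmid.ext (E := Mat n) (D1.val (D2.incl f)) (t : ℝ)) := by
    rw [e]; exact hd.hasFDerivAt
  have h4 := h3.comp_hasDerivWithinAt (t : ℝ) h2
  have h5 : (NormedSpace.exp : Mat n → Mat n) ∘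
      NahmSchmid.ext (E := Mat n) (D1.val (D2.incl f)) =
      NahmSchmid.ext (E := Mat n) (D1.val (D2.incl (D2.exp f))) :=
    funext fun s => (D2.exp_ev f _).symm
  rw [h5] at h4
  exact (uniqueDiffOn_Icc_zero_one t t.2).eq_deriv _ h1 h4

theorem isGaugeTransform_gaugeAct {E F : D2 n} (h : ∀ t, E.ev t * F.ev t = 1) (p : D1 n × D1 n) :
    IsGaugeTransform E p.1 p.2 (gaugeAct E F p).1 (gaugeAct E F p).2 := by
  intro t
  have e : (C2.ev E t)⁻¹ = F.ev t := Matrix.inv_eq_right_inv (h t)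
  rw [e]
  exact ⟨rfl, rfl⟩

theorem expI_ev_mul_neg (X : D2 n) (t : U) : (expI X).ev t * (expI (-X)).ev t = 1 := by
  simp [exp_mul_exp_neg]

theorem actI_isLieC (hG : IsClosed (G : Set (Matrix.unitaryGroup (Fin n) ℂ))) {X : D2 n}
    (hX : ∀ t, X.ev t ∈ lie G) {p : D1 n × D1 n} (hp : IsLieC G p) : IsLieC G (actI X p) := by
  have h1 (t) {W : Mat n} (hW : W ∈ lieC G) :
      (expI X).ev t * W * (expI (-X)).ev t ∈ lieC G := by
    have := exp_conj_mem_lieC hG (I_smul_mem_lieC (hX t)) hW 1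
    simpa using this
  refine ⟨fun t => ?_, fun t => h1 t (hp.2 t)⟩
  have h2 : (expI X).dot t * (expI (-X)).ev t ∈ lieC G := by
    have := fderiv_exp_mul_mem_lieC hG (I_smul_mem_lieC (hX t))
      (I_smul_mem_lieC (X.dot_mem_lie hG hX t))
    have e : (expI X).dot t = fderiv ℝ (NormedSpace.exp : Mat n → Mat n) (Complex.I • X.ev t)
      (Complex.I • X.dot t) := D2.exp_dot _ t
    rw [e]
    simpa using this
  exact (lieCSub hG).sub_mem (h1 t (hp.1 t)) h2

/-- The left hand side of the real equation is hermitian and 𝔤ᶜ-valued, hence i times an element of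
𝔤; the factor i/2 brings it into 𝔤. -/
theorem momentI_ev_mem_lie (hG : IsClosed (G : Set (Matrix.unitaryGroup (Fin n) ℂ))) {X : D2 n}
    (hX : ∀ t, X.ev t ∈ lie G) {p : D1 n × D1 n} (hp : IsLieC G p) (t : U) :
    (momentI X p).ev t ∈ lie G := by
  have hq := actI_isLieC hG hX hp
  have hm : (moment (actI X p)).ev t ∈ lieC G := by
    rw [moment_ev]
    have hd := D1.dot_mem_lieC hG _ hq.1 t
    exact (lieCSub hG).sub_mem ((lieCSub hG).add_mem ((lieCSub hG).add_mem hd (star_mem_lieC hd))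
      (lie_mem_lieC hG (hq.1 t) (star_mem_lieC (hq.1 t))))
      (lie_mem_lieC hG (hq.2 t) (star_mem_lieC (hq.2 t)))
  have hs : star ((moment (actI X p)).ev t) = (moment (actI X p)).ev t := by
    rw [moment_ev]
    simp only [Ring.lie_def, star_sub, star_add, star_mul, star_star]
    abel
  have h2 : (momentI X p).ev t = (-(1 / 2) : ℝ) • imPart ((moment (actI X p)).ev t) := by
    change (Complex.I / 2) • (moment (actI X p)).ev t = _
    rw [imPart, hs, ← two_smul ℂ ((moment (actI X p)).ev t), smul_smul,
      ← Complex.coe_smul, smul_smul]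
    congr 1
    push_cast
    ring
  rw [h2]
  exact smul_mem_lie _ (mem_lieC_iff.1 hm).2

theorem momentI_eq_zero_iff {X : D2 n} {p : D1 n × D1 n} :
    momentI X p = 0 ↔ moment (actI X p) = 0 := by
  constructor
  · intro h
    refine D0.ext fun t => ?_
    have h1 : (Complex.I / 2) • (moment (actI X p)).ev t = 0 :=
      congrArg (fun f : D0 n => f.ev t) h
    exact (smul_eq_zero.1 h1).resolve_left (by simp)
  · intro h
    rw [momentI, h, map_zero]

theorem moment_pairOf (hG : IsClosed (G : Set (Matrix.unitaryGroup (Fin n) ℂ))) {T : Quad n}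
    (hT : T ∈ solutions G) : moment (pairOf T) = 0 := by
  refine D0.ext fun t => ?_
  have hs (i) : star ((T i).ev t) = -(T i).ev t := star_of_mem_lie (hT.1 i t)
  have hd (i) : star ((T i).dot t) = -(T i).dot t :=
    star_of_mem_lie (D1.dot_mem_lie hG (T i) (hT.1 i) t)
  have h1 := (hT.2 t).1
  have h2 : (T 1).dot t = -⁅(T 0).ev t, (T 1).ev t⁆ - ⁅(T 2).ev t, (T 3).ev t⁆ := by
    rw [eq_sub_iff_add_eq, ← sub_eq_zero] at *
    rw [← h1]; abel
  rw [moment_ev, pairOf_fst_dot, pairOf_fst_ev, pairOf_snd_ev, D0.ev_zero]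
  simp only [star_add, star_sub, star_smul, hs, hd, Complex.star_def, Complex.conj_I]
  rw [h2]
  simp only [Ring.lie_def, mul_sub, sub_mul, mul_add, add_mul, smul_mul_assoc,
    mul_smul_comm, neg_mul, mul_neg, neg_smul, smul_neg, neg_neg, smul_sub, smul_add, smul_smul]
  match_scalars <;> ring_nf

theorem isLieC_pairOf {T : Quad n} (hG : IsClosed (G : Set (Matrix.unitaryGroup (Fin n) ℂ)))
    (hT : T ∈ configs G) : IsLieC G (pairOf T) :=
  ⟨fun t => (lieCSub hG).sub_mem (lie_subset_lieC (hT 0 t)) (I_smul_mem_lieC (hT 1 t)),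
    fun t => (lieCSub hG).add_mem (lie_subset_lieC (hT 2 t)) (I_smul_mem_lieC (hT 3 t))⟩

/-! ### Solving the real equation near a nondegenerate solution -/

/-- The real equation for `exp(iX).p`, made elliptic by a projection `π` onto the Lie algebra. -/
def realMap (π : Mat n →L[ℝ] Mat n) (q : (D1 n × D1 n) × D2z n) : D0 n :=
  D0.map π (momentI (D2.map π q.2) q.1) + (D2.der2 (q.2 : D2 n) - D0.map π (D2.der2 (q.2 : D2 n)))

theorem contDiff_realMap (π : Mat n →L[ℝ] Mat n) : ContDiff ℝ ω (realMap π) := by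
  have h1 : ContDiff ℝ ω fun q : (D1 n × D1 n) × D2z n => (q.2 : D2 n) :=
    (D2z n).subtypeL.contDiff.comp contDiff_snd
  have h2 := (D2.der2 (n := n)).contDiff.comp h1
  exact ((D0.map π).contDiff.comp (contDiff_momentI ((D2.map π).contDiff.comp h1)
    contDiff_fst)).add (h2.sub ((D0.map π).contDiff.comp h2))

/-- The derivative acts as π ∘ `jacobi` on the 𝔤-part πX and as X'' on the rest, so that the Banach
space of all matrix-valued functions can be used in place of the 𝔤-valued ones. A kernel element is
𝔤-valued and killed by `jacobi`, hence zero off the degeneracy locus; surjectivity is then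
`exists_bvp`. -/
theorem isInvertible_fderiv_realMap (hG : IsClosed (G : Set (Matrix.unitaryGroup (Fin n) ℂ)))
    (hB : IsInvariantInner G B) {T : Quad n} (hT : T ∈ solutions G)
    (hD : T ∉ degeneracyLocus G B) {π : Mat n →L[ℝ] Mat n} (hπ : ∀ X, π X ∈ lie G)
    (hπ' : ∀ X ∈ lie G, π X = X) :
    (fderiv ℝ (realMap π) (pairOf T, 0) ∘L .inr ℝ (D1 n × D1 n) (D2z n)).IsInvertible := by
  set Λ := fderiv ℝ (realMap π) (pairOf T, 0) ∘L .inr ℝ (D1 n × D1 n) (D2z n) with hΛ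
  let A₀ : D0 n →L[ℝ] D0 n := D0.map π ∘L (jacobi₀ T ∘L D0.map π)
  let A₁ : D0 n →L[ℝ] D0 n := D0.map π ∘L (jacobi₁ T ∘L D0.map π)
  have hππ (X) : π (π X) = π X := hπ' _ (hπ X)
  have key (X : D2z n) : Λ X = D0.map π (jacobi T (D2.map π X)) +
      (D2.der2 (X : D2 n) - D0.map π (D2.der2 (X : D2 n))) := by
    obtain ⟨L, hL, hLX⟩ := hasFDerivAt_momentI hG hT.1
    have hsub := (D2z n).subtypeL.hasFDerivAt (x := (0 : D2z n))
    have hmap := (D2.map π).hasFDerivAt.comp (0 : D2z n) hsub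
    have e0 : ((⇑(D2.map π)) ∘ ⇑(D2z n).subtypeL) 0 = 0 := map_zero ((D2.map π).comp (D2z n).subtypeL)
    rw [← e0] at hL
    have hd2 := (D2.der2 (n := n)).hasFDerivAt.comp (0 : D2z n) hsub
    have h1 := ((D0.map π).hasFDerivAt.comp (0 : D2z n) (hL.comp (0 : D2z n) hmap)).add
      (hd2.sub ((D0.map π).hasFDerivAt.comp (0 : D2z n) hd2))
    have h2 : HasFDerivAt (realMap π) _ (pairOf T, (0 : D2z n)) :=
      ((contDiff_realMap π).contDiffAt.differentiableAt (by simp)).hasFDerivAt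
    have h3 := h2.comp (0 : D2z n) (hasFDerivAt_prodMk_right (pairOf T) (0 : D2z n))
    have h4 := congrArg (fun L : D2z n →L[ℝ] D0 n => L X) (h3.unique h1)
    rw [← hLX _ (fun t => hπ _)]
    exact h4
  -- The two second order terms πX'' and X'' - πX'' add up to X'', which puts Λ in the form required
  -- by `exists_bvp`.
  have key2 (X : D2z n) : Λ X = D2.der2 (X : D2 n) + A₁ (D2.der1 (X : D2 n)) +
      A₀ (D2.val (X : D2 n)) := by
    rw [key, jacobi]
    refine D0.ext fun t => ?_
    change π (π ((X : D2 n).ddot t) + (jacobi₁ T (D0.map π (D2.der1 X))).ev t +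
      (jacobi₀ T (D0.map π (D2.val X))).ev t) + ((X : D2 n).ddot t - π ((X : D2 n).ddot t)) =
      (X : D2 n).ddot t + π ((jacobi₁ T (D0.map π (D2.der1 X))).ev t) +
      π ((jacobi₀ T (D0.map π (D2.val X))).ev t)
    rw [map_add, map_add, hππ]
    abel
  have hinj (X : D2z n) (h : Λ X = 0) : X = 0 := by
    rw [key] at h
    -- Since `jacobi` of πX is 𝔤-valued and π annihilates X'' - πX'', applying π makes the two
    -- summands vanish separately. Then X - πX is affine in t and zero at both ends.
    have h1 : D2.der2 (X : D2 n) - D0.map π (D2.der2 (X : D2 n)) = 0 ∧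
        jacobi T (D2.map π X) = 0 := by
      have hj (t) := jacobi_mem_lie hG hT.1 (X := D2.map π X) (fun t => hπ _) t
      have hp (t) : (jacobi T (D2.map π X)).ev t = 0 := by
        have h2 := congrArg (fun f : D0 n => π (f.ev t)) h
        change π (π ((jacobi T (D2.map π X)).ev t) + ((X : D2 n).ddot t - π ((X : D2 n).ddot t)))
          = π 0 at h2
        rw [map_add, map_sub, hππ, hππ, sub_self, add_zero, map_zero, hπ' _ (hj t)] at h2
        exact h2
      have hp' : jacobi T (D2.map π X) = 0 := D0.ext hp
      refine ⟨?_, hp'⟩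
      rwa [hp', map_zero, zero_add] at h
    have h2 : (X : D2 n) - D2.map π X = 0 := by
      refine D2.eq_zero_of_der2_eq_zero ((D2z n).sub_mem X.2 ?_) h1.1
      exact mem_D2z.2 ⟨by rw [D2.map_ev, (mem_D2z.1 X.2).1, map_zero],
        by rw [D2.map_ev, (mem_D2z.1 X.2).2, map_zero]⟩
    have h3 : (X : D2 n) = D2.map π X := sub_eq_zero.1 h2
    rw [← h3] at h1
    refine Subtype.ext (eq_zero_of_jacobi_eq_zero hG hB hT hD ⟨fun t => ?_, X.2⟩ h1.2)
    change (X : D2 n).ev t ∈ _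
    rw [h3]
    exact hπ _
  have hsurj : Function.Surjective Λ := by
    obtain ⟨C₀, hC₀, h₀⟩ := (IsPointwiseBounded.map π).comp
      ((isPointwiseBounded_jacobi₀ T).comp (.map π))
    obtain ⟨C₁, hC₁, h₁⟩ := (IsPointwiseBounded.map π).comp
      ((isPointwiseBounded_jacobi₁ T).comp (.map π))
    intro f
    obtain ⟨X, hX0, hX1, hX⟩ := exists_bvp (A₀ := A₀) (A₁ := A₁) (le_max_of_le_left (c := C₁) hC₀)
      (fun z t => (h₀ z t).trans (mul_le_mul_of_nonneg_right (le_max_left _ _) (norm_nonneg _)))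
      (fun z t => (h₁ z t).trans (mul_le_mul_of_nonneg_right (le_max_right _ _) (norm_nonneg _)))
      (fun X h0 h1 h => congrArg Subtype.val
        (hinj ⟨X, mem_D2z.2 ⟨h0, h1⟩⟩ ((key2 ⟨X, mem_D2z.2 ⟨h0, h1⟩⟩).trans h))) f
    exact ⟨⟨X, mem_D2z.2 ⟨hX0, hX1⟩⟩, (key2 _).trans hX⟩
  have hinj' : Function.Injective Λ := (injective_iff_map_eq_zero Λ).2 hinj
  exact ⟨ContinuousLinearEquiv.ofBijective Λ (LinearMap.ker_eq_bot.2 hinj')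
    (LinearMap.range_eq_top.2 hsurj), ContinuousLinearEquiv.coe_ofBijective Λ _ _⟩

/-- Near a nondegenerate solution the real equation can be solved uniquely by a small `exp(iX)`,
which depends analytically on the data. -/
theorem exists_slice (hG : IsClosed (G : Set (Matrix.unitaryGroup (Fin n) ℂ)))
    (hB : IsInvariantInner G B) {T : Quad n} (hT : T ∈ solutions G)
    (hD : T ∉ degeneracyLocus G B) :
    ∃ ψ : D1 n × D1 n → D2 n, ContDiffAt ℝ ω ψ (pairOf T) ∧ ψ (pairOf T) = 0 ∧
      (∀ᶠ p in 𝓝 (pairOf T), IsLieC G p → ψ p ∈ lieGauge G ∧ moment (actI (ψ p) p) = 0) ∧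
      ∀ᶠ q : (D1 n × D1 n) × D2 n in 𝓝 (pairOf T, 0), q.2 ∈ lieGauge G →
        moment (actI q.2 q.1) = 0 → ψ q.1 = q.2 := by
  obtain ⟨π, hπ, hπ'⟩ := exists_proj (lieSub hG)
  have hππ (X) : π (π X) = π X := hπ' _ (hπ X)
  have hc : ContDiffAt ℝ ω (realMap π) (pairOf T, (0 : D2z n)) := (contDiff_realMap π).contDiffAt
  have hi := isInvertible_fderiv_realMap hG hB hT hD hπ hπ'
  have hω : (ω : WithTop ℕ∞) ≠ 0 := by simp
  have h0 : realMap π (pairOf T, (0 : D2z n)) = 0 := by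
    have h1 : momentI (0 : D2 n) (pairOf T) = 0 := by
      rw [momentI_eq_zero_iff, actI_zero, moment_pairOf hG hT]
    simp [realMap, h1]
  let φ := hc.implicitFunction hω hi
  have hmap {X : D2 n} (hX : ∀ t, X.ev t ∈ lie G) : D2.map π X = X :=
    D2.ext fun t => hπ' _ (hX t)
  refine ⟨fun p => φ p, ?_, ?_, ?_, ?_⟩
  · exact (D2z n).subtypeL.contDiff.contDiffAt.comp _ (hc.contDiffAt_implicitFunction hω hi)
  · exact congrArg Subtype.val (hc.implicitFunction_apply_self hω hi)
  · filter_upwards [hc.eventually_apply_implicitFunction hω hi] with p hp hlie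
    change realMap π (p, φ p) = realMap π (pairOf T, (0 : D2z n)) at hp
    rw [h0] at hp
    set X : D2 n := (φ p : D2 n) with hX
    -- As in the linear case, π separates the equation: the 𝔤-valued term is the real equation for
    -- πX, and the other term forces X = πX.
    have hm (t) := momentI_ev_mem_lie hG (X := D2.map π X) (fun t => hπ _) hlie t
    have hz : momentI (D2.map π X) p = 0 := D0.ext fun t => by
      have h2 := congrArg (fun f : D0 n => π (f.ev t)) hp
      change π (π ((momentI (D2.map π X) p).ev t) + (X.ddot t - π (X.ddot t))) = π 0 at h2
      rw [map_add, map_sub, hππ, hππ, sub_self, add_zero, map_zero, hπ' _ (hm t)] at h2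
      exact h2
    have h1 : D2.der2 X - D0.map π (D2.der2 X) = 0 := by
      rw [realMap, ← hX, hz, map_zero, zero_add] at hp
      exact hp
    have hXz : X ∈ D2z n := (φ p).2
    have h2 : X - D2.map π X = 0 := by
      refine D2.eq_zero_of_der2_eq_zero ((D2z n).sub_mem hXz ?_) h1
      exact mem_D2z.2 ⟨by rw [D2.map_ev, (mem_D2z.1 hXz).1, map_zero],
        by rw [D2.map_ev, (mem_D2z.1 hXz).2, map_zero]⟩
    have h3 : X = D2.map π X := sub_eq_zero.1 h2
    rw [← h3, momentI_eq_zero_iff] at hz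
    refine ⟨⟨fun t => ?_, hXz⟩, hz⟩
    change X.ev t ∈ _
    rw [h3]
    exact hπ _
  · have h1 := hc.eventually_apply_eq_iff_implicitFunction hω hi
    -- The implicit function theorem is local in the functions vanishing at the ends; since these
    -- carry the subspace topology, its neighbourhood comes from one in the whole C² space.
    have hind : IsInducing (Prod.map id Subtype.val :
        (D1 n × D1 n) × D2z n → (D1 n × D1 n) × D2 n) := .prodMap .id .subtypeVal
    rw [hind.nhds_eq_comap, eventually_comap] at h1
    refine (h1 : ∀ᶠ q in 𝓝 (pairOf T, (0 : D2 n)), _).mono fun q hq hX hm => ?_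
    have h2 := hq (q.1, ⟨q.2, hX.2⟩) rfl
    refine congrArg Subtype.val (h2.1 ?_)
    have h3 : D2.map π q.2 = q.2 := hmap hX.1
    rw [h0, realMap, h3, momentI_eq_zero_iff.2 hm, map_zero, zero_add]
    refine D0.ext fun t => ?_
    change q.2.ddot t - π (q.2.ddot t) = 0
    rw [hπ' _ (q.2.ddot_mem_lie hG hX.1 t), sub_self]

end

section

variable {G : Subgroup (Matrix.unitaryGroup (Fin n) ℂ)} {B : LinearMap.BilinForm ℝ (Mat n)}

/-! ### The local slice theorem -/

theorem D1.norm_le_c1norm (p : D1 n) : ‖p‖ ≤ c1norm p :=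
  max_le (le_add_of_nonneg_right (norm_nonneg _)) (le_add_of_nonneg_left (norm_nonneg _))

theorem D2.norm_sub_one_le (u : D2 n) : ‖u - D2.one‖ ≤ c2distOne u := by
  have h1 (t : U) : ‖u.ev t - 1‖ ≤ ‖u.toProd.1 - 1‖ :=
    ContinuousMap.norm_coe_le_norm (u.toProd.1 - 1) t
  have h2 (t : U) : ‖u.dot t‖ ≤ ‖u.toProd.2.1‖ := ContinuousMap.norm_coe_le_norm u.toProd.2.1 t
  have h3 (t : U) : ‖u.ddot t‖ ≤ ‖u.toProd.2.2‖ := ContinuousMap.norm_coe_le_norm u.toProd.2.2 t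
  have e1 := norm_nonneg (u.toProd.1 - 1)
  have e2 := norm_nonneg u.toProd.2.1
  have e3 := norm_nonneg u.toProd.2.2
  change _ ≤ ‖u.toProd.1 - 1‖ + ‖u.toProd.2.1‖ + ‖u.toProd.2.2‖
  refine D2.norm_le (add_nonneg (add_nonneg e1 e2) e3) (fun t => ?_) (fun t => ?_) fun t => ?_
  · exact (h1 t).trans (by linarith)
  · rw [D2.dot_sub, D2.one_dot, sub_zero]
    exact (h2 t).trans (by linarith)
  · have : (u - D2.one).ddot t = u.ddot t - 0 := rfl
    rw [this, sub_zero]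
    exact (h3 t).trans (by linarith)

theorem D2.dist_one_lt {u : D2 n} {r : ℝ} (h : c2distOne u < r) : dist u D2.one < r := by
  rw [dist_eq_norm]
  exact u.norm_sub_one_le.trans_lt h

theorem D2.c2distOne_le (u : D2 n) : c2distOne u ≤ 3 * ‖u - D2.one‖ := by
  have h1 : ‖u.toProd.1 - 1‖ ≤ ‖u - D2.one‖ :=
    (ContinuousMap.norm_le _ (norm_nonneg _)).2 fun t => (u - D2.one).norm_ev_le t
  have h2 : ‖u.toProd.2.1‖ ≤ ‖u - D2.one‖ := (ContinuousMap.norm_le _ (norm_nonneg _)).2 fun t => by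
    have := (u - D2.one).norm_dot_le t
    rwa [D2.dot_sub, D2.one_dot, sub_zero] at this
  have h3 : ‖u.toProd.2.2‖ ≤ ‖u - D2.one‖ := (ContinuousMap.norm_le _ (norm_nonneg _)).2 fun t => by
    have := (u - D2.one).norm_ddot_le t
    have e : (u - D2.one).ddot t = u.ddot t - 0 := rfl
    rwa [e, sub_zero] at this
  change ‖u.toProd.1 - 1‖ + ‖u.toProd.2.1‖ + ‖u.toProd.2.2‖ ≤ _
  linarith

/-- A self-adjoint complex gauge transformation near the identity is of the form `exp(iX)`. -/
theorem eventually_eq_expI {ρ : ℝ} (hρ : 0 < ρ) : ∀ᶠ u : D2 n in 𝓝 D2.one, u ∈ gaugeC G →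
    (∀ t, IsSelfAdjoint (u.ev t)) → ∃ X : D2 n, X ∈ lieGauge G ∧ ‖X‖ < ρ ∧ u = expI X := by
  have hs : HasStrictFDerivAt (D2.exp : D2 n → D2 n)
      ((ContinuousLinearEquiv.refl ℝ (D2 n) : D2 n ≃L[ℝ] D2 n) : D2 n →L[ℝ] D2 n) 0 :=
    D2.contDiff_exp.contDiffAt.hasStrictFDerivAt' D2.hasFDerivAt_exp_zero one_ne_zero
  let e := hs.localInverse D2.exp _ 0
  have he0 : e D2.one = 0 := by
    have := hs.localInverse_apply_image
    rwa [D2.exp_zero] at this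
  have hec : Tendsto e (𝓝 D2.one) (𝓝 0) := by
    have := hs.localInverse_continuousAt
    rw [D2.exp_zero, ContinuousAt] at this
    rwa [← he0]
  have hinv : ∀ᶠ u in 𝓝 D2.one, D2.exp (e u) = u := by
    have := hs.eventually_right_inverse
    rwa [D2.exp_zero] at this
  obtain ⟨r₁, hr₁, h₁⟩ := Metric.eventually_nhds_iff.1 (eventually_logOne_exp (n := n))
  obtain ⟨r₂, hr₂, h₂⟩ := Metric.eventually_nhds_iff.1 (eventually_logOne_of_mem_groupC (G := G))
  have hX : Tendsto (fun u => D2.map (smulM (-Complex.I)) (e u)) (𝓝 D2.one) (𝓝 0) := by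
    have := ((D2.map (smulM (n := n) (-Complex.I))).continuous.tendsto 0).comp hec
    rwa [map_zero] at this
  filter_upwards [hinv, Metric.tendsto_nhds.1 hec r₁ hr₁, Metric.ball_mem_nhds _ hr₂,
    Metric.tendsto_nhds.1 hX ρ hρ] with u hu he hur hXu hg hsa
  -- The inverse e of the exponential on the Banach space provides C² regularity and C² smallness.
  -- Both logarithms are near 0, so e(u) is the matrix logarithm at each t, and the pointwise result
  -- on self-adjoint elements of Gᶜ applies.
  have hlog (t : U) : (e u).ev t = logOne (u.ev t) := by
    have h3 : u.ev t = NormedSpace.exp ((e u).ev t) := by rw [← D2.exp_ev, hu]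
    rw [h3]
    refine (h₁ ?_).symm
    rw [dist_zero_right] at he ⊢
    exact ((e u).norm_ev_le t).trans_lt he
  have hXt (t : U) : ∃ X ∈ lie G, (e u).ev t = Complex.I • X := by
    have h4 : dist (u.ev t) 1 < r₂ := by
      rw [mem_ball, dist_eq_norm] at hur
      rw [dist_eq_norm]
      exact ((u - D2.one).norm_ev_le t).trans_lt hur
    obtain ⟨X, hX, hX', -⟩ := h₂ h4 (hsa t) (hg.1 t)
    exact ⟨X, hX, (hlog t).trans hX'⟩
  refine ⟨D2.map (smulM (-Complex.I)) (e u), ⟨fun t => ?_, ?_, ?_⟩, by rwa [dist_zero_right] at hXu,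
    ?_⟩
  · obtain ⟨X, hX, h⟩ := hXt t
    change (-Complex.I) • (e u).ev t ∈ lie G
    rw [h, smul_smul]
    simpa using hX
  · change (-Complex.I) • (e u).ev 0 = 0
    have : u.ev 0 = 1 := hg.2.1
    rw [hlog, this, logOne_one, smul_zero]
  · change (-Complex.I) • (e u).ev 1 = 0
    have : u.ev 1 = 1 := hg.2.2
    rw [hlog, this, logOne_one, smul_zero]
  · rw [expI]
    have : D2.map (smulM Complex.I) (D2.map (smulM (-Complex.I)) (e u)) = e u :=
      D2.ext fun t => by simp [smul_smul]
    rw [this, hu]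

theorem expI_mem_gaugeC {X : D2 n} (hX : X ∈ lieGauge G) : expI X ∈ gaugeC G := by
  obtain ⟨h, h0, h1⟩ := hX
  replace h0 : X.ev 0 = 0 := h0
  replace h1 : X.ev 1 = 0 := h1
  refine ⟨fun t => ?_, ?_, ?_⟩
  · change (expI X).ev t ∈ _
    rw [expI_ev]
    exact exp_I_mem_groupC (h t)
  · change (expI X).ev 0 = 1
    rw [expI_ev, h0, smul_zero, NormedSpace.exp_zero]
  · change (expI X).ev 1 = 1
    rw [expI_ev, h1, smul_zero, NormedSpace.exp_zero]

theorem isSelfAdjoint_expI {X : D2 n} (hX : ∀ t, X.ev t ∈ lie G) (t : U) :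
    IsSelfAdjoint ((expI X).ev t) := by
  rw [expI_ev]
  exact (isSelfAdjoint_I_smul (star_of_mem_lie (hX t))).exp

theorem isGaugeTransform_unique {u : C2 n} {a b a' b' a'' b'' : C1 n}
    (h : IsGaugeTransform u a b a' b') (h' : IsGaugeTransform u a b a'' b'') :
    a' = a'' ∧ b' = b'' :=
  ⟨D1.ext fun t => (h t).1.trans (h' t).1.symm, D1.ext fun t => (h t).2.trans (h' t).2.symm⟩

/-- Existence is exp(iψ), which is C²-close to 1 by continuity of ψ. For uniqueness, a competitor
within δ₀ of 1 is exp(iX) with X small enough to lie in the uniqueness neighbourhood of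
`exists_slice`. Hence δ₀ depends only on that neighbourhood, and ε is chosen after δ. -/
theorem exists_unique_gauge (hG : IsClosed (G : Set (Matrix.unitaryGroup (Fin n) ℂ)))
    (hB : IsInvariantInner G B) {T : Quad n} (hT : T ∈ solutions G)
    (hD : T ∉ degeneracyLocus G B) :
    ∃ δ₀ : ℝ, 0 < δ₀ ∧ ∀ δ : ℝ, 0 < δ → δ ≤ δ₀ → ∃ ε : ℝ, 0 < ε ∧
      ∀ a b : C1 n, (∀ t, a.ev t ∈ lieC G) → (∀ t, b.ev t ∈ lieC G) → ComplexEq a b →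
        c1norm (a - alpha T) + c1norm (b - beta T) < ε →
        ∃! u : C2 n, u ∈ gaugeC G ∧ c2distOne u < δ ∧ (∀ t, IsSelfAdjoint (u.ev t)) ∧
          ∃ a' b' : C1 n, IsGaugeTransform u a b a' b' ∧ RealEq a' b' := by
  obtain ⟨ψ, hψ, hψ0, hsol, huniq⟩ := exists_slice hG hB hT hD
  obtain ⟨ρ, hρ, huniq⟩ := Metric.eventually_nhds_iff.1 huniq
  obtain ⟨r, hr, hexp⟩ := Metric.eventually_nhds_iff.1 (eventually_eq_expI (G := G) hρ)
  refine ⟨r, hr, fun δ hδ hδr => ?_⟩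
  have hcont : Tendsto (fun p => ‖expI (ψ p) - D2.one‖) (𝓝 (pairOf T)) (𝓝 0) := by
    have h1 : ContinuousAt (fun p => expI (ψ p)) (pairOf T) :=
      (contDiff_expI.continuous.continuousAt).comp hψ.continuousAt
    have h2 := (h1.sub (continuousAt_const (y := D2.one))).norm
    simpa [ContinuousAt, hψ0, expI_zero] using h2
  -- The bound δ/3 pays for the factor 3 between `c2distOne`, a sum of three sup norms, and the
  -- maximum norm.
  obtain ⟨ε, hε, h⟩ := Metric.eventually_nhds_iff.1 ((hsol.and
    (Metric.ball_mem_nhds (pairOf T) hρ)).and (hcont.eventually (gt_mem_nhds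
      (by positivity : 0 < δ / 3))))
  refine ⟨ε, hε, fun a b ha hb _ hab => ?_⟩
  let p : D1 n × D1 n := (a, b)
  have hp : dist p (pairOf T) < ε := by
    rw [dist_eq_norm]
    refine lt_of_le_of_lt (max_le ?_ ?_) hab
    · exact (D1.norm_le_c1norm _).trans (le_add_of_nonneg_right
        (add_nonneg (norm_nonneg _) (norm_nonneg _)))
    · exact (D1.norm_le_c1norm _).trans (le_add_of_nonneg_left
        (add_nonneg (norm_nonneg _) (norm_nonneg _)))
  obtain ⟨⟨hsol, hpρ⟩, hdist⟩ := h hp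
  obtain ⟨hX, hm⟩ := hsol ⟨ha, hb⟩
  refine ⟨expI (ψ p), ⟨expI_mem_gaugeC hX, ?_, isSelfAdjoint_expI hX.1, (actI (ψ p) p).1,
    (actI (ψ p) p).2, isGaugeTransform_gaugeAct (expI_ev_mul_neg _) p, moment_eq_zero_iff.1 hm⟩, ?_⟩
  · exact (D2.c2distOne_le _).trans_lt (by linarith)
  · rintro u ⟨hu, hud, hsa, a', b', hg, hre⟩
    have h1 := D2.dist_one_lt (u := u) (hud.trans_le hδr)
    obtain ⟨X, hXl, hXρ, rfl⟩ := hexp h1 hu hsa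
    obtain ⟨rfl, rfl⟩ := isGaugeTransform_unique hg
      (isGaugeTransform_gaugeAct (expI_ev_mul_neg X) p)
    have h2 : dist ((p, X) : (D1 n × D1 n) × D2 n) (pairOf T, 0) < ρ := by
      rw [Prod.dist_eq]
      exact max_lt hpρ (by rwa [dist_zero_right])
    have h3 := huniq h2 hXl (moment_eq_zero_iff.2 hre)
    exact congrArg expI h3.symm

end

section

variable {G : Subgroup (Matrix.unitaryGroup (Fin n) ℂ)} {B : LinearMap.BilinForm ℝ (Mat n)}

/-! ### The parallel transport of `α` and the map to the cotangent bundle -/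

theorem IsDeriv.map (φ : Mat n →L[ℝ] Mat n) {f f' : D0 n} (h : IsDeriv f f') :
    IsDeriv (D0.map φ f) (D0.map φ f') := (D1.map φ (D1.mk f f' h)).isDeriv

theorem IsDeriv.mul' {f f' g g' : D0 n} (hf : IsDeriv f f') (hg : IsDeriv g g') {h h' : D0 n}
    (e : ∀ t, h.ev t = f.ev t * g.ev t) (e' : ∀ t, h'.ev t = f'.ev t * g.ev t + f.ev t * g'.ev t) :
    IsDeriv h h' := by
  have h1 : h = f * g := D0.ext e
  have h2 : h' = f' * g + f * g' := D0.ext e'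
  rw [h1, h2]
  exact hf.mul hg

theorem IsDeriv.eq_const {f : D0 n} (h : IsDeriv f (0 : D0 n)) (t : U) : f.ev t = f.ev 0 := by
  have h1 := congrArg (fun f : D0 n => f.ev t) (D0.isDeriv_iff.1 h)
  simpa using h1

/-- The pointwise inverse of `parallel a`. -/
def parallelInv (a : D0 n) : D0 n := D0.map starM (parallel (-D0.map starM a))

/-- Adjoints exchange right and left multiplication: the transport of -a^* solves g' = -ga^*, so its
adjoint solves w' = -aw. -/
theorem isDeriv_parallelInv (a : D0 n) : IsDeriv (parallelInv a) (-(a * parallelInv a) : D0 n) := by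
  have h := (isDeriv_parallel (-D0.map starM a)).map starM
  have e : D0.map starM (parallel (-D0.map starM a) * -D0.map starM a) =
      -(a * parallelInv a) := D0.ext fun t => by simp [parallelInv]
  rwa [e] at h

theorem parallelInv_zero (a : D0 n) : (parallelInv a).ev 0 = 1 := by
  rw [parallelInv, D0.map_ev, parallel_zero, starM_apply, star_one]

theorem parallel_mul_inv (a : D0 n) (t : U) : (parallel a).ev t * (parallelInv a).ev t = 1 := by
  have h : IsDeriv (parallel a * parallelInv a : D0 n) (0 : D0 n) :=
    (isDeriv_parallel a).mul' (isDeriv_parallelInv a) (fun t => rfl) fun t => by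
      simp [mul_assoc]
  have h1 := h.eq_const t
  rwa [D0.ev_mul, D0.ev_mul, parallel_zero, parallelInv_zero, one_mul] at h1

theorem parallelInv_mul (a : D0 n) (t : U) : (parallelInv a).ev t * (parallel a).ev t = 1 :=
  mul_eq_one_comm.1 (parallel_mul_inv a t)

theorem inv_parallel (a : D0 n) (t : U) : ((parallel a).ev t)⁻¹ = (parallelInv a).ev t :=
  Matrix.inv_eq_right_inv (parallel_mul_inv a t)

theorem D2.dot_eq_of_mul_eq_one {E F : D2 n} (h : ∀ t, E.ev t * F.ev t = 1) (t : U) :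
    F.dot t = -(F.ev t * E.dot t * F.ev t) := by
  have h1 : D2.mul E F = D2.one := D2.ext h
  have h2 : E.dot t * F.ev t + E.ev t * F.dot t = 0 := congrArg (fun u : D2 n => u.dot t) h1
  have h3 : F.ev t * E.ev t = 1 := mul_eq_one_comm.1 (h t)
  calc F.dot t = F.ev t * E.ev t * F.dot t := by rw [h3, one_mul]
    _ = F.ev t * (E.ev t * F.dot t) := mul_assoc _ _ _
    _ = _ := by rw [eq_neg_of_add_eq_zero_right h2]; simp [mul_assoc]

/-- With F = E⁻¹, the product of the old transport and F solves the transformed equation with the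
same initial value, because F' = -FE'F. -/
theorem parallel_gaugeAct {E F : D2 n} (h : ∀ t, E.ev t * F.ev t = 1) (h0 : E.ev 0 = 1)
    (p : D1 n × D1 n) (t : U) :
    (parallel (D1.val (gaugeAct E F p).1)).ev t = (parallel (D1.val p.1)).ev t * F.ev t := by
  have h' (t) : F.ev t * E.ev t = 1 := mul_eq_one_comm.1 (h t)
  have hF0 : F.ev 0 = 1 := by simpa [h0] using h 0
  have h1 : IsDeriv (parallel (D1.val p.1) * D2.val F : D0 n)
      (parallel (D1.val p.1) * D2.val F * D1.val (gaugeAct E F p).1 : D0 n) := by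
    refine (isDeriv_parallel (D1.val p.1)).mul' (D2.incl F).isDeriv (fun t => rfl) fun t => ?_
    have e : (gaugeAct E F p).1.ev t = E.ev t * p.1.ev t * F.ev t - E.dot t * F.ev t := rfl
    simp only [D0.ev_mul, D1.val_ev, D1.der_ev, D2.val_ev, D2.incl_ev, D2.incl_dot, e,
      D2.dot_eq_of_mul_eq_one h]
    have e1 : F.ev t * (E.ev t * p.1.ev t * F.ev t) = p.1.ev t * F.ev t := by
      rw [mul_assoc (E.ev t), ← mul_assoc (F.ev t), h', one_mul]
    simp only [mul_assoc, mul_sub, mul_neg] at e1 ⊢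
    rw [e1]
    abel
  rw [← eq_parallel h1 (by rw [D0.ev_mul, parallel_zero, D2.val_ev, hF0, one_mul])]
  rfl

/-- The end point data `(g(1), -β(1))`, where `g' = gα`, `g(0) = 1`. -/
def endMap (p : D1 n × D1 n) : Mat n × Mat n :=
  ((parallel (D1.val p.1)).ev 1, -p.2.ev 1)

theorem contDiff_endMap : ContDiff ℝ ω (endMap : D1 n × D1 n → Mat n × Mat n) := by
  have h1 : ContDiff ℝ ω fun p : D1 n × D1 n => D0.evL 1 (parallel (D1.val p.1)) :=
    (D0.evL 1).contDiff.comp (contDiff_parallel.comp (D1.val.contDiff.comp contDiff_fst))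
  have h2 : ContDiff ℝ ω fun p : D1 n × D1 n => D0.evL 1 (D1.val p.2) :=
    (D0.evL 1).contDiff.comp (D1.val.contDiff.comp contDiff_snd)
  exact h1.prodMk h2.neg

theorem endMap_gaugeAct {E F : D2 n} (h : ∀ t, E.ev t * F.ev t = 1) (h0 : E.ev 0 = 1)
    (h1 : E.ev 1 = 1) (p : D1 n × D1 n) : endMap (gaugeAct E F p) = endMap p := by
  have hF1 : F.ev 1 = 1 := by simpa [h1] using h 1
  refine Prod.ext ?_ ?_
  · change (parallel (D1.val (gaugeAct E F p).1)).ev 1 = (parallel (D1.val p.1)).ev 1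
    rw [parallel_gaugeAct h h0, hF1, mul_one]
  · change -(E.ev 1 * p.2.ev 1 * F.ev 1) = -p.2.ev 1
    rw [h1, hF1, one_mul, mul_one]

theorem pair_eq_gaugeAct {E F : D2 n} (h : ∀ t, E.ev t * F.ev t = 1) {a b a' b' : C1 n}
    (hg : IsGaugeTransform E a b a' b') : ((a', b') : D1 n × D1 n) = gaugeAct E F (a, b) := by
  obtain ⟨h1, h2⟩ := isGaugeTransform_unique hg (isGaugeTransform_gaugeAct h (a, b))
  exact Prod.ext h1 h2

/-- Unitary gauge transformations act on pairs. -/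
theorem pairOf_eq_gaugeAct {T T' : solutions G} (h : SameOrbit G T T') :
    ∃ E ∈ gauge G, (∀ t, E.ev t ∈ gset G) ∧ (∀ t, E.ev t * (D2.map starM E).ev t = 1) ∧
      pairOf T'.1 = gaugeAct E (D2.map starM E) (pairOf T.1) := by
  obtain ⟨u, hu, h⟩ := h
  have hm (t) : u.ev t ∈ gset G := by
    obtain ⟨k, hk, hk'⟩ := hu.1 t
    exact ⟨k, hk, hk'⟩
  have hinv (t) : D2.ev u t * (D2.map starM u).ev t = 1 := mul_star_of_mem (hm t)
  refine ⟨u, hu, hm, hinv, ?_⟩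
  refine pair_eq_gaugeAct hinv fun t => ⟨?_, ?_⟩
  · change (T'.1 0).ev t - Complex.I • (T'.1 1).ev t = u.ev t * ((T.1 0).ev t -
      Complex.I • (T.1 1).ev t) * (u.ev t)⁻¹ - u.dot t * (u.ev t)⁻¹
    rw [(h t).1, (h t).2 1 one_ne_zero, mul_sub, sub_mul, mul_smul_comm, smul_mul_assoc]
    abel
  · change (T'.1 2).ev t + Complex.I • (T'.1 3).ev t = u.ev t * ((T.1 2).ev t +
      Complex.I • (T.1 3).ev t) * (u.ev t)⁻¹
    rw [(h t).2 2 (by decide), (h t).2 3 (by decide), mul_add, add_mul, mul_smul_comm,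
      smul_mul_assoc]

theorem endMap_eq_of_sameOrbit {T T' : solutions G} (h : SameOrbit G T T') :
    endMap (pairOf T.1) = endMap (pairOf T'.1) := by
  obtain ⟨E, hE, -, hinv, hp⟩ := pairOf_eq_gaugeAct h
  rw [hp, endMap_gaugeAct hinv hE.2.1 hE.2.2]

/-- The map `ℳ → T^*Gᶜ`. -/
def moduliMap (G : Subgroup (Matrix.unitaryGroup (Fin n) ℂ)) : Moduli G → Mat n × Mat n :=
  Quot.lift (fun T : solutions G => endMap (pairOf T.1)) fun _ _ => endMap_eq_of_sameOrbit

theorem lift_moduliMap {T : Quad n} (hT : T ∈ solutions G) :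
    NahmSchmid.lift (moduliMap G) T = endMap (pairOf T) :=
  Subtype.val_injective.extend_apply _ _ (⟨T, hT⟩ : solutions G)

/-- `pairOf` as a real linear map. -/
def pairL : (Fin 4 → D1 n) →L[ℝ] D1 n × D1 n :=
  ((ContinuousLinearMap.proj 0 : (Fin 4 → D1 n) →L[ℝ] D1 n) -
    D1.map (smulM Complex.I) ∘L (ContinuousLinearMap.proj 1 : (Fin 4 → D1 n) →L[ℝ] D1 n)).prod
  ((ContinuousLinearMap.proj 2 : (Fin 4 → D1 n) →L[ℝ] D1 n) +
    D1.map (smulM Complex.I) ∘L (ContinuousLinearMap.proj 3 : (Fin 4 → D1 n) →L[ℝ] D1 n))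

theorem contDiff_endMap_pairL : ContDiff ℝ ω fun T : Fin 4 → D1 n => endMap (pairL T) :=
  contDiff_endMap.comp (pairL (n := n)).contDiff

/-- On solutions the lift coincides with a map that is analytic on the whole Banach space of
quadruples. -/
theorem contDiffOn_lift {S : Set (Quad n)} (hS : S ⊆ solutions G) :
    ContDiffOn ℝ ∞ (NahmSchmid.lift (moduliMap G)) S :=
  ContDiffOn.congr (f := fun T : Quad n => endMap (pairOf T))
    ((contDiff_endMap_pairL (n := n)).of_le le_top).contDiffOn fun _ hT => lift_moduliMap (hS hT)

/-! ### The derivative of the map to the cotangent bundle -/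

theorem eq_of_isDeriv_mul {a f g g' : D0 n} (h : IsDeriv g (g * a + f : D0 n))
    (h' : IsDeriv g' (g' * a + f : D0 n)) (h0 : g.ev 0 = g'.ev 0) : g = g' := by
  rw [← inverse_one_sub_volterraMul a g, ← inverse_one_sub_volterraMul a g', isDeriv_mul_iff.1 h,
    isDeriv_mul_iff.1 h', h0]

/-- The derivative of `endMap ∘ pairOf`. -/
def endDeriv (T : Quad n) : (Fin 4 → D1 n) →L[ℝ] Mat n × Mat n :=
  fderiv ℝ endMap (pairOf T) ∘L pairL

theorem hasFDerivWithinAt_lift {T : Quad n} (hT : T ∈ solutions G) :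
    HasFDerivWithinAt (NahmSchmid.lift (moduliMap G)) (endDeriv T : Quad n →L[ℝ] Mat n × Mat n)
      (solutions G) T := by
  have h0 : HasFDerivAt (endMap (n := n)) (fderiv ℝ endMap (pairOf T)) (pairL (T : Fin 4 → D1 n)) :=
    (contDiff_endMap.contDiffAt.differentiableAt (by simp)).hasFDerivAt
  have h1 : HasFDerivAt (fun S : Fin 4 → D1 n => endMap (pairL S)) (endDeriv T) T :=
    h0.comp (T : Fin 4 → D1 n) (pairL (n := n)).hasFDerivAt
  exact HasFDerivWithinAt.congr (f := fun T : Quad n => endMap (pairOf T)) h1.hasFDerivWithinAt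
    (fun _ h => lift_moduliMap h) (lift_moduliMap hT)

theorem endDeriv_apply (T X : Quad n) : endDeriv T X =
    ((fderiv ℝ parallel (D1.val (pairOf T).1) (D1.val (pairOf X).1)).ev 1, -(pairOf X).2.ev 1) := by
  have h1 : HasFDerivAt (fun p : D1 n × D1 n => parallel (D1.val p.1)) _ (pairOf T) :=
    ((contDiff_parallel (n := n)).contDiffAt.differentiableAt (by simp)).hasFDerivAt.comp
      (pairOf T) ((D1.val (n := n)).hasFDerivAt.comp (pairOf T) hasFDerivAt_fst)
  have h2 := ((D0.evL (n := n) 1).hasFDerivAt.comp (pairOf T) h1).prodMk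
    (((D0.evL (n := n) 1).hasFDerivAt.comp (pairOf T) ((D1.val (n := n)).hasFDerivAt.comp
      (pairOf T) hasFDerivAt_snd)).neg)
  have h3 : fderiv ℝ endMap (pairOf T) = _ := HasFDerivAt.fderiv h2
  change fderiv ℝ endMap (pairOf T) (pairOf X) = _
  rw [h3]
  rfl

/-- I acts on (α,β) as multiplication by i, and the linearised transport equation is complex linear,
so i times a solution solves the equation for the rotated variation. -/
theorem endDeriv_strI (T X : Quad n) : endDeriv T (strI X) = Complex.I • endDeriv T X := by
  have e1 : (pairOf (strI X)).1 = D1.map (smulM Complex.I) (pairOf X).1 := D1.ext fun t => by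
    change (X 1).ev t - Complex.I • (-(X 0).ev t) =
      Complex.I • ((X 0).ev t - Complex.I • (X 1).ev t)
    simp only [smul_sub, smul_smul, Complex.I_mul_I, smul_neg, neg_smul, one_smul]
    abel
  have e2 : (pairOf (strI X)).2.ev 1 = Complex.I • (pairOf X).2.ev 1 := by
    change -(X 3).ev 1 + Complex.I • (X 2).ev 1 =
      Complex.I • ((X 2).ev 1 + Complex.I • (X 3).ev 1)
    simp only [smul_add, smul_smul, Complex.I_mul_I, neg_smul, one_smul]
    abel
  rw [endDeriv_apply, endDeriv_apply]
  refine Prod.ext ?_ ?_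
  · obtain ⟨y, hy, hy0, hyd⟩ := fderiv_parallel (D1.val (pairOf T).1) (D1.val (pairOf X).1)
    obtain ⟨z, hz, hz0, hzd⟩ := fderiv_parallel (D1.val (pairOf T).1) (D1.val (pairOf (strI X)).1)
    change (fderiv ℝ parallel _ _ : D0 n).ev 1 = Complex.I • (fderiv ℝ parallel _ _ : D0 n).ev 1
    rw [hy, hz]
    have h1 : D0.map (smulM Complex.I) y = z := by
      refine eq_of_isDeriv_mul (a := D1.val (pairOf T).1) ?_ hzd ?_
      · have h2 := hyd.map (smulM Complex.I)
        have h3 : D0.map (smulM Complex.I) (y * D1.val (pairOf T).1 +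
            parallel (D1.val (pairOf T).1) * D1.val (pairOf X).1) =
            D0.map (smulM Complex.I) y * D1.val (pairOf T).1 +
            parallel (D1.val (pairOf T).1) * D1.val (pairOf (strI X)).1 := by
          refine D0.ext fun t => ?_
          rw [e1]
          simp
        rwa [h3] at h2
      · rw [D0.map_ev, hy0, map_zero, hz0]
    rw [← h1]
    rfl
  · change -(pairOf (strI X)).2.ev 1 = Complex.I • -(pairOf X).2.ev 1
    rw [e2, smul_neg]

end

section

variable {G : Subgroup (Matrix.unitaryGroup (Fin n) ℂ)} {B : LinearMap.BilinForm ℝ (Mat n)}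

/-! ### The canonical symplectic form -/

/-- The skew-hermitian part, as a real linear map. -/
def rePartL : Mat n →ₗ[ℝ] Mat n where
  toFun := rePart
  map_add' Z W := by simp only [rePart, star_add]; module
  map_smul' c Z := by
    simp only [rePart, star_smul, star_trivial, RingHom.id_apply, ← smul_sub]
    exact smul_comm _ _ _

/-- The map `X + iY ↦ Y`, as a real linear map. -/
def imPartL : Mat n →ₗ[ℝ] Mat n where
  toFun := imPart
  map_add' Z W := by simp only [imPart, star_add]; module
  map_smul' c Z := by
    simp only [imPart, star_smul, star_trivial, RingHom.id_apply, ← smul_add]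
    exact smul_comm _ _ _

/-- The real part of `formC`. -/
def formRe (B : LinearMap.BilinForm ℝ (Mat n)) : LinearMap.BilinForm ℝ (Mat n) :=
  B.compl₁₂ rePartL rePartL - B.compl₁₂ imPartL imPartL

/-- The imaginary part of `formC`. -/
def formIm (B : LinearMap.BilinForm ℝ (Mat n)) : LinearMap.BilinForm ℝ (Mat n) :=
  B.compl₁₂ rePartL imPartL + B.compl₁₂ imPartL rePartL

theorem formRe_apply (Z W : Mat n) :
    formRe B Z W = B (rePart Z) (rePart W) - B (imPart Z) (imPart W) := rfl

theorem formIm_apply (Z W : Mat n) :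
    formIm B Z W = B (rePart Z) (imPart W) + B (imPart Z) (rePart W) := rfl

theorem formC_eq (Z W : Mat n) : formC B Z W = (formRe B Z W : ℂ) + Complex.I * formIm B Z W := rfl

/-- A real bilinear form is invariant on the complexified Lie algebra. -/
structure IsInvariantC (G : Subgroup (Matrix.unitaryGroup (Fin n) ℂ))
    (b : LinearMap.BilinForm ℝ (Mat n)) : Prop where
  lie_left : ∀ Z ∈ lieC G, ∀ W ∈ lieC G, ∀ V ∈ lieC G, b ⁅Z, W⁆ V = -b W ⁅Z, V⁆

theorem rePart_lie (hG : IsClosed (G : Set (Matrix.unitaryGroup (Fin n) ℂ))) {Z W : Mat n}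
    (hZ : Z ∈ lieC G) (hW : W ∈ lieC G) :
    rePart ⁅Z, W⁆ = ⁅rePart Z, rePart W⁆ - ⁅imPart Z, imPart W⁆ ∧
    imPart ⁅Z, W⁆ = ⁅rePart Z, imPart W⁆ + ⁅imPart Z, rePart W⁆ := by
  have hz := mem_lieC_iff.1 hZ
  have hw := mem_lieC_iff.1 hW
  have h := lie_add_I_smul (rePart Z) (imPart Z) (rePart W) (imPart W)
  rw [rePart_add_imPart, rePart_add_imPart] at h
  have h1 := star_of_mem_lie (sub_mem_lie hG (lie_mem_lie hG hz.1 hw.1) (lie_mem_lie hG hz.2 hw.2))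
  have h2 := star_of_mem_lie (add_mem_lie hG (lie_mem_lie hG hz.1 hw.2) (lie_mem_lie hG hz.2 hw.1))
  rw [h]
  exact ⟨rePart_add_I_smul h1 h2, imPart_add_I_smul h1 h2⟩

theorem IsInvariantInner.isInvariantC_formRe (hB : IsInvariantInner G B)
    (hG : IsClosed (G : Set (Matrix.unitaryGroup (Fin n) ℂ))) : IsInvariantC G (formRe B) where
  lie_left Z hZ W hW V hV := by
    have hz := mem_lieC_iff.1 hZ
    have hw := mem_lieC_iff.1 hW
    have hv := mem_lieC_iff.1 hV
    rw [formRe_apply, formRe_apply, (rePart_lie hG hZ hW).1, (rePart_lie hG hZ hW).2,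
      (rePart_lie hG hZ hV).1, (rePart_lie hG hZ hV).2]
    simp only [map_add, map_sub, LinearMap.add_apply, LinearMap.sub_apply,
      hB.lie_left hz.1 hw.1 hv.1, hB.lie_left hz.2 hw.2 hv.1, hB.lie_left hz.1 hw.2 hv.2,
      hB.lie_left hz.2 hw.1 hv.2]
    ring

theorem IsInvariantInner.isInvariantC_formIm (hB : IsInvariantInner G B)
    (hG : IsClosed (G : Set (Matrix.unitaryGroup (Fin n) ℂ))) : IsInvariantC G (formIm B) where
  lie_left Z hZ W hW V hV := by
    have hz := mem_lieC_iff.1 hZ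
    have hw := mem_lieC_iff.1 hW
    have hv := mem_lieC_iff.1 hV
    rw [formIm_apply, formIm_apply, (rePart_lie hG hZ hW).1, (rePart_lie hG hZ hW).2,
      (rePart_lie hG hZ hV).1, (rePart_lie hG hZ hV).2]
    simp only [map_add, map_sub, LinearMap.add_apply, LinearMap.sub_apply,
      hB.lie_left hz.1 hw.1 hv.2, hB.lie_left hz.2 hw.2 hv.2, hB.lie_left hz.1 hw.2 hv.1,
      hB.lie_left hz.2 hw.1 hv.1]
    ring

/-- `formC` as a continuous real bilinear map. -/
def formCL (B : LinearMap.BilinForm ℝ (Mat n)) : Mat n →L[ℝ] Mat n →L[ℝ] ℂ :=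
  LinearMap.toContinuousBilinearMap (LinearMap.mk₂ ℝ (formC B)
    (fun Z Z' W => by
      simp only [formC_eq, map_add, LinearMap.add_apply]; push_cast; ring)
    (fun c Z W => by
      simp only [formC_eq, map_smul, LinearMap.smul_apply, smul_eq_mul, Complex.real_smul]
      push_cast; ring)
    (fun Z W W' => by simp only [formC_eq, map_add]; push_cast; ring)
    (fun c Z W => by
      simp only [formC_eq, map_smul, smul_eq_mul, Complex.real_smul]
      push_cast; ring))

theorem formCL_apply (Z W : Mat n) : formCL B Z W = formC B Z W := rfl

/-- Tangent vectors to Gᶜ at g are written gγ. The vector (gγ, c) is constant in the linear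
coordinates, so only b and g⁻¹ vary, the latter by -γ'g⁻¹. -/
theorem fderiv_liouville {g h b γ c γ' c' : Mat n} (hgh : g * h = 1) :
    fderiv ℝ (fun y => liouville B y (g * γ, c)) (g, b) (g * γ', c') =
      formC B c' γ - formC B b (γ' * γ) := by
  have hhg : h * g = 1 := mul_eq_one_comm.1 hgh
  let u : (Mat n)ˣ := ⟨g, h, hgh, hhg⟩
  have h0 : HasFDerivAt (Ring.inverse : Mat n → Mat n)
      (-ContinuousLinearMap.mulLeftRight ℝ (Mat n) ↑u⁻¹ ↑u⁻¹) ((g, b) : Mat n × Mat n).1 :=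
    hasFDerivAt_ringInverse u
  have h1 := h0.comp (g, b) (hasFDerivAt_fst (𝕜 := ℝ) (E := Mat n) (F := Mat n))
  have h2 := ((ContinuousLinearMap.mul ℝ (Mat n)).flip (g * γ)).hasFDerivAt.comp (g, b) h1
  have h3 := (formCL B).hasFDerivAt_of_bilinear
    (hasFDerivAt_snd (𝕜 := ℝ) (E := Mat n) (F := Mat n) (p := (g, b))) h2
  have h4 : (fun y : Mat n × Mat n => liouville B y (g * γ, c)) = fun y => formCL B y.2
      ((⇑((ContinuousLinearMap.mul ℝ (Mat n)).flip (g * γ)) ∘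
        (Ring.inverse ∘ Prod.fst)) y) := by
    funext y
    simp only [liouville, formCL_apply, Function.comp_apply, Matrix.nonsing_inv_eq_ringInverse]
    rfl
  rw [h4, h3.fderiv]
  have e1 : Ring.inverse g = h := Ring.inverse_unit u
  have e2 : (↑u⁻¹ : Mat n) = h := rfl
  simp [formCL_apply, e1, e2]
  have e3 : h * (g * γ) = γ := by rw [← mul_assoc, hhg, one_mul]
  have e4 : h * (g * γ') * h * (g * γ) = γ' * γ := by
    rw [mul_assoc, e3, ← mul_assoc, hhg, one_mul]
  rw [e3, e4]
  ring

/-- The canonical form in the left trivialisation; the bracket arises from antisymmetrising γ'γ. -/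
theorem canonicalForm_eq {g h b γ c γ' c' : Mat n} (hgh : g * h = 1) :
    canonicalForm B (g, b) (g * γ, c) (g * γ', c') =
      formC B c' γ - formC B c γ' + formC B b ⁅γ, γ'⁆ := by
  rw [canonicalForm, fderiv_liouville hgh, fderiv_liouville hgh, Ring.lie_def]
  have e : formC B b (γ * γ' - γ' * γ) = formC B b (γ * γ') - formC B b (γ' * γ) :=
    (formCL B b).map_sub _ _
  rw [e]
  ring

/-! ### The pull-back of the canonical form -/

/-- The logarithmic derivative of the parallel transport in the direction `x`. -/
def logDeriv (a x : D0 n) : D0 n := parallelInv a * fderiv ℝ parallel a x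

theorem parallel_mul_logDeriv (a x : D0 n) (t : U) :
    (parallel a).ev t * (logDeriv a x).ev t = (fderiv ℝ parallel a x : D0 n).ev t := by
  rw [logDeriv, D0.ev_mul, ← mul_assoc, parallel_mul_inv, one_mul]

theorem logDeriv_zero (a x : D0 n) : (logDeriv a x).ev 0 = 0 := by
  obtain ⟨y, hy, hy0, -⟩ := fderiv_parallel a x
  rw [logDeriv, hy, D0.ev_mul, hy0, mul_zero]

/-- For γ = g⁻¹δg the equation (δg)' = (δg)a + gx becomes γ' = -[a,γ] + x, an equation inside 𝔤ᶜ. -/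
theorem isDeriv_logDeriv (a x : D0 n) : IsDeriv (logDeriv a x) (-(D0.ad a (logDeriv a x)) + x : D0 n) := by
  obtain ⟨y, hy, -, hyd⟩ := fderiv_parallel a x
  rw [logDeriv, hy]
  refine (isDeriv_parallelInv a).mul' hyd (fun t => rfl) fun t => ?_
  simp only [D0.ev_add, D0.ev_neg, D0.ad_ev, D0.ev_mul, Ring.lie_def, mul_add, neg_mul]
  rw [← mul_assoc _ _ (x.ev t), parallelInv_mul, one_mul]
  simp only [mul_assoc]
  abel

theorem D0.ev_mem_submodule_of_ode {S : Submodule ℝ (Mat n)} {a x y : D0 n}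
    (hS : ∀ t, ∀ h ∈ S, -⁅a.ev t, h⁆ + x.ev t ∈ S)
    (hy : IsDeriv y (-(D0.ad a y) + x : D0 n)) (h0 : y.ev 0 ∈ S) (t : U) : y.ev t ∈ S := by
  have h := mem_submodule_of_ode S
    (V := fun t z => -⁅NahmSchmid.ext (E := Mat n) a t, z⁆ + NahmSchmid.ext (E := Mat n) x t)
    (L := 2 * ‖a‖) (a := 0) (b := 1) (u := NahmSchmid.ext (E := Mat n) y) (fun s hs z w => ?_)
    (continuous_ext (E := Mat n) y).continuousOn (fun s hs => ?_) ?_ (fun s hs z hz => ?_) t t.2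
  · rwa [ext_coe (E := Mat n) y t] at h
  · have e : -⁅NahmSchmid.ext (E := Mat n) a s, z⁆ + NahmSchmid.ext (E := Mat n) x s -
        (-⁅NahmSchmid.ext (E := Mat n) a s, w⁆ + NahmSchmid.ext (E := Mat n) x s) =
        -⁅NahmSchmid.ext (E := Mat n) a s, z - w⁆ := by
      rw [mat_lie_sub]; abel
    rw [e, norm_neg]
    refine (lie_norm_le _ _).trans ?_
    gcongr
    exact norm_ext_le (E := Mat n) a s
  · have hs1 : s ∈ Icc (0 : ℝ) 1 := ⟨hs.1, hs.2.le⟩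
    have h1 := hy ⟨s, hs1⟩
    have h2 : HasDerivWithinAt (NahmSchmid.ext (E := Mat n) y)
        ((-(D0.ad a y) + x : D0 n).ev ⟨s, hs1⟩) (Ici s) s :=
      h1.mono_of_mem_nhdsWithin (Icc_mem_nhdsGE_of_mem hs)
    refine h2.congr_deriv ?_
    rw [ext_of_mem (E := Mat n) a hs1, ext_of_mem (E := Mat n) x hs1,
      ext_of_mem (E := Mat n) y hs1, D0.ev_add, D0.ev_neg, D0.ad_ev]
    rfl
  · have : NahmSchmid.ext (E := Mat n) y 0 = y.ev 0 := ext_coe (E := Mat n) y 0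
    rwa [this]
  · have hs1 : s ∈ Icc (0 : ℝ) 1 := ⟨hs.1, hs.2.le⟩
    rw [ext_of_mem (E := Mat n) a hs1, ext_of_mem (E := Mat n) x hs1]
    exact hS ⟨s, hs1⟩ z hz

theorem logDeriv_mem_lieC (hG : IsClosed (G : Set (Matrix.unitaryGroup (Fin n) ℂ))) {a x : D0 n}
    (ha : ∀ t, a.ev t ∈ lieC G) (hx : ∀ t, x.ev t ∈ lieC G) (t : U) :
    (logDeriv a x).ev t ∈ lieC G := by
  refine D0.ev_mem_submodule_of_ode (S := (lieCSub hG).restrictScalars ℝ) (fun t h hh => ?_)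
    (isDeriv_logDeriv a x) ?_ t
  · exact (lieCSub hG).add_mem ((lieCSub hG).neg_mem (lie_mem_lieC hG (ha t) hh)) (hx t)
  · rw [logDeriv_zero]
    exact zero_mem _

/-- Integration of the symplectic form along the interval. -/
theorem IsInvariantC.intU_eq (hG : IsClosed (G : Set (Matrix.unitaryGroup (Fin n) ℂ)))
    {b : LinearMap.BilinForm ℝ (Mat n)} (hb : IsInvariantC G b) {p x y : D1 n × D1 n}
    (hp : IsLieC G p) (hx : IsLieC G x) (hy : IsLieC G y)
    (hpe : ∀ t, p.2.dot t = -⁅p.1.ev t, p.2.ev t⁆)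
    (hxe : ∀ t, x.2.dot t = -⁅p.1.ev t, x.2.ev t⁆ - ⁅x.1.ev t, p.2.ev t⁆)
    (hye : ∀ t, y.2.dot t = -⁅p.1.ev t, y.2.ev t⁆ - ⁅y.1.ev t, p.2.ev t⁆) {γ δ : D0 n}
    (hγ : γ = logDeriv (D1.val p.1) (D1.val x.1)) (hδ : δ = logDeriv (D1.val p.1) (D1.val y.1)) :
    intU (fun t => b (x.2.ev t) (y.1.ev t) - b (y.2.ev t) (x.1.ev t)) =
      b (x.2.ev 1) (δ.ev 1) - b (y.2.ev 1) (γ.ev 1) - b (p.2.ev 1) ⁅γ.ev 1, δ.ev 1⁆ := by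
  have hγl (t) : γ.ev t ∈ lieC G := hγ ▸ logDeriv_mem_lieC hG hp.1 hx.1 t
  have hδl (t) : δ.ev t ∈ lieC G := hδ ▸ logDeriv_mem_lieC hG hp.1 hy.1 t
  have hγ0 : γ.ev 0 = 0 := hγ ▸ logDeriv_zero _ _
  have hδ0 : δ.ev 0 = 0 := hδ ▸ logDeriv_zero _ _
  let γ₁ : D1 n := D1.mk γ (-(D0.ad (D1.val p.1) γ) + D1.val x.1) (hγ ▸ isDeriv_logDeriv _ _)
  let δ₁ : D1 n := D1.mk δ (-(D0.ad (D1.val p.1) δ) + D1.val y.1) (hδ ▸ isDeriv_logDeriv _ _)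
  have hγd (t) : γ₁.dot t = -⁅p.1.ev t, γ.ev t⁆ + x.1.ev t := by
    rw [← D1.val_ev p.1, ← D0.ad_ev]; rfl
  have hδd (t) : δ₁.dot t = -⁅p.1.ev t, δ.ev t⁆ + y.1.ev t := by
    rw [← D1.val_ev p.1, ← D0.ad_ev]; rfl
  have hγe (t) : γ₁.ev t = γ.ev t := rfl
  have hδe (t) : δ₁.ev t = δ.ev t := rfl
  let c := D1.mul γ₁ δ₁ - D1.mul δ₁ γ₁
  have hce (t) : c.ev t = ⁅γ.ev t, δ.ev t⁆ := by rw [Ring.lie_def]; rfl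
  have hcd (t) : c.dot t = ⁅γ₁.dot t, δ.ev t⁆ + ⁅γ.ev t, δ₁.dot t⁆ := by
    have : c.dot t = (γ₁.dot t * δ.ev t + γ.ev t * δ₁.dot t) -
      (δ₁.dot t * γ.ev t + δ.ev t * γ₁.dot t) := rfl
    rw [this, Ring.lie_def, Ring.lie_def]; abel
  -- The primitive is b(x₂,δ) - b(y₂,γ) - b(p₂,[γ,δ]). It vanishes at 0 because γ and δ do, so only
  -- the value at 1 survives.
  have i1 := intU_deriv_bilin b x.2 δ₁
  have i2 := intU_deriv_bilin b y.2 γ₁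
  have i3 := intU_deriv_bilin b p.2 c
  have hcont (q r : D1 n) : Continuous fun t => b (q.ev t) (r.dot t) + b (q.dot t) (r.ev t) :=
    (continuous_bilinForm b q.continuous_ev r.continuous_dot).add
      (continuous_bilinForm b q.continuous_dot r.continuous_ev)
  have i4 := intU_sub (hcont x.2 δ₁) (hcont y.2 γ₁)
  have i5 := intU_sub (f := fun t => b (x.2.ev t) (δ₁.dot t) + b (x.2.dot t) (δ₁.ev t) -
    (b (y.2.ev t) (γ₁.dot t) + b (y.2.dot t) (γ₁.ev t))) ((hcont x.2 δ₁).sub (hcont y.2 γ₁)) (hcont p.2 c)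
  rw [i4, i1, i2, i3] at i5
  simp only [hγe, hδe, hce, hγ0, hδ0, map_zero, sub_zero] at i5
  have e0 : ⁅(0 : Mat n), (0 : Mat n)⁆ = 0 := by rw [Ring.lie_def]; simp
  rw [e0, map_zero, sub_zero] at i5
  rw [← i5]
  congr 1
  funext t
  -- In the derivative of the primitive, invariance and the Jacobi identity cancel every term
  -- containing p₁. The terms b(p₂,[x₁,δ]) and b(p₂,[y₁,γ]) cancel against the inhomogeneous parts
  -- of the equations for x₂ and y₂, which leaves b(x₂,y₁) - b(y₂,x₁).
  have hL := hb.lie_left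
  have hl {Z W : Mat n} (hZ : Z ∈ lieC G) (hW : W ∈ lieC G) := lie_mem_lieC hG hZ hW
  have a1 := hL _ (hp.1 t) _ (hx.2 t) _ (hδl t)
  have a2 := hL _ (hp.1 t) _ (hy.2 t) _ (hγl t)
  have a3 := hL _ (hp.1 t) _ (hp.2 t) _ (hl (hγl t) (hδl t))
  have b4 := hL _ (hx.1 t) _ (hp.2 t) _ (hδl t)
  have b5 := hL _ (hy.1 t) _ (hp.2 t) _ (hγl t)
  have jac : ⁅p.1.ev t, ⁅γ.ev t, δ.ev t⁆⁆ =
      ⁅⁅p.1.ev t, γ.ev t⁆, δ.ev t⁆ + ⁅γ.ev t, ⁅p.1.ev t, δ.ev t⁆⁆ := by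
    simp only [Ring.lie_def, mul_sub, sub_mul, mul_assoc]; abel
  have k1 : ⁅-⁅p.1.ev t, γ.ev t⁆ + x.1.ev t, δ.ev t⁆ =
      -⁅⁅p.1.ev t, γ.ev t⁆, δ.ev t⁆ + ⁅x.1.ev t, δ.ev t⁆ := by
    simp only [Ring.lie_def, mul_add, add_mul, neg_mul, mul_neg]; abel
  have k2 : ⁅γ.ev t, -⁅p.1.ev t, δ.ev t⁆ + y.1.ev t⁆ =
      -⁅γ.ev t, ⁅p.1.ev t, δ.ev t⁆⁆ - ⁅y.1.ev t, γ.ev t⁆ := by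
    simp only [Ring.lie_def, mul_add, add_mul, neg_mul, mul_neg]; abel
  rw [hcd, hγd, hδd, hpe, hxe, hye, k1, k2]
  rw [jac] at a3
  simp only [map_add, map_sub, map_neg, LinearMap.sub_apply,
    LinearMap.neg_apply] at a1 a2 a3 ⊢
  linarith

theorem tangentModuli_isLieC (hG : IsClosed (G : Set (Matrix.unitaryGroup (Fin n) ℂ)))
    {T X : Quad n} (hX : X ∈ tangentModuli G T) : IsLieC G (pairOf X) ∧ ∀ t,
      (pairOf X).2.dot t = -⁅(pairOf T).1.ev t, (pairOf X).2.ev t⁆ -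
        ⁅(pairOf X).1.ev t, (pairOf T).2.ev t⁆ := by
  refine ⟨isLieC_pairOf hG hX.1, fun t => ?_⟩
  obtain ⟨-, h2, h3, -⟩ := hX.2 t
  have e2 : (X 2).dot t = -(⁅(T 0).ev t, (X 2).ev t⁆ + ⁅(X 0).ev t, (T 2).ev t⁆
      - ⁅(T 3).ev t, (X 1).ev t⁆ - ⁅(X 3).ev t, (T 1).ev t⁆) := by
    rw [eq_neg_iff_add_eq_zero, ← h2]; abel
  have e3 : (X 3).dot t = -(⁅(T 0).ev t, (X 3).ev t⁆ + ⁅(X 0).ev t, (T 3).ev t⁆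
      - ⁅(T 1).ev t, (X 2).ev t⁆ - ⁅(X 1).ev t, (T 2).ev t⁆) := by
    rw [eq_neg_iff_add_eq_zero, ← h3]; abel
  rw [pairOf_snd_dot, pairOf_snd_ev, pairOf_fst_ev, pairOf_snd_ev, pairOf_fst_ev, e2, e3]
  simp only [Ring.lie_def, mul_sub, sub_mul, mul_add, add_mul, smul_mul_assoc,
    mul_smul_comm, smul_sub, smul_add, smul_smul, neg_sub]
  match_scalars <;> ring_nf <;> simp [Complex.I_sq]

theorem complexEq_pairOf {T : Quad n} (hT : T ∈ solutions G) (t : U) :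
    (pairOf T).2.dot t = -⁅(pairOf T).1.ev t, (pairOf T).2.ev t⁆ := by
  obtain ⟨-, h2, h3⟩ := hT.2 t
  have e2 : (T 2).dot t = ⁅(T 3).ev t, (T 1).ev t⁆ - ⁅(T 0).ev t, (T 2).ev t⁆ :=
    eq_sub_of_add_eq h2
  have e3 : (T 3).dot t = ⁅(T 1).ev t, (T 2).ev t⁆ - ⁅(T 0).ev t, (T 3).ev t⁆ :=
    eq_sub_of_add_eq h3
  rw [pairOf_snd_dot, pairOf_snd_ev, pairOf_fst_ev, e2, e3]
  simp only [Ring.lie_def, mul_sub, sub_mul, mul_add, add_mul, smul_mul_assoc,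
    mul_smul_comm, smul_sub, smul_add, smul_smul, neg_sub]
  match_scalars <;> ring_nf <;> simp [Complex.I_sq]

/-- Antisymmetrised in X and Y, these real and imaginary parts of ⟨β_X, α_Y⟩ are the integrands of
ω_S and ω_T. -/
theorem formRe_pairOf {X Y : Quad n} (hX : X ∈ configs G) (hY : Y ∈ configs G) (t : U) :
    formRe B ((pairOf X).2.ev t) ((pairOf Y).1.ev t) =
      B ((X 2).ev t) ((Y 0).ev t) + B ((X 3).ev t) ((Y 1).ev t) ∧
    formIm B ((pairOf X).2.ev t) ((pairOf Y).1.ev t) =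
      B ((X 3).ev t) ((Y 0).ev t) - B ((X 2).ev t) ((Y 1).ev t) := by
  have hx (i) := star_of_mem_lie (hX i t)
  have hy (i) := star_of_mem_lie (hY i t)
  have hy1 : star (-(Y 1).ev t) = -(-(Y 1).ev t) := by rw [star_neg, hy]
  have e : (pairOf Y).1.ev t = (Y 0).ev t + Complex.I • (-(Y 1).ev t) := by
    rw [pairOf_fst_ev, smul_neg, sub_eq_add_neg]
  rw [formRe_apply, formIm_apply, pairOf_snd_ev, e, rePart_add_I_smul (hx 2) (hx 3),
    imPart_add_I_smul (hx 2) (hx 3), rePart_add_I_smul (hy 0) hy1, imPart_add_I_smul (hy 0) hy1]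
  simp only [map_neg]
  exact ⟨by ring, by ring⟩

/-- The map to the cotangent bundle is symplectic. -/
theorem canonicalForm_endDeriv (hG : IsClosed (G : Set (Matrix.unitaryGroup (Fin n) ℂ)))
    (hB : IsInvariantInner G B) {T X Y : Quad n} (hT : T ∈ solutions G)
    (hX : X ∈ tangentModuli G T) (hY : Y ∈ tangentModuli G T) :
    canonicalForm B (endMap (pairOf T)) (endDeriv T X) (endDeriv T Y) = omegaC B X Y := by
  obtain ⟨hxl, hxe⟩ := tangentModuli_isLieC hG hX
  obtain ⟨hyl, hye⟩ := tangentModuli_isLieC hG hY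
  have hpl := isLieC_pairOf hG hT.1
  set p := pairOf T with hp
  set x := pairOf X with hx
  set y := pairOf Y with hy
  have i1 := (hB.isInvariantC_formRe hG).intU_eq hG hpl hxl hyl (complexEq_pairOf hT) hxe hye rfl rfl
  have i2 := (hB.isInvariantC_formIm hG).intU_eq hG hpl hxl hyl (complexEq_pairOf hT) hxe hye rfl rfl
  rw [endDeriv_apply, endDeriv_apply, endMap, ← hp, ← hx, ← hy, ← parallel_mul_logDeriv,
    ← parallel_mul_logDeriv, canonicalForm_eq (parallel_mul_inv _ _)]
  set γ := (logDeriv (D1.val p.1) (D1.val x.1)).ev 1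
  set δ := (logDeriv (D1.val p.1) (D1.val y.1)).ev 1
  have n1 (Z W : Mat n) : formC B (-Z) W = -formC B Z W := by
    rw [← formCL_apply, map_neg, neg_apply, formCL_apply]
  -- The sign in the second component -β(1) of `endMap` matches the signs of -dθ with those of the
  -- boundary value.
  rw [n1, n1, n1, formC_eq, formC_eq, formC_eq, omegaC]
  have m1 : intU (fun t => formRe B (x.2.ev t) (y.1.ev t) - formRe B (y.2.ev t) (x.1.ev t)) =
      intU (fun t => B ((strS X 0).ev t) ((Y 0).ev t) + B ((strS X 1).ev t) ((Y 1).ev t) -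
        B ((strS X 2).ev t) ((Y 2).ev t) - B ((strS X 3).ev t) ((Y 3).ev t)) := by
    congr 1
    funext t
    rw [(formRe_pairOf hX.1 hY.1 t).1, (formRe_pairOf hY.1 hX.1 t).1,
      hB.symm _ (hY.1 2 t) _ (hX.1 0 t), hB.symm _ (hY.1 3 t) _ (hX.1 1 t), ← sub_sub]
    rfl
  have m2 : intU (fun t => formIm B (x.2.ev t) (y.1.ev t) - formIm B (y.2.ev t) (x.1.ev t)) =
      intU (fun t => B ((strT X 0).ev t) ((Y 0).ev t) + B ((strT X 1).ev t) ((Y 1).ev t) -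
        B ((strT X 2).ev t) ((Y 2).ev t) - B ((strT X 3).ev t) ((Y 3).ev t)) := by
    congr 1
    funext t
    rw [(formRe_pairOf hX.1 hY.1 t).2, (formRe_pairOf hY.1 hX.1 t).2,
      hB.symm _ (hY.1 3 t) _ (hX.1 0 t), hB.symm _ (hY.1 2 t) _ (hX.1 1 t)]
    have f1 : (strT X 1).ev t = -(X 2).ev t := rfl
    have f2 : (strT X 2).ev t = -(X 1).ev t := rfl
    have f0 : (strT X 0).ev t = (X 3).ev t := rfl
    have f3 : (strT X 3).ev t = (X 0).ev t := rfl
    rw [f0, f1, f2, f3]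
    simp only [map_neg, LinearMap.neg_apply]
    ring
  have m1' := (metric_eq (B := B) (strS X) Y).trans (m1.symm.trans i1)
  have m2' := (metric_eq (B := B) (strT X) Y).trans (m2.symm.trans i2)
  refine Eq.trans ?_ (congrArg₂ (fun r s : ℝ => (r : ℂ) + Complex.I * s) m1' m2').symm
  push_cast
  ring

end

section

variable {G : Subgroup (Matrix.unitaryGroup (Fin n) ℂ)} {B : LinearMap.BilinForm ℝ (Mat n)}

/-! ### Positivity of the metric on orbits for small `T₂`, `T₃` -/

theorem exists_bilinForm_bound (B : LinearMap.BilinForm ℝ (Mat n)) :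
    ∃ K : ℝ, 0 < K ∧ ∀ X Y, |B X Y| ≤ K * ‖X‖ * ‖Y‖ := by
  let b := LinearMap.toContinuousBilinearMap B
  refine ⟨‖b‖ + 1, by positivity, fun X Y => ?_⟩
  have h1 : ‖b X Y‖ ≤ ‖b‖ * ‖X‖ * ‖Y‖ := b.le_opNorm₂ X Y
  refine h1.trans ?_
  gcongr
  linarith

theorem IsInvariantInner.exists_lower_bound (hB : IsInvariantInner G B)
    (hG : IsClosed (G : Set (Matrix.unitaryGroup (Fin n) ℂ))) :
    ∃ m : ℝ, 0 < m ∧ ∀ X ∈ lie G, m * ‖X‖ ^ 2 ≤ B X X := by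
  have hK : IsCompact (sphere (0 : Mat n) 1 ∩ lie G) :=
    (isCompact_sphere _ _).inter_right (isClosed_lie hG)
  have hc : Continuous fun X : Mat n => B X X := continuous_bilinForm B continuous_id continuous_id
  obtain ⟨m, hm, h⟩ : ∃ m : ℝ, 0 < m ∧ ∀ X ∈ sphere (0 : Mat n) 1 ∩ lie G, m ≤ B X X := by
    rcases (sphere (0 : Mat n) 1 ∩ lie G).eq_empty_or_nonempty with he | hne
    · exact ⟨1, one_pos, fun X hX => absurd hX (he ▸ notMem_empty X)⟩
    · obtain ⟨Y, hY, hmin⟩ := hK.exists_isMinOn hne hc.continuousOn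
      refine ⟨B Y Y, hB.pos Y hY.2 fun h0 => ?_, fun X hX => hmin hX⟩
      have := hY.1
      simp [h0] at this
  refine ⟨m, hm, fun X hX => ?_⟩
  by_cases h0 : X = 0
  · simp [h0]
  have hn : 0 < ‖X‖ := norm_pos_iff.2 h0
  have h1 := h (‖X‖⁻¹ • X) ⟨by simp [norm_smul, hn.ne'], smul_mem_lie _ hX⟩
  simp only [map_smul, LinearMap.smul_apply, smul_eq_mul] at h1
  field_simp at h1
  linarith

/-- The radius satisfies c² = m/(64K), so ‖[ξ,T]‖ ≤ 2c‖ξ‖ gives at most K·4c²‖ξ‖² = m‖ξ‖²/16. The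
constant 1/16 is used twice, for T₂ and T₃, and 2/16 is below the 1/4 of the Poincaré inequality. -/
theorem IsInvariantInner.exists_lie_bound (hB : IsInvariantInner G B)
    (hG : IsClosed (G : Set (Matrix.unitaryGroup (Fin n) ℂ))) :
    ∃ c : ℝ, 0 < c ∧ ∀ T, ‖T‖ ≤ c → ∀ ξ ∈ lie G, B ⁅ξ, T⁆ ⁅ξ, T⁆ ≤ 1 / 16 * B ξ ξ := by
  obtain ⟨m, hm, hlow⟩ := hB.exists_lower_bound hG
  obtain ⟨K, hK, hup⟩ := exists_bilinForm_bound B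
  refine ⟨√(m / (64 * K)), by positivity, fun T hT ξ hξ => ?_⟩
  have h1 : ‖⁅ξ, T⁆‖ ≤ 2 * ‖ξ‖ * √(m / (64 * K)) :=
    (lie_norm_le ξ T).trans (mul_le_mul_of_nonneg_left hT (by positivity))
  have h2 : ‖⁅ξ, T⁆‖ ^ 2 ≤ 4 * ‖ξ‖ ^ 2 * (m / (64 * K)) := by
    refine (pow_le_pow_left₀ (norm_nonneg _) h1 2).trans_eq ?_
    rw [mul_pow, Real.sq_sqrt (by positivity)]
    ring
  calc B ⁅ξ, T⁆ ⁅ξ, T⁆ ≤ K * ‖⁅ξ, T⁆‖ * ‖⁅ξ, T⁆‖ := (le_abs_self _).trans (hup _ _)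
    _ = K * ‖⁅ξ, T⁆‖ ^ 2 := by ring
    _ ≤ K * (4 * ‖ξ‖ ^ 2 * (m / (64 * K))) := by gcongr
    _ = 1 / 16 * (m * ‖ξ‖ ^ 2) := by field_simp; ring
    _ ≤ _ := by gcongr; exact hlow ξ hξ

theorem intU_pos {f : U → ℝ} (hf : Continuous f) (h : ∀ t, 0 ≤ f t) (h' : ∃ t, 0 < f t) :
    0 < intU f := by
  obtain ⟨t, ht⟩ := h'
  refine intervalIntegral.integral_pos zero_lt_one (hf.comp continuous_projIcc).continuousOn
    (fun _ _ => h _) ⟨t, t.2, ?_⟩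
  rwa [projIcc_val]

theorem intU_const_mul (c : ℝ) (f : U → ℝ) : intU (fun t => c * f t) = c * intU f :=
  intervalIntegral.integral_const_mul c _

/-- The function `t ↦ t`. -/
def D1.id (n : ℕ) : D1 n :=
  D1.mk (D0.const 0 + D0.integ 1) 1 (D0.isDeriv_integ _ _)

theorem D1.id_ev (t : U) : (D1.id n).ev t = (t : ℝ) • (1 : Mat n) := by
  change 0 + ∫ s in (0 : ℝ)..t, (1 : Mat n) = _
  rw [intervalIntegral.integral_const, sub_zero, zero_add]

theorem D1.id_dot (t : U) : (D1.id n).dot t = 1 := rfl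

/-- A Poincaré inequality. -/
theorem poincare (hB : IsInvariantInner G B)
    (hG : IsClosed (G : Set (Matrix.unitaryGroup (Fin n) ℂ))) {T : Quad n} (hT : T ∈ configs G)
    {ξ : D2 n} (hξ : ξ ∈ lieGauge G) :
    intU (fun t => B (ξ.ev t) (ξ.ev t)) ≤
      4 * intU (fun t => B ((orbitVec T ξ 0).ev t) ((orbitVec T ξ 0).ev t)) := by
  obtain ⟨hl, h0, h1⟩ := hξ
  replace hl : ∀ t, ξ.ev t ∈ lie G := hl
  have h1' : (D2.incl ξ).ev 1 = 0 := h1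
  have h0' : (D2.incl ξ).ev 0 = 0 := h0
  let N : U → ℝ := fun t => B (ξ.ev t) (ξ.ev t)
  let V : U → ℝ := fun t => B ((orbitVec T ξ 0).ev t) ((orbitVec T ξ 0).ev t)
  -- W is the derivative of t⟨ξ,ξ⟩, so its integral is zero by the boundary conditions, and N - W =
  -- -2t⟨ξ',ξ⟩.
  let W : U → ℝ := fun t => B ((D1.mul (D1.id n) (D2.incl ξ)).ev t) ((D2.incl ξ).dot t) +
    B ((D1.mul (D1.id n) (D2.incl ξ)).dot t) ((D2.incl ξ).ev t)
  have hpt (t : U) : N t - W t ≤ 2 * V t + 1 / 2 * N t := by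
    simp only [N, V, W]
    have hd := ξ.dot_mem_lie hG hl t
    have hv : (orbitVec T ξ 0).ev t = -(ξ.dot t + ⁅(T 0).ev t, ξ.ev t⁆) := by
      rw [orbitVec_zero_ev, ← mat_lie_skew]; abel
    have hw : ξ.dot t + ⁅(T 0).ev t, ξ.ev t⁆ ∈ lie G :=
      add_mem_lie hG hd (lie_mem_lie hG (hT 0 t) (hl t))
    set w := ξ.dot t + ⁅(T 0).ev t, ξ.ev t⁆ with hw'
    have e1 : B w (ξ.ev t) = B (ξ.dot t) (ξ.ev t) := by
      rw [hw', map_add, LinearMap.add_apply, hB.lie_self hG (hT 0 t) (hl t), add_zero]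
    have e2 : (D1.mul (D1.id n) (D2.incl ξ)).ev t = (t : ℝ) • ξ.ev t := by
      rw [D1.mul_ev, D1.id_ev, smul_mul_assoc, one_mul, D2.incl_ev]
    have e3 : (D1.mul (D1.id n) (D2.incl ξ)).dot t = ξ.ev t + (t : ℝ) • ξ.dot t := by
      rw [D1.mul_dot, D1.id_ev, D1.id_dot, smul_mul_assoc, one_mul, one_mul, D2.incl_ev,
        D2.incl_dot]
    -- By invariance ⟨[T₀,ξ],ξ⟩ = 0, so ξ' may be replaced by the covariant derivative w.
    -- Nonnegativity of ⟨2w + tξ, 2w + tξ⟩ together with t² ≤ 1 gives -2t⟨w,ξ⟩ ≤ 2V + N/2;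
    -- integration yields the constant 4.
    have hpos := hB.nonneg (add_mem_lie hG (smul_mem_lie 2 hw) (smul_mem_lie (t : ℝ) (hl t)))
    have ht : (t : ℝ) * t ≤ 1 := mul_le_one₀ t.2.2 t.2.1 t.2.2
    have hN := hB.nonneg (hl t)
    have hs := hB.symm _ (hl t) _ hd
    have hs' := hB.symm _ (hl t) _ hw
    have hN' := mul_le_mul_of_nonneg_right ht hN
    rw [e2, e3, hv, D2.incl_dot, D2.incl_ev]
    simp only [map_add, map_neg, map_smul, LinearMap.add_apply, LinearMap.smul_apply,
      LinearMap.neg_apply, smul_eq_mul, hs', hs, e1] at hpos ⊢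
    nlinarith
  have hW : Continuous W := (continuous_bilinForm B (D1.continuous_ev _) (D1.continuous_dot _)).add
    (continuous_bilinForm B (D1.continuous_dot _) (D1.continuous_ev _))
  have hN : Continuous N := continuous_bilinForm B ξ.continuous_ev ξ.continuous_ev
  have hV : Continuous V := continuous_bilinForm B (D1.continuous_ev _) (D1.continuous_ev _)
  have hi : intU W = _ := intU_deriv_bilin B (D1.mul (D1.id n) (D2.incl ξ)) (D2.incl ξ)
  rw [h1', h0', map_zero, map_zero, sub_zero] at hi
  have hm := intU_mono (f := fun t => N t - W t) (g := fun t => 2 * V t + 1 / 2 * N t)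
    (hN.sub hW) ((continuous_const.mul hV).add (continuous_const.mul hN)) hpt
  rw [intU_sub hN hW, hi, intU_add (f := fun t => 2 * V t) (g := fun t => 1 / 2 * N t)
    (continuous_const.mul hV) (continuous_const.mul hN), intU_const_mul, intU_const_mul] at hm
  change intU N ≤ 4 * intU V
  linarith

/-- The metric is positive on the tangent spaces of orbits if `T₂`, `T₃` are small. -/
theorem exists_metric_pos (hB : IsInvariantInner G B)
    (hG : IsClosed (G : Set (Matrix.unitaryGroup (Fin n) ℂ))) :
    ∃ c : ℝ, 0 < c ∧ ∀ T ∈ configs G, (∀ t, ‖(T 2).ev t‖ ≤ c) → (∀ t, ‖(T 3).ev t‖ ≤ c) →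
      ∀ ξ : D2 n, ξ ∈ lieGauge G → ξ ≠ 0 → 0 < metric B (orbitVec T ξ) (orbitVec T ξ) := by
  obtain ⟨c, hc, hb⟩ := hB.exists_lie_bound hG
  refine ⟨c, hc, fun T hT h2 h3 ξ hξ hne => ?_⟩
  have hp := poincare hB hG hT hξ
  have hl : ∀ t, ξ.ev t ∈ lie G := hξ.1
  have hcξ : Continuous fun t => B (ξ.ev t) (ξ.ev t) :=
    continuous_bilinForm B ξ.continuous_ev ξ.continuous_ev
  have hcv (i) : Continuous fun t => B ((orbitVec T ξ i).ev t) ((orbitVec T ξ i).ev t) :=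
    continuous_bilinForm B (D1.continuous_ev _) (D1.continuous_ev _)
  have hM : 0 < intU (fun t => B (ξ.ev t) (ξ.ev t)) := by
    refine intU_pos hcξ (fun t => hB.nonneg (hl t)) ?_
    by_contra! h
    refine hne (D2.ext fun t => ?_)
    by_contra h0
    exact absurd (h t) (not_le.2 (hB.pos _ (hl t) h0))
  let N : U → ℝ := fun t => B (ξ.ev t) (ξ.ev t)
  let V : Fin 4 → U → ℝ := fun i t => B ((orbitVec T ξ i).ev t) ((orbitVec T ξ i).ev t)
  have hN8 : Continuous fun t => 1 / 8 * N t := continuous_const.mul hcξ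
  -- The two negative terms cost at most N/16 each and the T₁ term is nonnegative. As the integral
  -- of V 0 is at least a quarter of that of N, the remainder is positive.
  have hm := intU_mono (f := fun t => V 0 t - 1 / 8 * N t)
    (g := fun t => V 0 t + V 1 t - V 2 t - V 3 t) ((hcv 0).sub hN8)
    ((((hcv 0).add (hcv 1)).sub (hcv 2)).sub (hcv 3)) fun t => by
      have e1 := hb _ (h2 t) _ (hl t)
      have e2 := hb _ (h3 t) _ (hl t)
      have e3 : 0 ≤ B ((orbitVec T ξ 1).ev t) ((orbitVec T ξ 1).ev t) := by
        refine hB.nonneg ?_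
        rw [orbitVec_ev _ _ _ one_ne_zero]
        exact lie_mem_lie hG (hl t) (hT 1 t)
      have f2 : (orbitVec T ξ 2).ev t = ⁅ξ.ev t, (T 2).ev t⁆ := orbitVec_ev _ _ _ (by decide)
      have f3 : (orbitVec T ξ 3).ev t = ⁅ξ.ev t, (T 3).ev t⁆ := orbitVec_ev _ _ _ (by decide)
      simp only [N, V]
      rw [f2, f3]
      linarith
  rw [metric_eq]
  refine lt_of_lt_of_le ?_ hm
  rw [intU_sub (hcv 0) hN8, intU_const_mul]
  change 0 < intU N at hM
  change intU N ≤ 4 * intU (V 0) at hp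
  change 0 < intU (V 0) - 1 / 8 * intU N
  linarith

theorem notMem_degeneracyLocus {T : Quad n}
    (h : ∀ ξ : D2 n, ξ ∈ lieGauge G → ξ ≠ 0 → 0 < metric B (orbitVec T ξ) (orbitVec T ξ)) :
    T ∉ degeneracyLocus G B := by
  rintro ⟨-, X, hX, hne, h0⟩
  obtain ⟨ξ, hξ, rfl⟩ := mem_orbitTangent hX
  refine (h ξ hξ ?_).ne' (h0 _ hX)
  rintro rfl
  refine hne (funext fun i => D1.ext fun t => ?_)
  by_cases hi : i = 0
  · subst hi
    rw [orbitVec_zero_ev, Ring.lie_def]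
    simp
    rfl
  · rw [orbitVec_ev _ _ _ hi, Ring.lie_def]
    simp
    rfl

end

section

variable {G : Subgroup (Matrix.unitaryGroup (Fin n) ℂ)} {B : LinearMap.BilinForm ℝ (Mat n)}

/-! ### Regularity -/

theorem exists_D1 {h : ℝ → Mat n} (hh : ContDiffOn ℝ 1 h (Icc 0 1)) :
    ∃ p : D1 n, (∀ t : U, p.ev t = h t) ∧ ∀ t : U, p.dot t = derivWithin h (Icc 0 1) t := by
  have hd : DifferentiableOn ℝ h (Icc 0 1) := hh.differentiableOn one_ne_zero
  have hc : ContinuousOn (derivWithin h (Icc 0 1)) (Icc 0 1) :=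
    hh.continuousOn_derivWithin uniqueDiffOn_Icc_zero_one le_rfl
  let f : D0 n := (⟨fun t : U => h t, hh.continuousOn.domRestrict⟩ : C(U, Mat n))
  let f' : D0 n := (⟨fun t : U => derivWithin h (Icc 0 1) t, hc.domRestrict⟩ : C(U, Mat n))
  have hf : IsDeriv f f' := fun t => by
    refine ((hd t t.2).hasDerivWithinAt).congr (fun s hs => ?_) ?_
    · exact ext_of_mem (E := Mat n) f hs
    · exact ext_coe (E := Mat n) f t
  exact ⟨D1.mk f f' hf, fun t => rfl, fun t => rfl⟩

theorem exists_D2 {h : ℝ → Mat n} (hh : ContDiffOn ℝ 2 h (Icc 0 1)) :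
    ∃ p : D2 n, ∀ t : U, p.ev t = h t := by
  obtain ⟨p, hp, hp'⟩ := exists_D1 (hh.of_le one_le_two)
  obtain ⟨q, hq, -⟩ := exists_D1 (hh.derivWithin uniqueDiffOn_Icc_zero_one
    (by norm_num : (1 : WithTop ℕ∞) + 1 ≤ 2))
  have h1 : D1.der p = D1.val q := D0.ext fun t => (hp' t).trans (hq t).symm
  refine ⟨D2.mk (D1.val p) q (h1 ▸ p.isDeriv), hp⟩

theorem contDiffOn_one_ext {f f' : C(U, Mat n)} (h : IsDeriv f f') :
    ContDiffOn ℝ 1 (NahmSchmid.ext f) (Icc 0 1) := by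
  rw [contDiffOn_one_iff_derivWithin uniqueDiffOn_Icc_zero_one]
  refine ⟨fun t ht => (h ⟨t, ht⟩).differentiableWithinAt, ?_⟩
  refine (continuous_ext f').continuousOn.congr fun t ht => ?_
  rw [ext_of_mem f' ht]
  exact (h ⟨t, ht⟩).derivWithin (uniqueDiffOn_Icc_zero_one t ht)

theorem D2.contDiffOn (f : D2 n) : ContDiffOn ℝ 2 (NahmSchmid.ext (E := Mat n) (D2.val f)) (Icc 0 1) := by
  have h1 : IsDeriv (D2.val f : D0 n) (D2.der1 f : D0 n) := (D2.incl f).isDeriv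
  have h2 : IsDeriv (D2.der1 f : D0 n) (D2.der2 f : D0 n) := (D2.diff f).isDeriv
  have e : (2 : WithTop ℕ∞) = 1 + 1 := by norm_num
  rw [e, contDiffOn_succ_iff_derivWithin uniqueDiffOn_Icc_zero_one]
  refine ⟨fun t ht => (h1 ⟨t, ht⟩).differentiableWithinAt, fun h => absurd h (by simp), ?_⟩
  refine (contDiffOn_one_ext h2).congr fun t ht => ?_
  rw [ext_of_mem (E := Mat n) (D2.der1 f) ht]
  exact (h1 ⟨t, ht⟩).derivWithin (uniqueDiffOn_Icc_zero_one t ht)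

/-- Composition of a `C²`-function with a smooth map. -/
theorem D2.exists_comp (f : D2 n) {φ : Mat n → Mat n} (h : ∀ t, ContDiffAt ℝ ω φ (f.ev t)) :
    ∃ p : D2 n, ∀ t, p.ev t = φ (f.ev t) := by
  have h1 : ContDiffOn ℝ 2 (φ ∘ NahmSchmid.ext (E := Mat n) (D2.val f)) (Icc 0 1) := fun t ht => by
    have h2 : ContDiffAt ℝ 2 φ (NahmSchmid.ext (E := Mat n) (D2.val f) t) := (h _).of_le le_top
    exact h2.comp_contDiffWithinAt t (D2.contDiffOn f t ht)
  obtain ⟨p, hp⟩ := exists_D2 h1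
  exact ⟨p, fun t => (hp t).trans (congrArg φ (ext_coe (E := Mat n) (D2.val f) t))⟩

/-- `parallel a` is of class `C²` if `a` is of class `C¹`. -/
def parallel₂ (a : D1 n) : D2 n :=
  D2.mk (parallel (D1.val a)) (D1.mul (D1.mk _ _ (isDeriv_parallel (D1.val a))) a)
    (isDeriv_parallel (D1.val a))

@[simp] theorem parallel₂_ev (a : D1 n) (t : U) :
    (parallel₂ a).ev t = (parallel (D1.val a)).ev t := rfl

theorem parallel₂_dot (a : D1 n) (t : U) :
    (parallel₂ a).dot t = (parallel (D1.val a)).ev t * a.ev t := rfl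

/-- `parallelInv a` is of class `C²` if `a` is of class `C¹`. -/
def parallelInv₂ (a : D1 n) : D2 n := D2.map starM (parallel₂ (-D1.map starM a))

@[simp] theorem parallelInv₂_ev (a : D1 n) (t : U) :
    (parallelInv₂ a).ev t = (parallelInv (D1.val a)).ev t := rfl

theorem parallelInv₂_dot (a : D1 n) (t : U) :
    (parallelInv₂ a).dot t = -(a.ev t * (parallelInv (D1.val a)).ev t) := by
  have h : (parallelInv₂ a).dot t =
    star ((parallel (D1.val (-D1.map starM a))).ev t * -star (a.ev t)) := rfl
  rw [h, star_mul, star_neg, star_star, neg_mul]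
  rfl

/-! ### Parallel transport takes values in the complexified group -/

theorem parallel_mem_groupC (hG : IsClosed (G : Set (Matrix.unitaryGroup (Fin n) ℂ))) {a : D0 n}
    (ha : ∀ t, a.ev t ∈ lieC G) (t : U) : (parallel a).ev t ∈ groupC G := by
  have hmono {f f' : D0 n} (h : IsDeriv f f') {s : ℝ} (hs : s ∈ Ico (0 : ℝ) 1) :
      HasDerivWithinAt (NahmSchmid.ext (E := Mat n) f) (NahmSchmid.ext (E := Mat n) f' s)
        (Ici s) s := by
    rw [ext_of_mem (E := Mat n) f' ⟨hs.1, hs.2.le⟩]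
    exact (h ⟨s, hs.1, hs.2.le⟩).mono_of_mem_nhdsWithin (Icc_mem_nhdsGE_of_mem hs)
  have h := mem_groupC_of_ode hG (α := NahmSchmid.ext (E := Mat n) a)
    (u := NahmSchmid.ext (E := Mat n) (parallel a))
    (w := NahmSchmid.ext (E := Mat n) (parallelInv a)) (L := ‖a‖) (a := 0) (b := 1)
    (fun s _ => norm_ext_le (E := Mat n) a s) (fun s _ => ha _)
    (continuous_ext (E := Mat n) _).continuousOn (continuous_ext (E := Mat n) _).continuousOn
    (fun s hs => hmono (isDeriv_parallel a) hs) (fun s hs => hmono (isDeriv_parallelInv a) hs)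
    ?_ ?_ t t.2
  · have := h.2
    rwa [ext_coe (E := Mat n) (parallel a) t] at this
  · have e : NahmSchmid.ext (E := Mat n) (parallel a) 0 = 1 :=
      (ext_coe (E := Mat n) (parallel a) 0).trans (parallel_zero a)
    rw [e]
    exact one_mem_groupC
  · exact (congrArg₂ (· * ·) (ext_coe (E := Mat n) (parallel a) 0)
      (ext_coe (E := Mat n) (parallelInv a) 0)).trans (parallel_mul_inv a 0)

theorem endMap_mem_cotangent (hG : IsClosed (G : Set (Matrix.unitaryGroup (Fin n) ℂ)))
    {p : D1 n × D1 n} (hp : IsLieC G p) : endMap p ∈ cotangentGroupC G :=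
  ⟨parallel_mem_groupC hG (a := D1.val p.1) hp.1 1, (lieCSub hG).neg_mem (hp.2 1)⟩

/-! ### Quadruples from pairs -/

/-- `rePart` as a continuous linear map. -/
def rePartCL : Mat n →L[ℝ] Mat n := LinearMap.toContinuousLinearMap (rePartL (n := n))

/-- `imPart` as a continuous linear map. -/
def imPartCL : Mat n →L[ℝ] Mat n := LinearMap.toContinuousLinearMap (imPartL (n := n))

/-- The quadruple of a pair `(α, β)`. -/
def quadOf : D1 n × D1 n →L[ℝ] (Fin 4 → D1 n) :=
  ContinuousLinearMap.pi ![D1.map rePartCL ∘L ContinuousLinearMap.fst ℝ (D1 n) (D1 n),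
    -(D1.map imPartCL ∘L ContinuousLinearMap.fst ℝ (D1 n) (D1 n)),
    D1.map rePartCL ∘L ContinuousLinearMap.snd ℝ (D1 n) (D1 n),
    D1.map imPartCL ∘L ContinuousLinearMap.snd ℝ (D1 n) (D1 n)]

theorem quadOf_ev (p : D1 n × D1 n) (t : U) :
    (quadOf p 0).ev t = rePart (p.1.ev t) ∧ (quadOf p 1).ev t = -imPart (p.1.ev t) ∧
    (quadOf p 2).ev t = rePart (p.2.ev t) ∧ (quadOf p 3).ev t = imPart (p.2.ev t) :=
  ⟨rfl, rfl, rfl, rfl⟩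

theorem pairOf_quadOf (p : D1 n × D1 n) : pairOf (quadOf p) = p := by
  refine Prod.ext (D1.ext fun t => ?_) (D1.ext fun t => ?_)
  · change rePart (p.1.ev t) - Complex.I • -imPart (p.1.ev t) = p.1.ev t
    rw [smul_neg, sub_neg_eq_add, rePart_add_imPart]
  · exact rePart_add_imPart (p.2.ev t)

theorem quadOf_mem_configs {p : D1 n × D1 n} (hp : IsLieC G p) : quadOf p ∈ configs G := by
  intro i t
  fin_cases i
  · exact (mem_lieC_iff.1 (hp.1 t)).1
  · exact neg_mem_lie (mem_lieC_iff.1 (hp.1 t)).2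
  · exact (mem_lieC_iff.1 (hp.2 t)).1
  · exact (mem_lieC_iff.1 (hp.2 t)).2

theorem norm_rePart_le (Z : Mat n) : ‖rePart Z‖ ≤ ‖Z‖ := by
  rw [rePart, norm_smul]
  have := norm_sub_le Z (star Z)
  rw [norm_star] at this
  norm_num
  linarith

theorem norm_imPart_le (Z : Mat n) : ‖imPart Z‖ ≤ ‖Z‖ := by
  rw [imPart, norm_smul]
  have := norm_add_le Z (star Z)
  rw [norm_star] at this
  norm_num
  linarith

theorem eq_of_pairOf_eq {T T' : Quad n} (hT : ∀ i t, star ((T i).ev t) = -(T i).ev t)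
    (hT' : ∀ i t, star ((T' i).ev t) = -(T' i).ev t) (h : pairOf T = pairOf T') : T = T' := by
  have key {T : Quad n} (hs : ∀ i t, star ((T i).ev t) = -(T i).ev t) :
      quadOf (pairOf T) = (T : Fin 4 → D1 n) := by
    have e (t) : (pairOf T).1.ev t = (T 0).ev t + Complex.I • (-(T 1).ev t) := by
      rw [pairOf_fst_ev, smul_neg, sub_eq_add_neg]
    have hs1 (t) : star (-(T 1).ev t) = -(-(T 1).ev t) := by rw [star_neg, hs]
    funext i
    refine D1.ext fun t => ?_
    obtain ⟨h0, h1, h2, h3⟩ := quadOf_ev (pairOf T) t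
    fin_cases i
    · refine h0.trans ?_
      rw [e, rePart_add_I_smul (hs 0 t) (hs1 t)]; rfl
    · refine h1.trans ?_
      rw [e, imPart_add_I_smul (hs 0 t) (hs1 t), neg_neg]; rfl
    · refine h2.trans ?_
      rw [pairOf_snd_ev, rePart_add_I_smul (hs 2 t) (hs 3 t)]; rfl
    · refine h3.trans ?_
      rw [pairOf_snd_ev, imPart_add_I_smul (hs 2 t) (hs 3 t)]; rfl
  exact (key hT).symm.trans ((congrArg _ h).trans (key hT'))

/-- A pair with values in the complexified Lie algebra that satisfies both equations comes from a
solution of the Nahm–Schmid equations. -/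
theorem quadOf_mem_solutions {p : D1 n × D1 n} (hG : IsClosed (G : Set (Matrix.unitaryGroup (Fin n) ℂ)))
    (hp : IsLieC G p) (hc : ∀ t, p.2.dot t = -⁅p.1.ev t, p.2.ev t⁆) (hm : moment p = 0) :
    quadOf p ∈ solutions G := by
  have hq := quadOf_mem_configs hp
  obtain ⟨T, hT⟩ : ∃ T : Quad n, T = quadOf p := ⟨_, rfl⟩
  have hpT : pairOf T = p := by rw [hT]; exact pairOf_quadOf p
  change (quadOf p : Quad n) ∈ configs G at hq
  rw [← hT] at hq
  suffices h : T ∈ solutions G by rw [hT] at h; exact h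
  refine ⟨hq, fun t => ?_⟩
  have hs (i) := star_of_mem_lie (hq i t)
  have hdl (i) : (T i).dot t ∈ lie G := D1.dot_mem_lie hG (T i) (hq i) t
  have hd (i) := star_of_mem_lie (hdl i)
  have hl {i j} : ⁅(T i).ev t, (T j).ev t⁆ ∈ lie G := lie_mem_lie hG (hq i t) (hq j t)
  have e1 : (T 1).dot t + ⁅(T 0).ev t, (T 1).ev t⁆ + ⁅(T 2).ev t, (T 3).ev t⁆ = 0 := by
    have h1 := congrArg (fun f : D0 n => f.ev t) hm
    simp only [moment_ev, ← hpT, pairOf_fst_dot, pairOf_fst_ev, pairOf_snd_ev, D0.ev_zero] at h1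
    -- For skew-hermitian Tᵢ the real equation is -2i times the first Nahm–Schmid equation.
    have h2 : (-2 * Complex.I) • ((T 1).dot t + ⁅(T 0).ev t, (T 1).ev t⁆ +
        ⁅(T 2).ev t, (T 3).ev t⁆) = 0 := by
      rw [← h1]
      simp only [star_add, star_sub, star_smul, hs, hd, Complex.star_def, Complex.conj_I]
      simp only [Ring.lie_def, mul_sub, sub_mul, mul_add, add_mul, smul_mul_assoc,
        mul_smul_comm, neg_mul, mul_neg, neg_smul, smul_neg, neg_neg, smul_sub, smul_add, smul_smul]
      match_scalars <;> ring_nf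
    exact (smul_eq_zero.1 h2).resolve_left (by simp)
  -- The complex equation combines the other two Nahm–Schmid equations as a 𝔤-part plus i times a
  -- 𝔤-part, and these are determined by the sum.
  have e2 : ((T 2).dot t + ⁅(T 0).ev t, (T 2).ev t⁆ - ⁅(T 3).ev t, (T 1).ev t⁆) +
      Complex.I • ((T 3).dot t + ⁅(T 0).ev t, (T 3).ev t⁆ - ⁅(T 1).ev t, (T 2).ev t⁆) = 0 := by
    have h1 := hc t
    rw [← hpT, pairOf_snd_dot, pairOf_fst_ev, pairOf_snd_ev, eq_neg_iff_add_eq_zero] at h1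
    rw [← h1]
    simp only [Ring.lie_def, mul_sub, sub_mul, mul_add, add_mul, smul_mul_assoc,
      mul_smul_comm, smul_sub, smul_add, smul_smul]
    match_scalars <;> ring_nf <;> simp [Complex.I_sq]
  have hA := star_of_mem_lie (sub_mem_lie hG (add_mem_lie hG (hdl 2) (hl (i := 0) (j := 2)))
    (hl (i := 3) (j := 1)))
  have hB := star_of_mem_lie (sub_mem_lie hG (add_mem_lie hG (hdl 3) (hl (i := 0) (j := 3)))
    (hl (i := 1) (j := 2)))
  have h2 := rePart_add_I_smul hA hB
  have h3 := imPart_add_I_smul hA hB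
  rw [e2] at h2 h3
  refine ⟨eq_neg_of_add_eq_zero_left e1, ?_, ?_⟩
  · refine sub_eq_zero.1 (h2.symm.trans ?_)
    simp [rePart]
  · refine sub_eq_zero.1 (h3.symm.trans ?_)
    simp [imPart]

end

section

variable {G : Subgroup (Matrix.unitaryGroup (Fin n) ℂ)} {B : LinearMap.BilinForm ℝ (Mat n)}

/-! ### Bounds along one-parameter groups of hermitian matrices -/

/-- The norm of `exp(isX) β exp(-isX)` is bounded on `0 ≤ s ≤ 1` by its values at the end points
(three lines theorem). -/
theorem norm_exp_conj_le {X β : Mat n} (hX : star X = -X) {c : ℝ} (hc : 0 < c) (h0 : ‖β‖ ≤ c)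
    (h1 : ‖NormedSpace.exp (Complex.I • X) * β * NormedSpace.exp (-(Complex.I • X))‖ ≤ c) {s : ℝ}
    (hs : s ∈ Icc (0 : ℝ) 1) :
    ‖NormedSpace.exp (Complex.I • s • X) * β * NormedSpace.exp (-(Complex.I • s • X))‖ ≤ c := by
  set f : ℂ → Mat n := fun z =>
    NormedSpace.exp (z • Complex.I • X) * β * NormedSpace.exp (-(z • Complex.I • X)) with hf
  have hfd : Differentiable ℂ f := fun z => by
    have e1 : DifferentiableAt ℂ (fun z : ℂ => NormedSpace.exp (z • Complex.I • X)) z :=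
      (hasDerivAt_exp_smul_const (Complex.I • X) z).differentiableAt
    have e2 : DifferentiableAt ℂ (fun z : ℂ => NormedSpace.exp (-(z • Complex.I • X))) z := by
      have := (hasDerivAt_exp_smul_const (-(Complex.I • X)) z).differentiableAt
      simpa only [smul_neg] using this
    exact (e1.mul_const β).mul e2
  -- The imaginary part of z acts by conjugation with exp(-Im(z)X), which is unitary. Therefore the
  -- norm depends only on Re z, which gives boundedness on the strip and reduces the boundary lines
  -- to the points 0 and 1.
  have hfz (z : ℂ) : ‖f z‖ = ‖f z.re‖ := by
    set u : Mat n := NormedSpace.exp (-(z.im • X)) with hu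
    set v : Mat n := NormedSpace.exp (z.im • X) with hv
    have hzW : z • Complex.I • X = -(z.im • X) + (z.re : ℂ) • Complex.I • X := by
      conv_lhs => rw [← Complex.re_add_im z]
      rw [add_smul, smul_smul (_ * _), mul_assoc, Complex.I_mul_I, mul_neg_one, neg_smul, add_comm]
      rfl
    have hcomm : Commute (-(z.im • X)) ((z.re : ℂ) • Complex.I • X) :=
      (((Commute.refl X).smul_left _).neg_left.smul_right _).smul_right _
    have huv : u * v = 1 := exp_neg_mul_exp _
    have hsu : star u = v := by
      rw [hu, NormedSpace.star_exp, star_neg, star_smul, hX]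
      simp [hv]
    have humem : u ∈ unitary (Mat n) := by
      rw [Unitary.mem_iff, hsu]
      exact ⟨mul_eq_one_comm.1 huv, huv⟩
    have hvmem : v ∈ unitary (Mat n) := hsu ▸ Unitary.star_mem humem
    have e1 : NormedSpace.exp (z • Complex.I • X) =
        u * NormedSpace.exp ((z.re : ℂ) • Complex.I • X) := by
      rw [hzW, Matrix.exp_add_of_commute _ _ hcomm]
    have e2 : NormedSpace.exp (-(z • Complex.I • X)) =
        NormedSpace.exp (-((z.re : ℂ) • Complex.I • X)) * v := by
      rw [hzW, neg_add, neg_neg, add_comm, Matrix.exp_add_of_commute]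
      have := hcomm.symm.neg_left.neg_right
      rwa [neg_neg] at this
    have e3 : f z = u * f z.re * v := by
      simp only [hf, e1, e2, mul_assoc]
    rw [e3, CStarRing.norm_mul_mem_unitary _ hvmem, CStarRing.norm_mem_unitary_mul _ humem]
  have hbdd : BddAbove ((norm ∘ f) '' Complex.HadamardThreeLines.verticalClosedStrip 0 1) := by
    have hc : ContinuousOn (fun r : ℝ => ‖f r‖) (Icc 0 1) :=
      (hfd.continuous.comp Complex.continuous_ofReal).norm.continuousOn
    obtain ⟨C, hC⟩ := isCompact_Icc.bddAbove_image hc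
    refine ⟨C, ?_⟩
    rintro _ ⟨z, hz, rfl⟩
    exact (hfz z).le.trans (hC ⟨z.re, hz, rfl⟩)
  have key := Complex.HadamardThreeLines.norm_le_interp_of_mem_verticalClosedStrip' (f := f)
    (z := s) (a := c) (b := c) zero_lt_one hs hfd.diffContOnCl hbdd
    (fun z hz => by
      rw [hfz z, show z.re = 0 from hz]
      simpa [hf] using h0)
    (fun z hz => by
      rw [hfz z, show z.re = 1 from hz]
      simpa [hf] using h1)
  rw [← Real.rpow_add hc, sub_add_cancel, Real.rpow_one] at key
  have e : ((s : ℝ) : ℂ) • Complex.I • X = Complex.I • s • X := by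
    rw [smul_comm]; rfl
  simpa only [hf, e] using key

/-! ### Composition of gauge transformations -/

theorem gaugeAct_gaugeAct {E F E' F' : D2 n} (h : ∀ t, E'.ev t * F'.ev t = 1)
    (p : D1 n × D1 n) :
    gaugeAct E F (gaugeAct E' F' p) = gaugeAct (D2.mul E E') (D2.mul F' F) p := by
  refine Prod.ext (D1.ext fun t => ?_) (D1.ext fun t => ?_)
  · change E.ev t * (E'.ev t * p.1.ev t * F'.ev t - E'.dot t * F'.ev t) * F.ev t -
      E.dot t * F.ev t = (E.ev t * E'.ev t) * p.1.ev t * (F'.ev t * F.ev t) -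
      (E.dot t * E'.ev t + E.ev t * E'.dot t) * (F'.ev t * F.ev t)
    have e : E.dot t * F.ev t = E.dot t * E'.ev t * (F'.ev t * F.ev t) := by
      rw [mul_assoc, ← mul_assoc (E'.ev t), h, one_mul]
    rw [e]
    noncomm_ring
  · change E.ev t * (E'.ev t * p.2.ev t * F'.ev t) * F.ev t =
      (E.ev t * E'.ev t) * p.2.ev t * (F'.ev t * F.ev t)
    noncomm_ring

theorem gaugeAct_congr {E F E' F' : D2 n} (h : ∀ t, E.ev t = E'.ev t) (h' : ∀ t, F.ev t = F'.ev t)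
    (p : D1 n × D1 n) : gaugeAct E F p = gaugeAct E' F' p := by
  rw [D2.ext h, D2.ext h']

theorem actI_actI (r s : ℝ) (X : D2 n) (p : D1 n × D1 n) :
    actI (r • X) (actI (s • X) p) = actI ((r + s) • X) p := by
  rw [actI, actI, gaugeAct_gaugeAct (expI_ev_mul_neg _)]
  have hc (t) (a b : ℝ) : Commute (Complex.I • a • X.ev t) (Complex.I • b • X.ev t) :=
    ((((Commute.refl _).smul_left _).smul_left _).smul_right _).smul_right _
  refine gaugeAct_congr (fun t => ?_) (fun t => ?_) p
  · rw [D2.mul_ev, expI_ev, expI_ev, expI_ev, D2.ev_smul, D2.ev_smul, D2.ev_smul,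
      ← Matrix.exp_add_of_commute _ _ (hc t r s), ← smul_add, ← add_smul]
  · simp only [← neg_smul]
    rw [D2.mul_ev, expI_ev, expI_ev, expI_ev, D2.ev_smul, D2.ev_smul, D2.ev_smul,
      ← Matrix.exp_add_of_commute _ _ (hc t (-s) (-r)), ← smul_add, ← add_smul, neg_add, add_comm]

/-- Equivariance of the real equation under unitary gauge transformations. -/
theorem moment_gaugeAct {k : D2 n} (hk : ∀ t, k.ev t * (D2.map starM k).ev t = 1)
    (p : D1 n × D1 n) (t : U) : (moment (gaugeAct k (D2.map starM k) p)).ev t =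
      k.ev t * (moment p).ev t * star (k.ev t) := by
  have hk1 (t) : k.ev t * star (k.ev t) = 1 := hk t
  have hk2 (t) : star (k.ev t) * k.ev t = 1 := mul_eq_one_comm.1 (hk1 t)
  have hd (t) : star (k.dot t) = -(star (k.ev t) * k.dot t * star (k.ev t)) :=
    D2.dot_eq_of_mul_eq_one hk t
  set q := gaugeAct k (D2.map starM k) p with hq
  have ha (t) : q.1.ev t = k.ev t * p.1.ev t * star (k.ev t) - k.dot t * star (k.ev t) := rfl
  have hb (t) : q.2.ev t = k.ev t * p.2.ev t * star (k.ev t) := rfl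
  have hsa (t) : star (q.1.ev t) =
      k.ev t * star (p.1.ev t) * star (k.ev t) + k.dot t * star (k.ev t) := by
    rw [ha]
    simp only [star_sub, star_mul, star_star, hd, mul_neg, ← mul_assoc, hk1, one_mul]
    rw [sub_neg_eq_add]
  -- Since k'k^* is skew-hermitian, the inhomogeneous term drops out of α + α^*; hence α' + α'^* can
  -- be computed without a second derivative of k.
  have hS : q.1 + D1.map starM q.1 = D1.mul (D1.mul (D2.incl k) (p.1 + D1.map starM p.1))
      (D2.incl (D2.map starM k)) := by
    refine D1.ext fun t => ?_
    change q.1.ev t + star (q.1.ev t) =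
      k.ev t * (p.1.ev t + star (p.1.ev t)) * star (k.ev t)
    rw [hsa, ha]
    noncomm_ring
  have hS' : q.1.dot t + star (q.1.dot t) =
      (k.dot t * (p.1.ev t + star (p.1.ev t)) + k.ev t * (p.1.dot t + star (p.1.dot t))) *
        star (k.ev t) + k.ev t * (p.1.ev t + star (p.1.ev t)) * star (k.dot t) :=
    congrArg (fun x : D1 n => x.dot t) hS
  rw [moment_ev, moment_ev, hS', hsa, ha, hb, hd]
  simp only [star_mul, star_star]
  have hx (x : Mat n) : star (k.ev t) * (k.ev t * x) = x := by rw [← mul_assoc, hk2, one_mul]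
  simp only [Ring.lie_def, mul_add, add_mul, mul_sub, sub_mul, mul_neg, mul_assoc, hx]
  abel

/-! ### Complex gauge equivalence -/

/-- With g' = gα, the complex equation says precisely that gβg⁻¹ has derivative zero. -/
theorem parallel_conj_eq {p : D1 n × D1 n} (hp : ∀ t, p.2.dot t = -⁅p.1.ev t, p.2.ev t⁆)
    (s t : U) : (parallel (D1.val p.1)).ev s * p.2.ev s * (parallelInv (D1.val p.1)).ev s =
      (parallel (D1.val p.1)).ev t * p.2.ev t * (parallelInv (D1.val p.1)).ev t := by
  set g := parallel (D1.val p.1)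
  set w := parallelInv (D1.val p.1)
  have h1 : IsDeriv (g * D1.val p.2 : D0 n) (g * D1.val p.2 * D1.val p.1 : D0 n) := by
    refine (isDeriv_parallel (D1.val p.1)).mul' p.2.isDeriv (fun t => rfl) fun t => ?_
    simp only [D0.ev_mul, D1.val_ev, D1.der_ev, hp, Ring.lie_def]
    noncomm_ring
  have h2 : IsDeriv (g * D1.val p.2 * w : D0 n) (0 : D0 n) := by
    refine h1.mul' (isDeriv_parallelInv (D1.val p.1)) (fun t => rfl) fun t => ?_
    simp only [D0.ev_mul, D0.ev_zero, D0.ev_neg, D1.val_ev]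
    noncomm_ring
  exact (h2.eq_const s).trans (h2.eq_const t).symm

/-- The transformation is v = g_q⁻¹g_p, with g_p and g_q the two transports: it carries α_p to α_q,
and v(1) = 1 because the end values agree. It carries β_p to β_q because gβg⁻¹ is constant for each
pair and the two constants agree at t = 1. -/
theorem exists_gaugeAct_of_endMap_eq (hG : IsClosed (G : Set (Matrix.unitaryGroup (Fin n) ℂ)))
    {p q : D1 n × D1 n} (hp : IsLieC G p) (hq : IsLieC G q)
    (hpc : ∀ t, p.2.dot t = -⁅p.1.ev t, p.2.ev t⁆) (hqc : ∀ t, q.2.dot t = -⁅q.1.ev t, q.2.ev t⁆)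
    (h : endMap p = endMap q) : ∃ v w : D2 n, (∀ t, v.ev t * w.ev t = 1) ∧
      (∀ t, v.ev t ∈ groupC G) ∧ v.ev 0 = 1 ∧ v.ev 1 = 1 ∧ q = gaugeAct v w p := by
  have hg1 : (parallel (D1.val p.1)).ev 1 = (parallel (D1.val q.1)).ev 1 := congrArg Prod.fst h
  have hb1 : p.2.ev 1 = q.2.ev 1 := neg_injective (congrArg Prod.snd h)
  have hw1 : (parallelInv (D1.val p.1)).ev 1 = (parallelInv (D1.val q.1)).ev 1 := by
    rw [← inv_parallel, ← inv_parallel, hg1]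
  have hvw (t) : (parallelInv (D1.val q.1)).ev t * (parallel (D1.val p.1)).ev t *
      ((parallelInv (D1.val p.1)).ev t * (parallel (D1.val q.1)).ev t) = 1 := by
    rw [mul_assoc, ← mul_assoc (_ : Mat n) (_ : Mat n) ((parallel (D1.val q.1)).ev t),
      parallel_mul_inv, one_mul, parallelInv_mul]
  refine ⟨D2.mul (parallelInv₂ q.1) (parallel₂ p.1), D2.mul (parallelInv₂ p.1) (parallel₂ q.1),
    hvw, fun t => ?_, ?_, ?_, ?_⟩
  · change (parallelInv (D1.val q.1)).ev t * (parallel (D1.val p.1)).ev t ∈ _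
    rw [← inv_parallel]
    exact mul_mem_groupC hG (inv_mem_groupC (parallel_mem_groupC hG hq.1 t))
      (parallel_mem_groupC hG hp.1 t)
  · rw [D2.mul_ev, parallelInv₂_ev, parallel₂_ev, parallelInv_zero, parallel_zero, one_mul]
  · rw [D2.mul_ev, parallelInv₂_ev, parallel₂_ev, ← hw1, parallelInv_mul]
  · refine Prod.ext (D1.ext fun t => ?_) (D1.ext fun t => ?_)
    · have e : (D2.mul (parallelInv₂ q.1) (parallel₂ p.1)).dot t =
          -(q.1.ev t * ((parallelInv (D1.val q.1)).ev t * (parallel (D1.val p.1)).ev t)) +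
          (parallelInv (D1.val q.1)).ev t * (parallel (D1.val p.1)).ev t * p.1.ev t := by
        rw [D2.mul_dot, parallelInv₂_dot, parallel₂_dot, parallelInv₂_ev, parallel₂_ev]
        noncomm_ring
      change q.1.ev t = (D2.mul (parallelInv₂ q.1) (parallel₂ p.1)).ev t * p.1.ev t * _ -
        (D2.mul (parallelInv₂ q.1) (parallel₂ p.1)).dot t * _
      rw [e, ← sub_mul, D2.mul_ev, parallelInv₂_ev, parallel₂_ev, sub_add_cancel_right, neg_neg,
        mul_assoc (q.1.ev t)]
      exact ((congrArg _ (hvw t)).trans (mul_one _)).symm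
    · have e : (parallel (D1.val q.1)).ev t * q.2.ev t * (parallelInv (D1.val q.1)).ev t =
          (parallel (D1.val p.1)).ev t * p.2.ev t * (parallelInv (D1.val p.1)).ev t := by
        rw [parallel_conj_eq hqc t 1, parallel_conj_eq hpc t 1, hg1, hb1, hw1]
      change q.2.ev t = (parallelInv (D1.val q.1)).ev t * (parallel (D1.val p.1)).ev t * p.2.ev t *
        ((parallelInv (D1.val p.1)).ev t * (parallel (D1.val q.1)).ev t)
      have e2 : (parallelInv (D1.val q.1)).ev t * ((parallel (D1.val q.1)).ev t * q.2.ev t *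
          (parallelInv (D1.val q.1)).ev t) * (parallel (D1.val q.1)).ev t = q.2.ev t := by
        rw [mul_assoc, mul_assoc, mul_assoc, parallelInv_mul, mul_one, ← mul_assoc,
          parallelInv_mul, one_mul]
      rw [← e2, e]
      simp only [mul_assoc]

theorem polarX_one : polarX (1 : Mat n) = 0 := by
  have := polarX_mul_exp (k := (1 : Mat n)) (X := 0) (by simp) (by simp)
  simpa using this

/-- Polar decomposition of complex gauge transformations. -/
theorem exists_polar_gauge {v w : D2 n} (hvw : ∀ t, v.ev t * w.ev t = 1)
    (hv : ∀ t, v.ev t ∈ groupC G) (h0 : v.ev 0 = 1) (h1 : v.ev 1 = 1) :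
    ∃ k X : D2 n, X ∈ lieGauge G ∧ k ∈ gauge G ∧ (∀ t, k.ev t ∈ gset G) ∧
      ∀ p, gaugeAct v w p = gaugeAct k (D2.map starM k) (actI X p) := by
  -- Smoothness of the polar decomposition at invertible matrices makes the hermitian factor of v of
  -- class C², so the unitary factor v exp(-iX) is C² as well.
  obtain ⟨X, hX⟩ := v.exists_comp (φ := polarX)
    fun t => contDiffAt_polarX (isUnit_of_mem_groupC (hv t))
  have hm (t) := mem_groupC_iff_polarX.1 (hv t)
  simp only [← hX] at hm
  have hX0 : X.ev 0 = 0 := by rw [hX, h0, polarX_one]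
  have hX1 : X.ev 1 = 0 := by rw [hX, h1, polarX_one]
  set k := D2.mul v (expI (-X)) with hk
  have hkev (t) : k.ev t = v.ev t * NormedSpace.exp (-(Complex.I • X.ev t)) := by
    rw [hk, D2.mul_ev, expI_ev, D2.ev_neg, smul_neg]
  have hkm (t) : k.ev t ∈ gset G := by rw [hkev]; exact (hm t).2
  have hkv (t) : (D2.mul k (expI X)).ev t = v.ev t := by
    rw [D2.mul_ev, hkev, mul_assoc, expI_ev, exp_neg_mul_exp, mul_one]
  refine ⟨k, X, ⟨fun t => (hm t).1, hX0, hX1⟩, ⟨fun t => ?_, ?_, ?_⟩, hkm, fun p => ?_⟩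
  · obtain ⟨k', hk', e⟩ := hkm t
    exact ⟨k', hk', e⟩
  · refine (hkev 0).trans ?_
    rw [h0, hX0]
    simp
  · refine (hkev 1).trans ?_
    rw [h1, hX1]
    simp
  · rw [actI, gaugeAct_gaugeAct (expI_ev_mul_neg _)]
    refine gaugeAct_congr (fun t => (hkv t).symm) (fun t => ?_) p
    have e1 : v.ev t * ((expI (-X)).ev t * star (k.ev t)) = 1 := by
      rw [← mul_assoc]
      exact mul_star_of_mem (hkm t)
    calc w.ev t = w.ev t * (v.ev t * ((expI (-X)).ev t * star (k.ev t))) := by rw [e1, mul_one]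
      _ = (w.ev t * v.ev t) * ((expI (-X)).ev t * star (k.ev t)) := by rw [mul_assoc]
      _ = (D2.mul (expI (-X)) (D2.map starM k)).ev t := by
        rw [mul_eq_one_comm.1 (hvw t), one_mul]; rfl

end

section

variable {G : Subgroup (Matrix.unitaryGroup (Fin n) ℂ)} {B : LinearMap.BilinForm ℝ (Mat n)}

/-! ### Uniqueness of solutions of the real equation -/

theorem intU_const (c : ℝ) : intU (fun _ => c) = c := by
  simp [intU]

theorem actI_ev_snd (X : D2 n) (p : D1 n × D1 n) (t : U) : (actI X p).2.ev t =
    NormedSpace.exp (Complex.I • X.ev t) * p.2.ev t * NormedSpace.exp (-(Complex.I • X.ev t)) := by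
  have h : (actI X p).2.ev t = (expI X).ev t * p.2.ev t * (expI (-X)).ev t := rfl
  rw [h, expI_ev, expI_ev, D2.ev_neg, smul_neg]

/-- Because exp(irX) = exp(i(r-s)X) exp(isX), the derivative at s is the linearisation at X = 0
based at the pair moved by exp(isX). The linearisation formula asks for no equation on that pair. -/
theorem hasDerivAt_momentI_smul (hG : IsClosed (G : Set (Matrix.unitaryGroup (Fin n) ℂ)))
    {p : D1 n × D1 n} (hp : IsLieC G p) {X : D2 n} (hX : ∀ t, X.ev t ∈ lie G) (s : ℝ) :
    HasDerivAt (fun s : ℝ => momentI (s • X) p) (jacobi (quadOf (actI (s • X) p)) X) s := by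
  have hs : IsLieC G (actI (s • X) p) :=
    actI_isLieC hG (fun t => by rw [D2.ev_smul]; exact smul_mem_lie s (hX t)) hp
  obtain ⟨L, hL, hL'⟩ := hasFDerivAt_momentI hG (quadOf_mem_configs hs)
  rw [pairOf_quadOf] at hL
  have h1 : HasDerivAt (fun r : ℝ => (r - s) • X) X s := by
    simpa using ((hasDerivAt_id s).sub_const s).smul_const X
  have h2 : HasFDerivAt (fun Y => momentI Y (actI (s • X) p)) L ((s - s) • X) := by
    rwa [sub_self, zero_smul]
  have h3 := h2.comp_hasDerivAt s h1
  rw [hL' X hX] at h3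
  refine h3.congr_of_eventuallyEq (Eventually.of_forall fun r => ?_)
  change momentI (r • X) p = momentI ((r - s) • X) (actI (s • X) p)
  rw [momentI, momentI, actI_actI, sub_add_cancel]

/-- The functional `f ↦ ∫ B(f, X)`. -/
theorem exists_intU_functional (B : LinearMap.BilinForm ℝ (Mat n)) (X : D2 n) :
    ∃ Λ : D0 n →L[ℝ] ℝ, ∀ f, Λ f = intU fun t => B (f.ev t) (X.ev t) := by
  obtain ⟨K, hK, hB⟩ := exists_bilinForm_bound B
  have hc (f : D0 n) : Continuous fun t => B (f.ev t) (X.ev t) :=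
    continuous_bilinForm B f.continuous_ev X.continuous_ev
  let Λ : D0 n →ₗ[ℝ] ℝ :=
    { toFun := fun f => intU fun t => B (f.ev t) (X.ev t)
      map_add' := fun f g => by
        rw [← intU_add (hc f) (hc g)]
        simp only [D0.ev_add, map_add, LinearMap.add_apply]
      map_smul' := fun c f => by
        rw [RingHom.id_apply, smul_eq_mul, ← intU_const_mul]
        simp only [D0.ev_smul, map_smul, LinearMap.smul_apply, smul_eq_mul] }
  refine ⟨Λ.mkContinuous (K * ‖X‖) fun f => ?_, fun f => rfl⟩
  have hb (t : U) : |B (f.ev t) (X.ev t)| ≤ K * ‖X‖ * ‖f‖ := by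
    refine (hB _ _).trans ?_
    have h1 : K * ‖f.ev t‖ ≤ K * ‖f‖ := mul_le_mul_of_nonneg_left (f.norm_ev_le t) hK.le
    have h2 := mul_le_mul h1 (X.norm_ev_le t) (norm_nonneg _) (mul_nonneg hK.le (norm_nonneg _))
    rw [mul_right_comm K ‖X‖]
    exact h2
  rw [Real.norm_eq_abs, abs_le]
  constructor
  · have := intU_mono continuous_const (hc f) fun t => (abs_le.1 (hb t)).1
    rwa [intU_const] at this
  · have := intU_mono (hc f) continuous_const fun t => (abs_le.1 (hb t)).2
    rwa [intU_const] at this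

/-- A hermitian gauge transformation between two solutions of the real equation with small `β` is
trivial. -/
theorem eq_zero_of_moment_actI_eq_zero (hG : IsClosed (G : Set (Matrix.unitaryGroup (Fin n) ℂ)))
    (hB : IsInvariantInner G B) {c : ℝ} (hc : 0 < c)
    (hpos : ∀ T ∈ configs G, (∀ t, ‖(T 2).ev t‖ ≤ c) → (∀ t, ‖(T 3).ev t‖ ≤ c) →
      ∀ ξ : D2 n, ξ ∈ lieGauge G → ξ ≠ 0 → 0 < metric B (orbitVec T ξ) (orbitVec T ξ))
    {p : D1 n × D1 n} (hp : IsLieC G p) {X : D2 n} (hX : X ∈ lieGauge G) (h0 : moment p = 0)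
    (h1 : moment (actI X p) = 0) (hb0 : ∀ t, ‖p.2.ev t‖ ≤ c)
    (hb1 : ∀ t, ‖(actI X p).2.ev t‖ ≤ c) : X = 0 := by
  by_contra hne
  obtain ⟨Λ, hΛ⟩ := exists_intU_functional B X
  have hXl : ∀ t, X.ev t ∈ lie G := hX.1
  have hder (s : ℝ) := Λ.hasFDerivAt.comp_hasDerivAt s (hasDerivAt_momentI_smul hG hp hXl s)
  have e0 : momentI ((0 : ℝ) • X) p = 0 := by
    rw [zero_smul, momentI_eq_zero_iff, actI_zero, h0]
  have e1 : momentI ((1 : ℝ) • X) p = 0 := by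
    rw [one_smul, momentI_eq_zero_iff, h1]
  -- Rolle's theorem for s ↦ ∫⟨momentI(sX), X⟩, which vanishes at both ends because both pairs solve
  -- the real equation.
  obtain ⟨s, hs, hs'⟩ := exists_hasDerivAt_eq_zero zero_lt_one
    (fun s _ => (hder s).continuousAt.continuousWithinAt)
    (by simp only [Function.comp_apply, e0, e1]) (fun s _ => hder s)
  have hsX : IsLieC G (actI (s • X) p) :=
    actI_isLieC hG (fun t => by rw [D2.ev_smul]; exact smul_mem_lie s (hXl t)) hp
  have hcfg := quadOf_mem_configs hsX
  -- The three lines bound at each t keeps β small at the intermediate pair found by Rolle's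
  -- theorem, so the metric is positive there.
  have hb (t) : ‖(actI (s • X) p).2.ev t‖ ≤ c := by
    rw [actI_ev_snd, D2.ev_smul]
    refine norm_exp_conj_le (star_of_mem_lie (hXl t)) hc (hb0 t) ?_ ⟨hs.1.le, hs.2.le⟩
    rw [← actI_ev_snd]
    exact hb1 t
  have hlt := hpos _ hcfg (fun t => (norm_rePart_le _).trans (hb t))
    (fun t => (norm_imPart_le _).trans (hb t)) X hX hne
  -- The metric on the orbit direction of X is minus the derivative just shown to vanish.
  rw [metric_orbitVec hG hB hcfg hXl hX, ← hΛ] at hlt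
  rw [hs'] at hlt
  simp at hlt

theorem isGaugeTransform_gauge {k : D2 n} (hk : ∀ t, k.ev t ∈ gset G) (T : Quad n) :
    ∃ S : Quad n, pairOf S = gaugeAct k (D2.map starM k) (pairOf T) ∧ ∀ t,
    (S 0).ev t = k.ev t * (T 0).ev t * (C2.ev k t)⁻¹ - k.dot t * (C2.ev k t)⁻¹ ∧
    ∀ i : Fin 4, i ≠ 0 → (S i).ev t = k.ev t * (T i).ev t * (C2.ev k t)⁻¹ := by
  have hinv (t) : (C2.ev k t)⁻¹ = (D2.map starM k).ev t := inv_of_mem (hk t)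
  let c (i : Fin 4) : D1 n := D1.mul (D1.mul (D2.incl k) (T i)) (D2.incl (D2.map starM k))
  let S : Fin 4 → D1 n := ![c 0 - D1.mul (D2.diff k) (D2.incl (D2.map starM k)), c 1, c 2, c 3]
  refine ⟨S, ?_, fun t => ⟨?_, fun i hi => ?_⟩⟩
  · refine Prod.ext (D1.ext fun t => ?_) (D1.ext fun t => ?_)
    · change (k.ev t * (T 0).ev t * star (k.ev t) - k.dot t * star (k.ev t)) -
        Complex.I • (k.ev t * (T 1).ev t * star (k.ev t)) =
        k.ev t * ((T 0).ev t - Complex.I • (T 1).ev t) * star (k.ev t) - k.dot t * star (k.ev t)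
      rw [mul_sub, sub_mul, mul_smul_comm, smul_mul_assoc]
      abel
    · change k.ev t * (T 2).ev t * star (k.ev t) +
        Complex.I • (k.ev t * (T 3).ev t * star (k.ev t)) =
        k.ev t * ((T 2).ev t + Complex.I • (T 3).ev t) * star (k.ev t)
      rw [mul_add, add_mul, mul_smul_comm, smul_mul_assoc]
  · rw [hinv]; rfl
  · rw [hinv]
    fin_cases i
    · exact absurd rfl hi
    all_goals rfl

theorem star_dot_mul_star {k : D2 n} (hk : ∀ t, k.ev t ∈ gset G) (t : U) :
    star (k.dot t * star (k.ev t)) = -(k.dot t * star (k.ev t)) := by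
  have hinv (t) : k.ev t * (D2.map starM k).ev t = 1 := mul_star_of_mem (hk t)
  have hd : star (k.dot t) = -(star (k.ev t) * k.dot t * star (k.ev t)) :=
    D2.dot_eq_of_mul_eq_one hinv t
  rw [star_mul, star_star, hd, mul_neg, ← mul_assoc, ← mul_assoc, mul_star_of_mem (hk t), one_mul]

theorem sameOrbit_of_pairOf_eq {T T' : solutions G} {k : D2 n} (hk : k ∈ gauge G)
    (hk' : ∀ t, k.ev t ∈ gset G)
    (h : pairOf T'.1 = gaugeAct k (D2.map starM k) (pairOf T.1)) : SameOrbit G T T' := by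
  obtain ⟨S, hS, hSe⟩ := isGaugeTransform_gauge hk' T.1
  have hi (t) : (C2.ev k t)⁻¹ = star (k.ev t) := inv_of_mem (hk' t)
  have hST : S = T'.1 := by
    refine eq_of_pairOf_eq (fun i t => ?_) (fun i t => star_of_mem_lie (T'.2.1 i t))
      (hS.trans h.symm)
    have hc (i : Fin 4) : star (k.ev t * (T.1 i).ev t * star (k.ev t)) =
        -(k.ev t * (T.1 i).ev t * star (k.ev t)) :=
      star_of_mem_lie (conj_mem_lie (hk' t) (T.2.1 i t))
    by_cases h0 : i = 0
    · have hw := star_dot_mul_star hk' t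
      rw [h0, (hSe t).1, hi, star_sub, hc, hw]
      abel
    · rw [(hSe t).2 i h0, hi]
      exact hc i
  exact ⟨k, hk, fun t => hST ▸ hSe t⟩

/-- Solutions with small `T₂` and `T₃` are determined up to `𝒢₀₀` by their end point data. -/
theorem sameOrbit_of_endMap_eq (hG : IsClosed (G : Set (Matrix.unitaryGroup (Fin n) ℂ)))
    (hB : IsInvariantInner G B) {c : ℝ} (hc : 0 < c)
    (hpos : ∀ T ∈ configs G, (∀ t, ‖(T 2).ev t‖ ≤ c) → (∀ t, ‖(T 3).ev t‖ ≤ c) →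
      ∀ ξ : D2 n, ξ ∈ lieGauge G → ξ ≠ 0 → 0 < metric B (orbitVec T ξ) (orbitVec T ξ))
    {T T' : solutions G} (hT : ∀ t, ‖(pairOf T.1).2.ev t‖ ≤ c)
    (hT' : ∀ t, ‖(pairOf T'.1).2.ev t‖ ≤ c) (h : endMap (pairOf T.1) = endMap (pairOf T'.1)) :
    SameOrbit G T T' := by
  have hp := isLieC_pairOf hG T.2.1
  obtain ⟨v, w, hvw, hv, h0, h1, hq⟩ := exists_gaugeAct_of_endMap_eq hG hp
    (isLieC_pairOf hG T'.2.1) (complexEq_pairOf T.2) (complexEq_pairOf T'.2) h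
  obtain ⟨k, X, hX, hk, hk', hact⟩ := exists_polar_gauge hvw hv h0 h1
  rw [hact] at hq
  -- The pair exp(iX).T is k⁻¹.T'. By unitary equivariance it solves the real equation, and its β
  -- has the same pointwise norm as that of T'.
  have hX0 : X = 0 := by
    refine eq_zero_of_moment_actI_eq_zero hG hB hc hpos hp hX (moment_pairOf hG T.2) ?_ hT
      fun t => ?_
    · have hm := moment_pairOf hG T'.2
      refine D0.ext fun t => ?_
      have e := moment_gaugeAct (fun t => mul_star_of_mem (hk' t)) (actI X (pairOf T.1)) t
      rw [← hq, hm, D0.ev_zero] at e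
      calc (moment (actI X (pairOf T.1))).ev t = (star (k.ev t) * k.ev t) *
            (moment (actI X (pairOf T.1))).ev t * (star (k.ev t) * k.ev t) := by
            rw [star_mul_of_mem (hk' t), one_mul, mul_one]
        _ = star (k.ev t) * (k.ev t * (moment (actI X (pairOf T.1))).ev t * star (k.ev t)) *
            k.ev t := by simp only [mul_assoc]
        _ = 0 := by rw [← e, mul_zero, zero_mul]
    · have e : (pairOf T'.1).2.ev t = k.ev t * (actI X (pairOf T.1)).2.ev t * star (k.ev t) := by
        rw [hq]; rfl
      have h2 := hT' t
      rwa [e, CStarRing.norm_mul_mem_unitary _ (gset_unitary (star_mem_gset (hk' t))),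
        CStarRing.norm_mem_unitary_mul _ (gset_unitary (hk' t))] at h2
  rw [hX0, actI_zero] at hq
  exact sameOrbit_of_pairOf_eq hk hk' hq

end

section

variable {G : Subgroup (Matrix.unitaryGroup (Fin n) ℂ)} {B : LinearMap.BilinForm ℝ (Mat n)}

/-! ### Moving the end point -/

theorem complexEq_gaugeAct {E F : D2 n} (h : ∀ t, E.ev t * F.ev t = 1) {p : D1 n × D1 n}
    (hp : ∀ t, p.2.dot t = -⁅p.1.ev t, p.2.ev t⁆) (t : U) : (gaugeAct E F p).2.dot t =
      -⁅(gaugeAct E F p).1.ev t, (gaugeAct E F p).2.ev t⁆ := by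
  have hx (x : Mat n) : F.ev t * (E.ev t * x) = x := by
    rw [← mul_assoc, mul_eq_one_comm.1 (h t), one_mul]
  change (E.dot t * p.2.ev t + E.ev t * p.2.dot t) * F.ev t + E.ev t * p.2.ev t * F.dot t =
    -⁅E.ev t * p.1.ev t * F.ev t - E.dot t * F.ev t, E.ev t * p.2.ev t * F.ev t⁆
  rw [hp, D2.dot_eq_of_mul_eq_one h]
  simp only [Ring.lie_def, add_mul, mul_sub, sub_mul, mul_neg, neg_mul, mul_assoc, hx]
  abel

/-- The path `t ↦ tZ`. -/
def D2.line : Mat n →L[ℝ] D2 n := LinearMap.toContinuousLinearMap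
  { toFun := fun Z => D2.map ((ContinuousLinearMap.mul ℝ (Mat n)).flip Z)
      (D2.mk (D1.val (D1.id n)) (D1.mk 1 0 (fun _ => hasDerivWithinAt_const _ _ (1 : Mat n)))
        (D1.id n).isDeriv)
    map_add' := fun _ _ => D2.ext fun _ => mul_add _ _ _
    map_smul' := fun _ _ => D2.ext fun _ => mul_smul_comm _ _ _ }

theorem D2.line_ev (Z : Mat n) (t : U) : (D2.line Z).ev t = (t : ℝ) • Z := by
  have h : (D2.line Z).ev t = (D1.id n).ev t * Z := rfl
  rw [h, D1.id_ev, smul_mul_assoc, one_mul]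

/-- The action of `t ↦ exp(-tZ)`. -/
def lineAct (Z : Mat n) (p : D1 n × D1 n) : D1 n × D1 n :=
  gaugeAct (D2.exp (-D2.line Z)) (D2.exp (D2.line Z)) p

theorem contDiff_lineAct {V : Type*} [NormedAddCommGroup V] [NormedSpace ℝ V] {Z : V → Mat n}
    {p : V → D1 n × D1 n} {m : WithTop ℕ∞} (hZ : ContDiff ℝ m Z) (hp : ContDiff ℝ m p) :
    ContDiff ℝ m fun x => lineAct (Z x) (p x) :=
  contDiff_gaugeAct (D2.contDiff_exp.comp (D2.line.contDiff.comp hZ).neg)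
    (D2.contDiff_exp.comp (D2.line.contDiff.comp hZ)) hp

theorem exp_neg_line_mul (Z : Mat n) (t : U) :
    (D2.exp (-D2.line Z)).ev t * (D2.exp (D2.line Z)).ev t = 1 := by
  rw [D2.exp_ev, D2.exp_ev, D2.ev_neg, exp_neg_mul_exp]

theorem lineAct_zero (p : D1 n × D1 n) : lineAct 0 p = p := by
  rw [lineAct, map_zero, neg_zero, D2.exp_zero, gaugeAct]
  refine Prod.ext (D1.ext fun t => ?_) (D1.ext fun t => ?_) <;> simp

theorem lineAct_isLieC (hG : IsClosed (G : Set (Matrix.unitaryGroup (Fin n) ℂ))) {Z : Mat n}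
    (hZ : Z ∈ lieC G) {p : D1 n × D1 n} (hp : IsLieC G p) : IsLieC G (lineAct Z p) := by
  have hZ' (t : U) : (-D2.line Z).ev t ∈ lieC G := by
    rw [D2.ev_neg, D2.line_ev, ← smul_neg]
    exact ((lieCSub hG).restrictScalars ℝ).smul_mem _ ((lieCSub hG).neg_mem hZ)
  have h1 (t) {W : Mat n} (hW : W ∈ lieC G) :
      (D2.exp (-D2.line Z)).ev t * W * (D2.exp (D2.line Z)).ev t ∈ lieC G := by
    have := exp_conj_mem_lieC hG (hZ' t) hW 1
    simpa using this
  refine ⟨fun t => ?_, fun t => h1 t (hp.2 t)⟩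
  have h2 : (D2.exp (-D2.line Z)).dot t * (D2.exp (D2.line Z)).ev t ∈ lieC G := by
    have := fderiv_exp_mul_mem_lieC hG (hZ' t)
      (D1.dot_mem_lieC hG (D2.incl (-D2.line Z)) hZ' t)
    rw [D2.exp_dot]
    simpa using this
  exact (lieCSub hG).sub_mem (h1 t (hp.1 t)) h2

theorem parallel_lineAct (Z : Mat n) (p : D1 n × D1 n) :
    (parallel (D1.val (lineAct Z p).1)).ev 1 =
      (parallel (D1.val p.1)).ev 1 * NormedSpace.exp Z := by
  rw [lineAct, parallel_gaugeAct (exp_neg_line_mul Z), D2.exp_ev, D2.line_ev]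
  · simp
  · rw [D2.exp_ev, D2.ev_neg, D2.line_ev]
    simp

theorem lineAct_snd_ev_one (Z : Mat n) (p : D1 n × D1 n) :
    (lineAct Z p).2.ev 1 = NormedSpace.exp (-Z) * p.2.ev 1 * NormedSpace.exp Z := by
  have h : (lineAct Z p).2.ev 1 =
    (D2.exp (-D2.line Z)).ev 1 * p.2.ev 1 * (D2.exp (D2.line Z)).ev 1 := rfl
  rw [h, D2.exp_ev, D2.exp_ev, D2.ev_neg, D2.line_ev]
  simp

/-- The solution `g⁻¹Cg` of `β' + [α,β] = 0`, where `g' = gα`, `g(0) = 1`. -/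
def conjParallel (a : D1 n) : Mat n →L[ℝ] D1 n := LinearMap.toContinuousLinearMap
  { toFun := fun C => D1.mul (D1.map ((ContinuousLinearMap.mul ℝ (Mat n)).flip C)
      (D2.incl (parallelInv₂ a))) (D2.incl (parallel₂ a))
    map_add' := fun _ _ => D1.ext fun _ =>
      (congrArg (· * _) (mul_add _ _ _)).trans (add_mul _ _ _)
    map_smul' := fun _ _ => D1.ext fun _ =>
      (congrArg (· * _) (mul_smul_comm _ _ _)).trans (smul_mul_assoc _ _ _) }

theorem conjParallel_ev (a : D1 n) (C : Mat n) (t : U) : (conjParallel a C).ev t =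
    (parallelInv (D1.val a)).ev t * C * (parallel (D1.val a)).ev t := rfl

theorem conjParallel_dot (a : D1 n) (C : Mat n) (t : U) :
    (conjParallel a C).dot t = -⁅a.ev t, (conjParallel a C).ev t⁆ := by
  have h : (conjParallel a C).dot t = (parallelInv₂ a).dot t * C * (parallel (D1.val a)).ev t +
    (parallelInv (D1.val a)).ev t * C * (parallel₂ a).dot t := rfl
  rw [h, parallelInv₂_dot, parallel₂_dot, conjParallel_ev, Ring.lie_def]
  noncomm_ring

theorem conj_mem_lieC_of_groupC (hG : IsClosed (G : Set (Matrix.unitaryGroup (Fin n) ℂ)))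
    {g h C : Mat n} (hg : g ∈ groupC G) (hgh : g * h = 1) (hC : C ∈ lieC G) :
    g * C * h ∈ lieC G := by
  obtain ⟨k, hk, X, hX, rfl⟩ := mem_groupC_iff.1 hg
  have h1 : h = NormedSpace.exp (-(Complex.I • X)) * star k := by
    rw [← one_mul (_ * star k), ← mul_eq_one_comm.1 hgh]
    simp only [mul_assoc]
    rw [← mul_assoc (NormedSpace.exp (Complex.I • X)), exp_mul_exp_neg, one_mul,
      mul_star_of_mem hk, mul_one]
  have h2 := exp_conj_mem_lieC hG (I_smul_mem_lieC hX) hC 1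
  rw [one_smul] at h2
  have h3 := conj_mem_lieC hk h2
  rw [h1]
  simpa only [mul_assoc] using h3

/-! ### Solutions with `T₂ = T₃ = 0` -/

/-- Write g = k exp(iX) = exp(iY)k with Y = kXk⁻¹, and choose a path κ in G from 1 to k. Undoing κ
on the constant solution (0, -Y, 0, 0) gives T₀ = κ⁻¹κ', T₁ = -κ⁻¹Yκ, T₂ = T₃ = 0. -/
theorem exists_solution_zero (hG : IsClosed (G : Set (Matrix.unitaryGroup (Fin n) ℂ)))
    (hc : IsConnected (G : Set (Matrix.unitaryGroup (Fin n) ℂ))) {g : Mat n} (hg : g ∈ groupC G) :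
    ∃ T ∈ solutions G, T 2 = 0 ∧ T 3 = 0 ∧ endMap (pairOf T) = (g, 0) := by
  obtain ⟨k, hk, X, hX, rfl⟩ := mem_groupC_iff.1 hg
  obtain ⟨κ, hκ, hκm, hκ0, hκ1⟩ := exists_path hG hc hk
  obtain ⟨Y, hY⟩ : ∃ Y, Y = k * X * star k := ⟨_, rfl⟩
  have hYl : Y ∈ lie G := hY ▸ conj_mem_lie hk hX
  have hd (t) : HasDerivAt κ (deriv κ t) t :=
    (hκ.differentiable (by simp) t).hasDerivAt
  have hds (t) : HasDerivAt (fun t => star (κ t)) (star (deriv κ t)) t :=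
    (starM (n := n)).hasFDerivAt.comp_hasDerivAt t (hd t)
  have hκ' : ContDiff ℝ 1 (deriv κ) := (contDiff_succ_iff_deriv.1 (hκ.of_le le_top :
    ContDiff ℝ (1 + 1) κ)).2.2
  have hκ1' : ContDiff ℝ 1 κ := hκ.of_le le_top
  have hκs : ContDiff ℝ 1 (fun t => star (κ t)) := (starM (n := n)).contDiff.comp hκ1'
  obtain ⟨T₀, hT₀, -⟩ := exists_D1 ((hκs.mul hκ').contDiffOn (s := Icc 0 1))
  obtain ⟨T₁, hT₁, hT₁'⟩ := exists_D1 (((hκs.mul contDiff_const).mul hκ1').neg.contDiffOn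
    (s := Icc 0 1) (f := fun t => -(star (κ t) * Y * κ t)))
  have hT₁d (t : U) : T₁.dot t =
      -(star (deriv κ t) * Y * κ t + star (κ t) * Y * deriv κ t) := by
    rw [hT₁']
    exact ((((hds t).mul_const Y).mul (hd t)).neg.hasDerivWithinAt).derivWithin
      (uniqueDiffOn_Icc_zero_one t t.2)
  have hs (t) : star (deriv κ t) = -(star (κ t) * deriv κ t * star (κ t)) := by
    have h1 := star_of_mem_lie (star_mul_deriv_mem_lie hG (hd t) hκm)
    rw [star_mul, star_star] at h1
    rw [← neg_mul, ← h1, mul_assoc, mul_star_of_mem (hκm t), mul_one]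
  have hx (t) (x : Mat n) : κ t * (star (κ t) * x) = x := by
    rw [← mul_assoc, mul_star_of_mem (hκm t), one_mul]
  let T : Fin 4 → D1 n := ![T₀, T₁, 0, 0]
  have hT0 (t : U) : (T 0).ev t = star (κ t) * deriv κ t := hT₀ t
  have hT1 (t : U) : (T 1).ev t = -(star (κ t) * Y * κ t) := hT₁ t
  have hcfg : (T : Quad n) ∈ configs G := by
    intro i t
    fin_cases i
    · change (T 0).ev t ∈ _
      rw [hT0]
      exact star_mul_deriv_mem_lie hG (hd t) hκm
    · change (T 1).ev t ∈ _
      rw [hT1]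
      refine neg_mem_lie ?_
      simpa only [star_star] using conj_mem_lie (star_mem_gset (hκm t)) hYl
    · exact zero_mem_lie
    · exact zero_mem_lie
  have hz2 (t : U) : (T 2).ev t = 0 := rfl
  have hz3 (t : U) : (T 3).ev t = 0 := rfl
  refine ⟨T, ⟨hcfg, fun t => ⟨?_, ?_, ?_⟩⟩, rfl, rfl, ?_⟩
  · change T₁.dot t + ⁅(T 0).ev t, (T 1).ev t⁆ = -⁅(T 2).ev t, (T 3).ev t⁆
    rw [hT₁d, hT0, hT1, hz2, hz3, hs]
    simp only [Ring.lie_def, mul_neg, neg_mul, mul_assoc, hx, zero_mul]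
    abel
  · change (0 : Mat n) + ⁅(T 0).ev t, (0 : Mat n)⁆ = ⁅(0 : Mat n), (T 1).ev t⁆
    simp [Ring.lie_def]
  · change (0 : Mat n) + ⁅(T 0).ev t, (0 : Mat n)⁆ = ⁅(T 1).ev t, (0 : Mat n)⁆
    simp [Ring.lie_def]
  · have hz : (pairOf T).2.ev 1 = 0 := by
      refine (pairOf_snd_ev (T : Quad n) 1).trans ?_
      change (0 : Mat n) + Complex.I • (0 : Mat n) = 0
      rw [smul_zero, add_zero]
    refine Prod.ext ?_ ((congrArg Neg.neg hz).trans neg_zero)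
    set a := (pairOf T).1 with ha
    have hae (t : U) : a.ev t = star (κ t) * deriv κ t +
        Complex.I • (star (κ t) * Y * κ t) := by
      refine (pairOf_fst_ev (T : Quad n) t).trans ?_
      change (T 0).ev t - Complex.I • (T 1).ev t = _
      rw [hT0, hT1, smul_neg, sub_neg_eq_add]
    -- The parallel transport of α = κ⁻¹κ' + iκ⁻¹Yκ in closed form; at t = 1 it equals exp(iY)k = g.
    set γ : ℝ → Mat n := fun t => NormedSpace.exp (t • Complex.I • Y) * κ t with hγ
    have hγd (t : ℝ) : HasDerivAt γ (NormedSpace.exp (t • Complex.I • Y) * (Complex.I • Y) * κ t +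
        NormedSpace.exp (t • Complex.I • Y) * deriv κ t) t :=
      (hasDerivAt_exp_smul (Complex.I • Y) t).mul (hd t)
    have hγc : Continuous γ := continuous_iff_continuousAt.2 fun t => (hγd t).continuousAt
    let g : D0 n := (⟨fun t : U => γ t, hγc.comp continuous_subtype_val⟩ : C(U, Mat n))
    have hg : IsDeriv g (g * D1.val a : D0 n) := fun t => by
      have e : (g * D1.val a : D0 n).ev t = NormedSpace.exp ((t : ℝ) • Complex.I • Y) *
          (Complex.I • Y) * κ t + NormedSpace.exp ((t : ℝ) • Complex.I • Y) * deriv κ t := by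
        have e1 : g.ev t = NormedSpace.exp ((t : ℝ) • Complex.I • Y) * κ t := rfl
        rw [D0.ev_mul, D1.val_ev, e1, hae, add_comm]
        simp only [mul_add, mul_assoc, mul_smul_comm, smul_mul_assoc, hx]
      have h1 := (hγd t).hasDerivWithinAt (s := Icc (0 : ℝ) 1)
      rw [← e] at h1
      refine h1.congr (fun s hs => ?_) ?_
      · exact ext_of_mem (E := Mat n) g hs
      · exact ext_coe (E := Mat n) g t
    have hg0 : g.ev 0 = 1 := by
      change NormedSpace.exp ((0 : ℝ) • Complex.I • Y) * κ 0 = 1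
      rw [hκ0]
      simp
    change (parallel (D1.val a)).ev 1 = _
    rw [← eq_parallel hg hg0]
    change NormedSpace.exp ((1 : ℝ) • Complex.I • Y) * κ 1 = _
    rw [hκ1, one_smul, hY, exp_conj_of_mem hk, mul_assoc, star_mul_of_mem hk, mul_one]

end

section

variable {G : Subgroup (Matrix.unitaryGroup (Fin n) ℂ)} {B : LinearMap.BilinForm ℝ (Mat n)}

/-! ### Local sections -/

/-- The pair with base pair `(a, 0)`, moved by `exp Y exp(iX)`, with `β` determined by `C`. -/
def movedPair (a : D1 n) (z : Mat n × Mat n × Mat n) : D1 n × D1 n :=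
  lineAct (Complex.I • z.2.1) (lineAct z.1 (a, conjParallel a z.2.2))

theorem contDiff_movedPair (a : D1 n) : ContDiff ℝ ω (movedPair a) := by
  have hI : ContDiff ℝ ω (fun z : Mat n × Mat n × Mat n => Complex.I • z.2.1) :=
    (smulM (n := n) Complex.I).contDiff.comp (contDiff_fst.comp contDiff_snd)
  exact contDiff_lineAct hI (contDiff_lineAct contDiff_fst
    (contDiff_const.prodMk ((conjParallel a).contDiff.comp (contDiff_snd.comp contDiff_snd))))

theorem movedPair_zero (a : D1 n) : movedPair a 0 = (a, 0) := by
  have h : movedPair a 0 = lineAct (Complex.I • (0 : Mat n)) (lineAct 0 (a, conjParallel a 0)) := rfl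
  rw [h, smul_zero, lineAct_zero, lineAct_zero, map_zero]

theorem movedPair_isLieC (hG : IsClosed (G : Set (Matrix.unitaryGroup (Fin n) ℂ))) {a : D1 n}
    (ha : ∀ t, a.ev t ∈ lieC G) {X Y C : Mat n} (hY : Y ∈ lie G) (hX : X ∈ lie G)
    (hC : C ∈ lieC G) : IsLieC G (movedPair a (Y, X, C)) := by
  refine lineAct_isLieC hG (I_smul_mem_lieC hX) (lineAct_isLieC hG (lie_subset_lieC hY)
    ⟨ha, fun t => ?_⟩)
  rw [conjParallel_ev, ← inv_parallel]
  exact conj_mem_lieC_of_groupC hG (inv_mem_groupC (parallel_mem_groupC hG (a := D1.val a) ha t))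
    (by rw [inv_parallel, parallelInv_mul]) hC

theorem complexEq_movedPair (a : D1 n) (z : Mat n × Mat n × Mat n) (t : U) :
    (movedPair a z).2.dot t = -⁅(movedPair a z).1.ev t, (movedPair a z).2.ev t⁆ :=
  complexEq_gaugeAct (exp_neg_line_mul _)
    (complexEq_gaugeAct (exp_neg_line_mul _) (conjParallel_dot a z.2.2)) t

theorem endMap_movedPair (a : D1 n) (X Y C : Mat n) : endMap (movedPair a (Y, X, C)) =
    ((parallel (D1.val a)).ev 1 * NormedSpace.exp Y * NormedSpace.exp (Complex.I • X),
      -(NormedSpace.exp (-(Complex.I • X)) * (NormedSpace.exp (-Y) *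
        ((parallelInv (D1.val a)).ev 1 * C * (parallel (D1.val a)).ev 1) * NormedSpace.exp Y) *
        NormedSpace.exp (Complex.I • X))) := by
  rw [endMap, movedPair, parallel_lineAct, parallel_lineAct, lineAct_snd_ev_one,
    lineAct_snd_ev_one, conjParallel_ev]

/-- The coordinates `(Y, X, C)` of a point of `T^*Gᶜ` near `(g, 0)`, where `h` is the inverse
of `g`. -/
def coords (h : Mat n) (y : Mat n × Mat n) : Mat n × Mat n × Mat n :=
  let X := polarX (h * y.1)
  let Y := logOne (h * y.1 * NormedSpace.exp (-(Complex.I • X)))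
  (Y, X, -(y.1 * y.2 * (NormedSpace.exp (-(Complex.I • X)) * NormedSpace.exp (-Y) * h)))

theorem coords_base {g h : Mat n} (hgh : h * g = 1) : coords h (g, 0) = 0 := by
  simp only [coords, hgh, polarX_one, smul_zero, neg_zero, NormedSpace.exp_zero, mul_one, logOne_one,
    mul_zero, zero_mul]
  rfl

theorem contDiffAt_unitaryFactor {g h : Mat n} (hgh : h * g = 1) :
    ContDiffAt ℝ ω (fun y : Mat n × Mat n => polarX (h * y.1)) (g, 0) ∧
    ContDiffAt ℝ ω (fun y : Mat n × Mat n =>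
      h * y.1 * NormedSpace.exp (-(Complex.I • polarX (h * y.1)))) (g, 0) := by
  have h1 : ContDiffAt ℝ ω (fun y : Mat n × Mat n => h * y.1) (g, 0) :=
    (contDiff_const.mul contDiff_fst).contDiffAt
  have hu : ContDiffAt ℝ ω (polarX (n := n)) (h * g) :=
    contDiffAt_polarX (hgh ▸ isUnit_one)
  have h2 : ContDiffAt ℝ ω (fun y : Mat n × Mat n => polarX (h * y.1)) (g, 0) :=
    ContDiffAt.comp (g := polarX) (g, (0 : Mat n)) hu h1
  have h3 : ContDiffAt ℝ ω (fun y : Mat n × Mat n => -(Complex.I • polarX (h * y.1))) (g, 0) :=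
    ((smulM (n := n) Complex.I).contDiff.contDiffAt.comp (g, 0) h2).neg
  exact ⟨h2, h1.mul (contDiff_exp.contDiffAt.comp (g, 0) h3)⟩

theorem contDiffAt_coords {g h : Mat n} (hgh : h * g = 1) :
    ContDiffAt ℝ ω (coords h) (g, 0) := by
  obtain ⟨hX, hA⟩ := contDiffAt_unitaryFactor hgh
  have hA1 : h * g * NormedSpace.exp (-(Complex.I • polarX (h * g))) = 1 := by
    rw [hgh, polarX_one]; simp
  have hY : ContDiffAt ℝ ω (fun y : Mat n × Mat n =>
      logOne (h * y.1 * NormedSpace.exp (-(Complex.I • polarX (h * y.1))))) (g, 0) :=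
    ContDiffAt.comp (g, 0) (by rw [hA1]; exact contDiffAt_logOne) hA
  have hX' : ContDiffAt ℝ ω (fun y : Mat n × Mat n => -(Complex.I • polarX (h * y.1))) (g, 0) :=
    ((smulM (n := n) Complex.I).contDiff.contDiffAt.comp (g, 0) hX).neg
  have hE1 := contDiff_exp.contDiffAt.comp (g, (0 : Mat n)) hX'
  have hE2 := contDiff_exp.contDiffAt.comp (g, (0 : Mat n)) hY.neg
  exact hY.prodMk (hX.prodMk (((contDiffAt_fst.mul contDiffAt_snd).mul
    ((hE1.mul hE2).mul contDiffAt_const)).neg))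

/-- The pairs with prescribed end point data. -/
theorem eventually_movedPair (hG : IsClosed (G : Set (Matrix.unitaryGroup (Fin n) ℂ))) {a : D1 n}
    (ha : ∀ t, a.ev t ∈ lieC G) {g h : Mat n} (hg : (parallel (D1.val a)).ev 1 = g)
    (hh : (parallelInv (D1.val a)).ev 1 = h) :
    ∀ᶠ y : Mat n × Mat n in 𝓝 (g, 0), y ∈ cotangentGroupC G →
      IsLieC G (movedPair a (coords h y)) ∧ endMap (movedPair a (coords h y)) = y := by
  have hhg : h * g = 1 := by rw [← hg, ← hh, parallelInv_mul]
  have hgh : g * h = 1 := mul_eq_one_comm.1 hhg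
  have hgm : g ∈ groupC G := hg ▸ parallel_mem_groupC hG (a := D1.val a) ha 1
  have hhm : h ∈ groupC G := by
    rw [← Matrix.inv_eq_right_inv hgh]
    exact inv_mem_groupC hgm
  have hA := (contDiffAt_unitaryFactor hhg).2.continuousAt
  rw [ContinuousAt, hhg, polarX_one, smul_zero, neg_zero, NormedSpace.exp_zero, mul_one] at hA
  filter_upwards [hA.eventually eventually_exp_logOne,
    hA.eventually (eventually_logOne_mem_lie hG)] with y h1 h2 hy
  -- Near the base point, g⁻¹y₁ is a nearby element of Gᶜ, whose polar form is exp(Y) exp(iX): its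
  -- unitary factor is close to 1, so its logarithm lies in 𝔤.
  obtain ⟨hX, hk⟩ := mem_groupC_iff_polarX.1 (mul_mem_groupC hG hhm hy.1)
  obtain ⟨X, hXe⟩ : ∃ X, X = polarX (h * y.1) := ⟨_, rfl⟩
  obtain ⟨Y, hYe⟩ : ∃ Y, Y = logOne (h * y.1 * NormedSpace.exp (-(Complex.I • X))) := ⟨_, rfl⟩
  rw [← hXe] at h1 h2 hX hk
  have hY : Y ∈ lie G := hYe ▸ h2 hk
  rw [← hYe] at h1
  obtain ⟨w, hw⟩ : ∃ w, w = NormedSpace.exp (-(Complex.I • X)) * NormedSpace.exp (-Y) * h :=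
    ⟨_, rfl⟩
  have hy1 : g * NormedSpace.exp Y * NormedSpace.exp (Complex.I • X) = y.1 := by
    rw [h1, mul_assoc, mul_assoc, exp_neg_mul_exp, mul_one, ← mul_assoc, hgh, one_mul]
  have hyw : w * y.1 = 1 := by
    rw [hw, ← hy1]
    simp only [mul_assoc]
    rw [← mul_assoc h, hhg, one_mul, ← mul_assoc (NormedSpace.exp (-Y)), exp_neg_mul_exp, one_mul,
      exp_neg_mul_exp]
  -- Here w = y₁⁻¹. The coordinate C = -y₁y₂y₁⁻¹ is forced: C is the constant value of gβg⁻¹ for the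
  -- moved pair, where g(1) = y₁ and -β(1) has to be y₂.
  have hc : coords h y = (Y, X, -(y.1 * y.2 * w)) := by
    rw [hw, hYe, hXe]
    rfl
  rw [hc]
  refine ⟨movedPair_isLieC hG ha hY hX ((lieCSub hG).neg_mem
    (conj_mem_lieC_of_groupC hG hy.1 (mul_eq_one_comm.1 hyw) hy.2)), ?_⟩
  rw [endMap_movedPair, hg, hh]
  refine Prod.ext hy1 ?_
  calc -(NormedSpace.exp (-(Complex.I • X)) * (NormedSpace.exp (-Y) *
        (h * -(y.1 * y.2 * w) * g) * NormedSpace.exp Y) * NormedSpace.exp (Complex.I • X))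
      = (NormedSpace.exp (-(Complex.I • X)) * NormedSpace.exp (-Y) * h) * (y.1 * y.2 * w) *
        (g * NormedSpace.exp Y * NormedSpace.exp (Complex.I • X)) := by noncomm_ring
    _ = (w * y.1) * y.2 * (w * y.1) := by rw [← hw, hy1]; simp only [mul_assoc]
    _ = y.2 := by rw [hyw, one_mul, mul_one]

theorem contDiffAt_actI {V : Type*} [NormedAddCommGroup V] [NormedSpace ℝ V] {X : V → D2 n}
    {p : V → D1 n × D1 n} {v : V} (hX : ContDiffAt ℝ ω X v) (hp : ContDiffAt ℝ ω p v) :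
    ContDiffAt ℝ ω (fun x => actI (X x) (p x)) v := by
  have hact : ContDiff ℝ ω fun x : D2 n × (D1 n × D1 n) => actI x.1 x.2 :=
    contDiff_actI contDiff_fst contDiff_snd
  have h := hX.prodMk hp
  have h' := ContDiff.comp_contDiffAt v hact h
  exact h'

theorem quadOf_actI_mem_solutions (hG : IsClosed (G : Set (Matrix.unitaryGroup (Fin n) ℂ)))
    {p : D1 n × D1 n} (hp : IsLieC G p) (hpc : ∀ t, p.2.dot t = -⁅p.1.ev t, p.2.ev t⁆) {X : D2 n}
    (hX : X ∈ lieGauge G) (hm : moment (actI X p) = 0) :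
    (quadOf (actI X p) : Quad n) ∈ solutions G ∧
      endMap (pairOf (quadOf (actI X p) : Quad n)) = endMap p := by
  refine ⟨quadOf_mem_solutions hG (actI_isLieC hG hX.1 hp)
    (complexEq_gaugeAct (expI_ev_mul_neg X) hpc) hm, ?_⟩
  have h : pairOf (quadOf (actI X p) : Quad n) = actI X p := pairOf_quadOf _
  rw [h]
  exact endMap_gaugeAct (expI_ev_mul_neg X) (expI_mem_gaugeC hX).2.1 (expI_mem_gaugeC hX).2.2 p

/-- A smooth local section of the end point map through a solution with `T₂ = T₃ = 0`. -/
theorem exists_section (hG : IsClosed (G : Set (Matrix.unitaryGroup (Fin n) ℂ)))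
    (hB : IsInvariantInner G B) {T : Quad n} (hT : T ∈ solutions G) (hD : T ∉ degeneracyLocus G B)
    {a : D1 n} (hTa : pairOf T = (a, 0)) {g : Mat n} (hg : endMap (pairOf T) = (g, 0)) {c : ℝ}
    (hc : 0 < c) : ∃ N : Set (Mat n × Mat n), IsOpen N ∧ (g, 0) ∈ N ∧
      ∃ σ : Mat n × Mat n → (Fin 4 → D1 n), ContDiffOn ℝ ∞ σ N ∧ ∀ y ∈ N ∩ cotangentGroupC G,
        (σ y : Quad n) ∈ solutions G ∧ endMap (pairOf (σ y : Quad n)) = y ∧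
        ‖D1.val (pairOf (σ y : Quad n)).2‖ < c := by
  have ha : ∀ t, a.ev t ∈ lieC G := by
    have := (isLieC_pairOf hG hT.1).1
    rwa [hTa] at this
  have hg1 : (parallel (D1.val a)).ev 1 = g := by
    have := congrArg Prod.fst hg
    rwa [hTa] at this
  obtain ⟨h, hh⟩ : ∃ h, (parallelInv (D1.val a)).ev 1 = h := ⟨_, rfl⟩
  have hhg : h * g = 1 := by rw [← hg1, ← hh, parallelInv_mul]
  obtain ⟨ψ, hψ, hψ0, hψ1, -⟩ := exists_slice hG hB hT hD
  rw [hTa] at hψ hψ0 hψ1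
  obtain ⟨Φ, hΦ⟩ : ∃ Φ : Mat n × Mat n → D1 n × D1 n, Φ = fun y => movedPair a (coords h y) :=
    ⟨_, rfl⟩
  have hΦe (y) : Φ y = movedPair a (coords h y) := by rw [hΦ]
  have hΦ0 : Φ (g, 0) = (a, 0) := by rw [hΦe, coords_base hhg, movedPair_zero]
  have hΦd : ContDiffAt ℝ ω Φ (g, 0) := by
    rw [hΦ]
    exact (contDiff_movedPair a).contDiffAt.comp (g, 0) (contDiffAt_coords hhg)
  have hψΦ : ContDiffAt ℝ ω (fun y => ψ (Φ y)) (g, 0) := by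
    rw [← hΦ0] at hψ
    exact ContDiffAt.comp (g, 0) hψ hΦd
  -- The moved pair Φ(y) solves the complex equation and has the prescribed data. Acting with
  -- exp(iψ) restores the real equation, and the data are unchanged because this transformation is 1
  -- at both ends.
  obtain ⟨Q, hQ⟩ : ∃ Q : Mat n × Mat n → D1 n × D1 n, Q = fun y => actI (ψ (Φ y)) (Φ y) := ⟨_, rfl⟩
  have hQe (y) : Q y = actI (ψ (Φ y)) (Φ y) := by rw [hQ]
  have hQd : ContDiffAt ℝ ω Q (g, 0) := by
    rw [hQ]
    exact contDiffAt_actI hψΦ hΦd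
  have hQ0 : Q (g, 0) = (a, 0) := by
    rw [hQe, hΦ0, hψ0, actI_zero]
  have hσd : ContDiffAt ℝ ω (fun y => quadOf (Q y)) (g, 0) :=
    (quadOf (n := n)).contDiff.contDiffAt.comp (g, 0) hQd
  have hnorm : ∀ᶠ y in 𝓝 (g, (0 : Mat n)), ‖D1.val (Q y).2‖ < c := by
    have hv : Continuous fun q : D1 n × D1 n => ‖D1.val q.2‖ :=
      ((D1.val (n := n)).continuous.comp continuous_snd).norm
    have h1 : ContinuousAt (fun y => ‖D1.val (Q y).2‖) (g, 0) :=
      ContinuousAt.comp (g := fun q : D1 n × D1 n => ‖D1.val q.2‖) hv.continuousAt hQd.continuousAt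
    refine h1.eventually_lt_const ?_
    change ‖D1.val (Q (g, 0)).2‖ < c
    rw [hQ0, map_zero, norm_zero]
    exact hc
  have hmoved := eventually_movedPair hG ha hg1 hh
  have hΦt : Tendsto Φ (𝓝 (g, 0)) (𝓝 (a, 0)) := by
    have := hΦd.continuousAt
    rwa [ContinuousAt, hΦ0] at this
  have hslice := hΦt.eventually hψ1
  simp only [← hΦe] at hmoved
  obtain ⟨N, hN, hNo, hNg⟩ := _root_.eventually_nhds_iff.1 ((hσd.eventually (by simp)).and
    (hnorm.and (hslice.and hmoved)))
  refine ⟨N, hNo, hNg, fun y => quadOf (Q y), fun y hy => ?_, fun y hy => ?_⟩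
  · exact ((hN y hy).1.of_le le_top).contDiffWithinAt
  · obtain ⟨-, h1, h2, h3⟩ := hN y hy.1
    obtain ⟨h4, h5⟩ := h3 hy.2
    obtain ⟨h6, h7⟩ := h2 h4
    have hce (t) : (Φ y).2.dot t = -⁅(Φ y).1.ev t, (Φ y).2.ev t⁆ := by
      rw [hΦe]; exact complexEq_movedPair a _ t
    have h8 := quadOf_actI_mem_solutions hG h4 hce h6 h7
    rw [← hQe, h5] at h8
    refine ⟨h8.1, h8.2, ?_⟩
    have hp : pairOf (quadOf (Q y) : Quad n) = Q y := pairOf_quadOf _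
    rw [hp]
    exact h1

end

section

variable {G : Subgroup (Matrix.unitaryGroup (Fin n) ℂ)} {B : LinearMap.BilinForm ℝ (Mat n)}

/-! ### The complex symplectic isomorphism -/

theorem norm_beta_eq_of_sameOrbit {T T' : solutions G} (h : SameOrbit G T T') :
    ‖D1.val (pairOf T'.1).2‖ = ‖D1.val (pairOf T.1).2‖ := by
  obtain ⟨E, -, hE, -, hq⟩ := pairOf_eq_gaugeAct h
  have e (t) : ‖(pairOf T'.1).2.ev t‖ = ‖(pairOf T.1).2.ev t‖ := by
    have e1 : (pairOf T'.1).2.ev t = E.ev t * (pairOf T.1).2.ev t * star (E.ev t) := by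
      rw [hq]; rfl
    rw [e1, CStarRing.norm_mul_mem_unitary _ (gset_unitary (star_mem_gset (hE t))),
      CStarRing.norm_mem_unitary_mul _ (gset_unitary (hE t))]
  refine le_antisymm (D0.norm_le (norm_nonneg _) fun t => ?_) (D0.norm_le (norm_nonneg _) fun t => ?_)
  · exact (e t).le.trans (D0.norm_ev_le (D1.val (pairOf T.1).2) t)
  · exact (e t).ge.trans (D0.norm_ev_le (D1.val (pairOf T'.1).2) t)

/-- The supremum of `‖β‖`, as a function on the moduli space. -/
def betaNorm (G : Subgroup (Matrix.unitaryGroup (Fin n) ℂ)) : Moduli G → ℝ :=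
  Quot.lift (fun T => ‖D1.val (pairOf T.1).2‖) fun _ _ h => (norm_beta_eq_of_sameOrbit h).symm

theorem isOpen_setOf_betaNorm {c : ℝ} {O : Set (Mat n × Mat n)} (hO : IsOpen O) :
    IsOpen {m : Moduli G | betaNorm G m < c ∧ moduliMap G m ∈ O} := by
  rw [← isQuotientMap_quot_mk.isOpen_preimage]
  have h0 : Continuous fun T : solutions G => pairOf T.1 := by
    have h : Continuous fun T : solutions G => (T.1 : Fin 4 → D1 n) := continuous_subtype_val
    exact (pairL (n := n)).continuous.comp h
  have h1 : Continuous fun T : solutions G => ‖D1.val (pairOf T.1).2‖ :=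
    ((D1.val (n := n)).continuous.comp (continuous_snd.comp h0)).norm
  have h2 : Continuous fun T : solutions G => endMap (pairOf T.1) :=
    contDiff_endMap.continuous.comp h0
  exact (isOpen_lt h1 continuous_const).inter (hO.preimage h2)

/-- The open sets on which the end point map has a smooth section with `‖β‖ < c`. -/
def sectionDomains (G : Subgroup (Matrix.unitaryGroup (Fin n) ℂ)) (c : ℝ) :
    Set (Set (Mat n × Mat n)) :=
  {N | IsOpen N ∧ ∃ σ : Mat n × Mat n → (Fin 4 → D1 n), ContDiffOn ℝ ∞ σ N ∧
    ∀ y ∈ N ∩ cotangentGroupC G, (σ y : Quad n) ∈ solutions G ∧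
      endMap (pairOf (σ y : Quad n)) = y ∧ ‖D1.val (pairOf (σ y : Quad n)).2‖ < c}

theorem norm_ev_beta_le {T : Quad n} {c : ℝ} (h : ‖D1.val (pairOf T).2‖ < c) (t : U) :
    ‖(pairOf T).2.ev t‖ ≤ c :=
  (D0.norm_ev_le (D1.val (pairOf T).2) t).trans h.le

theorem norm_ev_le_of_beta {T : Quad n} (hT : T ∈ configs G) {c : ℝ}
    (h : ‖D1.val (pairOf T).2‖ < c) (t : U) : ‖(T 2).ev t‖ ≤ c ∧ ‖(T 3).ev t‖ ≤ c := by
  have h2 := star_of_mem_lie (hT 2 t)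
  have h3 := star_of_mem_lie (hT 3 t)
  have hb := norm_ev_beta_le h t
  rw [pairOf_snd_ev] at hb
  constructor
  · rw [← rePart_add_I_smul h2 h3]
    exact (norm_rePart_le _).trans hb
  · rw [← imPart_add_I_smul h2 h3]
    exact (norm_imPart_le _).trans hb

/-- Defining the target by the existence of smooth sections with ‖β‖ < c makes surjectivity and
smoothness of the inverse immediate; no inverse function theorem on the quotient is needed. The
bound ‖β‖ < c on the source provides injectivity through `sameOrbit_of_endMap_eq`. -/
theorem isComplexSymplecticIso_moduliMap
    (hG : IsClosed (G : Set (Matrix.unitaryGroup (Fin n) ℂ))) (hB : IsInvariantInner G B) {c : ℝ}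
    (hc : 0 < c)
    (hpos : ∀ T ∈ configs G, (∀ t, ‖(T 2).ev t‖ ≤ c) → (∀ t, ‖(T 3).ev t‖ ≤ c) →
      ∀ ξ : D2 n, ξ ∈ lieGauge G → ξ ≠ 0 → 0 < metric B (orbitVec T ξ) (orbitVec T ξ)) :
    IsComplexSymplecticIso G B
      {m | betaNorm G m < c ∧ moduliMap G m ∈ ⋃₀ sectionDomains G c}
      (⋃₀ sectionDomains G c ∩ cotangentGroupC G) (moduliMap G) where
  bijOn := by
    refine ⟨?_, ?_, ?_⟩
    · rintro ⟨T⟩ hT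
      exact ⟨hT.2, endMap_mem_cotangent hG (isLieC_pairOf hG T.2.1)⟩
    · rintro ⟨T⟩ hT ⟨T'⟩ hT' h
      exact Quot.sound (sameOrbit_of_endMap_eq hG hB hc hpos (norm_ev_beta_le hT.1)
        (norm_ev_beta_le hT'.1) h)
    · rintro y ⟨⟨N, ⟨hN, σ, hσ, h⟩, hy⟩, hy'⟩
      obtain ⟨h1, h2, h3⟩ := h y ⟨hy, hy'⟩
      refine ⟨Quot.mk _ ⟨σ y, h1⟩, ⟨h3, ?_⟩, h2⟩
      change endMap (pairOf (σ y : Quad n)) ∈ _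
      rw [h2]
      exact ⟨N, ⟨hN, σ, hσ, h⟩, hy⟩
  smooth := contDiffOn_lift fun _ hT => hT.1
  smooth_inverse := by
    rintro x ⟨⟨N, ⟨hN, σ, hσ, h⟩, hx⟩, -⟩
    refine ⟨N, hN.mem_nhds hx, σ, hσ.mono inter_subset_left, fun y hy => ?_⟩
    obtain ⟨h1, h2, h3⟩ := h y ⟨hy.1, hy.2.2⟩
    refine ⟨h1, ⟨h3, ?_⟩, h2⟩
    change endMap (pairOf (σ y : Quad n)) ∈ _
    rw [h2]
    exact hy.2.1
  holomorphic_symplectic T _ := ⟨endDeriv T.1, hasFDerivWithinAt_lift T.2,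
    fun X _ => endDeriv_strI T.1 X, fun _ hX _ hY => canonicalForm_endDeriv hG hB T.2 hX hY⟩

/-- A neighbourhood of `{T₂ = T₃ = 0}` in the moduli space is isomorphic to a neighbourhood of the
zero section in `T^*Gᶜ`. -/
theorem exists_complexSymplecticIso (hG : IsClosed (G : Set (Matrix.unitaryGroup (Fin n) ℂ)))
    (hB : IsInvariantInner G B) (hconn : IsConnected (G : Set (Matrix.unitaryGroup (Fin n) ℂ))) :
    ∃ (W : Set (Moduli G)) (V : Set (Mat n × Mat n)) (F : Moduli G → Mat n × Mat n),
      IsOpen W ∧ moduliZero G ⊆ W ∧ W ⊆ moduliNondeg G B ∧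
      (∃ O : Set (Mat n × Mat n), IsOpen O ∧ V = O ∩ cotangentGroupC G) ∧
      groupC G ×ˢ {0} ⊆ V ∧ IsComplexSymplecticIso G B W V F := by
  obtain ⟨c, hc, hpos⟩ := exists_metric_pos hB hG
  have hO : IsOpen (⋃₀ sectionDomains G c) := isOpen_sUnion fun N hN => hN.1
  have hnd {T : Quad n} (hT : T ∈ configs G) (h : ‖D1.val (pairOf T).2‖ < c) :
      T ∉ degeneracyLocus G B :=
    notMem_degeneracyLocus (hpos T hT (fun t => (norm_ev_le_of_beta hT h t).1)
      fun t => (norm_ev_le_of_beta hT h t).2)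
  have hzero {T : Quad n} (hT : T ∈ solutions G) (h2 : T 2 = 0) (h3 : T 3 = 0) :
      ‖D1.val (pairOf T).2‖ < c ∧ endMap (pairOf T) ∈ ⋃₀ sectionDomains G c := by
    have hb : (pairOf T).2 = 0 := by
      refine D1.ext fun t => ?_
      rw [pairOf_snd_ev, h2, h3]
      change (0 : Mat n) + Complex.I • (0 : Mat n) = 0
      rw [smul_zero, add_zero]
    have hn : ‖D1.val (pairOf T).2‖ < c := by
      rw [hb, map_zero, norm_zero]
      exact hc
    have he : endMap (pairOf T) = ((parallel (D1.val (pairOf T).1)).ev 1, 0) := by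
      rw [endMap, hb, D1.ev_zero, neg_zero]
    obtain ⟨N, hN, hgN, σ, hσ, h⟩ := exists_section hG hB hT (hnd hT.1 hn) (Prod.ext rfl hb) he hc
    refine ⟨hn, N, ⟨hN, σ, hσ, h⟩, ?_⟩
    rw [he]
    exact hgN
  -- The last component fixes W as the classes with sup ‖β‖ < c whose data lie in a section domain,
  -- V as the part of T^*Gᶜ covered by section domains, and F as `moduliMap G`. Connectedness of G
  -- is used only to realise every point of the zero section.
  refine ⟨_, _, _, isOpen_setOf_betaNorm hO, ?_, ?_, ⟨_, hO, rfl⟩, ?_,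
    isComplexSymplecticIso_moduliMap hG hB hc hpos⟩
  · rintro _ ⟨T, h2, h3, rfl⟩
    exact hzero T.2 h2 h3
  · rintro ⟨T⟩ hT
    exact ⟨T, hnd T.2.1 hT.1, rfl⟩
  · rintro ⟨g, b⟩ ⟨hg, hb⟩
    obtain rfl : b = 0 := hb
    obtain ⟨T, hT, h2, h3, he⟩ := exists_solution_zero hG hconn hg
    have := (hzero hT h2 h3).2
    rw [he] at this
    exact ⟨this, hg, (lieCSub hG).zero_mem⟩

end

end NahmSchmid

end

open NahmSchmid in
theorem mainTheorem3 {n : ℕ} (G : Subgroup (Matrix.unitaryGroup (Fin n) ℂ))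
    (hG : IsClosed (G : Set (Matrix.unitaryGroup (Fin n) ℂ)))
    (B : LinearMap.BilinForm ℝ (Mat n)) (hB : IsInvariantInner G B) :
    (∀ T ∈ solutions G, T ∉ degeneracyLocus G B →
      ∃ δ₀ : ℝ, 0 < δ₀ ∧ ∀ δ : ℝ, 0 < δ → δ ≤ δ₀ → ∃ ε : ℝ, 0 < ε ∧
        ∀ a b : C1 n, (∀ t, a.ev t ∈ lieC G) → (∀ t, b.ev t ∈ lieC G) → ComplexEq a b →
          c1norm (a - alpha T) + c1norm (b - beta T) < ε →
          ∃! u : C2 n, u ∈ gaugeC G ∧ c2distOne u < δ ∧ (∀ t, IsSelfAdjoint (u.ev t)) ∧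
            ∃ a' b' : C1 n, IsGaugeTransform u a b a' b' ∧ RealEq a' b') ∧
    (IsConnected (G : Set (Matrix.unitaryGroup (Fin n) ℂ)) →
      ∃ (W : Set (Moduli G)) (V : Set (Mat n × Mat n)) (F : Moduli G → Mat n × Mat n),
        IsOpen W ∧ moduliZero G ⊆ W ∧ W ⊆ moduliNondeg G B ∧
        (∃ O : Set (Mat n × Mat n), IsOpen O ∧ V = O ∩ cotangentGroupC G) ∧
        groupC G ×ˢ {0} ⊆ V ∧
        IsComplexSymplecticIso G B W V F) := by
  exact ⟨fun T hT hD => exists_unique_gauge hG hB hT hD, exists_complexSymplecticIso hG hB⟩
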